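/- All vector spaces are over $\mathbb C$. For a graded space $W=\coprod_m W_{[m]}$ let $W'=\coprod_m W_{[m]}^*$ be its graded dual, graded by $(W')_{[m]}=W_{[m]}^*$. **Definitions.** A *meromorphic open-string vertex algebra* (MOSVA) is a $\mathbb Z$-graded space $V=\coprod_{n}V_{(n)}$ with $V_{(n)}=0$ for $n\ll 0$, a linear map $Y_V:V\otimes V\to V[[x,x^{-1}]]$ and $\mathbf 1\in V$ such that, with $\mathbf d_Vv=nv$ for $v\in V_{(n)}$ and $D_Vv=\lim_{x\to0}\frac{d}{dx}Y_V(v,x)\mathbf 1$: (1) $[\mathbf d_V,Y_V(u,x)]=x\frac{d}{dx}Y_V(u,x)+Y_V(\mathbf d_Vu,x)$; (2) $Y_V(\mathbf 1,x)=1_V$, $Y_V(u,x)\mathbf 1\in V[[x]]$ and $\lim_{x\to0}Y_V(u,x)\mathbf 1=u$; (3) $\frac{d}{dx}Y_V(u,x)=Y_V(D_Vu,x)=[D_V,Y_V(u,x)]$; (4) for $v'\in V'$, $\langle v',Y_V(u_1,z_1)\cdots Y_V(u_n,z_n)v\rangle$ converges absolutely for $|z_1|>\cdots>|z_n|>0$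 to a rational function with poles only at $z_i=0$ and $z_i=z_j$ ($i\ne j$), and $\langle v',Y_V(Y_V(u_1,z_1-z_2)u_2,z_2)v\rangle$ converges absolutely for $|z_2|>|z_1-z_2|>0$ to a rational function with poles only at $z_1=0$, $z_2=0$, $z_1=z_2$; (5) $\langle v',Y_V(u_1,z_1)Y_V(u_2,z_2)v\rangle=\langle v',Y_V(Y_V(u_1,z_1-z_2)u_2,z_2)v\rangle$ for $|z_1|>|z_2|>|z_1-z_2|>0$. A *left $V$-module* is a $\mathbb C$-graded space $W=\coprod_{m\in\mathbb C}W_{[m]}$ with $W_{[m]}=0$ for $\operatorname{Re}m\ll0$, a linear map $Y_W^L:V\otimes W\to W[[x,x^{-1}]]$, the operator $\mathbf d_W=m$ on $W_{[m]}$, and an operator $D_W$ of weight $1$, satisfying $[\mathbf d_W,Y_W^L(u,x)]=Y_W^L(\mathbf d_Vu,x)+x\frac{d}{dx}Y_W^L(u,x)$, $Y_W^L(\mathbf 1,x)=1_W$, $\frac{d}{dx}Y_W^L(u,x)=Y_W^L(D_Vu,x)=[D_W,Y_W^L(u,x)]$, and the analogues of (4), (5) for $\langle w',Y_W^L(u_1,z_1)\cdots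 Y_W^L(u_n,z_n)w\rangle$ and $\langle w',Y_W^L(Y_V(u_1,z_1-z_2)u_2,z_2)w\rangle$, $w'\in W'$. A *right $V$-module* has instead $Y_W^R:W\otimes V\to W[[x,x^{-1}]]$ with $\mathbf d_WY_W^R(w,x)-Y_W^R(w,x)\mathbf d_V=Y_W^R(\mathbf d_Ww,x)+x\frac{d}{dx}Y_W^R(w,x)$, $Y_W^R(w,x)\mathbf 1\in W[[x]]$ with constant term $w$, $\frac{d}{dx}Y_W^R(w,x)=Y_W^R(D_Ww,x)=D_WY_W^R(w,x)-Y_W^R(w,x)D_V$, and the analogues of (4), (5) for $\langle w',Y_W^R(w,z_1)Y_V(u_1,z_2)\cdots Y_V(u_{n-1},z_n)u_n\rangle$ and $\langle w',Y_W^R(Y_W^R(w,z_1-z_2)u_1,z_2)u_2\rangle$. A module is *grading-restricted* if $\dim W_{[m]}<\infty$ for all $m$. Let $\mathfrak{sl}(2)$ have the basis $L_{-1},L_0,L_1$ with $[L_0,L_{\mp1}]=\pm L_{\mp1}$, $[L_{-1},L_1]=-2L_0$. A *Möbius MOSVA* is a MOSVA with a representation $\rho_V$ of $\mathfrak{sl}(2)$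 on $V$, $L_V(j)=\rho_V(L_j)$, such that $L_V(0)=\mathbf d_V$, $L_V(-1)=D_V$ and $[L_V(1),Y_V(u,x)]=Y_V(L_V(1)u,x)+2xY_V(L_V(0)u,x)+x^2Y_V(L_V(-1)u,x)$. A *Möbius left $V$-module* is a left $V$-module with a representation $\rho_W$ of $\mathfrak{sl}(2)$ on $W$, $L_W(j)=\rho_W(L_j)$, such that $L_W(-1)=D_W$, $[L_W(0),Y_W^L(u,x)]=Y_W^L(L_V(0)u,x)+xY_W^L(L_V(-1)u,x)$, $[L_W(1),Y_W^L(u,x)]=Y_W^L(L_V(1)u,x)+2xY_W^L(L_V(0)u,x)+x^2Y_W^L(L_V(-1)u,x)$, and every $w\in W_{[n]}$ is killed by a power of $L_W(0)-n$. A *Möbius right $V$-module* is defined in the same way from a right $V$-module, with $L_W(j)Y_W^R(w,x)-Y_W^R(w,x)L_V(j)$ on the left-hand sides and with $Y_W^R(L_W(i)w,x)$ in place of $Y_W^L(L_V(i)u,x)$ on the right-hand sides. The *opposite* $V^{op}$ of $V$ is $V$ with the same grading, vacuum and $\rho_V$, and with vertex operator $Y_V^s(u,x)v=e^{xD_V}Y_V(v,-x)u$.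 **Theorem.** Let $(V,Y_V,\mathbf 1,\rho_V)$ be a Möbius MOSVA and let $(W,Y_W^L,\rho_W)$ be a grading-restricted Möbius left $V$-module. Then there are a vertex operator map $Y_W':V\otimes W'\to W'[[x,x^{-1}]]$ and a representation $\rho_W'$ of $\mathfrak{sl}(2)$ on $W'$, $L_W'(j)=\rho_W'(L_j)$, which are given by $$\langle Y_W'(u,x)w',w\rangle=\langle w',Y_W^L(e^{xL_V(1)}(-x^{-2})^{L_V(0)}u,x^{-1})w\rangle,\qquad \langle L_W'(j)w',w\rangle=\langle w',L_W(-j)w\rangle\quad(j=0,\pm1)$$ for $u\in V$, $w'\in W'$, $w\in W$; $V^{op}$ is a Möbius MOSVA; $(W',Y_W',\rho_W')$ is a Möbius left $V^{op}$-module; and $W'$ with $\rho_W'$ and the vertex operator map $w'\otimes v\mapsto e^{xL_W'(-1)}Y_W'(v,-x)w'$ is a Möbius right $V$-module. -/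

import Mathlib

attribute [local instance 100] LieRing.ofAssociativeRing

noncomputable section

namespace MOSVA

/-! ### Formal series -/

/-- `W[[x, x⁻¹]]`: the value at `k` is the coefficient of `x ^ k`. -/
abbrev Series (W : Type*) := ℤ → W

section Series

variable {W : Type*} [AddCommGroup W] [Module ℂ W]

/-- The formal derivative `d/dx`. -/
def ddx (F : Series W) : Series W := fun k => ((k + 1 : ℤ) : ℂ) • F (k + 1)

/-- Multiplication by `x ^ p`. -/
def mulX (p : ℤ) (F : Series W) : Series W := fun k => F (k - p)

/-- The substitution `x ↦ -x`. -/
def negX (F : Series W) : Series W := fun k => ((-1 : ℂ) ^ k) • F k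

/-- `e ^ (x T) F(x) = ∑ j ≥ 0, (x ^ j / j!) T ^ j F(x)`. Each coefficient is a finite sum as soon as
`F` has only finitely many negative powers of `x`. -/
def expX (T : W → W) (F : Series W) : Series W :=
  fun k => ∑ᶠ j : ℕ, ((j.factorial : ℂ)⁻¹) • T^[j] (F (k - j))

end Series

/-! ### Graded spaces and graded duals -/

section Graded

variable {ι : Type*} {W E : Type*} [AddCommGroup W] [Module ℂ W] [AddCommGroup E] [Module ℂ E]

/-- For `W = ∐ i, W_i`, the linear map on `W` whose restriction to `W_i` is that of `c i`. -/
def ofHomogeneous [DecidableEq ι] (gr : ι → Submodule ℂ W) (c : ι → W →ₗ[ℂ] E) : W →ₗ[ℂ] E :=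
  open Classical in
  if h : DirectSum.IsInternal gr then
    (DirectSum.toModule ℂ ι E fun i => c i ∘ₗ (gr i).subtype) ∘ₗ
      (LinearEquiv.ofBijective (DirectSum.coeLinearMap gr) h).symm.toLinearMap
  else 0

theorem ofHomogeneous_apply [DecidableEq ι] {gr : ι → Submodule ℂ W}
    (h : DirectSum.IsInternal gr) (c : ι → W →ₗ[ℂ] E) {i : ι} {w : W} (hw : w ∈ gr i) :
    ofHomogeneous gr c w = c i w := by
  have key : (LinearEquiv.ofBijective (DirectSum.coeLinearMap gr) h).symm w
      = DirectSum.lof ℂ ι (fun i => gr i) i ⟨w, hw⟩ := by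
    rw [LinearEquiv.symm_apply_eq]
    exact (DirectSum.coeLinearMap_lof gr i ⟨w, hw⟩).symm
  rw [ofHomogeneous, dif_pos h]
  change DirectSum.toModule ℂ ι E _ ((LinearEquiv.ofBijective (DirectSum.coeLinearMap gr) h).symm w)
    = c i w
  rw [key, DirectSum.toModule_lof]
  rfl

/-- The graded dual `W' = ∐ i, (W_i)^*`, realised inside the full dual: the functionals that vanish
on `W_i` for all but finitely many `i`. -/
def gradedDual (gr : ι → Submodule ℂ W) : Submodule ℂ (Module.Dual ℂ W) where
  carrier := {φ | {i | ∃ w ∈ gr i, φ w ≠ 0}.Finite}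
  zero_mem' := by simp
  add_mem' := by
    intro φ ψ hφ hψ
    refine (Set.Finite.union hφ hψ).subset ?_
    rintro i ⟨w, hw, hne⟩
    by_cases h : φ w = 0
    · exact Or.inr ⟨w, hw, fun h' => hne (by simp [h, h'])⟩
    · exact Or.inl ⟨w, hw, h⟩
  smul_mem' := by
    intro c φ hφ
    refine Set.Finite.subset hφ ?_
    rintro i ⟨w, hw, hne⟩
    exact ⟨w, hw, fun h => hne (by simp [h])⟩

/-- The homogeneous subspace `(W')_i = (W_i)^*` of the graded dual: the functionals that vanish on
`W_j` for all `j ≠ i`. -/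
def gradedDualGr (gr : ι → Submodule ℂ W) (i : ι) : Submodule ℂ (gradedDual gr) where
  carrier := {φ | ∀ j, j ≠ i → ∀ w ∈ gr j, (φ : Module.Dual ℂ W) w = 0}
  zero_mem' := by simp
  add_mem' := by
    intro φ ψ hφ hψ j hj w hw
    simp [hφ j hj w hw, hψ j hj w hw]
  smul_mem' := by
    intro c φ hφ j hj w hw
    simp [hφ j hj w hw]

end Graded

/-! ### Convergence to rational functions -/

/-- The series `∑ k, a k * z₁ ^ k₁ ⋯ zₙ ^ kₙ` converges absolutely when `|z₁| > ⋯ > |zₙ| > 0` to a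
rational function whose only possible poles are at `z_i = 0` and at `z_i = z_j`, `i ≠ j`.
(In `ℂ`, unconditional and absolute convergence agree.) -/
def ProductRational {n : ℕ} (a : (Fin n → ℤ) → ℂ) : Prop :=
  ∃ (f : MvPolynomial (Fin n) ℂ) (p : Fin n → ℕ) (q : Fin n → Fin n → ℕ),
    ∀ z : Fin n → ℂ, StrictAnti (fun i => ‖z i‖) → (∀ i, 0 < ‖z i‖) →
      HasSum (fun k : Fin n → ℤ => a k * ∏ i, z i ^ k i)
        (MvPolynomial.eval z f /
          ((∏ i, z i ^ p i) * ∏ i, ∏ j ∈ Finset.Ioi i, (z i - z j) ^ q i j))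

/-- The series `∑ k l, a k l * (z₁ - z₂) ^ k * z₂ ^ l` converges absolutely when
`|z₂| > |z₁ - z₂| > 0` to a rational function whose only possible poles are at `z₁ = 0`, `z₂ = 0`
and `z₁ = z₂`. -/
def IterateRational (a : ℤ → ℤ → ℂ) : Prop :=
  ∃ (f : MvPolynomial (Fin 2) ℂ) (p₁ p₂ p₁₂ : ℕ),
    ∀ z₁ z₂ : ℂ, 0 < ‖z₁ - z₂‖ → ‖z₁ - z₂‖ < ‖z₂‖ →
      HasSum (fun k : ℤ × ℤ => a k.1 k.2 * ((z₁ - z₂) ^ k.1 * z₂ ^ k.2))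
        (MvPolynomial.eval ![z₁, z₂] f / (z₁ ^ p₁ * z₂ ^ p₂ * (z₁ - z₂) ^ p₁₂))

/-- The series `∑ k l, a k l * z₁ ^ k * z₂ ^ l` (a product of two vertex operators) and
`∑ k l, b k l * (z₁ - z₂) ^ k * z₂ ^ l` (an iterate) converge to the same sum when
`|z₁| > |z₂| > |z₁ - z₂| > 0`. -/
def Associates (a b : ℤ → ℤ → ℂ) : Prop :=
  ∀ z₁ z₂ : ℂ, ‖z₂‖ < ‖z₁‖ → ‖z₁ - z₂‖ < ‖z₂‖ → 0 < ‖z₁ - z₂‖ →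
    ∃ s : ℂ,
      HasSum (fun k : ℤ × ℤ => a k.1 k.2 * (z₁ ^ k.1 * z₂ ^ k.2)) s ∧
      HasSum (fun k : ℤ × ℤ => b k.1 k.2 * ((z₁ - z₂) ^ k.1 * z₂ ^ k.2)) s

/-! ### Vertex operator maps -/

/-- A vertex operator map `A ⊗ B → C[[x, x⁻¹]]` is given as a function of two arguments, which is
bilinear. -/
def IsBilinear {A B C : Type*} [AddCommGroup A] [Module ℂ A] [AddCommGroup B] [Module ℂ B]
    [AddCommGroup C] [Module ℂ C] (Y : A → B → Series C) : Prop :=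
  (∀ b, IsLinearMap ℂ fun a => Y a b) ∧ ∀ a, IsLinearMap ℂ fun b => Y a b

/-- The coefficient of `x₁ ^ k₁ ⋯ xₙ ^ kₙ` in `Y(u₁, x₁) ⋯ Y(uₙ, xₙ) w`. -/
def prodCoeff {V W : Type*} (Y : V → W → Series W) {n : ℕ} (u : Fin n → V) (k : Fin n → ℤ)
    (w : W) : W :=
  Fin.foldr n (fun i x => Y (u i) x (k i)) w

/-- The skew-symmetry opposite `b ⊗ a ↦ e ^ (x D) Y(a, -x) b` of a vertex operator map `Y`. -/
def skewOpposite {A B W : Type*} [AddCommGroup W] [Module ℂ W] (D : W → W)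
    (Y : A → B → Series W) : B → A → Series W :=
  fun b a => expX D (negX (Y a b))

/-! ### Meromorphic open-string vertex algebras -/

section Algebra

variable {V : Type*} [AddCommGroup V] [Module ℂ V]

/-- The data `(V = ∐ n, V_(n), Y_V, 𝟏)` of a meromorphic open-string vertex algebra. -/
structure VertexData (V : Type*) [AddCommGroup V] [Module ℂ V] where
  gr : ℤ → Submodule ℂ V
  Y : V → V → Series V
  vac : V

/-- `d_V v = n v` for `v ∈ V_(n)`. -/
def VertexData.d (𝓥 : VertexData V) : V →ₗ[ℂ] V :=
  ofHomogeneous 𝓥.gr fun n => (n : ℂ) • LinearMap.id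

/-- `D_V v = lim_{x → 0} d/dx Y_V(v, x) 𝟏`. -/
def VertexData.D (𝓥 : VertexData V) (v : V) : V := ddx (𝓥.Y v 𝓥.vac) 0

/-- The opposite `(V, Y_V^s, 𝟏)`, with `Y_V^s(u, x) v = e ^ (x D_V) Y_V(v, -x) u`. -/
def VertexData.op (𝓥 : VertexData V) : VertexData V where
  gr := 𝓥.gr
  Y := skewOpposite 𝓥.D 𝓥.Y
  vac := 𝓥.vac

/-- `(V, Y_V, 𝟏)` is a meromorphic open-string vertex algebra. -/
structure IsMOSVA (𝓥 : VertexData V) : Prop where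
  internal : DirectSum.IsInternal 𝓥.gr
  bilinear : IsBilinear 𝓥.Y
  lower_bound : ∃ N : ℤ, ∀ n < N, 𝓥.gr n = ⊥
  d_commutator : ∀ u v,
    𝓥.d ∘ 𝓥.Y u v - 𝓥.Y u (𝓥.d v) = mulX 1 (ddx (𝓥.Y u v)) + 𝓥.Y (𝓥.d u) v
  identity : ∀ v, 𝓥.Y 𝓥.vac v = Pi.single 0 v
  creation : ∀ u, (∀ k < 0, 𝓥.Y u 𝓥.vac k = 0) ∧ 𝓥.Y u 𝓥.vac 0 = u
  D_derivative : ∀ u v, ddx (𝓥.Y u v) = 𝓥.Y (𝓥.D u) v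
  D_commutator : ∀ u v, ddx (𝓥.Y u v) = 𝓥.D ∘ 𝓥.Y u v - 𝓥.Y u (𝓥.D v)
  product_rational : ∀ φ ∈ gradedDual 𝓥.gr, ∀ (n : ℕ) (u : Fin n → V) (v : V),
    ProductRational fun k => φ (prodCoeff 𝓥.Y u k v)
  iterate_rational : ∀ φ ∈ gradedDual 𝓥.gr, ∀ u₁ u₂ v : V,
    IterateRational fun k l => φ (𝓥.Y (𝓥.Y u₁ u₂ k) v l)
  associativity : ∀ φ ∈ gradedDual 𝓥.gr, ∀ u₁ u₂ v : V,
    Associates (fun k l => φ (𝓥.Y u₁ (𝓥.Y u₂ v l) k)) (fun k l => φ (𝓥.Y (𝓥.Y u₁ u₂ k) v l))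

end Algebra

/-! ### The Lie algebra `sl(2)` -/

/-- The Lie algebra `sl(2)` of traceless complex `2 × 2` matrices. -/
abbrev sl2 := LieAlgebra.SpecialLinear.sl (Fin 2) ℂ

/-- The basis `L₋₁, L₀, L₁` of `sl(2)`. -/
def slL : SignType → sl2
  | .neg => ⟨!![0, 1; 0, 0], by simp [LieAlgebra.SpecialLinear.sl, Matrix.trace_fin_two]⟩
  | .zero => ⟨!![1 / 2, 0; 0, -(1 / 2)], by
      simp [LieAlgebra.SpecialLinear.sl, Matrix.trace_fin_two]⟩
  | .pos => ⟨!![0, 0; -1, 0], by simp [LieAlgebra.SpecialLinear.sl, Matrix.trace_fin_two]⟩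

theorem lie_slL_zero_neg : ⁅slL 0, slL (-1)⁆ = slL (-1) := by
  apply Subtype.ext
  change ⁅(!![1 / 2, 0; 0, -(1 / 2)] : Matrix (Fin 2) (Fin 2) ℂ), !![0, 1; 0, 0]⁆ = !![0, 1; 0, 0]
  ext i j
  fin_cases i <;> fin_cases j <;> simp [Ring.lie_def]
  norm_num

theorem lie_slL_zero_pos : ⁅slL 0, slL 1⁆ = -slL 1 := by
  apply Subtype.ext
  change ⁅(!![1 / 2, 0; 0, -(1 / 2)] : Matrix (Fin 2) (Fin 2) ℂ), !![0, 0; -1, 0]⁆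
    = -!![0, 0; -1, 0]
  ext i j
  fin_cases i <;> fin_cases j <;> simp [Ring.lie_def]
  norm_num

theorem lie_slL_neg_pos : ⁅slL (-1), slL 1⁆ = (-2 : ℂ) • slL 0 := by
  apply Subtype.ext
  change ⁅(!![0, 1; 0, 0] : Matrix (Fin 2) (Fin 2) ℂ), !![0, 0; -1, 0]⁆
    = (-2 : ℂ) • !![1 / 2, 0; 0, -(1 / 2)]
  ext i j
  fin_cases i <;> fin_cases j <;> simp [Ring.lie_def]

/-- Representations of `sl(2)` on `W`; the operator `L_W(j)` is `ρ (slL j)`. -/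
abbrev Sl2Rep (W : Type*) [AddCommGroup W] [Module ℂ W] := sl2 →ₗ⁅ℂ⁆ Module.End ℂ W

/-! ### Möbius meromorphic open-string vertex algebras and their modules -/

section Modules

variable {V W : Type*} [AddCommGroup V] [Module ℂ V] [AddCommGroup W] [Module ℂ W]

/-- `(V, Y_V, 𝟏, ρ_V)` is a Möbius MOSVA. -/
structure IsMoebiusMOSVA (𝓥 : VertexData V) (ρV : Sl2Rep V) : Prop where
  isMOSVA : IsMOSVA 𝓥
  L_zero : ∀ v, ρV (slL 0) v = 𝓥.d v
  L_neg : ∀ v, ρV (slL (-1)) v = 𝓥.D v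
  L_pos_commutator : ∀ u v,
    ρV (slL 1) ∘ 𝓥.Y u v - 𝓥.Y u (ρV (slL 1) v) =
      𝓥.Y (ρV (slL 1) u) v + (2 : ℂ) • mulX 1 (𝓥.Y (ρV (slL 0) u) v)
        + mulX 2 (𝓥.Y (ρV (slL (-1)) u) v)

/-- `(W = ∐ m, W_[m], Y_W^L, d_W, D_W)` is a left `V`-module. -/
structure IsLeftModule (𝓥 : VertexData V) (gr : ℂ → Submodule ℂ W) (Y : V → W → Series W)
    (d D : W →ₗ[ℂ] W) : Prop where
  internal : DirectSum.IsInternal gr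
  bilinear : IsBilinear Y
  D_weight : ∀ m, ∀ w ∈ gr m, D w ∈ gr (m + 1)
  lower_bound : ∃ N : ℝ, ∀ m : ℂ, m.re < N → gr m = ⊥
  d_grading : ∀ m, ∀ w ∈ gr m, d w = m • w
  d_commutator : ∀ u w, d ∘ Y u w - Y u (d w) = Y (𝓥.d u) w + mulX 1 (ddx (Y u w))
  identity : ∀ w, Y 𝓥.vac w = Pi.single 0 w
  D_derivative : ∀ u w, ddx (Y u w) = Y (𝓥.D u) w
  D_commutator : ∀ u w, ddx (Y u w) = D ∘ Y u w - Y u (D w)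
  product_rational : ∀ φ ∈ gradedDual gr, ∀ (n : ℕ) (u : Fin n → V) (w : W),
    ProductRational fun k => φ (prodCoeff Y u k w)
  iterate_rational : ∀ φ ∈ gradedDual gr, ∀ (u₁ u₂ : V) (w : W),
    IterateRational fun k l => φ (Y (𝓥.Y u₁ u₂ k) w l)
  associativity : ∀ φ ∈ gradedDual gr, ∀ (u₁ u₂ : V) (w : W),
    Associates (fun k l => φ (Y u₁ (Y u₂ w l) k)) (fun k l => φ (Y (𝓥.Y u₁ u₂ k) w l))

/-- `(W = ∐ m, W_[m], Y_W^R, d_W, D_W)` is a right `V`-module. In `product_rational` there are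
`n + 1` vertex operators, the first of which is that of `w`. -/
structure IsRightModule (𝓥 : VertexData V) (gr : ℂ → Submodule ℂ W) (Y : W → V → Series W)
    (d D : W →ₗ[ℂ] W) : Prop where
  internal : DirectSum.IsInternal gr
  bilinear : IsBilinear Y
  D_weight : ∀ m, ∀ w ∈ gr m, D w ∈ gr (m + 1)
  lower_bound : ∃ N : ℝ, ∀ m : ℂ, m.re < N → gr m = ⊥
  d_grading : ∀ m, ∀ w ∈ gr m, d w = m • w
  d_commutator : ∀ w u, d ∘ Y w u - Y w (𝓥.d u) = Y (d w) u + mulX 1 (ddx (Y w u))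
  creation : ∀ w, (∀ k < 0, Y w 𝓥.vac k = 0) ∧ Y w 𝓥.vac 0 = w
  D_derivative : ∀ w u, ddx (Y w u) = Y (D w) u
  D_commutator : ∀ w u, ddx (Y w u) = D ∘ Y w u - Y w (𝓥.D u)
  product_rational : ∀ φ ∈ gradedDual gr, ∀ (w : W) (n : ℕ) (u : Fin n → V) (v : V),
    ProductRational fun k : Fin (n + 1) → ℤ => φ (Y w (prodCoeff 𝓥.Y u (Fin.tail k) v) (k 0))
  iterate_rational : ∀ φ ∈ gradedDual gr, ∀ (w : W) (u₁ u₂ : V),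
    IterateRational fun k l => φ (Y (Y w u₁ k) u₂ l)
  associativity : ∀ φ ∈ gradedDual gr, ∀ (w : W) (u₁ u₂ : V),
    Associates (fun k l => φ (Y w (𝓥.Y u₁ u₂ l) k)) (fun k l => φ (Y (Y w u₁ k) u₂ l))

/-- `W = ∐ m, W_[m]` is grading-restricted: `dim W_[m] < ∞` for all `m`. -/
def GradingRestricted (gr : ℂ → Submodule ℂ W) : Prop := ∀ m, FiniteDimensional ℂ (gr m)

/-- `(W, Y_W^L, ρ_W)` is a Möbius left `V`-module. The operator `d_W` is determined by the grading
and `D_W` is `L_W(-1)`. -/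
structure IsMoebiusLeftModule (𝓥 : VertexData V) (ρV : Sl2Rep V) (gr : ℂ → Submodule ℂ W)
    (Y : V → W → Series W) (ρ : Sl2Rep W) : Prop where
  isLeftModule : ∃ d : W →ₗ[ℂ] W, IsLeftModule 𝓥 gr Y d (ρ (slL (-1)))
  L_zero_commutator : ∀ u w,
    ρ (slL 0) ∘ Y u w - Y u (ρ (slL 0) w) =
      Y (ρV (slL 0) u) w + mulX 1 (Y (ρV (slL (-1)) u) w)
  L_pos_commutator : ∀ u w,
    ρ (slL 1) ∘ Y u w - Y u (ρ (slL 1) w) =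
      Y (ρV (slL 1) u) w + (2 : ℂ) • mulX 1 (Y (ρV (slL 0) u) w)
        + mulX 2 (Y (ρV (slL (-1)) u) w)
  generalized_weight : ∀ n, ∀ w ∈ gr n, ∃ m : ℕ,
    ((ρ (slL 0) - n • (1 : Module.End ℂ W)) ^ m) w = 0

/-- `(W, Y_W^R, ρ_W)` is a Möbius right `V`-module. The operator `d_W` is determined by the grading
and `D_W` is `L_W(-1)`. -/
structure IsMoebiusRightModule (𝓥 : VertexData V) (ρV : Sl2Rep V) (gr : ℂ → Submodule ℂ W)
    (Y : W → V → Series W) (ρ : Sl2Rep W) : Prop where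
  isRightModule : ∃ d : W →ₗ[ℂ] W, IsRightModule 𝓥 gr Y d (ρ (slL (-1)))
  L_zero_commutator : ∀ w u,
    ρ (slL 0) ∘ Y w u - Y w (ρV (slL 0) u) =
      Y (ρ (slL 0) w) u + mulX 1 (Y (ρ (slL (-1)) w) u)
  L_pos_commutator : ∀ w u,
    ρ (slL 1) ∘ Y w u - Y w (ρV (slL 1) u) =
      Y (ρ (slL 1) w) u + (2 : ℂ) • mulX 1 (Y (ρ (slL 0) w) u)
        + mulX 2 (Y (ρ (slL (-1)) w) u)
  generalized_weight : ∀ n, ∀ w ∈ gr n, ∃ m : ℕ,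
    ((ρ (slL 0) - n • (1 : Module.End ℂ W)) ^ m) w = 0

/-! ### The opposite vertex operator -/

/-- `(-x⁻²) ^ L(0) u`, which is `(-1) ^ n x ^ (-2 n) u` for `u ∈ V_(n)`. -/
def negInvSqPow (𝓥 : VertexData V) : V →ₗ[ℂ] Series V :=
  ofHomogeneous 𝓥.gr fun n => ((-1 : ℂ) ^ n) • LinearMap.single ℂ (fun _ : ℤ => V) (-2 * n)

/-- The opposite vertex operator `Y_W^o(u, x) w = Y_W^L(e ^ (x L(1)) (-x⁻²) ^ L(0) u, x⁻¹) w`: if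
`∑ p, a_p x ^ p` (a finite sum) is the first argument, then the coefficient of `x ^ k` is the sum
over `p` of the coefficient of `x ^ (p - k)` in `Y_W^L(a_p, x) w`. -/
def oppositeVertexOperator (𝓥 : VertexData V) (ρV : Sl2Rep V) (Y : V → W → Series W) :
    V → W → Series W :=
  fun u w k => ∑ᶠ p : ℤ, Y (expX (ρV (slL 1)) (negInvSqPow 𝓥 u) p) w (p - k)

end Modules

end MOSVA

end

open MOSVA

/-! The analytic axioms are traded for identities between formal series. By uniqueness of Fourier
coefficients on a torus, a series `a` that sums to f / D in a domain satisfies D · a = f formally.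
Conversely, such an identity can be divided back, one linear factor after another, by geometric
series, provided `a` is truncated in the directions that belong to the domain. Thus convergence to a
rational function with poles at z_i = 0 and z_i = z_j means truncation (`LTrunc`) together with
finite support after multiplication by a power of the product of all differences (`RationalSeries`).
For two operators, rationality of iterates and associativity become weak associativity: (x₀ + x₂)^N
a(x₀ + x₂, x₂) = (x₀ + x₂)^N b(x₀, x₂). The passage is `weakAssoc_of_associates` in one direction
and `WeakAssoc.iterateRational_and_associates` in the other.

Two constructions have to be carried through this dictionary.

The skew-symmetry opposite Y^R(w, x) u = e^{xD} Y(u, -x) w. A functional in the graded dual is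
killed by composition with high powers of D, because weights are bounded below; so e^{xD} is a
finite sum inside a matrix coefficient. A product of right operators is then an iterate of left
operators in negated variables, and conversely, so weak associativity is inherited
(`weakAssoc_skew`). Rationality of longer products is not a formal consequence of this. It is
obtained from products of left operators followed by one right operator on the vacuum, Y^R(w, x) 𝟏 =
e^{xD} w. There D acts as the sum of all partial derivatives, and a polynomial numerator is
recovered by integrating along the diagonal from x = 0 (`rationalSeries_of_divergence`). The left
operators are then moved through the right ones by weak commutativity (`weakComm`,
`RationalSeries.of_weakComm`) until they meet the vacuum, where left and right operators coincide
(`rational_opLin_skew`). This makes a left module a right module over the opposite algebra and, for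
V itself, makes V^op an algebra.

The contragredient operator. Transposition reverses products, which is why V^op acts, and Y' is a
finite sum of operators of the form x^m Y(a, x⁻¹), since L(1) is locally nilpotent on V. Inversion
of the variables preserves rationality (`RationalSeries.reflect`). For weak associativity everything
is reduced to homogeneous vectors. The two-variable series are then homogeneous, so inverting both
variables amounts to exchanging them and multiplying by a monomial. What remains is the formula for
e^{xL(1)} Y(u, y) v (`L_pos_pow_Y_apply`), a consequence of the bracket of L(1) with vertex
operators. The sl(2) axioms come from the commutators of L(0), L(±1) with the opposite operator.
Finite-dimensionality of the weight spaces enters twice: it identifies the double graded dual of W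
with W, so that matrix coefficients on W' are matrix coefficients on W, and it bounds the nilpotency
of L'(0) - n on each weight space.

Finally W' is a left V^op-module, hence a right module over (V^op)^op = V. -/

noncomputable section

namespace MOSVA

open MvPolynomial

/-! ### Formal Laurent series in several variables -/

/-- Doubly infinite formal Laurent series in variables indexed by `σ`. -/
abbrev MSeries (σ : Type*) := (σ → ℤ) → ℂ

section Act

variable {σ : Type*}

/-- The multiplication of formal series by polynomials. -/
def act : MvPolynomial σ ℂ →ₐ[ℂ] Module.End ℂ (MSeries σ) :=
  AddMonoidAlgebra.lift ℂ (Module.End ℂ (MSeries σ)) (σ →₀ ℕ)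
    { toFun := fun m => LinearMap.funLeft ℂ ℂ fun k i => k i - (m.toAdd i : ℤ)
      map_one' := by
        ext F k
        simp [LinearMap.funLeft_apply]
      map_mul' := by
        intro m n
        ext F k
        simp only [toAdd_mul, Finsupp.coe_add, Pi.add_apply, Nat.cast_add, Module.End.mul_apply,
          LinearMap.funLeft_apply]
        congr 1
        funext i
        ring }

theorem act_monomial_apply (m : σ →₀ ℕ) (c : ℂ) (F : MSeries σ) (k : σ → ℤ) :
    act (monomial m c) F k = c * F fun i => k i - m i := by
  have : act (monomial m c) = c • LinearMap.funLeft ℂ ℂ fun (k : σ → ℤ) i => k i - (m i : ℤ) := by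
    unfold act
    exact AddMonoidAlgebra.lift_single _ _ _
  rw [this]
  simp [LinearMap.funLeft_apply]

theorem act_C_apply (c : ℂ) (F : MSeries σ) : act (C c) F = c • F := by
  rw [← algebraMap_eq, AlgHom.commutes]
  rfl

theorem act_X_apply [DecidableEq σ] (i : σ) (F : MSeries σ) (k : σ → ℤ) :
    act (X i) F k = F (k - Pi.single i 1) := by
  rw [X, act_monomial_apply, one_mul]
  congr 1
  funext j
  by_cases h : j = i
  · subst h; simp
  · simp [h]

theorem act_mul_apply (p q : MvPolynomial σ ℂ) (F : MSeries σ) :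
    act (p * q) F = act p (act q F) := by
  rw [map_mul]; rfl

theorem act_comm (p q : MvPolynomial σ ℂ) (F : MSeries σ) :
    act p (act q F) = act q (act p F) := by
  rw [← act_mul_apply, mul_comm, act_mul_apply]

theorem act_one_apply (F : MSeries σ) : act 1 F = F := by
  rw [map_one]; rfl

theorem act_add_apply (p q : MvPolynomial σ ℂ) (F : MSeries σ) :
    act (p + q) F = act p F + act q F := by
  rw [map_add]; rfl

theorem act_sub_apply (p q : MvPolynomial σ ℂ) (F : MSeries σ) :
    act (p - q) F = act p F - act q F := by
  rw [map_sub]; rfl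

theorem act_neg_apply (p : MvPolynomial σ ℂ) (F : MSeries σ) :
    act (-p) F = - act p F := by
  rw [map_neg]; rfl

/-- The series with constant term `1` and no other terms. -/
def oneSeries (σ : Type*) : MSeries σ := by
  classical exact Pi.single 0 1

theorem oneSeries_apply (k : σ → ℤ) [Decidable (k = 0)] :
    oneSeries σ k = if k = 0 then 1 else 0 := by
  classical
  simp only [oneSeries, Pi.single_apply]
  split_ifs <;> rfl

/-- A predicate on series that is stable under sums, scalars and the variables is stable under
multiplication by polynomials. -/
theorem act_induction {P : MSeries σ → Prop} (hadd : ∀ F G, P F → P G → P (F + G))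
    (hsmul : ∀ (c : ℂ) F, P F → P (c • F)) (hX : ∀ i F, P F → P (act (X i) F))
    (p : MvPolynomial σ ℂ) {F : MSeries σ} (hF : P F) : P (act p F) := by
  induction p using MvPolynomial.induction_on generalizing F with
  | C c => rw [act_C_apply]; exact hsmul _ _ hF
  | add p q hp hq => rw [act_add_apply]; exact hadd _ _ (hp hF) (hq hF)
  | mul_X p i hp => rw [act_mul_apply]; exact hp (hX i _ hF)

/-- Linear maps that commute with the variables up to a ring homomorphism commute with
polynomials. -/
theorem act_intertwine {τ : Type*} {P : MSeries σ → Prop}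
    (hadd : ∀ F G, P F → P G → P (F + G)) (hsmul : ∀ (c : ℂ) F, P F → P (c • F))
    (hX : ∀ i F, P F → P (act (X i) F)) (T : MSeries σ → MSeries τ)
    (Tadd : ∀ F G, P F → P G → T (F + G) = T F + T G)
    (Tsmul : ∀ (c : ℂ) F, P F → T (c • F) = c • T F)
    (θ : MvPolynomial σ ℂ →ₐ[ℂ] MvPolynomial τ ℂ)
    (TX : ∀ i F, P F → T (act (X i) F) = act (θ (X i)) (T F))
    (p : MvPolynomial σ ℂ) {F : MSeries σ} (hF : P F) : T (act p F) = act (θ p) (T F) := by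
  induction p using MvPolynomial.induction_on generalizing F with
  | C c =>
    rw [act_C_apply, Tsmul _ _ hF, ← algebraMap_eq, AlgHom.commutes, algebraMap_eq, act_C_apply]
  | add p q hp hq =>
    rw [act_add_apply, Tadd _ _ (act_induction hadd hsmul hX p hF)
      (act_induction hadd hsmul hX q hF), hp hF, hq hF, map_add, act_add_apply]
  | mul_X p i hp =>
    rw [act_mul_apply, hp (hX i _ hF), TX i _ hF, map_mul, act_mul_apply]

/-- Multiplication by a variable is a shift of exponents, so monomial factors can always be
cancelled. Differences of variables cannot be cancelled in general: they annihilate formal delta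
functions. -/
theorem act_X_injective (i : σ) {F G : MSeries σ} (h : act (X i) F = act (X i) G) : F = G := by
  classical
  funext k
  have := congrFun h (k + Pi.single i 1)
  simpa [act_X_apply] using this

theorem act_X_pow_injective (i : σ) (n : ℕ) {F G : MSeries σ}
    (h : act (X i ^ n) F = act (X i ^ n) G) : F = G := by
  induction n with
  | zero => simpa [act_one_apply] using h
  | succ n ih =>
    rw [pow_succ', act_mul_apply, act_mul_apply] at h
    exact ih (act_X_injective i h)

theorem act_X_pow_apply [DecidableEq σ] (i : σ) (n : ℕ) (F : MSeries σ) (k : σ → ℤ) :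
    act (X i ^ n) F k = F (k - Pi.single i (n : ℤ)) := by
  induction n generalizing k with
  | zero => simp
  | succ n ih =>
    rw [pow_succ', act_mul_apply, act_X_apply, ih]
    congr 1
    rw [sub_sub, ← Pi.single_add]
    congr 2
    push_cast
    ring

/-! ### Finite support -/

/-- Laurent polynomials. -/
def FinSupp (F : MSeries σ) : Prop := (Function.support F).Finite

theorem FinSupp.add {F G : MSeries σ} (hF : FinSupp F) (hG : FinSupp G) : FinSupp (F + G) :=
  (Set.Finite.union hF hG).subset (Function.support_add F G)

theorem FinSupp.smul (c : ℂ) {F : MSeries σ} (hF : FinSupp F) : FinSupp (c • F) :=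
  Set.Finite.subset hF (Function.support_const_smul_subset c F)

theorem FinSupp.comp_injective {τ : Type*} {F : MSeries σ} (hF : FinSupp F)
    {e : (τ → ℤ) → (σ → ℤ)} (he : Function.Injective e) : FinSupp fun k => F (e k) :=
  Set.Finite.preimage (he.injOn) hF

theorem FinSupp.act {F : MSeries σ} (hF : FinSupp F) (p : MvPolynomial σ ℂ) :
    FinSupp (MOSVA.act p F) := by
  classical
  refine act_induction (P := FinSupp) (fun _ _ => FinSupp.add) (fun c _ => FinSupp.smul c)
    (fun i F hF => ?_) p hF
  have : MOSVA.act (X i) F = fun k => F (k - Pi.single i 1) := funext fun k => act_X_apply i F k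
  rw [this]
  exact hF.comp_injective (sub_left_injective)

theorem FinSupp.zero : FinSupp (0 : MSeries σ) := by simp [FinSupp]

theorem finSupp_oneSeries : FinSupp (oneSeries σ) := by
  classical
  refine (Set.finite_singleton (0 : σ → ℤ)).subset fun k hk => ?_
  by_contra h
  exact hk (by rw [oneSeries_apply]; simp_all)

theorem FinSupp.of_act_X_pow (i : σ) (n : ℕ) {F : MSeries σ} (h : FinSupp (MOSVA.act (X i ^ n) F)) :
    FinSupp F := by
  classical
  have : F = fun k => MOSVA.act (X i ^ n) F (k + Pi.single i (n : ℤ)) := by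
    funext k; rw [act_X_pow_apply, add_sub_cancel_right]
  rw [this]
  exact h.comp_injective (add_left_injective _)

theorem FinSupp.of_act_prod_X_pow (s : Finset σ) (n : ℕ) {F : MSeries σ}
    (h : FinSupp (MOSVA.act (∏ i ∈ s, X i ^ n) F)) : FinSupp F := by
  classical
  induction s using Finset.induction_on with
  | empty => simpa [act_one_apply] using h
  | insert i s hi ih =>
    rw [Finset.prod_insert hi, act_mul_apply] at h
    exact ih (h.of_act_X_pow i n)

end Act

/-! ### Convergence and uniqueness -/

section Sums

variable {σ : Type*} [Fintype σ]

/-- The Laurent monomial `z ^ k`. -/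
def mon (z : σ → ℂ) (k : σ → ℤ) : ℂ := ∏ i, z i ^ k i

theorem mon_add {z : σ → ℂ} (hz : ∀ i, z i ≠ 0) (k l : σ → ℤ) :
    mon z (k + l) = mon z k * mon z l := by
  simp only [mon, Pi.add_apply, ← Finset.prod_mul_distrib]
  exact Finset.prod_congr rfl fun i _ => zpow_add₀ (hz i) _ _

theorem mon_single [DecidableEq σ] (z : σ → ℂ) (i : σ) (n : ℤ) :
    mon z (Pi.single i n) = z i ^ n := by
  rw [mon, Finset.prod_eq_single i]
  · simp
  · intro j _ hj; simp [hj]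
  · simp

theorem mon_ne_zero {z : σ → ℂ} (hz : ∀ i, z i ≠ 0) (k : σ → ℤ) : mon z k ≠ 0 :=
  Finset.prod_ne_zero_iff.2 fun i _ => zpow_ne_zero _ (hz i)

/-- A variable shifts the index of summation, which changes the sum by the factor z i. -/
theorem hasSum_act {z : σ → ℂ} (hz : ∀ i, z i ≠ 0) {F : MSeries σ} {s : ℂ}
    (h : HasSum (fun k => F k * mon z k) s) (p : MvPolynomial σ ℂ) :
    HasSum (fun k => act p F k * mon z k) (eval z p * s) := by
  classical
  induction p using MvPolynomial.induction_on generalizing F s with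
  | C c =>
    simp only [act_C_apply, Pi.smul_apply, smul_eq_mul, eval_C, mul_assoc]
    exact h.mul_left c
  | add p q hp hq =>
    rw [RingHom.map_add, add_mul]
    simp only [act_add_apply, Pi.add_apply, add_mul]
    exact (hp h).add (hq h)
  | mul_X p i hp =>
    rw [RingHom.map_mul, eval_X, mul_assoc]
    simp only [act_mul_apply]
    refine hp ?_
    rw [← (Equiv.addRight (Pi.single i (1 : ℤ))).hasSum_iff]
    refine (h.mul_left (z i)).congr_fun fun k => ?_
    simp only [Function.comp, Equiv.coe_addRight, act_X_apply, add_sub_cancel_right, mon_add hz,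
      mon_single, zpow_one]
    ring

theorem hasSum_oneSeries (z : σ → ℂ) : HasSum (fun k => oneSeries σ k * mon z k) 1 := by
  classical
  convert hasSum_single (f := fun k => oneSeries σ k * mon z k) 0 ?_ using 1
  · simp [oneSeries_apply, mon]
  · intro k hk; simp [oneSeries_apply, hk]

section Fourier

attribute [local instance] instMeasureSpaceUnitAddCircle
  instIsProbabilityMeasureUnitAddCircleVolume

/-- Uniqueness of Laurent expansions. -/
theorem eq_zero_of_hasSum_torus {H : MSeries σ} {r : σ → ℝ} (hr : ∀ i, 0 < r i)
    (h : ∀ z : σ → ℂ, (∀ i, ‖z i‖ = r i) → HasSum (fun k => H k * mon z k) 0) : H = 0 := by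
  classical
  have hr0 : ∀ i, (r i : ℂ) ≠ 0 := fun i => by exact_mod_cast (hr i).ne'
  -- Rescaling by the radii reduces to the unit torus, where the monomials are the characters.
  set c : (σ → ℤ) → ℂ := fun k => H k * mon (fun i => (r i : ℂ)) k with hc
  have hcs : Summable c := (h (fun i => (r i : ℂ)) fun i => by
    simp [abs_of_pos (hr i)]).summable
  have hsum : Summable fun k => c k • UnitAddTorus.mFourier k := by
    refine Summable.of_norm ?_
    simpa [norm_smul, UnitAddTorus.mFourier_norm] using hcs.norm
  have hval : ∀ x : UnitAddTorus σ, HasSum (fun k => c k * UnitAddTorus.mFourier k x) 0 := by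
    intro x
    have := h (fun i => r i * AddCircle.toCircle (x i)) fun i => by
      rw [norm_mul, Circle.norm_coe, mul_one, Complex.norm_real, Real.norm_of_nonneg (hr i).le]
    convert this using 1
    funext k
    simp only [hc, mul_assoc]
    congr 1
    simp only [mon, mul_zpow, Finset.prod_mul_distrib, UnitAddTorus.mFourier]
    congr 1
    simp [fourier_apply, AddCircle.toCircle_zsmul]
  -- The characters have sup norm one, so the series converges uniformly. It can therefore be mapped
  -- to L² and paired with a single character.
  have hg : HasSum (fun k => c k • UnitAddTorus.mFourier k) (0 : C(UnitAddTorus σ, ℂ)) := by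
    have h1 := hsum.hasSum
    convert h1
    ext x
    have h2 := (ContinuousMap.evalCLM ℂ x).hasSum h1
    exact (hval x).unique (by simpa using h2)
  have hL : HasSum (fun k => ContinuousMap.toLp (E := ℂ) 2 MeasureTheory.volume ℂ
      (c k • UnitAddTorus.mFourier k)) 0 := by
    simpa using (ContinuousMap.toLp (E := ℂ) 2 MeasureTheory.volume ℂ).hasSum hg
  funext n
  let T : MeasureTheory.Lp ℂ 2 (MeasureTheory.volume : MeasureTheory.Measure (UnitAddTorus σ)) →L[ℂ]
    ℂ := innerSL ℂ (UnitAddTorus.mFourierLp (d := σ) 2 n)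
  have hin := T.hasSum hL
  have hc0 : c n = 0 := by
    have h3 : ∀ k, T
        (ContinuousMap.toLp (E := ℂ) 2 MeasureTheory.volume ℂ (c k • UnitAddTorus.mFourier k))
        = if k = n then c n else 0 := by
      intro k
      rw [map_smul]
      change inner ℂ (UnitAddTorus.mFourierLp 2 n) (c k • UnitAddTorus.mFourierLp 2 k) = _
      rw [inner_smul_right, orthonormal_iff_ite.1 UnitAddTorus.orthonormal_mFourier]
      by_cases hk : k = n
      · simp [hk]
      · simp [hk, Ne.symm hk]
    simp only [h3, map_zero] at hin
    exact (hasSum_ite_eq n (c n)).unique hin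
  have : mon (fun i => (r i : ℂ)) n ≠ 0 := mon_ne_zero hr0 n
  simpa [hc, this] using hc0

end Fourier

/-- A series which sums to `f / D` on a torus is an expansion of `f / D`. -/
theorem act_eq_of_hasSum_torus {F : MSeries σ} {r : σ → ℝ} (hr : ∀ i, 0 < r i)
    {f D : MvPolynomial σ ℂ}
    (h : ∀ z : σ → ℂ, (∀ i, ‖z i‖ = r i) →
      eval z D ≠ 0 ∧ HasSum (fun k => F k * mon z k) (eval z f / eval z D)) :
    act D F = act f (oneSeries σ) := by
  refine sub_eq_zero.1 (eq_zero_of_hasSum_torus hr fun z hz => ?_)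
  have hz0 : ∀ i, z i ≠ 0 := fun i => norm_pos_iff.1 (by rw [hz i]; exact hr i)
  have h1 := hasSum_act hz0 (h z hz).2 D
  have h2 := hasSum_act hz0 (hasSum_oneSeries z) f
  rw [mul_div_cancel₀ _ (h z hz).1] at h1
  simpa [sub_mul] using h1.sub h2

end Sums

/-! ### Expansions in domains `|z i| > |z j|` -/

section LTrunc

variable {σ : Type*} [DecidableEq σ]

/-- `F` vanishes far out in the direction `e i - e j`; this holds for expansions in a domain with
`|z i| > |z j|`. -/
def LTrunc (i j : σ) (F : MSeries σ) : Prop :=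
  ∀ k, ∃ I : ℕ, ∀ n ≥ I, F (k + (Pi.single i (n : ℤ) - Pi.single j (n : ℤ))) = 0

variable {i j : σ}

theorem LTrunc.add {F G : MSeries σ} (hF : LTrunc i j F) (hG : LTrunc i j G) :
    LTrunc i j (F + G) := by
  intro k
  obtain ⟨I, hI⟩ := hF k
  obtain ⟨J, hJ⟩ := hG k
  refine ⟨max I J, fun n hn => ?_⟩
  rw [Pi.add_apply, hI n (le_trans (le_max_left _ _) hn), hJ n (le_trans (le_max_right _ _) hn),
    add_zero]

theorem LTrunc.smul (c : ℂ) {F : MSeries σ} (hF : LTrunc i j F) : LTrunc i j (c • F) := by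
  intro k
  obtain ⟨I, hI⟩ := hF k
  exact ⟨I, fun n hn => by rw [Pi.smul_apply, hI n hn, smul_zero]⟩

theorem LTrunc.zero : LTrunc i j (0 : MSeries σ) := fun _ => ⟨0, fun _ _ => rfl⟩

theorem LTrunc.neg {F : MSeries σ} (hF : LTrunc i j F) : LTrunc i j (-F) := by
  have := hF.smul (-1)
  rwa [neg_one_smul] at this

theorem LTrunc.sub {F G : MSeries σ} (hF : LTrunc i j F) (hG : LTrunc i j G) :
    LTrunc i j (F - G) := by
  rw [sub_eq_add_neg]; exact hF.add hG.neg

theorem LTrunc.sum {ι : Type*} (s : Finset ι) {F : ι → MSeries σ}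
    (hF : ∀ a ∈ s, LTrunc i j (F a)) : LTrunc i j (∑ a ∈ s, F a) :=
  Finset.sum_induction F (LTrunc i j) (fun _ _ => LTrunc.add) LTrunc.zero hF

theorem LTrunc.act_X {F : MSeries σ} (hF : LTrunc i j F) (l : σ) : LTrunc i j (act (X l) F) := by
  intro k
  obtain ⟨I, hI⟩ := hF (k - Pi.single l 1)
  refine ⟨I, fun n hn => ?_⟩
  rw [act_X_apply, ← hI n hn]
  congr 1
  abel

theorem LTrunc.act {F : MSeries σ} (hF : LTrunc i j F) (p : MvPolynomial σ ℂ) :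
    LTrunc i j (MOSVA.act p F) :=
  act_induction (P := LTrunc i j) (fun _ _ => LTrunc.add) (fun c _ => LTrunc.smul c)
    (fun l _ hF => LTrunc.act_X hF l) p hF

theorem FinSupp.lTrunc (hij : i ≠ j) {F : MSeries σ} (hF : FinSupp F) : LTrunc i j F := by
  intro k
  have hinj : Function.Injective fun n : ℕ =>
      k + (Pi.single i (n : ℤ) - Pi.single j (n : ℤ) : σ → ℤ) := by
    intro m n h
    have := congrFun h i
    simpa [hij] using this
  obtain ⟨I, hI⟩ := (hF.preimage hinj.injOn).bddAbove
  refine ⟨I + 1, fun n hn => ?_⟩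
  by_contra h
  have := hI (show n ∈ _ from h)
  omega

theorem act_linear_apply (c : ℂ) (F : MSeries σ) (k : σ → ℤ) :
    act (X i + C c * X j) F k = F (k - Pi.single i 1) + c * F (k - Pi.single j 1) := by
  rw [act_add_apply, act_mul_apply, act_C_apply, Pi.add_apply, Pi.smul_apply, act_X_apply,
    act_X_apply, smul_eq_mul]

/-- The partial sums of the geometric series for the inverse of X i + c X j, in powers of X j / X i,
telescope. Truncation in the direction e i - e j removes the remainder. -/
theorem sum_range_act_linear (c : ℂ) (F : MSeries σ) (k : σ → ℤ) (M : ℕ) :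
    ∑ m ∈ Finset.range M, (-c) ^ m * act (X i + C c * X j) F
        (k + Pi.single i 1 + (Pi.single i (m : ℤ) - Pi.single j (m : ℤ))) =
      F k - (-c) ^ M * F (k + (Pi.single i (M : ℤ) - Pi.single j (M : ℤ))) := by
  induction M with
  | zero => simp
  | succ M ih =>
    rw [Finset.sum_range_succ, ih, act_linear_apply]
    have e1 : k + Pi.single i 1 + (Pi.single i (M : ℤ) - Pi.single j (M : ℤ)) - Pi.single i 1
        = k + (Pi.single i (M : ℤ) - Pi.single j (M : ℤ)) := by abel
    have e2 : k + Pi.single i 1 + (Pi.single i (M : ℤ) - Pi.single j (M : ℤ)) - Pi.single j 1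
        = k + (Pi.single i ((M + 1 : ℕ) : ℤ) - Pi.single j ((M + 1 : ℕ) : ℤ)) := by
      push_cast
      rw [Pi.single_add, Pi.single_add]
      abel
    rw [e1, e2, pow_succ]
    ring

/-- Without truncation this fails for c ≠ 0, as the delta functions show; with truncation the
telescoping sum has no remainder. -/
theorem LTrunc.eq_zero_of_act_linear {c : ℂ} {F : MSeries σ} (hF : LTrunc i j F)
    (h : MOSVA.act (X i + C c * X j) F = 0) : F = 0 := by
  funext k
  obtain ⟨I, hI⟩ := hF k
  have := sum_range_act_linear (i := i) (j := j) c F k I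
  rw [h, hI I le_rfl] at this
  simpa using this.symm

theorem LTrunc.eq_zero_of_act_linear_pow {c : ℂ} {F : MSeries σ} (hF : LTrunc i j F) {N : ℕ}
    (h : MOSVA.act ((X i + C c * X j) ^ N) F = 0) : F = 0 := by
  induction N with
  | zero => simpa using h
  | succ N ih =>
    rw [pow_succ', act_mul_apply] at h
    exact ih ((hF.act _).eq_zero_of_act_linear h)

theorem LTrunc.eq_zero_of_act_sub_pow {F : MSeries σ} (hF : LTrunc i j F) {N : ℕ}
    (h : MOSVA.act ((X i - X j) ^ N) F = 0) : F = 0 := by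
  refine hF.eq_zero_of_act_linear_pow (c := -1) (N := N) ?_
  rw [← h]
  congr 3
  simp [sub_eq_add_neg]

variable [Fintype σ]

theorem mon_add_single_sub {z : σ → ℂ} (hz : ∀ i, z i ≠ 0) (k : σ → ℤ) (m : ℕ) :
    mon z (k + Pi.single i 1 + (Pi.single i (m : ℤ) - Pi.single j (m : ℤ)))
      = mon z k * z i * (z i ^ m / z j ^ m) := by
  have hs : (-Pi.single j (m : ℤ) : σ → ℤ) = Pi.single j (-(m : ℤ)) := by
    rw [Pi.single_neg]
  rw [sub_eq_add_neg, hs, mon_add hz, mon_add hz, mon_add hz, mon_single, mon_single,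
    mon_single, zpow_one, zpow_neg, zpow_natCast, zpow_natCast]
  rfl

/-- The shear `(k, m) ↦ (k + e i + m (e i - e j), m)`. -/
def shearEquiv (i j : σ) : (σ → ℤ) × ℕ ≃ (σ → ℤ) × ℕ where
  toFun p := (p.1 + Pi.single i 1 + (Pi.single i (p.2 : ℤ) - Pi.single j (p.2 : ℤ)), p.2)
  invFun p := (p.1 - (Pi.single i 1 + (Pi.single i (p.2 : ℤ) - Pi.single j (p.2 : ℤ))), p.2)
  left_inv p := by ext1 <;> simp [add_assoc]
  right_inv p := by ext1 <;> simp [add_assoc]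

/-- Division of an absolutely convergent series by `z i + c z j`, expanded in the domain
`|z i| > |c z j|`. -/
theorem LTrunc.hasSum_div {c : ℂ} {F : MSeries σ} (hF : LTrunc i j F) {z : σ → ℂ}
    (hz : ∀ i, z i ≠ 0) (hij : ‖c * z j‖ < ‖z i‖) {s : ℂ}
    (h : HasSum (fun k => MOSVA.act (X i + C c * X j) F k * mon z k) s) :
    HasSum (fun k => F k * mon z k) (s / (z i + c * z j)) := by
  obtain ⟨G, hG⟩ : ∃ G, G = MOSVA.act (X i + C c * X j) F := ⟨_, rfl⟩
  rw [← hG] at h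
  obtain ⟨ρ, hρ⟩ : ∃ ρ, ρ = -(c * z j / z i) := ⟨_, rfl⟩
  have hρ1 : ‖ρ‖ < 1 := by
    rw [hρ, norm_neg, norm_div]
    exact (div_lt_one (norm_pos_iff.2 (hz i))).2 hij
  have hgeo : HasSum (fun m : ℕ => (z i)⁻¹ * ρ ^ m) ((z i)⁻¹ * (1 - ρ)⁻¹) :=
    (hasSum_geometric_of_norm_lt_one hρ1).mul_left (z i)⁻¹
  have hsm : Summable fun x : (σ → ℤ) × ℕ => G x.1 * mon z x.1 * ((z i)⁻¹ * ρ ^ x.2) :=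
    summable_mul_of_summable_norm (f := fun k => G k * mon z k) (g := fun m : ℕ => (z i)⁻¹ * ρ ^ m)
      h.summable.norm hgeo.summable.norm
  have hmul : HasSum (fun x : (σ → ℤ) × ℕ => G x.1 * mon z x.1 * ((z i)⁻¹ * ρ ^ x.2))
    (s * ((z i)⁻¹ * (1 - ρ)⁻¹)) := by
    rw [← h.tsum_eq, ← hgeo.tsum_eq, h.summable.tsum_mul_tsum hgeo.summable hsm]
    exact hsm.hasSum
  have hval : s * ((z i)⁻¹ * (1 - ρ)⁻¹) = s / (z i + c * z j) := by
    rw [div_eq_mul_inv, ← mul_inv, hρ]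
    congr 2
    rw [sub_neg_eq_add, mul_add, mul_one, mul_div_cancel₀ _ (hz i)]
  rw [hval, ← (shearEquiv i j).hasSum_iff] at hmul
  have key : ∀ p : (σ → ℤ) × ℕ, (-c) ^ p.2 *
      G (p.1 + Pi.single i 1 + (Pi.single i (p.2 : ℤ) - Pi.single j (p.2 : ℤ))) * mon z p.1
      = ((fun x : (σ → ℤ) × ℕ => G x.1 * mon z x.1 * ((z i)⁻¹ * ρ ^ x.2)) ∘ shearEquiv i j) p := by
    rintro ⟨k, m⟩
    simp only [Function.comp, shearEquiv, Equiv.coe_fn_mk, mon_add_single_sub hz]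
    have h1 : (-c) ^ m = (z i ^ m / z j ^ m) * ρ ^ m := by
      rw [hρ, ← div_pow, ← mul_pow]
      congr 1
      have hi := hz i
      have hj := hz j
      field_simp
    rw [h1]
    have h2 : z i * (z i)⁻¹ = 1 := mul_inv_cancel₀ (hz i)
    linear_combination (-(z i ^ m / z j ^ m) * ρ ^ m * mon z k *
      G (k + Pi.single i 1 + (Pi.single i (m : ℤ) - Pi.single j (m : ℤ)))) * h2
  have hmul' := hmul.congr_fun key
  -- The double series is the product with the geometric series. Summed over `m` for fixed `k`, it
  -- telescopes to the coefficient of `F`, and only finitely many `m` contribute because `F` is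
  -- truncated.
  refine hmul'.prod_fiberwise fun k => ?_
  obtain ⟨I, hI⟩ := hF k
  have hsum := sum_range_act_linear (i := i) (j := j) c F k I
  rw [hI I le_rfl, mul_zero, sub_zero, ← hG] at hsum
  rw [← hsum, Finset.sum_mul]
  refine hasSum_sum_of_ne_finset_zero fun m hm => ?_
  have hm' : I ≤ m := by simpa using hm
  have e1 : k + Pi.single i 1 + (Pi.single i (m : ℤ) - Pi.single j (m : ℤ)) - Pi.single i 1
      = k + (Pi.single i (m : ℤ) - Pi.single j (m : ℤ)) := by abel
  have e2 : k + Pi.single i 1 + (Pi.single i (m : ℤ) - Pi.single j (m : ℤ)) - Pi.single j 1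
      = k + (Pi.single i ((m + 1 : ℕ) : ℤ) - Pi.single j ((m + 1 : ℕ) : ℤ)) := by
    push_cast
    rw [Pi.single_add, Pi.single_add]
    abel
  rw [hG, act_linear_apply, e1, e2, hI m hm', hI (m + 1) (by omega)]
  simp

theorem hasSum_div_X {F : MSeries σ} {z : σ → ℂ} (hz : ∀ i, z i ≠ 0) {s : ℂ} (i : σ)
    (h : HasSum (fun k => act (X i) F k * mon z k) s) :
    HasSum (fun k => F k * mon z k) (s / z i) := by
  rw [← (Equiv.addRight (Pi.single i (1 : ℤ))).hasSum_iff] at h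
  rw [div_eq_inv_mul]
  refine (h.mul_left (z i)⁻¹).congr_fun fun k => ?_
  simp only [Function.comp, Equiv.coe_addRight, act_X_apply, add_sub_cancel_right, mon_add hz,
    mon_single, zpow_one]
  field_simp [hz i]

end LTrunc

/-! ### Division of convergent series by products of linear forms -/

section CanDivide

variable {σ : Type*} [Fintype σ]

/-- The polynomials by which series with the property `P` can be divided at the point `z`. -/
def CanDivide (P : MSeries σ → Prop) (z : σ → ℂ) (p : MvPolynomial σ ℂ) : Prop :=
  ∀ F, P F → ∀ s, HasSum (fun k => act p F k * mon z k) s →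
    HasSum (fun k => F k * mon z k) (s / eval z p)

/-- Division by `p` is applied to the series `act q F`, so the truncation property has to survive
multiplication by polynomials. -/
theorem CanDivide.mul {P : MSeries σ → Prop} (hP : ∀ p F, P F → P (act p F)) {z : σ → ℂ}
    {p q : MvPolynomial σ ℂ} (hp : CanDivide P z p) (hq : CanDivide P z q) :
    CanDivide P z (p * q) := by
  intro F hF s hs
  rw [RingHom.map_mul, ← div_div]
  refine hq F hF _ (hp _ (hP _ _ hF) s ?_)
  simpa only [act_mul_apply] using hs

theorem CanDivide.one {P : MSeries σ → Prop} {z : σ → ℂ} : CanDivide P z 1 := by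
  intro F _ s hs
  simpa using hs

theorem CanDivide.prod {P : MSeries σ → Prop} (hP : ∀ p F, P F → P (act p F)) {z : σ → ℂ}
    {ι : Type*} (s : Finset ι) (p : ι → MvPolynomial σ ℂ) (hp : ∀ a ∈ s, CanDivide P z (p a)) :
    CanDivide P z (∏ a ∈ s, p a) :=
  Finset.prod_induction p (CanDivide P z) (fun _ _ => CanDivide.mul hP) CanDivide.one hp

theorem CanDivide.pow {P : MSeries σ → Prop} (hP : ∀ p F, P F → P (act p F)) {z : σ → ℂ}
    {p : MvPolynomial σ ℂ} (hp : CanDivide P z p) (n : ℕ) : CanDivide P z (p ^ n) := by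
  simpa using CanDivide.prod hP (Finset.range n) (fun _ => p) fun _ _ => hp

end CanDivide

/-! ### Rational series -/

open Classical in
/-- A series in the variables `τ`, regarded as a series in more variables. -/
def extSeries {σ τ : Type*} (e : τ → σ) (F : MSeries τ) : MSeries σ :=
  fun k => if ∀ i ∉ Set.range e, k i = 0 then F (k ∘ e) else 0

section Rational

variable {σ : Type*} [Fintype σ] [DecidableEq σ]

/-- The product of all `X i - X j` with `i ≠ j`. -/
def vander (σ : Type*) [Fintype σ] [DecidableEq σ] : MvPolynomial σ ℂ :=
  ∏ i, ∏ j, if i = j then 1 else X i - X j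

/-- Expansions of rational functions whose poles are at `z i = 0` and at `z i = z j`. -/
def RationalSeries (F : MSeries σ) : Prop := ∃ q : ℕ, FinSupp (act (vander σ ^ q) F)

omit [Fintype σ] [DecidableEq σ] in
theorem FinSupp.of_dvd {p r : MvPolynomial σ ℂ} (h : p ∣ r) {F : MSeries σ}
    (hF : FinSupp (MOSVA.act p F)) : FinSupp (MOSVA.act r F) := by
  obtain ⟨c, rfl⟩ := h
  rw [mul_comm, act_mul_apply]
  exact hF.act c

/-- Monomials act invertibly on series with finite support, so poles at z i = 0 need no record; only
the order of the poles on the diagonals matters. -/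
theorem RationalSeries.of_dvd {p : MvPolynomial σ ℂ} {N q : ℕ}
    (h : p ∣ (∏ i, X i) ^ N * vander σ ^ q) {F : MSeries σ} (hF : FinSupp (act p F)) :
    RationalSeries F := by
  refine ⟨q, ?_⟩
  have := hF.of_dvd h
  rw [act_mul_apply, ← Finset.prod_pow] at this
  exact this.of_act_prod_X_pow _ _

theorem RationalSeries.add {F G : MSeries σ} (hF : RationalSeries F) (hG : RationalSeries G) :
    RationalSeries (F + G) := by
  obtain ⟨q, hq⟩ := hF
  obtain ⟨r, hr⟩ := hG
  refine ⟨q + r, ?_⟩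
  rw [map_add]
  exact (hq.of_dvd (pow_dvd_pow _ (by omega))).add (hr.of_dvd (pow_dvd_pow _ (by omega)))

theorem RationalSeries.zero : RationalSeries (0 : MSeries σ) :=
  ⟨0, by simpa using FinSupp.zero⟩

theorem RationalSeries.sum {ι : Type*} (s : Finset ι) {F : ι → MSeries σ}
    (hF : ∀ a ∈ s, RationalSeries (F a)) : RationalSeries (∑ a ∈ s, F a) :=
  Finset.sum_induction F RationalSeries (fun _ _ => RationalSeries.add) RationalSeries.zero hF

/-- `q` arises from `p` by the inversion of the variables, up to a monomial. -/
def ReflectsTo (p q : MvPolynomial σ ℂ) : Prop :=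
  ∃ v : σ → ℤ, ∀ F : MSeries σ, act p (fun k => F (-k)) = fun k => act q F (v - k)

omit [Fintype σ] [DecidableEq σ] in
theorem ReflectsTo.mul {p q p' q' : MvPolynomial σ ℂ} (h : ReflectsTo p q)
    (h' : ReflectsTo p' q') : ReflectsTo (p * p') (q * q') := by
  obtain ⟨v, hv⟩ := h
  obtain ⟨w, hw⟩ := h'
  refine ⟨v + w, fun F => ?_⟩
  have key : ∀ G : MSeries σ, act p (fun k => G (w - k)) = fun k => act q G (v + w - k) := by
    intro G
    have := hv fun k => G (w + k)
    simp only [← sub_eq_add_neg] at this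
    rw [this]
    have h2 := act_intertwine (P := fun _ : MSeries σ => True) (by simp) (by simp) (by simp)
      (fun (F : MSeries σ) k => F (w + k)) (by intros; rfl) (by intros; rfl)
      (AlgHom.id ℂ _) (by
        classical
        intro i F _
        funext k
        simp only [AlgHom.coe_id, id, act_X_apply]
        congr 1
        abel) q (F := G) trivial
    funext k
    have h3 := congrFun h2 (v - k)
    simp only [AlgHom.coe_id, id] at h3
    rw [← h3]
    exact congrArg (act q G) (by abel)
  rw [act_mul_apply, hw, key]
  funext k
  rw [act_mul_apply]

omit [Fintype σ] [DecidableEq σ] in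
theorem ReflectsTo.one : ReflectsTo (1 : MvPolynomial σ ℂ) 1 :=
  ⟨0, fun F => by simp⟩

omit [Fintype σ] [DecidableEq σ] in
theorem ReflectsTo.prod {ι : Type*} (s : Finset ι) {p q : ι → MvPolynomial σ ℂ}
    (h : ∀ a ∈ s, ReflectsTo (p a) (q a)) : ReflectsTo (∏ a ∈ s, p a) (∏ a ∈ s, q a) := by
  classical
  induction s using Finset.induction_on with
  | empty => simpa using ReflectsTo.one
  | insert a s ha ih =>
    rw [Finset.prod_insert ha, Finset.prod_insert ha]
    exact (h a (Finset.mem_insert_self _ _)).mul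
      (ih fun b hb => h b (Finset.mem_insert_of_mem hb))

omit [Fintype σ] in
theorem reflectsTo_X_sub_X (i j : σ) : ReflectsTo (X i - X j : MvPolynomial σ ℂ) (X j - X i) := by
  -- This is x_i⁻¹ - x_j⁻¹ = (x_j - x_i) / (x_i x_j).
  refine ⟨Pi.single i 1 + Pi.single j 1, fun F => ?_⟩
  funext k
  simp only [act_sub_apply, Pi.sub_apply, act_X_apply]
  congr 2 <;> abel

theorem reflectsTo_vander : ReflectsTo (vander σ) (vander σ) := by
  have : vander σ = ∏ i : σ, ∏ j : σ, if i = j then 1 else X j - X i := by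
    rw [vander, Finset.prod_comm]
    simp only [eq_comm]
  conv => arg 2; rw [this]
  refine ReflectsTo.prod _ fun i _ => ReflectsTo.prod _ fun j _ => ?_
  split_ifs
  · exact ReflectsTo.one
  · exact reflectsTo_X_sub_X i j

/-- Inversion of all variables maps differences to differences up to sign and monomials. The lemma
serves the substitution x ↦ x⁻¹ in the opposite vertex operator; `v` accounts for an additional
monomial factor. -/
theorem RationalSeries.reflect {F : MSeries σ} (hF : RationalSeries F) (v : σ → ℤ) :
    RationalSeries fun k => F (v - k) := by
  obtain ⟨q, hq⟩ := hF
  have h : ReflectsTo (vander σ ^ q) (vander σ ^ q) := by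
    rw [← Finset.card_range q, ← Finset.prod_const]
    exact ReflectsTo.prod _ fun _ _ => reflectsTo_vander
  have h1 : ReflectsTo (1 : MvPolynomial σ ℂ) 1 := ReflectsTo.one
  obtain ⟨w, hw⟩ := h
  refine ⟨q, ?_⟩
  have h2 := act_intertwine (P := fun _ : MSeries σ => True) (by simp) (by simp) (by simp)
    (fun (F : MSeries σ) k => F (k - v)) (by intros; rfl) (by intros; rfl)
    (AlgHom.id ℂ _) (by
      intro i F _
      funext k
      simp only [AlgHom.coe_id, id, act_X_apply]
      congr 1
      abel) (vander σ ^ q) (F := fun k => F (-k)) trivial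
  have h3 : (fun k => F (v - k)) = fun k => (fun k => F (-k)) (k - v) := by
    funext k; simp
  rw [h3]
  simp only [AlgHom.coe_id, id] at h2
  rw [← h2, hw]
  refine hq.comp_injective (e := fun k => w - (k - v)) fun a b h => ?_
  simpa using h

/-! ### Change of variables -/

section Ext

variable {τ : Type*} [Fintype τ] [DecidableEq τ]

omit [Fintype σ] [Fintype τ] in
theorem act_rename_extSeries {e : τ → σ} (he : Function.Injective e) (p : MvPolynomial τ ℂ)
    (F : MSeries τ) : act (rename e p) (extSeries e F) = extSeries e (act p F) := by
  refine (act_intertwine (P := fun _ => True) (by simp) (by simp) (by simp) (extSeries e) ?_ ?_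
    (rename e) ?_ p trivial).symm
  · intro F G _ _
    funext k
    simp only [extSeries, Pi.add_apply]
    split_ifs <;> simp
  · intro c F _
    funext k
    simp only [extSeries, Pi.smul_apply]
    split_ifs <;> simp
  · intro a F _
    funext k
    rw [rename_X, act_X_apply]
    unfold extSeries
    have h1 : (∀ i ∉ Set.range e, (k - Pi.single (e a) 1 : σ → ℤ) i = 0) ↔ ∀ i ∉ Set.range e, k i = 0 := by
      refine forall₂_congr fun i hi => ?_
      have : i ≠ e a := fun h => hi ⟨a, h.symm⟩
      simp [this]
    have h2 : (k - Pi.single (e a) 1) ∘ e = k ∘ e - Pi.single a 1 := by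
      funext b
      by_cases hb : b = a
      · subst hb; simp
      · simp [hb, he.ne hb]
    simp only [h2, act_X_apply]
    classical exact if_congr h1.symm rfl rfl

omit [Fintype σ] [DecidableEq σ] [Fintype τ] [DecidableEq τ] in
theorem extSeries_extend {e : τ → σ} (he : Function.Injective e) (F : MSeries τ) (l : τ → ℤ) :
    extSeries e F (Function.extend e l 0) = F l := by
  rw [extSeries, if_pos]
  · congr 1
    funext a
    simp [he.extend_apply]
  · intro i hi
    rw [Function.extend_apply']
    · rfl
    · simpa using hi

omit [Fintype σ] [DecidableEq σ] [Fintype τ] [DecidableEq τ] in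
theorem extend_injective {e : τ → σ} (he : Function.Injective e) :
    Function.Injective fun l : τ → ℤ => Function.extend e l 0 := by
  intro l m h
  funext a
  have := congrFun h (e a)
  simpa [he.extend_apply] using this

omit [Fintype σ] [DecidableEq σ] [Fintype τ] [DecidableEq τ] in
theorem FinSupp.extSeries {e : τ → σ} (he : Function.Injective e) {F : MSeries τ}
    (hF : FinSupp F) : FinSupp (extSeries e F) := by
  refine (Set.Finite.image (fun l : τ → ℤ => Function.extend e l 0) hF).subset fun k hk => ?_
  simp only [Function.mem_support, MOSVA.extSeries, ne_eq, ite_eq_right_iff, not_forall] at hk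
  obtain ⟨h1, h2⟩ := hk
  refine ⟨k ∘ e, h2, ?_⟩
  funext i
  by_cases hi : i ∈ Set.range e
  · obtain ⟨a, rfl⟩ := hi
    simp [he.extend_apply]
  · rw [h1 i hi]
    exact Function.extend_apply' _ _ _ (by simpa using hi)

theorem rename_vander_dvd {e : τ → σ} (he : Function.Injective e) :
    rename e (vander τ) ∣ vander σ := by
  have h : rename e (vander τ) = ∏ i ∈ Finset.univ.image e, ∏ j ∈ Finset.univ.image e,
      (if i = j then 1 else X i - X j : MvPolynomial σ ℂ) := by
    rw [Finset.prod_image he.injOn, vander, map_prod]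
    refine Finset.prod_congr rfl fun a _ => ?_
    rw [Finset.prod_image he.injOn, map_prod]
    refine Finset.prod_congr rfl fun b _ => ?_
    simp only [he.eq_iff]
    split_ifs <;> simp
  rw [h, vander]
  exact (Finset.prod_dvd_prod_of_dvd _ _ fun i _ =>
    Finset.prod_dvd_prod_of_subset _ _ _ (Finset.subset_univ _)).trans
    (Finset.prod_dvd_prod_of_subset _ _ _ (Finset.subset_univ _))

theorem RationalSeries.extSeries {e : τ → σ} (he : Function.Injective e) {F : MSeries τ}
    (hF : RationalSeries F) : RationalSeries (extSeries e F) := by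
  obtain ⟨q, hq⟩ := hF
  refine ⟨q, ?_⟩
  have h1 : rename e (vander τ ^ q) ∣ vander σ ^ q := by
    rw [map_pow]; exact pow_dvd_pow_of_dvd (rename_vander_dvd he) q
  refine FinSupp.of_dvd h1 ?_
  rw [act_rename_extSeries he]
  exact FinSupp.extSeries he hq

theorem RationalSeries.comp_equiv (e : τ ≃ σ) {F : MSeries τ} (hF : RationalSeries F) :
    RationalSeries fun k : σ → ℤ => F (k ∘ e) := by
  have := hF.extSeries e.injective
  convert this using 1
  funext k
  simp [MOSVA.extSeries]

end Ext

end Rational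

/-! ### Polynomials -/

section IsPoly

variable {σ : Type*} [Fintype σ]

/-- Formal series that are polynomials. -/
def IsPoly (F : MSeries σ) : Prop := ∃ d : ℤ, ∀ k, F k ≠ 0 → (∀ i, 0 ≤ k i) ∧ ∑ i, k i ≤ d

theorem IsPoly.add {F G : MSeries σ} (hF : IsPoly F) (hG : IsPoly G) : IsPoly (F + G) := by
  obtain ⟨d, hd⟩ := hF
  obtain ⟨d', hd'⟩ := hG
  refine ⟨max d d', fun k hk => ?_⟩
  by_cases h : F k = 0
  · have : G k ≠ 0 := fun h' => hk (by simp [h, h'])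
    exact ⟨(hd' k this).1, (hd' k this).2.trans (le_max_right _ _)⟩
  · exact ⟨(hd k h).1, (hd k h).2.trans (le_max_left _ _)⟩

theorem IsPoly.smul (c : ℂ) {F : MSeries σ} (hF : IsPoly F) : IsPoly (c • F) := by
  obtain ⟨d, hd⟩ := hF
  exact ⟨d, fun k hk => hd k fun h => hk (by simp [h])⟩

theorem IsPoly.act {F : MSeries σ} (hF : IsPoly F) (p : MvPolynomial σ ℂ) :
    IsPoly (MOSVA.act p F) := by
  classical
  refine act_induction (P := IsPoly) (fun _ _ => IsPoly.add) (fun c _ => IsPoly.smul c) ?_ p hF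
  rintro i F ⟨d, hd⟩
  refine ⟨d + 1, fun k hk => ?_⟩
  rw [act_X_apply] at hk
  obtain ⟨h1, h2⟩ := hd _ hk
  constructor
  · intro j
    have := h1 j
    by_cases hj : j = i
    · subst hj; simp at this; omega
    · simpa [hj] using this
  · simp only [Pi.sub_apply, Finset.sum_sub_distrib, Finset.sum_pi_single', Finset.mem_univ,
      if_true] at h2
    have : ∑ x, (Pi.single i (1 : ℤ) : σ → ℤ) x = 1 := by simp
    omega

theorem IsPoly.finSupp {F : MSeries σ} (hF : IsPoly F) : FinSupp F := by
  obtain ⟨d, hd⟩ := hF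
  classical
  refine (Set.finite_Icc (0 : σ → ℤ) (fun _ => d)).subset fun k hk => ?_
  obtain ⟨h1, h2⟩ := hd k hk
  exact ⟨h1, fun i => (Finset.single_le_sum (fun j _ => h1 j) (Finset.mem_univ i)).trans h2⟩

theorem FinSupp.exists_isPoly {F : MSeries σ} (hF : FinSupp F) :
    ∃ N : ℕ, ∀ n ≥ N, IsPoly (MOSVA.act ((∏ i, X i) ^ n) F) := by
  classical
  obtain ⟨B, hB⟩ := (hF.image fun k => ∑ i, |k i|).bddAbove
  have hB' : ∀ k, F k ≠ 0 → ∀ i, |k i| ≤ B := fun k hk i =>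
    (Finset.single_le_sum (f := fun i => |k i|) (fun _ _ => abs_nonneg _) (Finset.mem_univ i)).trans
      (hB ⟨k, hk, rfl⟩)
  have hact : ∀ (n : ℕ) (s : Finset σ) (k : σ → ℤ),
      MOSVA.act ((∏ i ∈ s, X i) ^ n) F k = F fun i => if i ∈ s then k i - n else k i := by
    intro n s
    induction s using Finset.induction_on with
    | empty => intro k; simp
    | insert a s ha ih =>
      intro k
      rw [Finset.prod_insert ha, mul_pow, act_mul_apply, act_X_pow_apply, ih]
      congr 1
      funext i
      by_cases hi : i = a
      · subst hi; simp [ha]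
      · simp [hi]
  refine ⟨B.toNat, fun n hn => ⟨∑ _i : σ, (B + n), fun k hk => ?_⟩⟩
  rw [hact] at hk
  simp only [Finset.mem_univ, if_true] at hk
  have hk' := hB' _ hk
  have hBn : B ≤ n := Int.toNat_le.1 hn
  constructor
  · intro i
    have := abs_le.1 (hk' i)
    omega
  · refine Finset.sum_le_sum fun i _ => ?_
    have := abs_le.1 (hk' i)
    omega

theorem IsPoly.exists_polynomial {F : MSeries σ} (hF : IsPoly F) :
    ∃ f : MvPolynomial σ ℂ, F = MOSVA.act f (oneSeries σ) := by
  classical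
  have hfin : (Function.support F).Finite := hF.finSupp
  obtain ⟨d, hd⟩ := hF
  refine ⟨∑ k ∈ hfin.toFinset, monomial (Finsupp.equivFunOnFinite.symm fun i => (k i).toNat) (F k),
    ?_⟩
  funext l
  rw [map_sum, LinearMap.sum_apply, Finset.sum_apply]
  simp only [act_monomial_apply, oneSeries_apply, Finsupp.equivFunOnFinite_symm_apply_apply]
  have h : ∀ k ∈ hfin.toFinset, (F k * if (fun i => l i - ((k i).toNat : ℤ)) = 0 then 1 else 0)
      = if k = l then F l else 0 := by
    intro k hk
    have hk0 := (hd k (by simpa using hk)).1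
    have : ((fun i => l i - ((k i).toNat : ℤ)) = 0) ↔ k = l := by
      rw [funext_iff, funext_iff]
      refine forall_congr' fun i => ?_
      have := hk0 i
      simp only [Pi.zero_apply]
      omega
    simp only [this]
    split_ifs with h
    · rw [h, mul_one]
    · rw [mul_zero]
  rw [Finset.sum_congr rfl h, Finset.sum_ite_eq']
  split_ifs with h'
  · rfl
  · simpa using h'

end IsPoly

/-! ### Layers -/

section Layers

variable {σ : Type*} [Fintype σ] [DecidableEq σ]

theorem rename_equiv_vander {τ : Type*} [Fintype τ] [DecidableEq τ] (e : τ ≃ σ) :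
    rename e (vander τ) = vander σ := by
  rw [vander, vander, map_prod, ← e.prod_comp]
  refine Finset.prod_congr rfl fun a _ => ?_
  rw [map_prod, ← e.prod_comp]
  refine Finset.prod_congr rfl fun b _ => ?_
  simp only [e.apply_eq_iff_eq]
  split_ifs <;> simp

theorem vander_option {τ : Type*} [Fintype τ] [DecidableEq τ] :
    vander (Option τ) = rename some (vander τ) *
      ∏ a : τ, ((X none - X (some a)) * (X (some a) - X none)) := by
  simp only [vander, Fintype.prod_option, map_prod, if_true, one_mul, reduceCtorEq, if_false,
    Option.some.injEq, Finset.prod_mul_distrib]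
  have : ∀ a b : τ, (if a = b then 1 else X (some a) - X (some b) : MvPolynomial (Option τ) ℂ)
      = rename some (if a = b then 1 else X a - X b) := by
    intro a b; split_ifs <;> simp
  simp only [this]
  ring

/-- Separates the factors without `i₀` from those that become monomials when the variable `i₀` is
set to zero. -/
theorem vander_eq_mul (i₀ : σ) :
    vander σ = rename ((↑) : {i // i ≠ i₀} → σ) (vander {i // i ≠ i₀}) *
      ∏ a : {i // i ≠ i₀}, ((X i₀ - X a.1) * (X a.1 - X i₀)) := by
  rw [← rename_equiv_vander (Equiv.optionSubtypeNe i₀), vander_option, map_mul, rename_rename,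
    map_prod]
  congr 1
  refine Finset.prod_congr rfl fun a _ => ?_
  simp

/-- `F` has no negative powers of the variable `i₀`. -/
def NonnegIn (i₀ : σ) (F : MSeries σ) : Prop := ∀ k, k i₀ < 0 → F k = 0

omit [Fintype σ] in
theorem NonnegIn.act {i₀ : σ} {F : MSeries σ} (hF : NonnegIn i₀ F) (p : MvPolynomial σ ℂ) :
    NonnegIn i₀ (MOSVA.act p F) := by
  refine act_induction (P := NonnegIn i₀) ?_ ?_ ?_ p hF
  · intro F G hF hG k hk
    simp [hF k hk, hG k hk]
  · intro c F hF k hk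
    simp [hF k hk]
  · intro i F hF k hk
    rw [act_X_apply]
    refine hF _ ?_
    by_cases h : i₀ = i
    · subst h; simp; omega
    · simpa [h] using hk

/-- `p` and `q` have the same effect on the terms of degree at most zero in `i₀`. -/
def SameLayer (i₀ : σ) (p q : MvPolynomial σ ℂ) : Prop :=
  ∀ F F' : MSeries σ, NonnegIn i₀ F → NonnegIn i₀ F' → (∀ k, k i₀ ≤ 0 → F k = F' k) →
    ∀ k, k i₀ ≤ 0 → act p F k = act q F' k

omit [Fintype σ] in
theorem SameLayer.mul {i₀ : σ} {p q p' q' : MvPolynomial σ ℂ} (h : SameLayer i₀ p q)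
    (h' : SameLayer i₀ p' q') : SameLayer i₀ (p * p') (q * q') := by
  intro F F' hF hF' hFF'
  simp only [act_mul_apply]
  exact h _ _ (hF.act _) (hF'.act _) (h' F F' hF hF' hFF')

omit [Fintype σ] in
theorem SameLayer.refl (i₀ : σ) (p : MvPolynomial σ ℂ) : SameLayer i₀ p p := by
  intro F F' _ _ h
  have := act_induction (P := fun G : MSeries σ => ∀ k, k i₀ ≤ 0 → G k = 0) ?_ ?_ ?_ p
    (F := F - F') (fun k hk => sub_eq_zero.2 (h k hk))
  · intro k hk
    have h1 := this k hk
    rw [map_sub] at h1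
    exact sub_eq_zero.1 h1
  · intro F G hF hG k hk
    simp [hF k hk, hG k hk]
  · intro c F hF k hk
    simp [hF k hk]
  · intro i F hF k hk
    rw [act_X_apply]
    refine hF _ ?_
    by_cases h : i₀ = i
    · subst h; simp; omega
    · simpa [h] using hk

omit [Fintype σ] in
theorem SameLayer.prod {i₀ : σ} {ι : Type*} (s : Finset ι) {p q : ι → MvPolynomial σ ℂ}
    (h : ∀ a ∈ s, SameLayer i₀ (p a) (q a)) : SameLayer i₀ (∏ a ∈ s, p a) (∏ a ∈ s, q a) := by
  classical
  induction s using Finset.induction_on with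
  | empty => simpa using SameLayer.refl i₀ 1
  | insert a s ha ih =>
    rw [Finset.prod_insert ha, Finset.prod_insert ha]
    exact (h a (Finset.mem_insert_self _ _)).mul
      (ih fun b hb => h b (Finset.mem_insert_of_mem hb))

omit [Fintype σ] in
theorem SameLayer.pow {i₀ : σ} {p q : MvPolynomial σ ℂ} (h : SameLayer i₀ p q) (n : ℕ) :
    SameLayer i₀ (p ^ n) (q ^ n) := by
  simpa using SameLayer.prod (Finset.range n) fun _ _ => h

omit [Fintype σ] in
-- On series without negative powers of the variable `i₀`, multiplication by that variable
-- contributes nothing in degree at most zero.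
theorem sameLayer_X_sub (i₀ i : σ) : SameLayer i₀ (X i - X i₀ : MvPolynomial σ ℂ) (X i) := by
  intro F F' hF hF' h k hk
  rw [act_sub_apply, Pi.sub_apply, SameLayer.refl i₀ (X i) F F' hF hF' h k hk, act_X_apply i₀ F,
    hF _ (by simp; omega), sub_zero]

omit [Fintype σ] in
theorem sameLayer_X_sub' (i₀ i : σ) : SameLayer i₀ (X i₀ - X i : MvPolynomial σ ℂ) (-X i) := by
  intro F F' hF hF' h k hk
  rw [← neg_sub, act_neg_apply, act_neg_apply, Pi.neg_apply, Pi.neg_apply,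
    sameLayer_X_sub i₀ i F F' hF hF' h k hk]

theorem sameLayer_vander (i₀ : σ) :
    SameLayer i₀ (vander σ) (rename ((↑) : {i // i ≠ i₀} → σ)
      (vander {i // i ≠ i₀} * ∏ a : {i // i ≠ i₀}, (-X a * X a))) := by
  rw [vander_eq_mul i₀, map_mul, map_prod]
  refine (SameLayer.refl i₀ _).mul (SameLayer.prod _ fun a _ => ?_)
  rw [map_mul, map_neg, rename_X]
  exact (sameLayer_X_sub' i₀ a.1).mul (sameLayer_X_sub i₀ a.1)

/-- The terms of degree zero in the variable `i₀`. -/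
def layer (i₀ : σ) (F : MSeries σ) : MSeries {i // i ≠ i₀} :=
  fun l => F (Function.extend (↑) l 0)

omit [Fintype σ] [DecidableEq σ] in
theorem extend_val_apply_self (i₀ : σ) (l : {i // i ≠ i₀} → ℤ) :
    Function.extend ((↑) : {i // i ≠ i₀} → σ) l 0 i₀ = 0 :=
  Function.extend_apply' _ _ _ fun ⟨a, ha⟩ => a.2 ha

omit [Fintype σ] [DecidableEq σ] in
theorem extend_val_of_eq_zero {i₀ : σ} {k : σ → ℤ} (hk : k i₀ = 0) :
    Function.extend ((↑) : {i // i ≠ i₀} → σ) (fun a => k a.1) 0 = k := by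
  funext i
  by_cases hi : i = i₀
  · rw [hi, extend_val_apply_self, hk]
  · exact Subtype.val_injective.extend_apply (fun a : {i // i ≠ i₀} => k a.1) 0 ⟨i, hi⟩

/-- Setting the variable `i₀` to zero is compatible with multiplication by polynomials, and the
differences that contain it turn into monomials. Hence rationality survives the specialization. -/
theorem act_vander_layer {i₀ : σ} {F : MSeries σ} (hF : NonnegIn i₀ F) (q : ℕ) :
    layer i₀ (act (vander σ ^ q) F) =
      act ((vander {i // i ≠ i₀} * ∏ a : {i // i ≠ i₀}, (-X a * X a)) ^ q) (layer i₀ F) := by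
  funext l
  have hval : Function.Injective ((↑) : {i // i ≠ i₀} → σ) := Subtype.val_injective
  set F' : MSeries σ := extSeries ((↑) : {i // i ≠ i₀} → σ) (layer i₀ F) with hF'
  have hnot : i₀ ∉ Set.range ((↑) : {i // i ≠ i₀} → σ) := fun ⟨a, ha⟩ => a.2 ha
  have h1 : NonnegIn i₀ F' := by
    intro k hk
    rw [hF', extSeries, if_neg]
    exact fun h => hk.ne (h i₀ hnot)
  have h2 : ∀ k, k i₀ ≤ 0 → F k = F' k := by
    intro k hk
    rcases hk.lt_or_eq with hk | hk
    · rw [hF k hk, h1 k hk]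
    · rw [← extend_val_of_eq_zero hk, hF', extSeries_extend hval]
      rfl
  have h3 := (sameLayer_vander i₀).pow q F F' hF h1 h2 (Function.extend (↑) l 0)
    (extend_val_apply_self i₀ l).le
  rw [layer, h3, ← map_pow, hF', act_rename_extSeries hval, extSeries_extend hval]

theorem RationalSeries.layer {i₀ : σ} {F : MSeries σ} (hF : NonnegIn i₀ F)
    (hr : RationalSeries F) : RationalSeries (layer i₀ F) := by
  obtain ⟨q, hq⟩ := hr
  have h1 : FinSupp (MOSVA.layer i₀ (act (vander σ ^ q) F)) :=
    hq.comp_injective (extend_injective Subtype.val_injective)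
  rw [act_vander_layer hF] at h1
  refine RationalSeries.of_dvd (N := 2 * q) (q := q) ?_ h1
  rw [mul_pow, mul_comm]
  refine mul_dvd_mul_right ?_ _
  rw [pow_mul]
  refine pow_dvd_pow_of_dvd ?_ q
  rw [Finset.prod_mul_distrib, Finset.prod_neg, mul_assoc, ← sq]
  exact ⟨(-1) ^ Finset.univ.card, by
    rw [mul_comm, ← mul_assoc, ← pow_add, ← two_mul, pow_mul]; simp⟩

/-! ### Translations -/

/-- The sum of the partial derivatives. -/
def divergence (F : MSeries σ) : MSeries σ :=
  fun k => ∑ i, ((k i + 1 : ℤ) : ℂ) * F (k + Pi.single i 1)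

theorem divergence_act_X (i : σ) (F : MSeries σ) :
    divergence (act (X i) F) = act (X i) (divergence F) + F := by
  funext k
  rw [Pi.add_apply, act_X_apply]
  simp only [divergence, act_X_apply]
  rw [← sub_eq_iff_eq_add', ← Finset.sum_sub_distrib, Finset.sum_eq_single i]
  · simp only [add_sub_cancel_right, sub_add_cancel, Pi.sub_apply, Pi.single_eq_same]
    push_cast
    ring
  · intro j _ hj
    have : k + Pi.single j 1 - Pi.single i 1 = k - Pi.single i 1 + Pi.single j (1 : ℤ) := by abel
    simp [this, hj]
  · simp

/-- Differences of variables are invariant under simultaneous translation, so a denominator made of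
differences can be cleared before or after the diagonal derivative. -/
theorem divergence_act_X_sub (i j : σ) (F : MSeries σ) :
    divergence (act (X i - X j) F) = act (X i - X j) (divergence F) := by
  have hsub : ∀ F G : MSeries σ, divergence (F - G) = divergence F - divergence G := by
    intro F G
    funext k
    simp [divergence, mul_sub]
  rw [act_sub_apply, act_sub_apply, hsub, divergence_act_X, divergence_act_X]
  abel

theorem divergence_act_vander (F : MSeries σ) (q : ℕ) :
    divergence (act (vander σ ^ q) F) = act (vander σ ^ q) (divergence F) := by
  let P : MvPolynomial σ ℂ → Prop := fun p => ∀ F, divergence (act p F) = act p (divergence F)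
  have hmul : ∀ p q, P p → P q → P (p * q) := by
    intro p q hp hq F
    rw [act_mul_apply, act_mul_apply, hp, hq]
  have hone : P 1 := fun F => by simp
  have hv : P (vander σ) := by
    refine Finset.prod_induction _ P hmul hone fun i _ => Finset.prod_induction _ P hmul hone
      fun j _ => ?_
    split_ifs
    · exact hone
    · exact divergence_act_X_sub i j
  have hq : P (vander σ ^ q) := by
    rw [← Finset.card_range q, ← Finset.prod_const]
    exact Finset.prod_induction _ P hmul hone fun _ _ => hv
  exact hq F

/-- The diagonal derivative expresses a coefficient of degree n + 1 in the variable `i₀` by the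
derivative and by coefficients of degree n in `i₀`. So `H` is determined by its derivative and its
layer. Total degree is constant along the recursion, which is why `IsPoly` bounds the total degree
rather than each exponent. -/
theorem isPoly_of_divergence {i₀ : σ} {H : MSeries σ} (h₀ : NonnegIn i₀ H)
    (hl : IsPoly (layer i₀ H)) (hd : IsPoly (divergence H)) : IsPoly H := by
  obtain ⟨d₁, h₁⟩ := hl
  obtain ⟨d₂, h₂⟩ := hd
  refine ⟨max d₁ (d₂ + 1), fun k hk => ?_⟩
  obtain ⟨n, hn⟩ : ∃ n : ℕ, k i₀ = n :=
    Int.eq_ofNat_of_zero_le (not_lt.1 fun h => hk (h₀ k h))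
  induction n generalizing k with
  | zero =>
    have hk0 : k i₀ = 0 := by simpa using hn
    have := h₁ (fun a => k a.1) (by rw [layer, extend_val_of_eq_zero hk0]; exact hk)
    constructor
    · intro i
      by_cases hi : i = i₀
      · rw [hi, hk0]
      · exact this.1 ⟨i, hi⟩
    · refine le_trans (le_of_eq ?_) (this.2.trans (le_max_left _ _))
      rw [← (Equiv.optionSubtypeNe i₀).sum_comp, Fintype.sum_option]
      simp [hk0]
  | succ n ih =>
    set k' : σ → ℤ := k - Pi.single i₀ 1 with hk'
    have hkk : k = k' + Pi.single i₀ 1 := by rw [hk']; abel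
    -- If the derivative vanishes at `k'`, another term of the divergence must cancel the one at
    -- `k`, and that term has smaller degree in `i₀`. Otherwise the bound for the derivative
    -- applies, one degree lower.
    by_cases hdiv : divergence H k' = 0
    · have hex : ∃ i, i ≠ i₀ ∧ ((k' i + 1 : ℤ) : ℂ) * H (k' + Pi.single i 1) ≠ 0 := by
        by_contra! hcon
        rw [divergence, Finset.sum_eq_single i₀ (fun i _ hi => hcon i hi) (by simp), ← hkk] at hdiv
        rcases mul_eq_zero.1 hdiv with h | h
        · have : k' i₀ + 1 = 0 := by exact_mod_cast h
          simp [hk', hn] at this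
          omega
        · exact hk h
      obtain ⟨i, hi, hne⟩ := hex
      -- The factor from differentiating x_i^0 is zero, so a nonzero term cannot pass from exponent
      -- 0 to exponent -1. Hence the exponent k i stays nonnegative.
      have hi1 : k i + 1 ≠ 0 := by
        intro h
        apply hne
        have : k' i + 1 = 0 := by simp [hk', hi, h]
        simp [this]
      have hH : H (k' + Pi.single i 1) ≠ 0 := right_ne_zero_of_mul hne
      have := ih _ hH (by simp [hk', hn, Ne.symm hi])
      constructor
      · intro j
        have hj := this.1 j
        by_cases hj0 : j = i₀
        · subst hj0; rw [hn]; positivity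
        · by_cases hji : j = i
          · subst hji
            simp [hk', hj0] at hj
            omega
          · simpa [hk', hj0, hji] using hj
      · have h2 := this.2
        simp only [hk', Pi.add_apply, Pi.sub_apply, Finset.sum_add_distrib,
          Finset.sum_sub_distrib, Finset.sum_pi_single', Finset.mem_univ, if_true] at h2
        omega
    · have := h₂ k' hdiv
      constructor
      · intro j
        have hj := this.1 j
        by_cases hj0 : j = i₀
        · subst hj0; rw [hn]; positivity
        · simpa [hk', hj0] using hj
      · have h2 := this.2
        simp only [hk', Pi.sub_apply, Finset.sum_sub_distrib, Finset.sum_pi_single',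
          Finset.mem_univ, if_true] at h2
        exact le_max_of_le_right (by omega)

/-- A sequence of series, each of which is the derivative of the preceding one along the diagonal,
consists of rational series if it terminates and the constant terms in one variable are rational. -/
theorem rationalSeries_of_divergence {i₀ : σ} (E : ℕ → MSeries σ) (h₀ : ∀ s, NonnegIn i₀ (E s))
    (hd : ∀ s, divergence (E s) = E (s + 1)) (hl : ∀ s, RationalSeries (layer i₀ (E s)))
    {J : ℕ} (hJ : ∀ s ≥ J, E s = 0) (s : ℕ) : RationalSeries (E s) := by
  -- Descending induction on `s` from `J`. The claim is strengthened from finite support to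
  -- polynomials, because the recursion that integrates the derivative needs nonnegative exponents.
  suffices h : ∀ n s, J ≤ s + n → ∃ q, IsPoly (act (vander σ ^ q) (E s)) by
    obtain ⟨q, hq⟩ := h J s (by omega)
    exact ⟨q, hq.finSupp⟩
  intro n
  induction n with
  | zero =>
    intro s hs
    refine ⟨0, 0, fun k hk => ?_⟩
    simp [hJ s hs] at hk
  | succ n ih =>
    intro s hs
    obtain ⟨q₁, hq₁⟩ := ih (s + 1) (by omega)
    obtain ⟨q₀, hq₀⟩ := hl s
    obtain ⟨N, hN⟩ := hq₀.exists_isPoly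
    refine ⟨q₁ + q₀ + N, isPoly_of_divergence ((h₀ s).act _) ?_ ?_⟩
    · rw [act_vander_layer (h₀ s)]
      -- The factors of `vander` that contain `i₀` supply on the layer the powers of the other
      -- variables which clear its negative exponents.
      have e : (vander {i // i ≠ i₀} * ∏ a : {i // i ≠ i₀}, (-X a * X a)) ^ (q₁ + q₀ + N)
          = (vander {i // i ≠ i₀} ^ (q₁ + N) * (∏ a : {i // i ≠ i₀}, (-X a)) ^ (q₁ + q₀ + N)) *
            ((∏ a : {i // i ≠ i₀}, X a) ^ (q₁ + q₀ + N) * vander {i // i ≠ i₀} ^ q₀) := by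
        rw [Finset.prod_mul_distrib]
        ring
      rw [e, act_mul_apply]
      refine IsPoly.act ?_ _
      rw [act_mul_apply]
      exact hN _ (by omega)
    · rw [divergence_act_vander, hd, add_assoc, add_comm q₁, pow_add, act_mul_apply]
      exact hq₁.act _

end Layers

/-! ### Slices -/

section Slices

variable {σ : Type*} [DecidableEq σ]

/-- The restriction of a series to the plane through `k` spanned by `e i` and `e j`. -/
def slice (i j : σ) (k : σ → ℤ) (F : MSeries σ) : MSeries (Fin 2) :=
  fun κ => F (k + (Pi.single i (κ 0) + Pi.single j (κ 1)))

theorem slice_act_X (i j : σ) (k : σ → ℤ) (F : MSeries σ) (l : σ) :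
    slice i j k (act (X l) F) = slice i j (k - Pi.single l 1) F := by
  funext κ
  simp only [slice, act_X_apply]
  congr 1
  abel

theorem LTrunc.slice {i j : σ} {F : MSeries σ} (hF : LTrunc i j F) (k : σ → ℤ) :
    LTrunc 0 1 (slice i j k F) := by
  intro κ
  obtain ⟨I, hI⟩ := hF (k + (Pi.single i (κ 0) + Pi.single j (κ 1)))
  refine ⟨I, fun n hn => ?_⟩
  rw [← hI n hn]
  simp only [MOSVA.slice, Pi.add_apply, Pi.sub_apply, Pi.single_eq_same, ne_eq, one_ne_zero,
    not_false_eq_true, Pi.single_eq_of_ne, zero_ne_one, sub_zero, zero_sub, Pi.single_add,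
    Pi.single_neg]
  congr 1
  abel

/-- If two series agree on all planes after multiplication by powers of `X i - X j`, then a
polynomial multiple of the first that is finite is the same multiple of the second. -/
theorem act_eq_act_of_slice {i j : σ} (hij : i ≠ j) {F F' : MSeries σ}
    (h : ∀ k, ∃ N : ℕ, act ((X 0 - X 1) ^ N) (slice i j k (F - F')) = 0)
    (hF' : LTrunc i j F') {D : MvPolynomial σ ℂ} (hD : FinSupp (act D F)) :
    act D F' = act D F := by
  have hnil := act_induction (P := fun G : MSeries σ =>
    ∀ k, ∃ N : ℕ, act ((X 0 - X 1) ^ N) (slice i j k G) = 0) ?_ ?_ ?_ D h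
  -- The exponent `N` depends on the plane. It does not matter: `act D F` has finite support and
  -- `F'` is truncated, so the product of `D` with the difference is truncated, and a truncated
  -- slice killed by some power of X 0 - X 1 is zero.
  · have ht : LTrunc i j (act D (F - F')) := by
      rw [map_sub]
      exact (hD.lTrunc hij).sub (hF'.act D)
    have hz : act D (F - F') = 0 := by
      funext k
      obtain ⟨N, hN⟩ := hnil k
      have h0 := congrFun ((ht.slice k).eq_zero_of_act_sub_pow hN) 0
      simpa [slice] using h0
    rw [map_sub] at hz
    exact (sub_eq_zero.1 hz).symm
  · intro F G hF hG k
    obtain ⟨N, hN⟩ := hF k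
    obtain ⟨M, hM⟩ := hG k
    refine ⟨N + M, ?_⟩
    have e : slice i j k (F + G) = slice i j k F + slice i j k G := rfl
    rw [e, map_add]
    nth_rw 1 [add_comm N M]
    rw [pow_add, pow_add, act_mul_apply, act_mul_apply, hN, hM]
    simp
  · intro c F hF k
    obtain ⟨N, hN⟩ := hF k
    refine ⟨N, ?_⟩
    have e : slice i j k (c • F) = c • slice i j k F := rfl
    rw [e, map_smul, hN, smul_zero]
  · intro l F hF k
    rw [slice_act_X]
    exact hF _

end Slices

/-! ### Rational series and convergence -/

section Product

theorem prod_prod_ite_eq {R : Type*} [CommMonoid R] {n : ℕ} (g : Fin n → Fin n → R) :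
    (∏ i, ∏ j, if i = j then 1 else g i j) = ∏ i, ∏ j ∈ Finset.Ioi i, (g i j * g j i) := by
  have h := Finset.prod_prod_Ioi_mul_eq_prod_prod_off_diag fun i j => g j i
  rw [h]
  refine Finset.prod_congr rfl fun i _ => ?_
  rw [← Finset.prod_subset (Finset.subset_univ ({i}ᶜ : Finset (Fin n)))]
  · refine Finset.prod_congr rfl fun j hj => ?_
    rw [if_neg]
    simpa [eq_comm] using hj
  · intro j _ hj
    rw [if_pos]
    simpa [eq_comm] using hj

/-- One torus inside the domain of convergence suffices to turn the sum f / D into the formal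
identity D · a = f. -/
theorem ProductRational.rationalSeries {n : ℕ} {a : (Fin n → ℤ) → ℂ} (h : ProductRational a) :
    RationalSeries a := by
  obtain ⟨f, p, q, h⟩ := h
  let D : MvPolynomial (Fin n) ℂ :=
    (∏ i, X i ^ p i) * ∏ i, ∏ j ∈ Finset.Ioi i, (X i - X j) ^ q i j
  have hact : act D a = act f (oneSeries (Fin n)) := by
    -- The radii n, n - 1, …, 1 are positive and strictly decreasing.
    refine act_eq_of_hasSum_torus (r := fun i : Fin n => (n : ℝ) - (i : ℕ)) (fun i => ?_) fun z hz => ?_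
    · have : ((i : ℕ) : ℝ) < n := by exact_mod_cast i.2
      linarith
    · have hanti : StrictAnti fun i => ‖z i‖ := by
        intro i j hij
        have : ((i : ℕ) : ℝ) < (j : ℕ) := by exact_mod_cast hij
        simp only [hz]
        linarith
      have hpos : ∀ i, 0 < ‖z i‖ := by
        intro i
        have : ((i : ℕ) : ℝ) < n := by exact_mod_cast i.2
        rw [hz]
        linarith
      have hD : eval z D = (∏ i, z i ^ p i) * ∏ i, ∏ j ∈ Finset.Ioi i, (z i - z j) ^ q i j := by
        simp [D, map_prod]
      refine ⟨?_, ?_⟩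
      · rw [hD]
        refine mul_ne_zero (Finset.prod_ne_zero_iff.2 fun i _ => pow_ne_zero _
          (norm_pos_iff.1 (hpos i))) (Finset.prod_ne_zero_iff.2 fun i _ =>
          Finset.prod_ne_zero_iff.2 fun j hj => pow_ne_zero _ fun h0 => ?_)
        have : ‖z j‖ < ‖z i‖ := hanti (Finset.mem_Ioi.1 hj)
        rw [sub_eq_zero.1 h0] at this
        exact lt_irrefl _ this
      · rw [hD]
        exact h z hanti hpos
  have hfin : FinSupp (act D a) := by
    rw [hact]
    exact finSupp_oneSeries.act f
  refine RationalSeries.of_dvd (N := ∑ i, p i) (q := ∑ i, ∑ j, q i j) (mul_dvd_mul ?_ ?_) hfin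
  · rw [← Finset.prod_pow]
    exact Finset.prod_dvd_prod_of_dvd _ _ fun i hi => pow_dvd_pow _
      (Finset.single_le_sum (f := p) (fun _ _ => Nat.zero_le _) hi)
  · rw [vander, ← Finset.prod_pow]
    refine Finset.prod_dvd_prod_of_dvd _ _ fun i hi => ?_
    rw [← Finset.prod_pow]
    refine (Finset.prod_dvd_prod_of_dvd _ _ fun j hj => ?_).trans
      (Finset.prod_dvd_prod_of_subset _ _ _ (Finset.subset_univ _))
    rw [if_neg (Finset.mem_Ioi.1 hj).ne]
    refine pow_dvd_pow _ ?_
    exact (Finset.single_le_sum (f := fun j => q i j) (fun _ _ => Nat.zero_le _)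
      (Finset.mem_univ j)).trans (Finset.single_le_sum (f := fun i => ∑ j, q i j)
      (fun _ _ => Nat.zero_le _) hi)

theorem canDivide_X_sub_X {σ : Type*} [Fintype σ] [DecidableEq σ] {P : MSeries σ → Prop} {i j : σ}
    (hP : ∀ F, P F → LTrunc i j F) {z : σ → ℂ} (hz : ∀ i, z i ≠ 0) (hij : ‖z j‖ < ‖z i‖) :
    CanDivide P z (X i - X j) := by
  intro F hF s hs
  have h1 : (X i - X j : MvPolynomial σ ℂ) = X i + C (-1) * X j := by
    rw [C_neg, C_1]; ring
  rw [h1] at hs ⊢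
  have := (hP F hF).hasSum_div hz (by simpa using hij) hs
  simpa using this

theorem canDivide_X_sub_X' {σ : Type*} [Fintype σ] [DecidableEq σ] {P : MSeries σ → Prop} {i j : σ}
    (hP : ∀ F, P F → LTrunc j i F) {z : σ → ℂ} (hz : ∀ i, z i ≠ 0) (hij : ‖z i‖ < ‖z j‖) :
    CanDivide P z (X i - X j) := by
  intro F hF s hs
  have := canDivide_X_sub_X hP hz hij F hF (-s) (by
    rw [← neg_sub]
    simp only [act_neg_apply, Pi.neg_apply, neg_mul]
    exact hs.neg)
  rw [← neg_sub, map_neg, div_neg, ← neg_div]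
  exact this

/-- The converse of `ProductRational.rationalSeries`. Truncation in the directions i < j selects the
expansion in |z i| > |z j|, and every factor of the denominator can be divided out there by a
geometric series. -/
theorem RationalSeries.productRational {n : ℕ} {a : (Fin n → ℤ) → ℂ} (h : RationalSeries a)
    (ht : ∀ i j, i < j → LTrunc i j a) : ProductRational a := by
  obtain ⟨q, hq⟩ := h
  obtain ⟨N, hN⟩ := hq.exists_isPoly
  obtain ⟨f, hf⟩ := (hN N le_rfl).exists_polynomial
  rw [← act_mul_apply] at hf
  -- Each pair i < j occurs in `vander` in both orders and contributes -(X i - X j)², whence the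
  -- sign and the exponent 2q.
  refine ⟨C (∏ i : Fin n, ∏ _j ∈ Finset.Ioi i, (-1) ^ q) * f, fun _ => N, fun _ _ => 2 * q,
    fun z hz hpos => ?_⟩
  have hz0 : ∀ i, z i ≠ 0 := fun i => norm_pos_iff.1 (hpos i)
  have hP : ∀ p F, (∀ i j : Fin n, i < j → LTrunc i j F) →
      ∀ i j : Fin n, i < j → LTrunc i j (act p F) :=
    fun p F hF i j hij => (hF i j hij).act p
  have hdiv : CanDivide (fun F => ∀ i j : Fin n, i < j → LTrunc i j F) z
      ((∏ i, X i) ^ N * vander (Fin n) ^ q) := by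
    refine CanDivide.mul hP (CanDivide.pow hP (CanDivide.prod hP _ _ fun i _ => ?_) _)
      (CanDivide.pow hP (CanDivide.prod hP _ _ fun i _ => CanDivide.prod hP _ _ fun j _ => ?_) _)
    · intro F _ s hs
      rw [eval_X]
      exact hasSum_div_X hz0 i hs
    · split_ifs with hij
      · exact CanDivide.one
      · rcases lt_or_gt_of_ne hij with h | h
        · exact canDivide_X_sub_X (fun F hF => hF i j h) hz0 (hz h)
        · exact canDivide_X_sub_X' (fun F hF => hF j i h) hz0 (hz h)
  have hone := hasSum_act hz0 (hasSum_oneSeries z) f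
  rw [← hf] at hone
  have hsum := hdiv a ht _ hone
  change HasSum (fun k => a k * mon z k) _
  have hv : eval z ((∏ i, X i) ^ N * vander (Fin n) ^ q) = (∏ i, z i ^ N) *
      ((∏ i : Fin n, ∏ _j ∈ Finset.Ioi i, (-1 : ℂ) ^ q) *
        ∏ i, ∏ j ∈ Finset.Ioi i, (z i - z j) ^ (2 * q)) := by
    rw [vander, prod_prod_ite_eq]
    simp only [map_mul, map_pow, map_prod, eval_X, map_sub, ← Finset.prod_pow,
      ← Finset.prod_mul_distrib]
    refine Finset.prod_congr rfl fun i _ => congrArg _ (Finset.prod_congr rfl fun j _ => ?_)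
    rw [pow_mul, ← mul_pow]
    congr 1
    ring
  rw [hv, mul_one] at hsum
  rw [RingHom.map_mul, eval_C]
  have hsq : (∏ i : Fin n, ∏ _j ∈ Finset.Ioi i, (-1 : ℂ) ^ q) *
      (∏ i : Fin n, ∏ _j ∈ Finset.Ioi i, (-1 : ℂ) ^ q) = 1 := by
    simp only [← Finset.prod_mul_distrib, ← mul_pow]
    simp
  set sg := ∏ i : Fin n, ∏ _j ∈ Finset.Ioi i, (-1 : ℂ) ^ q
  have hsg : sg ≠ 0 := left_ne_zero_of_mul_eq_one hsq
  convert hsum using 1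
  rw [← mul_div_mul_left (eval z f) _ hsg]
  congr 1
  linear_combination (-(∏ i, z i ^ N) *
    ∏ i, ∏ j ∈ Finset.Ioi i, (z i - z j) ^ (2 * q)) * hsq

end Product

/-! ### Substitutions in two variables -/

section Substitution

theorem sum_range_antidiagonal {M : Type*} [AddCommMonoid M] {f : ℕ → ℕ → M} {R : ℕ}
    (h : ∀ i j, R ≤ i + j → f i j = 0) :
    ∑ N ∈ Finset.range R, ∑ p ∈ Finset.HasAntidiagonal.antidiagonal N, f p.1 p.2 =
      ∑ i ∈ Finset.range R, ∑ j ∈ Finset.range R, f i j := by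
  rw [← Finset.sum_product', ← Finset.sum_filter_of_ne (p := fun x : ℕ × ℕ => x.1 + x.2 < R)
    (fun x _ hx => by by_contra h'; exact hx (h _ _ (not_lt.1 h'))),
    ← Finset.sum_fiberwise_of_maps_to (t := Finset.range R) (g := fun x : ℕ × ℕ => x.1 + x.2)
      (fun x hx => Finset.mem_range.2 (Finset.mem_filter.1 hx).2)]
  refine Finset.sum_congr rfl fun N hN => Finset.sum_congr ?_ fun _ _ => rfl
  ext ⟨a, b⟩
  simp only [Finset.mem_range, Finset.HasAntidiagonal.mem_antidiagonal, Finset.mem_filter,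
    Finset.mem_product] at *
  omega

/-- The substitution `a = α + c β`, `b = β`, expanded for `|α| > |β|`. -/
def substSum (c : ℂ) (F : MSeries (Fin 2)) : MSeries (Fin 2) :=
  fun κ => ∑ᶠ i : ℕ, ((Ring.choose (κ 0 + i) i : ℤ) : ℂ) * c ^ i *
    F (κ + (Pi.single 0 (i : ℤ) - Pi.single 1 (i : ℤ)))

variable {c : ℂ} {F G : MSeries (Fin 2)}

theorem substSum_eq_sum {κ : Fin 2 → ℤ} {I : ℕ}
    (hI : ∀ n ≥ I, F (κ + (Pi.single 0 (n : ℤ) - Pi.single 1 (n : ℤ))) = 0) :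
    substSum c F κ = ∑ i ∈ Finset.range I, ((Ring.choose (κ 0 + i) i : ℤ) : ℂ) * c ^ i *
      F (κ + (Pi.single 0 (i : ℤ) - Pi.single 1 (i : ℤ))) := by
  refine finsum_eq_sum_of_support_subset _ fun i hi => ?_
  by_contra h
  refine hi ?_
  simp only [Finset.coe_range, Set.mem_Iio, not_lt] at h
  simp only [hI i h, mul_zero]

theorem substSum_add (hF : LTrunc 0 1 F) (hG : LTrunc 0 1 G) :
    substSum c (F + G) = substSum c F + substSum c G := by
  funext κ
  obtain ⟨I, hI⟩ := hF κ
  obtain ⟨J, hJ⟩ := hG κ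
  have hI' : ∀ n ≥ max I J, _ := fun n hn => hI n (le_trans (le_max_left _ _) hn)
  have hJ' : ∀ n ≥ max I J, _ := fun n hn => hJ n (le_trans (le_max_right _ _) hn)
  rw [Pi.add_apply, substSum_eq_sum hI', substSum_eq_sum hJ', substSum_eq_sum (I := max I J)
    (fun n hn => by rw [Pi.add_apply, hI' n hn, hJ' n hn, add_zero]), ← Finset.sum_add_distrib]
  exact Finset.sum_congr rfl fun i _ => by rw [Pi.add_apply, mul_add]

theorem substSum_smul (d : ℂ) (F : MSeries (Fin 2)) :
    substSum c (d • F) = d • substSum c F := by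
  funext κ
  rw [Pi.smul_apply, substSum, substSum, smul_finsum]
  refine finsum_congr fun i => ?_
  simp only [Pi.smul_apply, smul_eq_mul]
  ring

theorem LTrunc.substSum (hF : LTrunc 0 1 F) : LTrunc 0 1 (substSum c F) := by
  intro κ
  obtain ⟨I, hI⟩ := hF κ
  refine ⟨I, fun n hn => ?_⟩
  rw [MOSVA.substSum]
  refine (finsum_congr fun i => ?_).trans finsum_zero
  have : κ + (Pi.single 0 (n : ℤ) - Pi.single 1 (n : ℤ)) +
      (Pi.single 0 (i : ℤ) - Pi.single 1 (i : ℤ)) =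
      κ + (Pi.single 0 ((n + i : ℕ) : ℤ) - Pi.single 1 ((n + i : ℕ) : ℤ)) := by
    push_cast
    rw [Pi.single_add, Pi.single_add]
    abel
  rw [this, hI _ (by omega), mul_zero]

theorem substSum_act_X_one (F : MSeries (Fin 2)) :
    substSum c (act (X 1) F) = act (X 1) (substSum c F) := by
  funext κ
  rw [act_X_apply, substSum, substSum]
  refine finsum_congr fun i => ?_
  rw [act_X_apply]
  congr 2
  · simp
  · abel

theorem substSum_act_X_zero (hF : LTrunc 0 1 F) :
    substSum c (act (X 0) F) = act (X 0 + C c * X 1) (substSum c F) := by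
  funext κ
  rw [act_linear_apply]
  obtain ⟨I, hI⟩ := hF (κ - Pi.single 0 1)
  have e2 : ∀ i : ℕ, κ - Pi.single 1 (1 : ℤ) + (Pi.single 0 (i : ℤ) - Pi.single 1 (i : ℤ)) =
      κ - Pi.single 0 1 + (Pi.single 0 ((i + 1 : ℕ) : ℤ) - Pi.single 1 ((i + 1 : ℕ) : ℤ)) := by
    intro i
    push_cast
    rw [Pi.single_add, Pi.single_add]
    abel
  have e1 : ∀ i : ℕ, κ + (Pi.single 0 (i : ℤ) - Pi.single 1 (i : ℤ)) - Pi.single 0 1 =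
      κ - Pi.single 0 (1 : ℤ) + (Pi.single 0 (i : ℤ) - Pi.single 1 (i : ℤ)) := by
    intro i; abel
  rw [substSum_eq_sum (I := I + 1) (fun n hn => hI n (by omega)),
    substSum_eq_sum (κ := κ - Pi.single 1 1) (I := I) (fun n hn => by
      rw [e2]; exact hI _ (by omega)),
    substSum_eq_sum (κ := κ) (I := I + 1) (fun n hn => by
      rw [act_X_apply, e1]; exact hI _ (by omega)),
    Finset.sum_range_succ', Finset.sum_range_succ' (n := I)]
  simp only [act_X_apply, e1, e2, Finset.mul_sum]
  rw [add_right_comm, ← Finset.sum_add_distrib]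
  congr 1
  · refine Finset.sum_congr rfl fun i _ => ?_
    -- Pascal's rule is the coefficient form of the substitution a = α + c β.
    have h := Ring.choose_succ_succ (κ 0 + i) i
    simp only [Pi.sub_apply, Pi.single_eq_same, ne_eq, zero_ne_one, not_false_eq_true,
      Pi.single_eq_of_ne, sub_zero]
    push_cast at h ⊢
    have h1 : κ 0 + ((i : ℤ) + 1) = κ 0 + i + 1 := by ring
    have h2 : κ 0 - 1 + ((i : ℤ) + 1) = κ 0 + i := by ring
    rw [h1, h2, h]
    push_cast
    ring
  · simp

/-- The ring homomorphism that corresponds to `substSum c`. -/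
def substHom (c : ℂ) : MvPolynomial (Fin 2) ℂ →ₐ[ℂ] MvPolynomial (Fin 2) ℂ :=
  aeval ![X 0 + C c * X 1, X 1]

theorem substSum_act (hF : LTrunc 0 1 F) (p : MvPolynomial (Fin 2) ℂ) :
    substSum c (act p F) = act (substHom c p) (substSum c F) := by
  refine act_intertwine (P := LTrunc 0 1) (fun _ _ => LTrunc.add) (fun c _ => LTrunc.smul c)
    (fun l _ hF => hF.act_X l) (substSum c) (fun _ _ => substSum_add)
    (fun d F _ => substSum_smul d F) (substHom c) ?_ p hF
  intro i F hF
  fin_cases i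
  · simpa [substHom] using substSum_act_X_zero hF
  · simpa [substHom] using substSum_act_X_one F

theorem substSum_oneSeries : substSum c (oneSeries (Fin 2)) = oneSeries (Fin 2) := by
  classical
  funext κ
  rw [substSum, finsum_eq_single _ 0]
  · simp
  · intro i hi
    rw [oneSeries_apply]
    split_ifs with h
    · have h0 : κ 0 + i = 0 := by simpa using congrFun h 0
      rw [h0, Ring.choose_zero_pos ℤ (Nat.pos_of_ne_zero hi)]
      simp
    · simp

/-- The shears α ↦ α - β and α ↦ α + β are inverse to each other. Truncation makes the double sum
finite, and each antidiagonal with N ≠ 0 is an alternating sum of binomial coefficients, hence zero.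
-/
theorem substSum_substSum (hF : LTrunc 0 1 F) : substSum 1 (substSum (-1) F) = F := by
  funext κ
  obtain ⟨I, hI⟩ := hF κ
  have e : ∀ i j : ℕ, κ + (Pi.single 0 (i : ℤ) - Pi.single 1 (i : ℤ)) +
      (Pi.single 0 (j : ℤ) - Pi.single 1 (j : ℤ)) =
      κ + (Pi.single 0 ((i + j : ℕ) : ℤ) - Pi.single 1 ((i + j : ℕ) : ℤ)) := by
    intro i j
    push_cast
    rw [Pi.single_add, Pi.single_add]
    abel
  have hR : ∀ R ≥ I + 1, substSum 1 (substSum (-1) F) κ = ∑ i ∈ Finset.range R,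
      ∑ j ∈ Finset.range R, ((Ring.choose (κ 0 + i) i : ℤ) : ℂ) *
        (((Ring.choose (κ 0 + i + j) j : ℤ) : ℂ) * (-1) ^ j *
        F (κ + (Pi.single 0 ((i + j : ℕ) : ℤ) - Pi.single 1 ((i + j : ℕ) : ℤ)))) := by
    intro R hR
    have hin : ∀ i : ℕ, substSum (-1) F (κ + (Pi.single 0 (i : ℤ) - Pi.single 1 (i : ℤ))) =
        ∑ j ∈ Finset.range R, ((Ring.choose (κ 0 + i + j) j : ℤ) : ℂ) * (-1) ^ j *
        F (κ + (Pi.single 0 ((i + j : ℕ) : ℤ) - Pi.single 1 ((i + j : ℕ) : ℤ))) := by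
      intro i
      rw [substSum_eq_sum (I := R) (fun n hn => by rw [e]; exact hI _ (by omega))]
      refine Finset.sum_congr rfl fun j _ => ?_
      rw [e]
      simp
    rw [substSum_eq_sum (I := R)]
    · refine Finset.sum_congr rfl fun i _ => ?_
      rw [hin, one_pow, mul_one, Finset.mul_sum]
    · intro n hn
      rw [hin]
      exact Finset.sum_eq_zero fun j _ => by rw [hI _ (by omega), mul_zero]
  rw [hR (I + 1) le_rfl, ← sum_range_antidiagonal]
  · rw [Finset.sum_eq_single 0]
    · simp
    · intro N _ hN
      have h1 : ∀ p ∈ Finset.HasAntidiagonal.antidiagonal N, ((Ring.choose (κ 0 + p.1) p.1 : ℤ) : ℂ) *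
          (((Ring.choose (κ 0 + p.1 + p.2) p.2 : ℤ) : ℂ) * (-1) ^ p.2 *
          F (κ + (Pi.single 0 ((p.1 + p.2 : ℕ) : ℤ) - Pi.single 1 ((p.1 + p.2 : ℕ) : ℤ)))) =
          (((-1) ^ p.2 * (N.choose p.2 : ℤ) : ℤ) : ℂ) * (((Ring.choose (κ 0 + N) N : ℤ) : ℂ) *
          F (κ + (Pi.single 0 (N : ℤ) - Pi.single 1 (N : ℤ)))) := by
        rintro ⟨i, j⟩ hij
        obtain rfl : i + j = N := Finset.HasAntidiagonal.mem_antidiagonal.1 hij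
        have := Ring.choose_smul_choose (κ 0 + (i + j : ℕ)) (Nat.le_add_left j i)
        rw [nsmul_eq_mul, Nat.add_sub_cancel] at this
        have e3 : κ 0 + ((i + j : ℕ) : ℤ) - j = κ 0 + i := by push_cast; ring
        have e4 : κ 0 + ((i + j : ℕ) : ℤ) = κ 0 + i + j := by push_cast; ring
        rw [e3] at this
        have h2 := congrArg (Int.cast : ℤ → ℂ) this
        rw [e4] at h2 ⊢
        push_cast at h2 ⊢
        linear_combination (-(-1) ^ j *
          F (κ + (Pi.single 0 ((i : ℤ) + j) - Pi.single 1 ((i : ℤ) + j)))) * h2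
      rw [Finset.sum_congr rfl h1, ← Finset.sum_mul, ← Int.cast_sum]
      have h3 := Int.alternating_sum_range_choose_of_ne hN
      rw [← Finset.Nat.sum_antidiagonal_eq_sum_range_succ_mk
        (fun p : ℕ × ℕ => (-1 : ℤ) ^ p.1 * (N.choose p.1 : ℤ)),
        ← Finset.Nat.sum_antidiagonal_swap] at h3
      simp only [Prod.fst_swap] at h3
      rw [h3]
      simp
    · simp
  · intro i j hij
    rw [hI _ (by omega), mul_zero, mul_zero]

end Substitution

/-! ### Weak associativity -/

section WeakAssociativity

/-- A series in two variables, written with a single index. -/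
def ser2 (a : ℤ → ℤ → ℂ) : MSeries (Fin 2) := fun κ => a (κ 0) (κ 1)

/-- `(x₀ + x₂) ^ N a(x₀ + x₂, x₂) = (x₀ + x₂) ^ N b(x₀, x₂)` for some `N`. -/
def WeakAssoc (a b : MSeries (Fin 2)) : Prop :=
  ∃ N : ℕ, act ((X 0 + X 1) ^ N) (substSum 1 a - b) = 0

theorem exists_act_eq_zero_of_le {p : MvPolynomial (Fin 2) ℂ} {F : MSeries (Fin 2)} {N M : ℕ}
    (h : act (p ^ N) F = 0) (hNM : N ≤ M) : act (p ^ M) F = 0 := by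
  rw [← Nat.sub_add_cancel hNM, pow_add, act_mul_apply, h, map_zero]

theorem WeakAssoc.add {a a' b b' : MSeries (Fin 2)} (ha : LTrunc 0 1 a) (ha' : LTrunc 0 1 a')
    (h : WeakAssoc a b) (h' : WeakAssoc a' b') : WeakAssoc (a + a') (b + b') := by
  obtain ⟨N, hN⟩ := h
  obtain ⟨N', hN'⟩ := h'
  refine ⟨max N N', ?_⟩
  rw [substSum_add ha ha', add_sub_add_comm, map_add,
    exists_act_eq_zero_of_le hN (le_max_left _ _), exists_act_eq_zero_of_le hN' (le_max_right _ _),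
    add_zero]

/-- The product of the possible poles in two variables. -/
def poles : MvPolynomial (Fin 2) ℂ := X 0 * X 1 * (X 0 - X 1)

theorem eval_poles (z₁ z₂ : ℂ) : eval ![z₁, z₂] poles = z₁ * z₂ * (z₁ - z₂) := by
  simp [poles]

theorem eval_substHom_one (p : MvPolynomial (Fin 2) ℂ) (z : Fin 2 → ℂ) :
    eval z (substHom 1 p) = eval ![z 0 + z 1, z 1] p := by
  have h : (aeval z).comp (substHom 1) = (aeval ![z 0 + z 1, z 1] : _ →ₐ[ℂ] ℂ) := by
    ext i
    fin_cases i <;> simp [substHom]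
  have := congrArg (fun φ : MvPolynomial (Fin 2) ℂ →ₐ[ℂ] ℂ => φ p) h
  simpa [aeval_eq_eval] using this

theorem hasSum_ser2_iff {a : ℤ → ℤ → ℂ} {z : Fin 2 → ℂ} {s : ℂ} :
    HasSum (fun κ => ser2 a κ * mon z κ) s ↔
      HasSum (fun k : ℤ × ℤ => a k.1 k.2 * (z 0 ^ k.1 * z 1 ^ k.2)) s := by
  rw [← (finTwoArrowEquiv ℤ).hasSum_iff]
  have e : (fun κ => ser2 a κ * mon z κ) =
      (fun k : ℤ × ℤ => a k.1 k.2 * (z 0 ^ k.1 * z 1 ^ k.2)) ∘ finTwoArrowEquiv ℤ := by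
    funext κ
    simp [ser2, mon, Fin.prod_univ_two]
  rw [e]

theorem mul_pow_sub_div_mul_pow {x a b c : ℂ} (ha : a ≠ 0) (hb : b ≠ 0) (hc : c ≠ 0)
    {p q r P : ℕ} (hp : p ≤ P) (hq : q ≤ P) (hr : r ≤ P) :
    x * (a ^ (P - p) * b ^ (P - q) * c ^ (P - r)) / (a * b * c) ^ P =
      x / (a ^ p * b ^ q * c ^ r) := by
  rw [div_eq_div_iff (by positivity) (by positivity), mul_pow, mul_pow,
    ← pow_sub_mul_pow a hp, ← pow_sub_mul_pow b hq, ← pow_sub_mul_pow c hr]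
  ring

/-- The three pole orders are replaced by one exponent, and every larger exponent is allowed as
well, so that a product and an iterate can be given the same denominator. -/
theorem ProductRational.exists_poles {a : ℤ → ℤ → ℂ} (h : ProductRational (ser2 a)) :
    ∃ P₀ : ℕ, ∀ P ≥ P₀, ∃ f : MvPolynomial (Fin 2) ℂ, ∀ z₁ z₂ : ℂ, ‖z₂‖ < ‖z₁‖ → 0 < ‖z₂‖ →
      HasSum (fun κ => ser2 a κ * mon ![z₁, z₂] κ)
        (eval ![z₁, z₂] f / eval ![z₁, z₂] (poles ^ P)) := by
  obtain ⟨f, p, q, h⟩ := h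
  refine ⟨p 0 + p 1 + q 0 1, fun P hP =>
    ⟨f * (X 0 ^ (P - p 0) * X 1 ^ (P - p 1) * (X 0 - X 1) ^ (P - q 0 1)), fun z₁ z₂ h12 h2 => ?_⟩⟩
  have hs := h ![z₁, z₂] (by
    intro i j hij
    fin_cases i <;> fin_cases j <;> simp_all) (by
    intro i
    fin_cases i
    · exact h2.trans h12
    · exact h2)
  have h1 : z₁ ≠ 0 := norm_pos_iff.1 (h2.trans h12)
  have h2' : z₂ ≠ 0 := norm_pos_iff.1 h2
  have h12' : z₁ - z₂ ≠ 0 := fun h0 => by rw [sub_eq_zero.1 h0] at h12; exact lt_irrefl _ h12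
  have hI0 : Finset.Ioi (0 : Fin 2) = {1} := rfl
  have hI1 : Finset.Ioi (1 : Fin 2) = ∅ := rfl
  simp only [Fin.prod_univ_two, hI0, hI1, Finset.prod_singleton, Finset.prod_empty, mul_one,
    Matrix.cons_val_zero, Matrix.cons_val_one] at hs
  simp only [mon, Fin.prod_univ_two]
  simp only [map_mul, map_pow, map_sub, eval_X, eval_poles, Matrix.cons_val_zero,
    Matrix.cons_val_one]
  rw [mul_pow_sub_div_mul_pow h1 h2' h12' (by omega) (by omega) (by omega)]
  exact hs

theorem IterateRational.exists_poles {b : ℤ → ℤ → ℂ} (h : IterateRational b) :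
    ∃ P₀ : ℕ, ∀ P ≥ P₀, ∃ g : MvPolynomial (Fin 2) ℂ, ∀ z₁ z₂ : ℂ, 0 < ‖z₁ - z₂‖ →
      ‖z₁ - z₂‖ < ‖z₂‖ → HasSum (fun κ => ser2 b κ * mon ![z₁ - z₂, z₂] κ)
        (eval ![z₁, z₂] g / eval ![z₁, z₂] (poles ^ P)) := by
  obtain ⟨f, p₁, p₂, p₁₂, h⟩ := h
  refine ⟨p₁ + p₂ + p₁₂, fun P hP =>
    ⟨f * (X 0 ^ (P - p₁) * X 1 ^ (P - p₂) * (X 0 - X 1) ^ (P - p₁₂)), fun z₁ z₂ h0 h02 => ?_⟩⟩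
  rw [hasSum_ser2_iff]
  have h12' : z₁ - z₂ ≠ 0 := norm_pos_iff.1 h0
  have h2' : z₂ ≠ 0 := norm_pos_iff.1 (h0.trans h02)
  have h1 : z₁ ≠ 0 := by
    rintro rfl
    simp at h02
  simp only [Matrix.cons_val_zero, Matrix.cons_val_one]
  simp only [map_mul, map_pow, map_sub, eval_X, eval_poles, Matrix.cons_val_zero,
    Matrix.cons_val_one]
  rw [mul_pow_sub_div_mul_pow h1 h2' h12' (by omega) (by omega) (by omega)]
  exact h z₁ z₂ h0 h02

theorem substHom_one_poles : substHom 1 poles = (X 0 + X 1) * X 1 * X 0 := by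
  simp [substHom, poles]

/-- Rationality and associativity imply weak associativity. -/
theorem weakAssoc_of_associates {a b : ℤ → ℤ → ℂ} (hat : LTrunc 0 1 (ser2 a))
    (ha : ProductRational (ser2 a)) (hb : IterateRational b) (hab : Associates a b) :
    WeakAssoc (ser2 a) (ser2 b) := by
  obtain ⟨P₁, h₁⟩ := ha.exists_poles
  obtain ⟨P₂, h₂⟩ := hb.exists_poles
  obtain ⟨f, hf⟩ := h₁ (max P₁ P₂) (le_max_left _ _)
  obtain ⟨g, hg⟩ := h₂ (max P₁ P₂) (le_max_right _ _)
  set P := max P₁ P₂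
  -- The two numerators agree at all real points with 2 < z₂ < 3 < z₁ < 4. These lie in the common
  -- domain, since z₁ - z₂ < 2 < z₂, and a product of infinite sets determines a polynomial.
  have hfg : f = g := by
    have hinf : ∀ a b : ℝ, a < b → ((fun x : ℝ => (x : ℂ)) '' Set.Ioo a b).Infinite := fun a b h =>
      (Set.Ioo_infinite h).image Complex.ofReal_injective.injOn
    refine funext_set ![(fun x : ℝ => (x : ℂ)) '' Set.Ioo 3 4, (fun x : ℝ => (x : ℂ)) '' Set.Ioo 2 3]
      ?_ ?_
    · intro i
      fin_cases i
      · exact hinf 3 4 (by norm_num)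
      · exact hinf 2 3 (by norm_num)
    · intro x hx
      obtain ⟨r, hr, hr0⟩ := hx 0 trivial
      obtain ⟨t, ht, ht0⟩ := hx 1 trivial
      have hx' : x = ![(r : ℂ), (t : ℂ)] := by
        funext i
        fin_cases i
        · exact hr0.symm
        · exact ht0.symm
      simp only [Set.mem_Ioo] at hr ht
      have hn1 : ‖(r : ℂ)‖ = r := by rw [Complex.norm_real, Real.norm_of_nonneg (by linarith)]
      have hn2 : ‖(t : ℂ)‖ = t := by rw [Complex.norm_real, Real.norm_of_nonneg (by linarith)]
      have hn12 : ‖(r : ℂ) - t‖ = r - t := by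
        rw [← Complex.ofReal_sub, Complex.norm_real, Real.norm_of_nonneg (by linarith)]
      obtain ⟨s, hs1, hs2⟩ := hab r t (by rw [hn1, hn2]; linarith) (by rw [hn12, hn2]; linarith)
        (by rw [hn12]; linarith)
      have h3 := (hasSum_ser2_iff.1 (hf r t (by rw [hn1, hn2]; linarith)
        (by rw [hn2]; linarith))).unique hs1
      have h4 := (hasSum_ser2_iff.1 (hg r t (by rw [hn12]; linarith)
        (by rw [hn12, hn2]; linarith))).unique hs2
      have hne : eval ![(r : ℂ), (t : ℂ)] (poles ^ P) ≠ 0 := by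
        rw [map_pow, eval_poles]
        refine pow_ne_zero _ (mul_ne_zero (mul_ne_zero ?_ ?_) ?_) <;>
          rw [← norm_pos_iff]
        · rw [hn1]; linarith
        · rw [hn2]; linarith
        · rw [hn12]; linarith
      rw [hx']
      rw [← h4] at h3
      exact (div_left_inj' hne).1 h3
  have hA : act (poles ^ P) (ser2 a) = act f (oneSeries (Fin 2)) := by
    refine act_eq_of_hasSum_torus (r := ![2, 1]) (fun i => by fin_cases i <;> simp) fun z hz => ?_
    have hz' : z = ![z 0, z 1] := by funext i; fin_cases i <;> rfl
    have h0 : ‖z 0‖ = 2 := hz 0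
    have h1 : ‖z 1‖ = 1 := hz 1
    have hlt : ‖z 1‖ < ‖z 0‖ := by rw [h0, h1]; norm_num
    have hz0 : z 0 ≠ 0 := norm_pos_iff.1 (by rw [h0]; norm_num)
    have hz1 : z 1 ≠ 0 := norm_pos_iff.1 (by rw [h1]; norm_num)
    have hz01 : z 0 - z 1 ≠ 0 := fun h => by rw [sub_eq_zero.1 h] at hlt; exact lt_irrefl _ hlt
    rw [hz']
    refine ⟨?_, hf _ _ hlt (by rw [h1]; norm_num)⟩
    rw [map_pow, eval_poles]
    exact pow_ne_zero _ (mul_ne_zero (mul_ne_zero hz0 hz1) hz01)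
  -- The variables of `b` are z₁ - z₂ and z₂, so the radii 1 and 2 lie in the domain |z₁ - z₂| <
  -- |z₂|, and all polynomials are rewritten in these variables by `substHom 1`.
  have hB : act (substHom 1 (poles ^ P)) (ser2 b) = act (substHom 1 f) (oneSeries (Fin 2)) := by
    refine act_eq_of_hasSum_torus (r := ![1, 2]) (fun i => by fin_cases i <;> simp) fun z hz => ?_
    have h0 : ‖z 0‖ = 1 := hz 0
    have h1 : ‖z 1‖ = 2 := hz 1
    have hz0 : z 0 ≠ 0 := norm_pos_iff.1 (by rw [h0]; norm_num)
    have hz1 : z 1 ≠ 0 := norm_pos_iff.1 (by rw [h1]; norm_num)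
    have hz01 : z 0 + z 1 ≠ 0 := fun h => by
      rw [eq_neg_of_add_eq_zero_left h, norm_neg, h1] at h0
      norm_num at h0
    have hz' : z = ![z 0 + z 1 - z 1, z 1] := by funext i; fin_cases i <;> simp
    rw [eval_substHom_one, eval_substHom_one]
    refine ⟨?_, ?_⟩
    · rw [map_pow, eval_poles, add_sub_cancel_right]
      exact pow_ne_zero _ (mul_ne_zero (mul_ne_zero hz01 hz1) hz0)
    · have := hg (z 0 + z 1) (z 1) (by simpa using hz0) (by rw [add_sub_cancel_right, h0, h1]; norm_num)
      rw [← hz', ← hfg] at this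
      exact this
  have hΨ := substSum_act (c := 1) hat (poles ^ P)
  rw [hA, substSum_act (finSupp_oneSeries.lTrunc (by simp)), substSum_oneSeries, ← hB, map_pow,
    substHom_one_poles] at hΨ
  -- After the substitution the poles are (X 0 + X 1) X 1 X 0. The monomials cancel and only the
  -- power of X 0 + X 1 remains.
  refine ⟨P, act_X_pow_injective 0 P (act_X_pow_injective 1 P ?_)⟩
  rw [map_zero, map_zero, ← act_mul_apply, ← act_mul_apply, ← mul_pow, ← mul_pow, map_sub,
    sub_eq_zero]
  have e : (X 1 * X 0 * (X 0 + X 1) : MvPolynomial (Fin 2) ℂ) = (X 0 + X 1) * X 1 * X 0 := by ring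
  rw [e, hΨ]

/-- Weak associativity implies that iterates are rational and associativity. -/
theorem WeakAssoc.iterateRational_and_associates {a b : ℤ → ℤ → ℂ} (h : WeakAssoc (ser2 a) (ser2 b))
    (hat : LTrunc 0 1 (ser2 a)) (hbt : LTrunc 1 0 (ser2 b)) (ha : RationalSeries (ser2 a)) :
    IterateRational b ∧ Associates a b := by
  obtain ⟨M, hM⟩ := h
  obtain ⟨q, hq⟩ := ha
  have hq' : FinSupp (act ((X 0 - X 1) ^ (2 * q)) (ser2 a)) := by
    refine hq.of_dvd ?_
    rw [pow_mul]
    refine pow_dvd_pow_of_dvd ⟨-1, ?_⟩ q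
    simp [vander, Fin.prod_univ_two]
    ring
  obtain ⟨N, hN⟩ := hq'.exists_isPoly
  obtain ⟨P, hPM, hPq, hPN⟩ : ∃ P : ℕ, M ≤ P ∧ 2 * q ≤ P ∧ N ≤ P := ⟨M + 2 * q + N, by omega⟩
  obtain ⟨f, hf⟩ : ∃ f, act (poles ^ P) (ser2 a) = act f (oneSeries (Fin 2)) := by
    refine IsPoly.exists_polynomial ?_
    have e : (poles ^ P : MvPolynomial (Fin 2) ℂ) =
        (X 0 - X 1) ^ (P - 2 * q) * ((∏ i, X i) ^ P * (X 0 - X 1) ^ (2 * q)) := by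
      rw [poles, mul_pow, Fin.prod_univ_two]
      nth_rw 2 [← Nat.sub_add_cancel hPq]
      ring
    rw [e, act_mul_apply, act_mul_apply]
    exact (hN P hPN).act _
  -- Weak associativity transports the numerator `f` from the product to the iterate, once the
  -- exponent of the poles is at least `M`.
  have hB : act (substHom 1 (poles ^ P)) (ser2 b) = act (substHom 1 f) (oneSeries (Fin 2)) := by
    rw [← substSum_oneSeries (c := 1), ← substSum_act (finSupp_oneSeries.lTrunc (by simp)), ← hf,
      substSum_act hat, eq_comm, ← sub_eq_zero, ← map_sub, map_pow, substHom_one_poles,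
      mul_assoc, mul_pow, mul_comm, act_mul_apply, exists_act_eq_zero_of_le hM hPM, map_zero]
  have hiter : ∀ z₁ z₂ : ℂ, 0 < ‖z₁ - z₂‖ → ‖z₁ - z₂‖ < ‖z₂‖ →
      HasSum (fun k : ℤ × ℤ => b k.1 k.2 * ((z₁ - z₂) ^ k.1 * z₂ ^ k.2))
        (eval ![z₁, z₂] f / (z₁ * z₂ * (z₁ - z₂)) ^ P) := by
    intro z₁ z₂ h0 h02
    have hz : ∀ i, ![z₁ - z₂, z₂] i ≠ 0 := by
      intro i
      fin_cases i
      · exact norm_pos_iff.1 h0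
      · exact norm_pos_iff.1 (h0.trans h02)
    have hdiv : CanDivide (LTrunc 1 0) ![z₁ - z₂, z₂] (substHom 1 (poles ^ P)) := by
      rw [map_pow, substHom_one_poles]
      have hP : ∀ (p : MvPolynomial (Fin 2) ℂ) F, LTrunc 1 0 F → LTrunc 1 0 (act p F) :=
        fun p F hF => hF.act p
      refine CanDivide.pow hP (CanDivide.mul hP (CanDivide.mul hP ?_ ?_) ?_) P
      · intro F hF s hs
        -- For the iterate the dominant variable is z₂, so this factor is expanded in powers of X 0
        -- / X 1; the truncation `hbt` has the matching direction.
        have e : (X 0 + X 1 : MvPolynomial (Fin 2) ℂ) = X 1 + C 1 * X 0 := by rw [C_1]; ring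
        rw [e] at hs ⊢
        have := hF.hasSum_div hz (by simpa using h02) hs
        simpa using this
      · intro F hF s hs
        rw [eval_X]
        exact hasSum_div_X hz 1 hs
      · intro F hF s hs
        rw [eval_X]
        exact hasSum_div_X hz 0 hs
    have hone := hasSum_act hz (hasSum_oneSeries _) (substHom 1 f)
    rw [← hB] at hone
    have := hdiv _ hbt _ hone
    rw [hasSum_ser2_iff, mul_one, eval_substHom_one, eval_substHom_one, map_pow] at this
    simpa [eval_poles] using this
  have hprod : ∀ z₁ z₂ : ℂ, ‖z₂‖ < ‖z₁‖ → 0 < ‖z₂‖ →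
      HasSum (fun k : ℤ × ℤ => a k.1 k.2 * (z₁ ^ k.1 * z₂ ^ k.2))
        (eval ![z₁, z₂] f / (z₁ * z₂ * (z₁ - z₂)) ^ P) := by
    intro z₁ z₂ h12 h2
    have hz : ∀ i, ![z₁, z₂] i ≠ 0 := by
      intro i
      fin_cases i
      · exact norm_pos_iff.1 (h2.trans h12)
      · exact norm_pos_iff.1 h2
    have hdiv : CanDivide (LTrunc 0 1) ![z₁, z₂] (poles ^ P) := by
      have hP : ∀ (p : MvPolynomial (Fin 2) ℂ) F, LTrunc 0 1 F → LTrunc 0 1 (act p F) :=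
        fun p F hF => hF.act p
      refine CanDivide.pow hP (CanDivide.mul hP (CanDivide.mul hP ?_ ?_) ?_) P
      · intro F hF s hs
        rw [eval_X]
        exact hasSum_div_X hz 0 hs
      · intro F hF s hs
        rw [eval_X]
        exact hasSum_div_X hz 1 hs
      · exact canDivide_X_sub_X (fun F hF => hF) hz (by simpa using h12)
    have hone := hasSum_act hz (hasSum_oneSeries _) f
    rw [← hf] at hone
    have := hdiv _ hat _ hone
    rw [hasSum_ser2_iff, mul_one, map_pow, eval_poles] at this
    simpa using this
  refine ⟨⟨f, P, P, P, fun z₁ z₂ h0 h02 => ?_⟩, fun z₁ z₂ h12 h02 h0 =>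
    ⟨_, hprod z₁ z₂ h12 (h0.trans h02), hiter z₁ z₂ h0 h02⟩⟩
  rw [← mul_pow, ← mul_pow]
  exact hiter z₁ z₂ h0 h02

end WeakAssociativity

/-! ### Graded spaces -/

section Gradings

variable {V W ι ι' : Type*} [AddCommGroup V] [Module ℂ V] [AddCommGroup W] [Module ℂ W]

theorem isInternal_induction [DecidableEq ι] {gr : ι → Submodule ℂ W}
    (h : DirectSum.IsInternal gr) {p : W → Prop} (mem : ∀ i, ∀ w ∈ gr i, p w) (zero : p 0)
    (add : ∀ v w, p v → p w → p (v + w)) (w : W) : p w := by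
  have hw : w ∈ ⨆ i, gr i := by
    rw [h.submodule_iSup_eq_top]
    trivial
  exact Submodule.iSup_induction gr (motive := p) hw mem zero add

theorem linearMap_ext_of_isInternal [DecidableEq ι] {gr : ι → Submodule ℂ W}
    (h : DirectSum.IsInternal gr) {f g : W →ₗ[ℂ] V} (hfg : ∀ i, ∀ w ∈ gr i, f w = g w) :
    f = g :=
  LinearMap.ext fun w => isInternal_induction h hfg (by simp) (fun v w hv hw => by simp [hv, hw]) w

/-- The part of the vector in the other degrees is an eigenvector for f i lying in the sum of the
other eigenspaces, so it vanishes by independence of eigenspaces. -/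
theorem mem_of_eigenvector [DecidableEq ι] {gr : ι → Submodule ℂ W} (h : DirectSum.IsInternal gr)
    {f : ι → ℂ} (hf : Function.Injective f) {d : W →ₗ[ℂ] W}
    (hd : ∀ i, ∀ w ∈ gr i, d w = f i • w) {i : ι} {w : W} (hw : d w = f i • w) : w ∈ gr i := by
  have htop : w ∈ gr i ⊔ ⨆ (j) (_ : j ≠ i), gr j := by
    have : (⊤ : Submodule ℂ W) ≤ gr i ⊔ ⨆ (j) (_ : j ≠ i), gr j := by
      rw [← h.submodule_iSup_eq_top]
      refine iSup_le fun j => ?_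
      by_cases hj : j = i
      · subst hj; exact le_sup_left
      · exact le_sup_of_le_right (le_iSup₂_of_le j hj le_rfl)
    exact this trivial
  obtain ⟨a, ha, b, hb, rfl⟩ := Submodule.mem_sup.1 htop
  have hb1 : b ∈ Module.End.eigenspace d (f i) := by
    rw [Module.End.mem_eigenspace_iff]
    rw [map_add, hd i a ha, smul_add] at hw
    exact add_left_cancel hw
  have hb2 : b ∈ ⨆ (μ) (_ : μ ≠ f i), Module.End.eigenspace d μ := by
    refine (iSup₂_le fun j hj => ?_ : (⨆ (j) (_ : j ≠ i), gr j) ≤ _) hb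
    refine le_iSup₂_of_le (f j) (fun e => hj (hf e)) fun x hx => ?_
    rw [Module.End.mem_eigenspace_iff]
    exact hd j x hx
  have hb0 : b = 0 := by
    have := (Module.End.eigenspaces_iSupIndep d (f i)).le_bot ⟨hb1, hb2⟩
    simpa using this
  rw [hb0, add_zero]
  exact ha

theorem comp_mem_gradedDual {gr : ι → Submodule ℂ W} {gr' : ι' → Submodule ℂ V}
    {φ : Module.Dual ℂ W} (hφ : φ ∈ gradedDual gr) {T : V →ₗ[ℂ] W} {e : ι' → ι}
    (he : Function.Injective e) (hT : ∀ i, ∀ v ∈ gr' i, T v ∈ gr (e i)) :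
    φ ∘ₗ T ∈ gradedDual gr' := by
  refine Set.Finite.subset (Set.Finite.preimage he.injOn hφ) ?_
  rintro i ⟨v, hv, hne⟩
  exact ⟨T v, hT i v hv, hne⟩

theorem eventually_eq_zero_of_mem_gradedDual {gr : ι → Submodule ℂ W} {φ : Module.Dual ℂ W}
    (hφ : φ ∈ gradedDual gr) (h : ι → ℝ) : ∃ B : ℝ, ∀ i, B < h i → ∀ w ∈ gr i, φ w = 0 := by
  obtain ⟨B, hB⟩ := (Set.Finite.image h hφ).bddAbove
  refine ⟨B, fun i hi w hw => by_contra fun hne => ?_⟩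
  exact absurd (hB ⟨i, ⟨w, hw, hne⟩, rfl⟩) (not_le.2 hi)

end Gradings

theorem VertexData.d_apply {V : Type*} [AddCommGroup V] [Module ℂ V] {𝓥 : VertexData V}
    (h : DirectSum.IsInternal 𝓥.gr) {n : ℤ} {v : V} (hv : v ∈ 𝓥.gr n) :
    𝓥.d v = (n : ℂ) • v := by
  rw [VertexData.d, ofHomogeneous_apply h _ hv]
  rfl

/-! ### Graded vertex operator maps -/

section GradedAction

variable {V W ι : Type*} [AddCommGroup V] [Module ℂ V] [AddCommGroup W] [Module ℂ W]

/-- The grading conditions on a vertex operator map `V ⊗ W → W[[x, x⁻¹]]` and on the operator `D`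
of weight one. The index set `ι` contains `ℤ` by `c`, and `h` is the real part. -/
structure IsGradedAction [AddCommGroup ι] [DecidableEq ι] (c : ℤ →+ ι) (h : ι →+ ℝ)
    (𝓥 : VertexData V) (gr : ι → Submodule ℂ W) (Y : V → W → Series W) (D : W →ₗ[ℂ] W) :
    Prop where
  height : ∀ n, h (c n) = n
  internal_left : DirectSum.IsInternal 𝓥.gr
  internal : DirectSum.IsInternal gr
  bilinear : IsBilinear Y
  lower_bound : ∃ N : ℝ, ∀ i, h i < N → gr i = ⊥
  Y_mem : ∀ n, ∀ u ∈ 𝓥.gr n, ∀ i, ∀ w ∈ gr i, ∀ k, Y u w k ∈ gr (c n + i + c k)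
  D_mem : ∀ i, ∀ w ∈ gr i, D w ∈ gr (i + c 1)

namespace IsBilinear

variable {A B C : Type*} [AddCommGroup A] [Module ℂ A] [AddCommGroup B] [Module ℂ B]
    [AddCommGroup C] [Module ℂ C] {Y : A → B → Series C}

theorem add_left (hY : IsBilinear Y) (a a' : A) (b : B) : Y (a + a') b = Y a b + Y a' b :=
  (hY.1 b).map_add a a'

theorem add_right (hY : IsBilinear Y) (a : A) (b b' : B) : Y a (b + b') = Y a b + Y a b' :=
  (hY.2 a).map_add b b'

theorem smul_left (hY : IsBilinear Y) (r : ℂ) (a : A) (b : B) : Y (r • a) b = r • Y a b :=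
  (hY.1 b).map_smul r a

theorem smul_right (hY : IsBilinear Y) (r : ℂ) (a : A) (b : B) : Y a (r • b) = r • Y a b :=
  (hY.2 a).map_smul r b

theorem zero_left (hY : IsBilinear Y) (b : B) : Y 0 b = 0 := (hY.1 b).map_zero

theorem zero_right (hY : IsBilinear Y) (a : A) : Y a 0 = 0 := (hY.2 a).map_zero

end IsBilinear

/-- The linear map `b ↦ Y(a, x) b`, coefficient of `x ^ k`. -/
def IsBilinear.right {A B C : Type*} [AddCommGroup A] [Module ℂ A] [AddCommGroup B] [Module ℂ B]
    [AddCommGroup C] [Module ℂ C] {Y : A → B → Series C} (hY : IsBilinear Y) (a : A) (k : ℤ) :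
    B →ₗ[ℂ] C where
  toFun b := Y a b k
  map_add' b b' := by rw [hY.add_right]; rfl
  map_smul' r b := by rw [hY.smul_right]; rfl

/-- The linear map `a ↦ Y(a, x) b`, coefficient of `x ^ k`. -/
def IsBilinear.left {A B C : Type*} [AddCommGroup A] [Module ℂ A] [AddCommGroup B] [Module ℂ B]
    [AddCommGroup C] [Module ℂ C] {Y : A → B → Series C} (hY : IsBilinear Y) (b : B) (k : ℤ) :
    A →ₗ[ℂ] C where
  toFun a := Y a b k
  map_add' a a' := by rw [hY.add_left]; rfl
  map_smul' r a := by rw [hY.smul_left]; rfl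

theorem IsBilinear.right_apply {A B C : Type*} [AddCommGroup A] [Module ℂ A] [AddCommGroup B]
    [Module ℂ B] [AddCommGroup C] [Module ℂ C] {Y : A → B → Series C} (hY : IsBilinear Y) (a : A)
    (b : B) (k : ℤ) : hY.right a k b = Y a b k := rfl

theorem IsBilinear.left_apply {A B C : Type*} [AddCommGroup A] [Module ℂ A] [AddCommGroup B]
    [Module ℂ B] [AddCommGroup C] [Module ℂ C] {Y : A → B → Series C} (hY : IsBilinear Y) (a : A)
    (b : B) (k : ℤ) : hY.left b k a = Y a b k := rfl

namespace IsGradedAction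

variable [AddCommGroup ι] [DecidableEq ι] {c : ℤ →+ ι} {h : ι →+ ℝ} {𝓥 : VertexData V}
  {gr : ι → Submodule ℂ W} {Y : V → W → Series W} {D : W →ₗ[ℂ] W}

theorem injective (hA : IsGradedAction c h 𝓥 gr Y D) : Function.Injective c := by
  intro m n e
  have := congrArg h e
  rw [hA.height, hA.height] at this
  exact_mod_cast this

/-- `Y(u, x) w` has only finitely many negative powers of `x`. -/
theorem trunc (hA : IsGradedAction c h 𝓥 gr Y D) (u : V) (w : W) :
    ∃ K : ℤ, ∀ k < K, Y u w k = 0 := by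
  obtain ⟨N, hN⟩ := hA.lower_bound
  refine isInternal_induction hA.internal_left (p := fun u => ∃ K : ℤ, ∀ k < K, Y u w k = 0)
    (fun n u hu => ?_) ⟨0, fun k _ => by rw [hA.bilinear.zero_left]; rfl⟩ ?_ u
  · refine isInternal_induction hA.internal (p := fun w => ∃ K : ℤ, ∀ k < K, Y u w k = 0)
      (fun i w hw => ?_) ⟨0, fun k _ => by rw [hA.bilinear.zero_right]; rfl⟩ ?_ w
    · refine ⟨⌊N - n - h i⌋, fun k hk => ?_⟩
      have hm := hA.Y_mem n u hu i w hw k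
      rw [hN] at hm
      · simpa using hm
      · rw [map_add, map_add, hA.height, hA.height]
        have : (k : ℝ) < N - n - h i :=
          lt_of_lt_of_le (by exact_mod_cast hk) (Int.floor_le _)
        linarith
    · rintro w w' ⟨K, hK⟩ ⟨K', hK'⟩
      refine ⟨min K K', fun k hk => ?_⟩
      rw [hA.bilinear.add_right, Pi.add_apply, hK k (lt_of_lt_of_le hk (min_le_left _ _)),
        hK' k (lt_of_lt_of_le hk (min_le_right _ _)), add_zero]
  · rintro u u' ⟨K, hK⟩ ⟨K', hK'⟩
    refine ⟨min K K', fun k hk => ?_⟩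
    rw [hA.bilinear.add_left, Pi.add_apply, hK k (lt_of_lt_of_le hk (min_le_left _ _)),
      hK' k (lt_of_lt_of_le hk (min_le_right _ _)), add_zero]

theorem D_pow_mem (hA : IsGradedAction c h 𝓥 gr Y D) {i : ι} {w : W} (hw : w ∈ gr i) (j : ℕ) :
    (D ^ j) w ∈ gr (i + c j) := by
  induction j with
  | zero => simpa using hw
  | succ j ih =>
    rw [pow_succ', Module.End.mul_apply]
    have := hA.D_mem _ _ ih
    rwa [add_assoc, ← map_add] at this

/-- D raises weights by one, weights are bounded below, and a functional in the graded dual sees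
only finitely many of them. Hence e^{xD} is a finite sum in every matrix coefficient. -/
theorem comp_D_eventually_zero (hA : IsGradedAction c h 𝓥 gr Y D) {φ : Module.Dual ℂ W}
    (hφ : φ ∈ gradedDual gr) : ∃ J : ℕ, ∀ j ≥ J, ∀ w, φ ((D ^ j) w) = 0 := by
  obtain ⟨N, hN⟩ := hA.lower_bound
  obtain ⟨B, hB⟩ := eventually_eq_zero_of_mem_gradedDual hφ h
  refine ⟨⌈B - N⌉₊ + 1, fun j hj w => ?_⟩
  refine isInternal_induction hA.internal (p := fun w => φ ((D ^ j) w) = 0)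
    (fun i w hw => ?_) (by simp) (fun v w hv hw => by simp [hv, hw]) w
  by_cases hi : h i < N
  · rw [hN i hi, Submodule.mem_bot] at hw
    simp [hw]
  · refine hB _ ?_ _ (hA.D_pow_mem hw j)
    have h1 := hA.height j
    rw [map_add, h1]
    have h2 : B - N ≤ ⌈B - N⌉₊ := Nat.le_ceil _
    have h3 : ((⌈B - N⌉₊ : ℕ) : ℝ) + 1 ≤ j := by exact_mod_cast hj
    push_cast
    linarith

theorem comp_D_mem (hA : IsGradedAction c h 𝓥 gr Y D) {φ : Module.Dual ℂ W}
    (hφ : φ ∈ gradedDual gr) : φ ∘ₗ D ∈ gradedDual gr :=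
  comp_mem_gradedDual hφ (add_left_injective (c 1)) hA.D_mem

theorem comp_right_mem (hA : IsGradedAction c h 𝓥 gr Y D) {φ : Module.Dual ℂ W}
    (hφ : φ ∈ gradedDual gr) (u : V) (k : ℤ) : φ ∘ₗ hA.bilinear.right u k ∈ gradedDual gr := by
  refine isInternal_induction hA.internal_left
    (p := fun u => φ ∘ₗ hA.bilinear.right u k ∈ gradedDual gr) (fun n u hu => ?_) ?_ ?_ u
  · refine comp_mem_gradedDual hφ (e := fun i => c n + i + c k)
      ((add_left_injective (c k)).comp (add_right_injective (c n))) fun i w hw =>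
        hA.Y_mem n u hu i w hw k
  · convert (gradedDual gr).zero_mem
    ext w
    change φ (Y 0 w k) = 0
    rw [hA.bilinear.zero_left]
    exact map_zero φ
  · intro u v hu hv
    convert (gradedDual gr).add_mem hu hv
    ext w
    change φ (Y (u + v) w k) = φ (Y u w k) + φ (Y v w k)
    rw [hA.bilinear.add_left]
    exact map_add φ _ _

theorem comp_left_mem (hA : IsGradedAction c h 𝓥 gr Y D) {φ : Module.Dual ℂ W}
    (hφ : φ ∈ gradedDual gr) (w : W) (k : ℤ) :
    φ ∘ₗ hA.bilinear.left w k ∈ gradedDual 𝓥.gr := by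
  refine isInternal_induction hA.internal
    (p := fun w => φ ∘ₗ hA.bilinear.left w k ∈ gradedDual 𝓥.gr) (fun i w hw => ?_) ?_ ?_ w
  · refine comp_mem_gradedDual hφ (e := fun n => c n + i + c k)
      ((add_left_injective (c k)).comp ((add_left_injective i).comp hA.injective)) fun n u hu =>
        hA.Y_mem n u hu i w hw k
  · convert (gradedDual 𝓥.gr).zero_mem
    ext u
    change φ (Y u 0 k) = 0
    rw [hA.bilinear.zero_right]
    exact map_zero φ
  · intro v w hv hw
    convert (gradedDual 𝓥.gr).add_mem hv hw
    ext u
    change φ (Y u (v + w) k) = φ (Y u v k) + φ (Y u w k)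
    rw [hA.bilinear.add_right]
    exact map_add φ _ _

end IsGradedAction

/-- The derivation `D_V` as a linear map. -/
def IsMOSVA.DLin {𝓥 : VertexData V} (h : IsMOSVA 𝓥) : V →ₗ[ℂ] V where
  toFun := 𝓥.D
  map_add' u v := by
    simp only [VertexData.D, ddx, h.bilinear.add_left, Pi.add_apply, smul_add]
  map_smul' r u := by
    simp only [VertexData.D, ddx, h.bilinear.smul_left, Pi.smul_apply, RingHom.id_apply]
    rw [smul_comm]

@[simp]
theorem IsMOSVA.DLin_apply {𝓥 : VertexData V} (h : IsMOSVA 𝓥) (v : V) : h.DLin v = 𝓥.D v := rfl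

/-- The d-commutator for Y(𝟏, x) 𝟏 leaves Y(d 𝟏, x) 𝟏 = 0 in degree zero, and the creation property
reads off d 𝟏 = 0. -/
theorem IsMOSVA.vac_mem {𝓥 : VertexData V} (h : IsMOSVA 𝓥) : 𝓥.vac ∈ 𝓥.gr 0 := by
  refine mem_of_eigenvector h.internal (f := fun n : ℤ => (n : ℂ)) Int.cast_injective
    (fun n v hv => VertexData.d_apply h.internal hv) ?_
  have h1 := congrFun (h.d_commutator 𝓥.vac 𝓥.vac) 0
  simp only [h.identity, Pi.add_apply, Pi.sub_apply, Function.comp, mulX, ddx] at h1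
  simp only [Pi.single_eq_same, sub_self, zero_sub, neg_add_cancel, Int.cast_zero, zero_smul,
    zero_add, (h.creation (𝓥.d 𝓥.vac)).2] at h1
  simp [← h1]

theorem IsMOSVA.Y_mem {𝓥 : VertexData V} (h : IsMOSVA 𝓥) {n i : ℤ} {u v : V} (hu : u ∈ 𝓥.gr n)
    (hv : v ∈ 𝓥.gr i) (k : ℤ) : 𝓥.Y u v k ∈ 𝓥.gr (n + i + k) := by
  refine mem_of_eigenvector h.internal (f := fun n : ℤ => (n : ℂ)) Int.cast_injective
    (fun n v hv => VertexData.d_apply h.internal hv) ?_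
  have h1 := congrFun (h.d_commutator u v) k
  simp only [VertexData.d_apply h.internal hu, VertexData.d_apply h.internal hv,
    h.bilinear.smul_left, h.bilinear.smul_right, Pi.add_apply, Pi.sub_apply, Function.comp, mulX,
    ddx, sub_add_cancel, Pi.smul_apply] at h1
  rw [sub_eq_iff_eq_add] at h1
  rw [h1]
  push_cast
  module

theorem IsMOSVA.D_mem {𝓥 : VertexData V} (h : IsMOSVA 𝓥) {i : ℤ} {v : V} (hv : v ∈ 𝓥.gr i) :
    𝓥.D v ∈ 𝓥.gr (i + 1) := by
  have := h.Y_mem hv h.vac_mem 1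
  simpa [VertexData.D, ddx] using this

theorem IsMOSVA.isGradedAction {𝓥 : VertexData V} (h : IsMOSVA 𝓥) :
    IsGradedAction (AddMonoidHom.id ℤ) (Int.castAddHom ℝ) 𝓥 𝓥.gr 𝓥.Y h.DLin where
  height n := rfl
  internal_left := h.internal
  internal := h.internal
  bilinear := h.bilinear
  lower_bound := by
    obtain ⟨N, hN⟩ := h.lower_bound
    exact ⟨N, fun i hi => hN i (Int.cast_lt.1 hi)⟩
  Y_mem n u hu i w hw k := h.Y_mem hu hw k
  D_mem i w hw := h.D_mem hw

theorem IsLeftModule.isGradedAction {𝓥 : VertexData V} (hV : DirectSum.IsInternal 𝓥.gr)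
    {gr : ℂ → Submodule ℂ W} {Y : V → W → Series W} {d D : W →ₗ[ℂ] W}
    (h : IsLeftModule 𝓥 gr Y d D) :
    IsGradedAction (Int.castAddHom ℂ) Complex.reAddGroupHom 𝓥 gr Y D where
  height n := by simp
  internal_left := hV
  internal := h.internal
  bilinear := h.bilinear
  lower_bound := by
    obtain ⟨N, hN⟩ := h.lower_bound
    exact ⟨N, fun i hi => hN i hi⟩
  Y_mem n u hu i w hw k := by
    refine mem_of_eigenvector h.internal (f := id) Function.injective_id
      (fun n v hv => h.d_grading n v hv) ?_
    have h1 := congrFun (h.d_commutator u w) k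
    simp only [VertexData.d_apply hV hu, h.d_grading i w hw, h.bilinear.smul_left,
      h.bilinear.smul_right, Pi.add_apply, Pi.sub_apply, Function.comp, mulX,
      ddx, sub_add_cancel, Pi.smul_apply] at h1
    rw [sub_eq_iff_eq_add] at h1
    rw [h1]
    simp only [Int.coe_castAddHom, id]
    module
  D_mem i w hw := by simpa using h.D_weight i w hw

end GradedAction

set_option linter.unusedSectionVars false

/-! ### Exponentials of operators -/

section ExpX

variable {W E : Type*} [AddCommGroup W] [Module ℂ W] [AddCommGroup E] [Module ℂ E]

/-- `F` has only finitely many negative powers of `x`. -/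
def Trunc (F : Series W) : Prop := ∃ K : ℤ, ∀ k < K, F k = 0

theorem Trunc.add {F G : Series W} (hF : Trunc F) (hG : Trunc G) : Trunc (F + G) := by
  obtain ⟨K, hK⟩ := hF
  obtain ⟨L, hL⟩ := hG
  exact ⟨min K L, fun k hk => by
    rw [Pi.add_apply, hK k (lt_of_lt_of_le hk (min_le_left _ _)),
      hL k (lt_of_lt_of_le hk (min_le_right _ _)), add_zero]⟩

theorem Trunc.smul {F : Series W} (hF : Trunc F) (c : ℂ) : Trunc (c • F) := by
  obtain ⟨K, hK⟩ := hF
  exact ⟨K, fun k hk => by rw [Pi.smul_apply, hK k hk, smul_zero]⟩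

theorem Trunc.neg {F : Series W} (hF : Trunc F) : Trunc (-F) := by
  simpa using hF.smul (-1)

theorem Trunc.mulX {F : Series W} (hF : Trunc F) (p : ℤ) : Trunc (MOSVA.mulX p F) := by
  obtain ⟨K, hK⟩ := hF
  exact ⟨K + p, fun k hk => hK _ (by omega)⟩

theorem Trunc.negX {F : Series W} (hF : Trunc F) : Trunc (MOSVA.negX F) := by
  obtain ⟨K, hK⟩ := hF
  exact ⟨K, fun k hk => by rw [MOSVA.negX, hK _ hk, smul_zero]⟩

theorem Trunc.comp {F : Series W} (hF : Trunc F) (T : W →ₗ[ℂ] E) : Trunc (T ∘ F) := by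
  obtain ⟨K, hK⟩ := hF
  exact ⟨K, fun k hk => by rw [Function.comp, hK _ hk, map_zero]⟩

theorem trunc_single (w : W) : Trunc (Pi.single 0 w) :=
  ⟨0, fun k hk => Pi.single_eq_of_ne (by omega) _⟩

/-- The bound `R` is free, subject to k - K < R, so that exponentials with shifted arguments can be
written over compatible ranges. -/
theorem expX_apply {F : Series W} {K : ℤ} (hK : ∀ k < K, F k = 0) (T : W →ₗ[ℂ] W) {k : ℤ} {R : ℕ}
    (hR : k - K < R) :
    expX T F k = ∑ j ∈ Finset.range R, ((j.factorial : ℂ)⁻¹) • (T ^ j) (F (k - j)) := by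
  rw [expX]
  simp_rw [← Module.End.pow_apply]
  refine finsum_eq_sum_of_support_subset _ fun j hj => ?_
  rw [Finset.coe_range, Set.mem_Iio]
  by_contra hne
  rw [not_lt] at hne
  refine hj ?_
  change ((j.factorial : ℂ)⁻¹) • (T ^ j) (F (k - j)) = 0
  rw [hK _ (by omega), map_zero, smul_zero]

theorem expX_apply_eq_zero {F : Series W} {K : ℤ} (hK : ∀ k < K, F k = 0) (T : W →ₗ[ℂ] W) {k : ℤ}
    (hk : k < K) : expX T F k = 0 := by
  rw [expX_apply hK T (R := 0) (by simpa using hk)]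
  simp

theorem Trunc.expX {F : Series W} (hF : Trunc F) (T : W →ₗ[ℂ] W) : Trunc (MOSVA.expX T F) := by
  obtain ⟨K, hK⟩ := hF
  exact ⟨K, fun k hk => expX_apply_eq_zero hK T hk⟩

theorem Trunc.exists_common {F G : Series W} (hF : Trunc F) (hG : Trunc G) :
    ∃ K : ℤ, (∀ k < K, F k = 0) ∧ ∀ k < K, G k = 0 := by
  obtain ⟨K, hK⟩ := hF
  obtain ⟨L, hL⟩ := hG
  exact ⟨min K L, fun k hk => hK k (lt_of_lt_of_le hk (min_le_left _ _)),
    fun k hk => hL k (lt_of_lt_of_le hk (min_le_right _ _))⟩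

theorem exists_nat_gt (k K : ℤ) : ∃ R : ℕ, k - K < R := ⟨(k - K + 1).toNat, by omega⟩

theorem expX_add (T : W →ₗ[ℂ] W) {F G : Series W} (hF : Trunc F) (hG : Trunc G) :
    expX T (F + G) = expX T F + expX T G := by
  obtain ⟨K, hF, hG⟩ := hF.exists_common hG
  funext k
  obtain ⟨R, hR⟩ := exists_nat_gt k K
  rw [Pi.add_apply, expX_apply hF T hR, expX_apply hG T hR,
    expX_apply (F := F + G) (fun k hk => by simp [hF k hk, hG k hk]) T hR, ← Finset.sum_add_distrib]
  simp

theorem expX_smul (T : W →ₗ[ℂ] W) (c : ℂ) {F : Series W} (hF : Trunc F) :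
    expX T (c • F) = c • expX T F := by
  obtain ⟨K, hF⟩ := hF
  funext k
  obtain ⟨R, hR⟩ := exists_nat_gt k K
  rw [Pi.smul_apply, expX_apply hF T hR,
    expX_apply (F := c • F) (fun k hk => by simp [hF k hk]) T hR, Finset.smul_sum]
  simp only [Pi.smul_apply, map_smul]
  exact Finset.sum_congr rfl fun j _ => smul_comm _ _ _

theorem expX_neg (T : W →ₗ[ℂ] W) {F : Series W} (hF : Trunc F) : expX T (-F) = -expX T F := by
  simpa using expX_smul T (-1) hF

theorem expX_sub (T : W →ₗ[ℂ] W) {F G : Series W} (hF : Trunc F) (hG : Trunc G) :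
    expX T (F - G) = expX T F - expX T G := by
  rw [sub_eq_add_neg, expX_add T hF hG.neg, expX_neg T hG, ← sub_eq_add_neg]

theorem expX_mulX (T : W → W) (p : ℤ) (F : Series W) : expX T (mulX p F) = mulX p (expX T F) := by
  funext k
  simp only [expX, mulX, sub_right_comm]

theorem expX_comp (T : W →ₗ[ℂ] W) {F : Series W} (hF : Trunc F) :
    expX T (T ∘ F) = T ∘ expX T F := by
  obtain ⟨K, hF⟩ := hF
  funext k
  obtain ⟨R, hR⟩ := exists_nat_gt k K
  rw [Function.comp, expX_apply hF T hR,
    expX_apply (F := T ∘ F) (fun k hk => by simp [hF k hk]) T hR, map_sum]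
  refine Finset.sum_congr rfl fun j _ => ?_
  rw [map_smul, Function.comp, ← Module.End.mul_apply, ← Module.End.mul_apply, ← pow_succ,
    ← pow_succ']

theorem expX_single_of_neg (T : W →ₗ[ℂ] W) (w : W) {k : ℤ} (hk : k < 0) :
    expX T (Pi.single 0 w) k = 0 :=
  expX_apply_eq_zero (F := Pi.single 0 w) (K := 0) (fun _ h => Pi.single_eq_of_ne (by omega) _) T hk

theorem expX_single (T : W →ₗ[ℂ] W) (w : W) (n : ℕ) :
    expX T (Pi.single 0 w) n = ((n.factorial : ℂ)⁻¹) • (T ^ n) w := by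
  rw [expX_apply (F := Pi.single 0 w) (K := 0) (fun _ h => Pi.single_eq_of_ne (by omega) _) T
    (R := n + 1) (by push_cast; omega), Finset.sum_eq_single n]
  · simp
  · intro j _ hj
    rw [Pi.single_eq_of_ne (by omega), map_zero, smul_zero]
  · simp

/-- The cancellation j / j! = 1 / (j - 1)! behind every differentiation of an exponential below. -/
theorem sum_range_inv_factorial_smul (R : ℕ) (g : ℕ → W) :
    ∑ j ∈ Finset.range (R + 1), ((j.factorial : ℂ)⁻¹) • (j : ℂ) • g j =
      ∑ j ∈ Finset.range R, ((j.factorial : ℂ)⁻¹) • g (j + 1) := by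
  rw [Finset.sum_range_succ']
  simp only [Nat.cast_zero, zero_smul, smul_zero, add_zero]
  refine Finset.sum_congr rfl fun j _ => ?_
  rw [smul_smul, Nat.factorial_succ, Nat.cast_mul, mul_inv, mul_right_comm,
    inv_mul_cancel₀ (Nat.cast_ne_zero.2 j.succ_ne_zero), one_mul]

theorem ddx_expX (T : W →ₗ[ℂ] W) {F : Series W} (hF : Trunc F) :
    ddx (expX T F) = T ∘ expX T F + expX T (ddx F) := by
  obtain ⟨K, hF⟩ := hF
  funext k
  obtain ⟨R, hR⟩ := exists_nat_gt k K
  have hF' : ∀ k < K - 1, ddx F k = 0 := fun k hk => by rw [ddx, hF _ (by omega), smul_zero]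
  rw [Pi.add_apply, Function.comp, ddx, expX_apply hF T hR,
    expX_apply hF T (R := R + 1) (by push_cast; omega),
    expX_apply hF' T (R := R + 1) (by push_cast; omega)]
  have h1 := sum_range_inv_factorial_smul R fun j => (T ^ j) (F (k + 1 - j))
  have h2 : T (∑ j ∈ Finset.range R, ((j.factorial : ℂ)⁻¹) • (T ^ j) (F (k - j))) =
      ∑ j ∈ Finset.range R, ((j.factorial : ℂ)⁻¹) • (T ^ (j + 1)) (F (k + 1 - (j + 1 : ℕ))) := by
    rw [map_sum]
    refine Finset.sum_congr rfl fun j _ => ?_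
    rw [map_smul, pow_succ', Module.End.mul_apply]
    congr 4
    push_cast
    ring
  rw [h2, ← h1, ← Finset.sum_add_distrib, Finset.smul_sum]
  refine Finset.sum_congr rfl fun j _ => ?_
  have e : k - (j : ℤ) + 1 = k + 1 - j := by ring
  rw [ddx, map_smul, e]
  push_cast
  module

theorem comp_pow_of_weight_one {T A : W →ₗ[ℂ] W} (hA : ∀ w, A (T w) = T (A w) + T w) (j : ℕ)
    (w : W) : A ((T ^ j) w) = (T ^ j) (A w) + (j : ℂ) • (T ^ j) w := by
  induction j generalizing w with
  | zero => simp
  | succ j ih =>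
    rw [pow_succ, Module.End.mul_apply, ih, hA, map_add, Module.End.mul_apply]
    push_cast
    module

/-- Since [A, T] = T, conjugation gives e^{-xT} A e^{xT} = A + xT. -/
theorem comp_expX_of_weight_one {T A : W →ₗ[ℂ] W} (hA : ∀ w, A (T w) = T (A w) + T w)
    {F : Series W} (hF : Trunc F) :
    A ∘ expX T F = expX T (A ∘ F) + mulX 1 (T ∘ expX T F) := by
  obtain ⟨K, hF⟩ := hF
  funext k
  obtain ⟨R, hR⟩ := exists_nat_gt k K
  have hF' : ∀ k < K, (A ∘ F) k = 0 := fun k hk => by rw [Function.comp, hF _ hk, map_zero]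
  rw [Pi.add_apply, Function.comp, mulX, Function.comp, expX_apply hF T (k := k - 1) (R := R) (by omega),
    expX_apply hF T (R := R + 1) (by push_cast; omega),
    expX_apply hF' T (R := R + 1) (by push_cast; omega)]
  have h1 := sum_range_inv_factorial_smul R fun j => (T ^ j) (F (k - j))
  have h2 : T (∑ j ∈ Finset.range R, ((j.factorial : ℂ)⁻¹) • (T ^ j) (F (k - 1 - j))) =
      ∑ j ∈ Finset.range R, ((j.factorial : ℂ)⁻¹) • (T ^ (j + 1)) (F (k - (j + 1 : ℕ))) := by
    rw [map_sum]
    refine Finset.sum_congr rfl fun j _ => ?_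
    rw [map_smul, pow_succ', Module.End.mul_apply]
    congr 4
    push_cast
    ring
  rw [h2, ← h1, ← Finset.sum_add_distrib, map_sum]
  refine Finset.sum_congr rfl fun j _ => ?_
  rw [map_smul, comp_pow_of_weight_one hA, smul_add, Function.comp]

/-- Here T, A, B play the roles of L(-1), L(0), L(1). The truncated exponent j - 1 is harmless,
since the factor j vanishes at j = 0. -/
theorem comp_pow_of_sl2 {T A B : W →ₗ[ℂ] W} (hA : ∀ w, A (T w) = T (A w) + T w)
    (hB : ∀ w, B (T w) = T (B w) + (2 : ℂ) • A w) (j : ℕ) (w : W) :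
    B ((T ^ j) w) = (T ^ j) (B w) + (j : ℂ) • ((2 : ℂ) • (T ^ (j - 1)) (A w)) +
      (j : ℂ) • ((j - 1 : ℂ) • (T ^ (j - 1)) w) := by
  induction j generalizing w with
  | zero => simp
  | succ j ih =>
    rw [pow_succ, Module.End.mul_apply, ih, hB, hA, Module.End.mul_apply, Nat.add_sub_cancel]
    rcases j with _ | j
    · simp
    · rw [Nat.add_sub_cancel]
      have e : ∀ v, (T ^ j) (T v) = (T ^ (j + 1)) v := fun v => by
        rw [pow_succ, Module.End.mul_apply]
      simp only [map_add, map_smul, e]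
      push_cast
      module

/-- The conjugation e^{-xL(-1)} L(1) e^{xL(-1)} = L(1) + 2x L(0) + x² L(-1). -/
theorem comp_expX_of_sl2 {T A B : W →ₗ[ℂ] W} (hA : ∀ w, A (T w) = T (A w) + T w)
    (hB : ∀ w, B (T w) = T (B w) + (2 : ℂ) • A w) {F : Series W} (hF : Trunc F) :
    B ∘ expX T F = expX T (B ∘ F) + (2 : ℂ) • mulX 1 (expX T (A ∘ F)) +
      mulX 2 (T ∘ expX T F) := by
  obtain ⟨K, hF⟩ := hF
  funext k
  obtain ⟨R, hR⟩ := exists_nat_gt k K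
  have hA' : ∀ k < K, (A ∘ F) k = 0 := fun k hk => by rw [Function.comp, hF _ hk, map_zero]
  have hB' : ∀ k < K, (B ∘ F) k = 0 := fun k hk => by rw [Function.comp, hF _ hk, map_zero]
  rw [Pi.add_apply, Pi.add_apply, Function.comp, mulX, Function.comp, Pi.smul_apply, mulX,
    expX_apply hF T (k := k - 2) (R := R) (by omega),
    expX_apply hF T (R := R + 2) (by push_cast; omega),
    expX_apply hA' T (R := R + 1) (by push_cast; omega),
    expX_apply hB' T (R := R + 2) (by push_cast; omega)]
  have h1 := sum_range_inv_factorial_smul (R + 1) fun j => (2 : ℂ) • (T ^ (j - 1)) (A (F (k - j)))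
  have h2 := sum_range_inv_factorial_smul (R + 1) fun j =>
    (j - 1 : ℂ) • (T ^ (j - 1)) (F (k - j))
  have h3 := sum_range_inv_factorial_smul R fun j => (T ^ j) (F (k - (j + 1 : ℕ)))
  simp only [Nat.cast_succ, add_sub_cancel_right, Nat.add_sub_cancel] at h1 h2 h3
  rw [h3] at h2
  have h4 : T (∑ j ∈ Finset.range R, ((j.factorial : ℂ)⁻¹) • (T ^ j) (F (k - 2 - j))) =
      ∑ j ∈ Finset.range R, ((j.factorial : ℂ)⁻¹) • (T ^ (j + 1)) (F (k - (j + 1 + 1))) := by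
    rw [map_sum]
    refine Finset.sum_congr rfl fun j _ => ?_
    rw [map_smul, pow_succ', Module.End.mul_apply]
    congr 4
    ring
  have h5 : (2 : ℂ) • ∑ j ∈ Finset.range (R + 1),
      ((j.factorial : ℂ)⁻¹) • (T ^ j) ((A ∘ F) (k - 1 - j)) =
      ∑ j ∈ Finset.range (R + 1), ((j.factorial : ℂ)⁻¹) • (2 : ℂ) •
        (T ^ j) (A (F (k - (j + 1)))) := by
    rw [Finset.smul_sum]
    refine Finset.sum_congr rfl fun j _ => ?_
    rw [smul_comm, Function.comp, sub_sub, add_comm (1 : ℤ)]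
  rw [h4, ← h2, h5, ← h1, ← Finset.sum_add_distrib, ← Finset.sum_add_distrib, map_sum]
  refine Finset.sum_congr rfl fun j _ => ?_
  rw [map_smul, comp_pow_of_sl2 hA hB, smul_add, smul_add, Function.comp]

theorem sum_antidiagonal_inv_factorial {n : ℕ} (hn : n ≠ 0) :
    ∑ p ∈ Finset.HasAntidiagonal.antidiagonal n,
      ((p.1.factorial : ℂ)⁻¹) * ((p.2.factorial : ℂ)⁻¹ * (-1) ^ p.2) = 0 := by
  have h := (Commute.all (1 : ℂ) (-1)).add_pow' n
  rw [add_neg_cancel, zero_pow hn] at h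
  have hne : (n.factorial : ℂ) ≠ 0 := Nat.cast_ne_zero.2 n.factorial_ne_zero
  refine (mul_right_inj' hne).1 ?_
  rw [mul_zero, h, Finset.mul_sum]
  refine Finset.sum_congr rfl fun p hp => ?_
  rw [Finset.HasAntidiagonal.mem_antidiagonal] at hp
  subst hp
  rw [one_pow, one_mul, nsmul_eq_mul, ← Nat.add_choose_mul_factorial_mul_factorial p.1 p.2]
  have h1 : (p.1.factorial : ℂ) ≠ 0 := Nat.cast_ne_zero.2 p.1.factorial_ne_zero
  have h2 : (p.2.factorial : ℂ) ≠ 0 := Nat.cast_ne_zero.2 p.2.factorial_ne_zero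
  push_cast
  field_simp
  exact_mod_cast Nat.choose_symm_add.symm

/-- F(x) ↦ e^{xT} F(-x) is an involution because e^{xT} e^{-xT} = 1; this is why the opposite of the
opposite is the original map. -/
theorem expX_negX_expX_negX (T : W →ₗ[ℂ] W) {F : Series W} (hF : Trunc F) :
    expX T (negX (expX T (negX F))) = F := by
  obtain ⟨K, hF⟩ := hF
  have h1 : ∀ k < K, negX F k = 0 := fun k hk => by rw [negX, hF _ hk, smul_zero]
  have h2 : ∀ k < K, negX (expX T (negX F)) k = 0 := fun k hk => by
    rw [negX, expX_apply_eq_zero h1 T hk, smul_zero]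
  funext k
  obtain ⟨R', hR'⟩ := exists_nat_gt k K
  obtain ⟨R, rfl, hR⟩ : ∃ R : ℕ, R = R' + 1 ∧ k - K < R := ⟨R' + 1, rfl, by push_cast; omega⟩
  rw [expX_apply h2 T hR]
  have h3 : ∀ i ∈ Finset.range (R' + 1), ((i.factorial : ℂ)⁻¹) •
      (T ^ i) (negX (expX T (negX F)) (k - i)) = ∑ j ∈ Finset.range (R' + 1),
        (((i.factorial : ℂ)⁻¹) * ((j.factorial : ℂ)⁻¹ * (-1) ^ j)) •
          (T ^ (i + j)) (F (k - (i + j : ℕ))) := by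
    intro i _
    rw [negX, expX_apply h1 T (R := R' + 1) (by omega), map_smul, map_sum, Finset.smul_sum,
      Finset.smul_sum]
    refine Finset.sum_congr rfl fun j _ => ?_
    have e : k - (i : ℤ) - j = k - (i + j : ℕ) := by push_cast; ring
    have e2 : (-1 : ℂ) ^ (k - (i : ℤ)) * (-1) ^ (k - (i + j : ℕ)) = (-1) ^ j := by
      rw [← e, zpow_sub₀ (by norm_num) (k - i), zpow_natCast]
      have h3 : (-1 : ℂ) ^ j * (-1) ^ j = 1 := by rw [← mul_pow]; norm_num
      have h4 : (-1 : ℂ) ^ (k - (i : ℤ)) * (-1) ^ (k - (i : ℤ)) = 1 := by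
        rw [← mul_zpow]; norm_num
      rw [mul_div_assoc', h4, one_div, inv_eq_of_mul_eq_one_left h3]
    rw [e, negX, map_smul, map_smul, map_smul, pow_add, Module.End.mul_apply, smul_smul, smul_smul,
      smul_smul, ← e2]
    congr 1
    ring
  rw [Finset.sum_congr rfl h3, ← sum_range_antidiagonal (R := R' + 1) (f := fun i j =>
    (((i.factorial : ℂ)⁻¹) * ((j.factorial : ℂ)⁻¹ * (-1) ^ j)) •
          (T ^ (i + j)) (F (k - (i + j : ℕ))))]
  · rw [Finset.sum_range_succ', Finset.sum_eq_zero, zero_add]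
    · simp
    · intro n _
      rw [Finset.sum_congr rfl fun p hp => by
        rw [Finset.HasAntidiagonal.mem_antidiagonal.1 hp], ← Finset.sum_smul,
        sum_antidiagonal_inv_factorial n.succ_ne_zero, zero_smul]
  · intro i j hij
    rw [hF _ (by omega), map_zero, smul_zero]

theorem negX_add (F G : Series W) : negX (F + G) = negX F + negX G := by
  funext k; simp [negX]

theorem negX_sub (F G : Series W) : negX (F - G) = negX F - negX G := by
  funext k; simp [negX, smul_sub]

theorem negX_smul (c : ℂ) (F : Series W) : negX (c • F) = c • negX F := by
  funext k
  exact smul_comm _ _ _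

theorem negX_comp (T : W →ₗ[ℂ] E) (F : Series W) : negX (T ∘ F) = T ∘ negX F := by
  funext k; simp only [negX, Function.comp, map_smul]

theorem neg_one_zpow_add_one (k : ℤ) : (-1 : ℂ) ^ (k + 1) = -(-1) ^ k := by
  rw [zpow_add₀ (by norm_num), zpow_one, mul_neg_one]

theorem neg_one_zpow_sub_one (k : ℤ) : (-1 : ℂ) ^ (k - 1) = -(-1) ^ k := by
  rw [← neg_eq_iff_eq_neg, ← neg_one_zpow_add_one, sub_add_cancel]

theorem ddx_negX (F : Series W) : ddx (negX F) = -negX (ddx F) := by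
  funext k
  simp only [negX, ddx, Pi.neg_apply, neg_one_zpow_add_one]
  module

theorem negX_mulX_one (F : Series W) : negX (mulX 1 F) = -mulX 1 (negX F) := by
  funext k
  simp only [negX, mulX, Pi.neg_apply, neg_one_zpow_sub_one]
  module

theorem negX_mulX_two (F : Series W) : negX (mulX 2 F) = mulX 2 (negX F) := by
  funext k
  have e : (-1 : ℂ) ^ (k - 2) = (-1) ^ k := by
    rw [show k - 2 = k - 1 - 1 by ring, neg_one_zpow_sub_one, neg_one_zpow_sub_one, neg_neg]
  simp only [negX, mulX, e]

theorem negX_single (w : W) : negX (Pi.single 0 w) = Pi.single 0 w := by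
  funext k
  rcases eq_or_ne k 0 with rfl | hk
  · simp [negX]
  · simp [negX, hk]

theorem mulX_add (p : ℤ) (F G : Series W) : mulX p (F + G) = mulX p F + mulX p G := rfl

theorem mulX_neg (p : ℤ) (F : Series W) : mulX p (-F) = -mulX p F := rfl

theorem mulX_sub (p : ℤ) (F G : Series W) : mulX p (F - G) = mulX p F - mulX p G := rfl

theorem mulX_mulX (p q : ℤ) (F : Series W) : mulX p (mulX q F) = mulX (p + q) F := by
  funext k
  simp only [mulX, sub_sub]

end ExpX

/-! ### The skew-symmetry opposite of a vertex operator map -/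

section Skew

variable {V W : Type*} [AddCommGroup V] [Module ℂ V] [AddCommGroup W] [Module ℂ W]

/-- The properties of a vertex operator map `V ⊗ W → W[[x, x⁻¹]]` which do not refer to gradings;
functionals are restricted to `S` and `T`. -/
structure IsLocalAction (𝓥 : VertexData V) (S : Submodule ℂ (Module.Dual ℂ V))
    (T : Submodule ℂ (Module.Dual ℂ W)) (Y : V → W → Series W) (D : W →ₗ[ℂ] W) : Prop where
  bilinear : IsBilinear Y
  trunc : ∀ u w, Trunc (Y u w)
  identity : ∀ w, Y 𝓥.vac w = Pi.single 0 w
  D_derivative : ∀ u w, ddx (Y u w) = Y (𝓥.D u) w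
  D_commutator : ∀ u w, ddx (Y u w) = D ∘ Y u w - Y u (D w)
  comp_D_mem : ∀ φ ∈ T, φ ∘ₗ D ∈ T
  comp_D_pow : ∀ φ ∈ T, ∃ J : ℕ, ∀ j ≥ J, ∀ w, φ ((D ^ j) w) = 0
  comp_right_mem : ∀ φ ∈ T, ∀ u k, φ ∘ₗ bilinear.right u k ∈ T
  comp_left_mem : ∀ φ ∈ T, ∀ w k, φ ∘ₗ bilinear.left w k ∈ S
  product_rational : ∀ φ ∈ T, ∀ (n : ℕ) (u : Fin n → V) (w : W),
    RationalSeries fun k : Fin n → ℤ => φ (prodCoeff Y u k w)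
  weakAssoc : ∀ φ ∈ T, ∀ (u₁ u₂ : V) (w : W),
    WeakAssoc (ser2 fun k l => φ (Y u₁ (Y u₂ w l) k)) (ser2 fun k l => φ (Y (𝓥.Y u₁ u₂ k) w l))

theorem lTrunc_product {A B C : Type*} [AddCommGroup B] [Module ℂ B] [AddCommGroup C]
    [Module ℂ C] {Y₁ : A → B → Series C} {F : Series B} (hY : ∀ a, Y₁ a 0 = 0)
    (hF : Trunc F) (φ : Module.Dual ℂ C) (a : A) :
    LTrunc 0 1 (ser2 fun k l => φ (Y₁ a (F l) k)) := by
  intro κ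
  obtain ⟨K, hK⟩ := hF
  refine ⟨(κ 1 - K + 1).toNat, fun n hn => ?_⟩
  simp only [ser2]
  rw [hK _ (by simp; omega), hY]
  exact map_zero φ

theorem IsBilinear.skewOpposite {V W : Type*} [AddCommGroup V] [Module ℂ V] [AddCommGroup W]
    [Module ℂ W] {Y : V → W → Series W} (hY : IsBilinear Y) (ht : ∀ u w, Trunc (Y u w))
    (D : W →ₗ[ℂ] W) : IsBilinear (MOSVA.skewOpposite D Y) := by
  refine ⟨fun u => ⟨fun w w' => ?_, fun c w => ?_⟩, fun w => ⟨fun u u' => ?_, fun c u => ?_⟩⟩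
  · simp only [MOSVA.skewOpposite, hY.add_right, negX_add, expX_add D (ht u w).negX (ht u w').negX]
  · simp only [MOSVA.skewOpposite, hY.smul_right, negX_smul, expX_smul D c (ht u w).negX]
  · simp only [MOSVA.skewOpposite, hY.add_left, negX_add, expX_add D (ht u w).negX (ht u' w).negX]
  · simp only [MOSVA.skewOpposite, hY.smul_left, negX_smul, expX_smul D c (ht u w).negX]

namespace IsLocalAction

variable {𝓥 : VertexData V} {S : Submodule ℂ (Module.Dual ℂ V)}
  {T : Submodule ℂ (Module.Dual ℂ W)} {Y : V → W → Series W} {D : W →ₗ[ℂ] W}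

theorem trunc_skew (h : IsLocalAction 𝓥 S T Y D) (w : W) (u : V) :
    Trunc (skewOpposite D Y w u) := (h.trunc u w).negX.expX D

theorem bilinear_skew (h : IsLocalAction 𝓥 S T Y D) : IsBilinear (skewOpposite D Y) :=
  h.bilinear.skewOpposite h.trunc D

/-- Passage to the skew opposite exchanges the two forms of the derivative property: the
D-commutator of Y gives the D-derivative of the opposite, and the D-derivative of Y gives its
D-commutator. -/
theorem ddx_skew (h : IsLocalAction 𝓥 S T Y D) (w : W) (u : V) :
    ddx (skewOpposite D Y w u) = skewOpposite D Y (D w) u := by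
  have h1 := (h.trunc u w).negX
  have h2 := (h.trunc u (D w)).negX
  simp only [skewOpposite]
  rw [ddx_expX D h1, ddx_negX, h.D_commutator, negX_sub, negX_comp, neg_sub,
    expX_sub D h2 (h1.comp D), expX_comp D h1]
  abel

theorem ddx_skew_eq_commutator (h : IsLocalAction 𝓥 S T Y D) (w : W) (u : V) :
    ddx (skewOpposite D Y w u) = D ∘ skewOpposite D Y w u - skewOpposite D Y w (𝓥.D u) := by
  have h1 := (h.trunc u w).negX
  have h2 := (h.trunc (𝓥.D u) w).negX
  simp only [skewOpposite]
  rw [ddx_expX D h1, ddx_negX, h.D_derivative, expX_neg D h2, sub_eq_add_neg]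

theorem skew_weight_commutator (h : IsLocalAction 𝓥 S T Y D) {A : W →ₗ[ℂ] W} {a : V → V}
    (hA : ∀ w, A (D w) = D (A w) + D w)
    (hY : ∀ u w, A ∘ Y u w - Y u (A w) = Y (a u) w + mulX 1 (Y (𝓥.D u) w)) (w : W) (u : V) :
    A ∘ skewOpposite D Y w u - skewOpposite D Y w (a u) =
      skewOpposite D Y (A w) u + mulX 1 (skewOpposite D Y (D w) u) := by
  have h1 := (h.trunc u w).negX
  have h2 := (h.trunc u (A w)).negX
  have h3 := (h.trunc (a u) w).negX
  have h4 := (h.trunc (𝓥.D u) w).negX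
  have h5 := h.ddx_skew w u
  rw [h.ddx_skew_eq_commutator] at h5
  rw [← h5]
  simp only [skewOpposite]
  rw [comp_expX_of_weight_one hA h1, ← negX_comp, sub_eq_iff_eq_add.1 (hY u w), negX_add, negX_add,
    negX_mulX_one, expX_add D (h3.add (h4.mulX 1).neg) h2, expX_add D h3 (h4.mulX 1).neg,
    expX_neg D (h4.mulX 1), expX_mulX, mulX_sub]
  abel

/-- Conjugation of L(1) by e^{xD} produces terms in x L(0) and x² L(-1), while x ↦ -x reverses the
sign of the x-term in the bracket for Y. The terms combine once Y^R(Dw, x) is rewritten by the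
D-commutator. -/
theorem skew_sl2_commutator (h : IsLocalAction 𝓥 S T Y D) {A B : W →ₗ[ℂ] W} {a b : V → V}
    (hA : ∀ w, A (D w) = D (A w) + D w) (hB : ∀ w, B (D w) = D (B w) + (2 : ℂ) • A w)
    (hYA : ∀ u w, A ∘ Y u w - Y u (A w) = Y (a u) w + mulX 1 (Y (𝓥.D u) w))
    (hYB : ∀ u w, B ∘ Y u w - Y u (B w) =
      Y (b u) w + (2 : ℂ) • mulX 1 (Y (a u) w) + mulX 2 (Y (𝓥.D u) w)) (w : W) (u : V) :
    B ∘ skewOpposite D Y w u - skewOpposite D Y w (b u) =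
      skewOpposite D Y (B w) u + (2 : ℂ) • mulX 1 (skewOpposite D Y (A w) u) +
        mulX 2 (skewOpposite D Y (D w) u) := by
  have h1 := (h.trunc u w).negX
  have h2 := (h.trunc u (A w)).negX
  have h3 := (h.trunc (a u) w).negX
  have h4 := (h.trunc (𝓥.D u) w).negX
  have h6 := (h.trunc u (B w)).negX
  have h7 := (h.trunc (b u) w).negX
  have h5 := h.ddx_skew w u
  rw [h.ddx_skew_eq_commutator] at h5
  rw [← h5]
  simp only [skewOpposite]
  have h8 := (h3.mulX 1).neg.smul (2 : ℂ)
  rw [comp_expX_of_sl2 hA hB h1, ← negX_comp, ← negX_comp, sub_eq_iff_eq_add.1 (hYA u w),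
    sub_eq_iff_eq_add.1 (hYB u w)]
  simp only [negX_add, negX_smul, negX_mulX_one, negX_mulX_two]
  rw [expX_add D ((h7.add h8).add (h4.mulX 2)) h6, expX_add D (h7.add h8) (h4.mulX 2),
    expX_add D h7 h8, expX_smul D _ (h3.mulX 1).neg, expX_neg D (h3.mulX 1),
    expX_add D (h3.add (h4.mulX 1).neg) h2, expX_add D h3 (h4.mulX 1).neg,
    expX_neg D (h4.mulX 1)]
  simp only [expX_mulX, mulX_sub, mulX_add, mulX_neg, mulX_mulX]
  norm_num
  module

theorem skew_vac (h : IsLocalAction 𝓥 S T Y D) (w : W) :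
    skewOpposite D Y w 𝓥.vac = expX D (Pi.single 0 w) := by
  rw [skewOpposite, h.identity, negX_single]

theorem creation_skew (h : IsLocalAction 𝓥 S T Y D) (w : W) :
    (∀ k < 0, skewOpposite D Y w 𝓥.vac k = 0) ∧ skewOpposite D Y w 𝓥.vac 0 = w := by
  rw [h.skew_vac]
  refine ⟨fun k hk => expX_single_of_neg D w hk, ?_⟩
  simpa using expX_single D w 0

end IsLocalAction

/-! ### The opposite of an algebra -/

theorem IsMOSVA.op_D {𝓥 : VertexData V} (h : IsMOSVA 𝓥) : 𝓥.op.D = 𝓥.D := by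
  funext v
  rw [VertexData.D, VertexData.op]
  simp only [skewOpposite, ddx, h.identity, negX_single]
  have h1 : expX 𝓥.D (Pi.single 0 v) (1 : ℤ) = 𝓥.D v := by
    refine (expX_single h.DLin v 1).trans ?_
    simp
  simpa using h1

theorem IsMOSVA.op_op {𝓥 : VertexData V} (h : IsMOSVA 𝓥) : 𝓥.op.op = 𝓥 := by
  have hY : 𝓥.op.op.Y = 𝓥.Y := by
    funext u v
    change expX 𝓥.op.D (negX (expX 𝓥.D (negX (𝓥.Y u v)))) = _
    rw [h.op_D]
    exact expX_negX_expX_negX h.DLin (h.isGradedAction.trunc u v)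
  cases 𝓥
  simp only [VertexData.op] at hY ⊢
  rw [hY]

/-- The operator `D_V` determines `Y_V(v, x) 𝟏 = e ^ (x D_V) v`. -/
theorem IsMOSVA.Y_vac {𝓥 : VertexData V} (h : IsMOSVA 𝓥) (v : V) :
    𝓥.Y v 𝓥.vac = expX 𝓥.D (Pi.single 0 v) := by
  have hc : ∀ n : ℕ, 𝓥.Y v 𝓥.vac n = ((n.factorial : ℂ)⁻¹) • (h.DLin ^ n) v := by
    intro n
    induction n generalizing v with
    | zero => simpa using (h.creation v).2
    | succ n ih =>
      have h1 := congrFun (h.D_derivative v 𝓥.vac) n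
      rw [ih, ddx] at h1
      rw [pow_succ, Module.End.mul_apply, Nat.factorial_succ, Nat.cast_mul, mul_inv, mul_smul,
        h.DLin_apply, ← h1, smul_smul]
      push_cast
      rw [inv_mul_cancel₀ (Nat.cast_add_one_ne_zero n), one_smul]
  funext k
  rcases lt_or_ge k 0 with hk | hk
  · rw [(h.creation v).1 k hk]
    exact (expX_single_of_neg h.DLin v hk).symm
  · lift k to ℕ using hk
    rw [hc]
    exact (expX_single h.DLin v k).symm

end Skew

/-! ### Weak commutativity and weak associativity of the opposite -/

section SignChanges

/-- The substitution `x₁ ↦ -x₁`. -/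
def negOne (F : MSeries (Fin 2)) : MSeries (Fin 2) := fun κ => (-1 : ℂ) ^ κ 1 * F κ

theorem negOne_act (N : ℕ) (F : MSeries (Fin 2)) :
    negOne (act ((X 0 + X 1) ^ N) F) = act ((X 0 - X 1) ^ N) (negOne F) := by
  have := act_intertwine (P := fun _ : MSeries (Fin 2) => True) (fun _ _ _ _ => trivial)
    (fun _ _ _ => trivial) (fun _ _ _ => trivial) negOne
    (fun F G _ _ => by funext κ; simp only [negOne, Pi.add_apply, mul_add])
    (fun c F _ => by
      funext κ
      simp only [negOne, Pi.smul_apply, smul_eq_mul]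
      ring)
    (aeval ![X 0, -X 1]) ?_ ((X 0 + X 1) ^ N) (F := F) trivial
  · rw [this]
    simp [sub_eq_add_neg]
  · intro i F _
    funext κ
    fin_cases i
    · simp [negOne, act_X_apply]
    · simp [negOne, act_X_apply, neg_one_zpow_sub_one]

/-- The substitution `x₀ ↦ -x₁`, `x₁ ↦ -x₀`. -/
def negSwap (F : MSeries (Fin 2)) : MSeries (Fin 2) :=
  fun κ => (-1 : ℂ) ^ (κ 0 + κ 1) * F ![κ 1, κ 0]

theorem vec_two_sub_single_zero (m n : ℤ) (k : ℤ) :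
    (![m, n] : Fin 2 → ℤ) - Pi.single 0 k = ![m - k, n] := by
  funext i
  fin_cases i <;> simp

theorem vec_two_sub_single_one (m n : ℤ) (k : ℤ) :
    (![m, n] : Fin 2 → ℤ) - Pi.single 1 k = ![m, n - k] := by
  funext i
  fin_cases i <;> simp

theorem negSwap_add (F G : MSeries (Fin 2)) : negSwap (F + G) = negSwap F + negSwap G := by
  funext κ
  simp only [negSwap, Pi.add_apply, mul_add]

theorem negSwap_smul (c : ℂ) (F : MSeries (Fin 2)) : negSwap (c • F) = c • negSwap F := by
  funext κ
  simp only [negSwap, Pi.smul_apply, smul_eq_mul]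
  ring

theorem negSwap_sub (F G : MSeries (Fin 2)) : negSwap (F - G) = negSwap F - negSwap G := by
  funext κ
  simp only [negSwap, Pi.sub_apply, mul_sub]

/-- Negating and exchanging the variables preserves X 0 + X 1 up to sign. -/
theorem act_add_pow_negSwap {N : ℕ} {F : MSeries (Fin 2)} (h : act ((X 0 + X 1) ^ N) F = 0) :
    act ((X 0 + X 1) ^ N) (negSwap F) = 0 := by
  have := act_intertwine (P := fun _ : MSeries (Fin 2) => True) (fun _ _ _ _ => trivial)
    (fun _ _ _ => trivial) (fun _ _ _ => trivial) negSwap (fun F G _ _ => negSwap_add F G)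
    (fun c F _ => negSwap_smul c F)
    (aeval ![-X 1, -X 0]) ?_ ((X 0 + X 1) ^ N) (F := F) trivial
  · rw [h] at this
    have e : (aeval ![-X 1, -X 0] ((X 0 + X 1) ^ N : MvPolynomial (Fin 2) ℂ) :
        MvPolynomial (Fin 2) ℂ) = (-1) ^ N * (X 0 + X 1) ^ N := by
      simp only [map_pow, map_add, aeval_X, Matrix.cons_val_zero, Matrix.cons_val_one]
      rw [← mul_pow]
      ring
    have h0 : negSwap 0 = 0 := by
      funext κ
      simp [negSwap]
    have h1 := congrArg (act ((-1 : MvPolynomial (Fin 2) ℂ) ^ N)) this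
    rw [h0, map_zero, e, ← act_mul_apply, ← mul_assoc, ← mul_pow] at h1
    simpa using h1.symm
  · intro i F _
    rw [aeval_X]
    funext κ
    fin_cases i
    · change (-1 : ℂ) ^ (κ 0 + κ 1) * act (X 0) F ![κ 1, κ 0] = act (-X 1) (negSwap F) κ
      rw [act_neg_apply, Pi.neg_apply, act_X_apply, act_X_apply, vec_two_sub_single_zero]
      simp [negSwap, ← add_sub_assoc, neg_one_zpow_sub_one]
    · change (-1 : ℂ) ^ (κ 0 + κ 1) * act (X 1) F ![κ 1, κ 0] = act (-X 0) (negSwap F) κ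
      rw [act_neg_apply, Pi.neg_apply, act_X_apply, act_X_apply, vec_two_sub_single_one]
      simp [negSwap, sub_add_eq_add_sub, neg_one_zpow_sub_one]

theorem act_add_pow_apply (n : ℕ) (F : MSeries (Fin 2)) (k l : ℤ) :
    act ((X 0 + X 1) ^ n) F ![k, l] = ∑ p ∈ Finset.HasAntidiagonal.antidiagonal n,
      (n.choose p.1 : ℂ) * F ![k - p.2, l - p.1] := by
  rw [add_comm (X 0 : MvPolynomial (Fin 2) ℂ),
    (Commute.all (X 1 : MvPolynomial (Fin 2) ℂ) (X 0)).add_pow', map_sum, LinearMap.sum_apply,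
    Finset.sum_apply]
  refine Finset.sum_congr rfl fun p _ => ?_
  rw [map_nsmul, LinearMap.smul_apply, act_mul_apply, Pi.smul_apply, act_X_pow_apply,
    act_X_pow_apply, vec_two_sub_single_one, vec_two_sub_single_zero, nsmul_eq_mul]

theorem substSum_sum {ι : Type*} (s : Finset ι) {F : ι → MSeries (Fin 2)} (c : ℂ)
    (hF : ∀ i ∈ s, LTrunc 0 1 (F i)) :
    substSum c (∑ i ∈ s, F i) = ∑ i ∈ s, substSum c (F i) := by
  classical
  induction s using Finset.induction_on with
  | empty => simpa using substSum_smul (c := c) 0 (0 : MSeries (Fin 2))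
  | insert i s hi ih =>
    rw [Finset.sum_insert hi, Finset.sum_insert hi, substSum_add (hF i (Finset.mem_insert_self _ _))
      (LTrunc.sum s fun j hj => hF j (Finset.mem_insert_of_mem hj)),
      ih fun j hj => hF j (Finset.mem_insert_of_mem hj)]

theorem exists_forall_act_eq_zero {p : MvPolynomial (Fin 2) ℂ} {H : ℕ → MSeries (Fin 2)}
    (h : ∀ s, ∃ N : ℕ, act (p ^ N) (H s) = 0) (J : ℕ) :
    ∃ N : ℕ, ∀ s < J, act (p ^ N) (H s) = 0 := by
  choose N hN using h
  exact ⟨∑ s ∈ Finset.range J, N s, fun s hs => exists_act_eq_zero_of_le (hN s)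
    (Finset.single_le_sum (fun _ _ => Nat.zero_le _) (Finset.mem_range.2 hs))⟩

theorem succ_mul_choose (m : ℤ) (i : ℕ) :
    ((i + 1 : ℕ) : ℂ) * ((Ring.choose (m + 1) (i + 1) : ℤ) : ℂ) =
      ((m + 1 : ℤ) : ℂ) * ((Ring.choose m i : ℤ) : ℂ) := by
  have h := Ring.choose_smul_choose (m + 1) (Nat.le_add_left 1 i)
  rw [Ring.choose_one_right, Nat.choose_one_right, nsmul_eq_mul, Nat.add_sub_cancel, Nat.cast_one,
    add_sub_cancel_right] at h
  exact_mod_cast congrArg (Int.cast : ℤ → ℂ) h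

/-- Taylor's formula Z(e^{yE} u, x) = Z(u, x + y), coefficient by coefficient. -/
theorem inv_factorial_smul_derivative {V W : Type*} [AddCommGroup V] [Module ℂ V]
    [AddCommGroup W] [Module ℂ W] {Z : V → Series W} {E : V →ₗ[ℂ] V}
    (hZ : ∀ u p, Z (E u) p = ((p + 1 : ℤ) : ℂ) • Z u (p + 1)) (u : V) (p : ℤ) (j : ℕ) :
    ((j.factorial : ℂ)⁻¹) • Z ((E ^ j) u) p =
      ((Ring.choose (p + j) j : ℤ) : ℂ) • Z u (p + j) := by
  induction j generalizing u with
  | zero => simp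
  | succ j ih =>
    have hj : (j + 1 : ℂ) ≠ 0 := Nat.cast_add_one_ne_zero j
    refine (smul_right_inj hj).1 ?_
    rw [Nat.factorial_succ, smul_smul, pow_succ, Module.End.mul_apply]
    push_cast
    rw [mul_inv, mul_inv_cancel_left₀ hj, ih, hZ]
    have e : p + ((j : ℤ) + 1) = p + j + 1 := by ring
    rw [e, smul_smul, smul_smul]
    congr 1
    have hc := succ_mul_choose (p + j) j
    push_cast at hc ⊢
    linear_combination -hc

theorem ser2_vec (a : ℤ → ℤ → ℂ) (k l : ℤ) : ser2 a ![k, l] = a k l := rfl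

theorem vec_eta (κ : Fin 2 → ℤ) : κ = ![κ 0, κ 1] := by
  funext i
  fin_cases i <;> rfl

theorem substSum_vec {c : ℂ} {F : MSeries (Fin 2)} {k l : ℤ} {I : ℕ}
    (h : ∀ n : ℕ, I ≤ n → F ![k + n, l - n] = 0) :
    substSum c F ![k, l] = ∑ i ∈ Finset.range I,
      ((Ring.choose (k + i) i : ℤ) : ℂ) * c ^ i * F ![k + i, l - i] := by
  have e : ∀ n : ℕ, (![k, l] + (Pi.single 0 (n : ℤ) - Pi.single 1 (n : ℤ)) : Fin 2 → ℤ) =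
      ![k + n, l - n] := by
    intro n
    funext i
    fin_cases i
    · simp
    · simp [sub_eq_add_neg]
  rw [substSum_eq_sum (I := I) fun n hn => by rw [e]; exact h n hn]
  exact Finset.sum_congr rfl fun i _ => by rw [e]; rfl

end SignChanges

/-! ### Left and right vertex operators in one product -/

section WeakCommutativity

variable {V W : Type*} [AddCommGroup V] [Module ℂ V] [AddCommGroup W] [Module ℂ W]

/-- The series `⟨φ, Y(a, x₀) Y(b, x₁) w⟩`. -/
def prodSeries (Y : V → W → Series W) (φ : Module.Dual ℂ W) (a b : V) (w : W) :
    MSeries (Fin 2) := ser2 fun k l => φ (Y a (Y b w l) k)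

/-- The series `⟨φ, Y(Y_V(a, x₀) b, x₁) w⟩`. -/
def iterSeries (𝓥 : VertexData V) (Y : V → W → Series W) (φ : Module.Dual ℂ W) (a b : V) (w : W) :
    MSeries (Fin 2) := ser2 fun k l => φ (Y (𝓥.Y a b k) w l)

namespace IsLocalAction

variable {𝓥 : VertexData V} {S : Submodule ℂ (Module.Dual ℂ V)}
  {T : Submodule ℂ (Module.Dual ℂ W)} {Y : V → W → Series W} {D : W →ₗ[ℂ] W}

theorem Y_D_apply (h : IsLocalAction 𝓥 S T Y D) (u : V) (w : W) (p : ℤ) :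
    Y u (D w) p = D (Y u w p) - ((p + 1 : ℤ) : ℂ) • Y u w (p + 1) := by
  have := congrFun (h.D_commutator u w) p
  rw [ddx, Pi.sub_apply, Function.comp] at this
  rw [this]
  abel

/-- The coefficients of Y(u, x) e^{yD} w = e^{yD} Y(u, x - y) w. -/
theorem Y_D_pow_apply (h : IsLocalAction 𝓥 S T Y D) (u : V) (w : W) (p : ℤ) (j : ℕ) :
    ((j.factorial : ℂ)⁻¹) • Y u ((D ^ j) w) p =
      ∑ x ∈ Finset.HasAntidiagonal.antidiagonal j, ((x.1.factorial : ℂ)⁻¹ * ((-1) ^ x.2 *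
        ((Ring.choose (p + x.2) x.2 : ℤ) : ℂ))) • (D ^ x.1) (Y u w (p + x.2)) := by
  induction j generalizing w with
  | zero => simp
  | succ j ih =>
    have hj : (j + 1 : ℂ) ≠ 0 := Nat.cast_add_one_ne_zero j
    refine (smul_right_inj hj).1 ?_
    rw [Nat.factorial_succ, smul_smul, pow_succ, Module.End.mul_apply]
    push_cast
    rw [mul_inv, mul_inv_cancel_left₀ hj, ih, Finset.smul_sum]
    have hsplit : ∀ x ∈ Finset.HasAntidiagonal.antidiagonal (j + 1),
        (j + 1 : ℂ) • (((x.1.factorial : ℂ)⁻¹ * ((-1) ^ x.2 *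
          ((Ring.choose (p + x.2) x.2 : ℤ) : ℂ))) • (D ^ x.1) (Y u w (p + x.2))) =
        ((x.1 : ℂ) * ((x.1.factorial : ℂ)⁻¹ * ((-1) ^ x.2 *
          ((Ring.choose (p + x.2) x.2 : ℤ) : ℂ)))) • (D ^ x.1) (Y u w (p + x.2)) +
        ((x.2 : ℂ) * ((x.1.factorial : ℂ)⁻¹ * ((-1) ^ x.2 *
          ((Ring.choose (p + x.2) x.2 : ℤ) : ℂ)))) • (D ^ x.1) (Y u w (p + x.2)) := by
      intro x hx
      have hx' : ((x.1 : ℂ) + x.2) = j + 1 := by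
        exact_mod_cast Finset.HasAntidiagonal.mem_antidiagonal.1 hx
      rw [← hx', smul_smul, ← add_smul, add_mul]
    rw [Finset.sum_congr rfl hsplit, Finset.sum_add_distrib, Finset.Nat.sum_antidiagonal_succ,
      Finset.Nat.sum_antidiagonal_succ']
    simp only [Nat.cast_zero, zero_mul, zero_smul, zero_add, ← Finset.sum_add_distrib]
    refine Finset.sum_congr rfl fun x _ => ?_
    rw [h.Y_D_apply, map_sub, map_smul, smul_sub, sub_eq_add_neg]
    congr 1
    · rw [← Module.End.mul_apply, ← pow_succ, Nat.factorial_succ, Nat.cast_mul, mul_inv,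
        ← mul_assoc ((x.1 + 1 : ℕ) : ℂ), ← mul_assoc ((x.1 + 1 : ℕ) : ℂ),
        mul_inv_cancel₀ (Nat.cast_ne_zero.2 x.1.succ_ne_zero), one_mul]
    · have e : p + ((x.2 + 1 : ℕ) : ℤ) = p + x.2 + 1 := by push_cast; ring
      rw [e, smul_smul, ← neg_smul]
      congr 1
      have hc := succ_mul_choose (p + x.2) x.2
      rw [pow_succ]
      linear_combination (x.1.factorial : ℂ)⁻¹ * (-1) ^ x.2 * hc

theorem Y_derivative_pow_apply (h : IsLocalAction 𝓥 S T Y D) (E : V →ₗ[ℂ] V)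
    (hE : ∀ v, E v = 𝓥.D v) (u : V) (w : W) (p : ℤ) (j : ℕ) :
    ((j.factorial : ℂ)⁻¹) • Y ((E ^ j) u) w p =
      ((Ring.choose (p + j) j : ℤ) : ℂ) • Y u w (p + j) :=
  inv_factorial_smul_derivative (Z := fun u => Y u w) (fun u p => by rw [hE, ← h.D_derivative]; rfl)
    u p j

/-- `⟨φ, Y(a, x₀) Y^R(w, x₁) b⟩` in terms of the products of left vertex operators. -/
theorem apply_Y_skew (h : IsLocalAction 𝓥 S T Y D) {φ : Module.Dual ℂ W} {J : ℕ}
    (hJ : ∀ j ≥ J, ∀ w, φ ((D ^ j) w) = 0) (a b : V) (w : W) (p q : ℤ) :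
    φ (Y a (skewOpposite D Y w b q) p) = ∑ s ∈ Finset.range J, (s.factorial : ℂ)⁻¹ *
      ((-1) ^ (q - s) * substSum 1 (prodSeries Y (φ ∘ₗ D ^ s) a b w) ![p, q - s]) := by
  obtain ⟨K, hK⟩ := h.trunc b w
  have hK' : ∀ k < K, negX (Y b w) k = 0 := fun k hk => by rw [negX, hK k hk, smul_zero]
  obtain ⟨R₀, hR₀⟩ := exists_nat_gt q K
  obtain ⟨R, hJR, hR⟩ : ∃ R : ℕ, J ≤ R ∧ q - K < R := ⟨R₀ + J, by omega, by omega⟩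
  have h0 : ∀ i : ℕ, R ≤ i → ∀ a k, Y a (Y b w (q - i)) k = 0 := fun i hi a k => by
    rw [hK _ (by omega), h.bilinear.zero_right]
    rfl
  have h1 : ∀ s i : ℕ, R ≤ s + i → (s.factorial : ℂ)⁻¹ * ((-1) ^ (q - s) *
      (((Ring.choose (p + i) i : ℤ) : ℂ) * 1 ^ i *
        φ ((D ^ s) (Y a (Y b w (q - s - i)) (p + i))))) = 0 := by
    intro s i hi
    have := h0 (s + i) hi a (p + i)
    rw [Nat.cast_add, ← sub_sub] at this
    rw [this]
    simp
  have h2 : ∀ s : ℕ, substSum 1 (prodSeries Y (φ ∘ₗ D ^ s) a b w) ![p, q - s] =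
      ∑ i ∈ Finset.range R, ((Ring.choose (p + i) i : ℤ) : ℂ) * 1 ^ i *
        φ ((D ^ s) (Y a (Y b w (q - s - i)) (p + i))) := by
    intro s
    refine substSum_vec fun n hn => ?_
    rw [prodSeries, ser2_vec, LinearMap.comp_apply, hK _ (by omega), h.bilinear.zero_right]
    simp
  -- The computation is Y(a, x₀) e^{x₁D} Y(b, -x₁) w = e^{x₁D} Y(a, x₀ - x₁) Y(b, -x₁) w. The range
  -- is enlarged to `R`, where the exponential before `φ` is also a finite sum, and the added terms
  -- vanish.
  rw [Finset.sum_subset (Finset.range_subset_range.2 hJR)]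
  · simp only [h2, Finset.mul_sum]
    rw [← sum_range_antidiagonal h1, skewOpposite, expX_apply hK' D hR, ← h.bilinear.right_apply,
      map_sum, map_sum]
    refine Finset.sum_congr rfl fun j _ => ?_
    rw [h.bilinear.right_apply, negX, map_smul, smul_comm, h.bilinear.smul_right, Pi.smul_apply,
      h.bilinear.smul_right, Pi.smul_apply, h.Y_D_pow_apply, map_smul, map_sum, Finset.smul_sum]
    refine Finset.sum_congr rfl fun x hx => ?_
    have hx' : x.1 + x.2 = j := Finset.HasAntidiagonal.mem_antidiagonal.1 hx
    subst hx'
    have e : q - ((x.1 + x.2 : ℕ) : ℤ) = q - x.1 - x.2 := by push_cast; ring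
    have e2 : (-1 : ℂ) ^ (q - (x.1 : ℤ) - x.2) * (-1) ^ x.2 = (-1) ^ (q - (x.1 : ℤ)) := by
      rw [← zpow_natCast, ← zpow_add₀ (by norm_num), sub_add_cancel]
    rw [e, map_smul, smul_eq_mul, smul_eq_mul, ← e2]
    ring
  · intro s _ hs
    rw [Finset.mem_range, not_lt] at hs
    rw [h2, Finset.sum_eq_zero fun i _ => by rw [hJ s hs, mul_zero]]
    simp

end IsLocalAction

end WeakCommutativity

/-! ### Weak commutativity and weak associativity for right vertex operators -/

section Opposite

variable {V W : Type*} [AddCommGroup V] [Module ℂ V] [AddCommGroup W] [Module ℂ W]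

namespace IsLocalAction

variable {𝓥 : VertexData V} {S : Submodule ℂ (Module.Dual ℂ V)}
  {T : Submodule ℂ (Module.Dual ℂ W)} {Y : V → W → Series W} {D : W →ₗ[ℂ] W}

theorem comp_D_pow_mem (h : IsLocalAction 𝓥 S T Y D) {φ : Module.Dual ℂ W} (hφ : φ ∈ T) (s : ℕ) :
    φ ∘ₗ (D ^ s) ∈ T := by
  induction s with
  | zero => simpa [Module.End.one_eq_id] using hφ
  | succ s ih => simpa [pow_succ, Module.End.mul_eq_comp, LinearMap.comp_assoc] using h.comp_D_mem _ ih

theorem apply_skew (h : IsLocalAction 𝓥 S T Y D) {φ : Module.Dual ℂ W} {J : ℕ}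
    (hJ : ∀ j ≥ J, ∀ w, φ ((D ^ j) w) = 0) (w : W) (u : V) (q : ℤ) :
    φ (skewOpposite D Y w u q) = ∑ s ∈ Finset.range J, (s.factorial : ℂ)⁻¹ *
      ((-1) ^ (q - s) * φ ((D ^ s) (Y u w (q - s)))) := by
  obtain ⟨K, hK⟩ := (h.trunc u w).negX
  obtain ⟨R₀, hR₀⟩ := exists_nat_gt q K
  obtain ⟨R, hJR, hR⟩ : ∃ R : ℕ, J ≤ R ∧ q - K < R := ⟨R₀ + J, by omega, by omega⟩
  rw [Finset.sum_subset (Finset.range_subset_range.2 hJR), skewOpposite, expX_apply hK D hR,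
    map_sum]
  · refine Finset.sum_congr rfl fun s _ => ?_
    rw [negX, map_smul, map_smul, map_smul, smul_eq_mul, smul_eq_mul]
  · intro s _ hs
    rw [Finset.mem_range, not_lt] at hs
    rw [hJ s hs, mul_zero, mul_zero]

/-- Weak commutativity of left and right vertex operators. -/
theorem weakComm (h : IsLocalAction 𝓥 S T Y D) {φ : Module.Dual ℂ W} (hφ : φ ∈ T) (a b : V)
    (w : W) : ∃ N : ℕ, act ((X 0 - X 1) ^ N)
      (ser2 (fun p q => φ (Y a (skewOpposite D Y w b q) p)) -
        ser2 (fun p q => φ (skewOpposite D Y w (𝓥.Y a b p) q))) = 0 := by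
  obtain ⟨J, hJ⟩ := h.comp_D_pow φ hφ
  -- Only finitely many functionals φ ∘ D^s are nonzero, so one exponent serves all of them.
  obtain ⟨N, hN⟩ := exists_forall_act_eq_zero
    (fun s => h.weakAssoc _ (h.comp_D_pow_mem hφ s) a b w) J
  refine ⟨N, ?_⟩
  -- Both orders carry the same factor e^{x₁D} on the outside. Their difference is therefore built
  -- from the defects of weak associativity at x₁ ↦ -x₁, which turns X 0 + X 1 into X 0 - X 1.
  have e : ser2 (fun p q => φ (Y a (skewOpposite D Y w b q) p)) -
      ser2 (fun p q => φ (skewOpposite D Y w (𝓥.Y a b p) q)) =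
      ∑ s ∈ Finset.range J, (s.factorial : ℂ)⁻¹ • act (X 1 ^ s)
        (negOne (substSum 1 (prodSeries Y (φ ∘ₗ D ^ s) a b w) -
          iterSeries 𝓥 Y (φ ∘ₗ D ^ s) a b w)) := by
    funext κ
    rw [vec_eta κ, Finset.sum_apply, Pi.sub_apply, ser2_vec, ser2_vec, h.apply_Y_skew hJ,
      h.apply_skew hJ, ← Finset.sum_sub_distrib]
    refine Finset.sum_congr rfl fun s _ => ?_
    rw [Pi.smul_apply, act_X_pow_apply, vec_two_sub_single_one, negOne, Pi.sub_apply, iterSeries,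
      ser2_vec, smul_eq_mul, LinearMap.comp_apply, mul_sub, mul_sub]
    rfl
  rw [e, map_sum]
  refine Finset.sum_eq_zero fun s hs => ?_
  rw [map_smul, act_comm, ← negOne_act]
  have := hN s (Finset.mem_range.1 hs)
  have h0 : negOne 0 = 0 := by
    funext κ
    simp [negOne]
  change act ((X 0 + X 1) ^ N) (substSum 1 (prodSeries Y (φ ∘ₗ D ^ s) a b w) -
          iterSeries 𝓥 Y (φ ∘ₗ D ^ s) a b w) = 0 at this
  rw [this, h0, map_zero, smul_zero]

theorem lTrunc_negSwap_iterSeries (h : IsLocalAction 𝓥 S T Y D)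
    (ht : ∀ u v, Trunc (𝓥.Y u v)) (φ : Module.Dual ℂ W) (a b : V) (w : W) :
    LTrunc 0 1 (negSwap (iterSeries 𝓥 Y φ a b w)) := by
  intro κ
  obtain ⟨K, hK⟩ := ht a b
  refine ⟨(κ 1 - K + 1).toNat, fun n hn => ?_⟩
  rw [negSwap, iterSeries, ser2_vec, hK _ (by simp; omega), h.bilinear.zero_left]
  simp

/-- The product `⟨φ, Y^R(w, x₀) Y^s(a, x₁) b⟩` in terms of iterates of left vertex operators. -/
theorem skew_prodSeries_eq (h : IsLocalAction 𝓥 S T Y D) {E : V →ₗ[ℂ] V} (hE : ∀ v, E v = 𝓥.D v)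
    (ht : ∀ u v, Trunc (𝓥.Y u v)) {φ : Module.Dual ℂ W} {J : ℕ}
    (hJ : ∀ j ≥ J, ∀ w, φ ((D ^ j) w) = 0) (w : W) (a b : V) :
    (ser2 fun k l => φ (skewOpposite D Y w (skewOpposite 𝓥.D 𝓥.Y a b l) k)) =
      ∑ s ∈ Finset.range J, (s.factorial : ℂ)⁻¹ • act (X 0 ^ s)
        (substSum (-1) (negSwap (iterSeries 𝓥 Y (φ ∘ₗ D ^ s) b a w))) := by
  have hE' : 𝓥.D = E := (funext hE).symm
  funext κ
  rw [vec_eta κ, Finset.sum_apply, ser2_vec, h.apply_skew hJ]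
  refine Finset.sum_congr rfl fun s _ => ?_
  rw [Pi.smul_apply, act_X_pow_apply, vec_two_sub_single_zero, smul_eq_mul]
  congr 1
  obtain ⟨K, hK⟩ := ht b a
  have hK' : ∀ k < K, negX (𝓥.Y b a) k = 0 := fun k hk => by rw [negX, hK k hk, smul_zero]
  obtain ⟨R, hR⟩ := exists_nat_gt (κ 1) K
  rw [substSum_vec (I := R), skewOpposite, hE', expX_apply hK' E hR, ← h.bilinear.left_apply,
    map_sum, map_sum, map_sum, Finset.mul_sum]
  · refine Finset.sum_congr rfl fun j _ => ?_
    rw [map_smul, h.bilinear.left_apply, h.Y_derivative_pow_apply E hE, negX, h.bilinear.smul_left,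
      Pi.smul_apply, negSwap, iterSeries, ser2_vec, LinearMap.comp_apply, map_smul, map_smul,
      map_smul, map_smul, smul_eq_mul, smul_eq_mul]
    have e : (-1 : ℂ) ^ (κ 0 - s) * (-1) ^ (κ 1 - j) =
        (-1) ^ j * (-1) ^ (κ 0 - s + j + (κ 1 - j)) := by
      have h1 : (-1 : ℂ) ^ (j : ℤ) * (-1) ^ (j : ℤ) = 1 := by rw [← mul_zpow]; norm_num
      rw [← zpow_natCast, zpow_add₀ (by norm_num), zpow_add₀ (by norm_num)]
      linear_combination (-(-1 : ℂ) ^ (κ 0 - s) * (-1) ^ (κ 1 - j)) * h1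
    change _ = _ * ((-1 : ℂ) ^ (κ 0 - s + j + (κ 1 - j)) * φ ((D ^ s) (Y (𝓥.Y b a (κ 1 - j)) w (κ 0 - s + j))))
    linear_combination (((Ring.choose (κ 0 - s + j) j : ℤ) : ℂ) *
      φ ((D ^ s) (Y (𝓥.Y b a (κ 1 - j)) w (κ 0 - s + j)))) * e
  · intro n hn
    rw [negSwap, iterSeries, ser2_vec]
    change _ * (φ ∘ₗ D ^ s) (Y (𝓥.Y b a (κ 1 - n)) w _) = 0
    rw [hK _ (by omega), h.bilinear.zero_left]
    simp

/-- The iterate `⟨φ, Y^R(Y^R(w, x₀) a, x₁) b⟩` in terms of products of left vertex operators. -/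
theorem skew_iterSeries_eq (h : IsLocalAction 𝓥 S T Y D) {φ : Module.Dual ℂ W} {J : ℕ}
    (hJ : ∀ j ≥ J, ∀ w, φ ((D ^ j) w) = 0) (w : W) (a b : V) :
    (ser2 fun k l => φ (skewOpposite D Y (skewOpposite D Y w a k) b l)) =
      ∑ n ∈ Finset.range J, (n.factorial : ℂ)⁻¹ • act ((X 0 + X 1) ^ n)
        (negSwap (substSum 1 (prodSeries Y (φ ∘ₗ D ^ n) b a w))) := by
  funext κ
  rw [vec_eta κ, Finset.sum_apply, ser2_vec, h.apply_skew hJ]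
  -- The inner exponential e^{x₀D} is moved to the outside as well. Together with the outer one it
  -- becomes e^{(x₀ + x₁)D}, whose terms are the powers of X 0 + X 1.
  have h1 : ∀ i : ℕ, φ ((D ^ i) (Y b (skewOpposite D Y w a (κ 0)) (κ 1 - i))) =
      ∑ s ∈ Finset.range J, (s.factorial : ℂ)⁻¹ * ((-1) ^ (κ 0 - s) *
        substSum 1 (prodSeries Y (φ ∘ₗ D ^ (i + s)) b a w) ![κ 1 - i, κ 0 - s]) := by
    intro i
    have := h.apply_Y_skew (φ := φ ∘ₗ D ^ i) (J := J) (fun j hj w => by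
      rw [LinearMap.comp_apply, ← Module.End.mul_apply, ← pow_add]
      exact hJ _ (by omega) w) b a w (κ 1 - i) (κ 0)
    rw [LinearMap.comp_apply] at this
    rw [this]
    simp only [LinearMap.comp_assoc, ← Module.End.mul_eq_comp, ← pow_add]
  have h2 : ∀ i s : ℕ, J ≤ i + s → (i.factorial : ℂ)⁻¹ * ((-1) ^ (κ 1 - i) *
      ((s.factorial : ℂ)⁻¹ * ((-1) ^ (κ 0 - s) *
        substSum 1 (prodSeries Y (φ ∘ₗ D ^ (i + s)) b a w) ![κ 1 - i, κ 0 - s]))) = 0 := by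
    intro i s his
    have h0 : prodSeries Y (φ ∘ₗ D ^ (i + s)) b a w = 0 := by
      funext κ
      exact hJ _ his _
    have h00 : substSum 1 (0 : MSeries (Fin 2)) = 0 := by
      simpa using substSum_smul (c := 1) 0 (0 : MSeries (Fin 2))
    rw [h0, h00]
    simp
  simp only [h1, Finset.mul_sum]
  rw [← sum_range_antidiagonal h2]
  refine Finset.sum_congr rfl fun n _ => ?_
  rw [Pi.smul_apply, act_add_pow_apply, smul_eq_mul, Finset.mul_sum]
  refine Finset.sum_congr rfl fun x hx => ?_
  have hx' : x.1 + x.2 = n := Finset.HasAntidiagonal.mem_antidiagonal.1 hx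
  subst hx'
  rw [negSwap]
  change _ = _ * (_ * ((-1) ^ (κ 0 - x.2 + (κ 1 - x.1)) * substSum 1
    (prodSeries Y (φ ∘ₗ D ^ (x.1 + x.2)) b a w) ![κ 1 - x.1, κ 0 - x.2]))
  have hf : ((x.1 + x.2).choose x.1 : ℂ) * x.1.factorial * x.2.factorial =
      (x.1 + x.2).factorial := by
    rw [Nat.choose_symm_add]
    exact_mod_cast Nat.add_choose_mul_factorial_mul_factorial x.1 x.2
  have hc : ((x.1 + x.2).factorial : ℂ)⁻¹ * ((x.1 + x.2).choose x.1 : ℂ) =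
      (x.1.factorial : ℂ)⁻¹ * (x.2.factorial : ℂ)⁻¹ := by
    rw [← hf]
    have h1 : (x.1.factorial : ℂ) ≠ 0 := Nat.cast_ne_zero.2 x.1.factorial_ne_zero
    have h2 : (x.2.factorial : ℂ) ≠ 0 := Nat.cast_ne_zero.2 x.2.factorial_ne_zero
    have h3 : ((x.1 + x.2).choose x.1 : ℂ) ≠ 0 :=
      Nat.cast_ne_zero.2 (Nat.choose_pos (Nat.le_add_right _ _)).ne'
    field_simp
  rw [← mul_assoc ((x.1 + x.2).factorial : ℂ)⁻¹, hc, zpow_add₀ (by norm_num)]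
  ring

/-- Products of right operators are iterates of left operators and conversely, in variables that are
negated and exchanged. So weak associativity for right operators is that of Y with its two sides
interchanged; the shear in the formula for the product is undone by `substSum_substSum`. -/
theorem weakAssoc_skew (h : IsLocalAction 𝓥 S T Y D) {E : V →ₗ[ℂ] V} (hE : ∀ v, E v = 𝓥.D v)
    (ht : ∀ u v, Trunc (𝓥.Y u v)) {φ : Module.Dual ℂ W} (hφ : φ ∈ T) (w : W) (a b : V) :
    WeakAssoc (ser2 fun k l => φ (skewOpposite D Y w (skewOpposite 𝓥.D 𝓥.Y a b l) k))
      (ser2 fun k l => φ (skewOpposite D Y (skewOpposite D Y w a k) b l)) := by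
  obtain ⟨J, hJ⟩ := h.comp_D_pow φ hφ
  obtain ⟨N, hN⟩ := exists_forall_act_eq_zero
    (fun s => h.weakAssoc _ (h.comp_D_pow_mem hφ s) b a w) J
  refine ⟨N, ?_⟩
  rw [h.skew_prodSeries_eq hE ht hJ, h.skew_iterSeries_eq hJ, substSum_sum,
    ← Finset.sum_sub_distrib, map_sum]
  · refine Finset.sum_eq_zero fun s hs => ?_
    have hl := h.lTrunc_negSwap_iterSeries ht (φ ∘ₗ D ^ s) b a w
    have hs' : substHom 1 (X 0 ^ s) = (X 0 + X 1) ^ s := by simp [substHom]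
    rw [substSum_smul, substSum_act hl.substSum, substSum_substSum hl, ← smul_sub, hs', ← map_sub,
      ← negSwap_sub, map_smul, act_comm]
    have h1 := hN s (Finset.mem_range.1 hs)
    have h2 := act_add_pow_negSwap h1
    have e : iterSeries 𝓥 Y (φ ∘ₗ D ^ s) b a w - substSum 1 (prodSeries Y (φ ∘ₗ D ^ s) b a w) =
        (-1 : ℂ) • (substSum 1 (prodSeries Y (φ ∘ₗ D ^ s) b a w) -
          iterSeries 𝓥 Y (φ ∘ₗ D ^ s) b a w) := by
      rw [neg_one_smul, neg_sub]
    rw [e, negSwap_smul, map_smul]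
    change act _ (negSwap (substSum 1 (prodSeries Y (φ ∘ₗ D ^ s) b a w) -
          iterSeries 𝓥 Y (φ ∘ₗ D ^ s) b a w)) = 0 at h2
    rw [h2, smul_zero, map_zero, smul_zero]
  · intro s _
    exact ((h.lTrunc_negSwap_iterSeries ht _ _ _ _).substSum.act _).smul _

end IsLocalAction

end Opposite

/-! ### Products of vertex operators -/

section Transfer

variable {σ : Type*} [Fintype σ] [DecidableEq σ]

theorem act_shift {τ : Type*} (p : MvPolynomial τ ℂ) (G : MSeries τ) (v : τ → ℤ) :
    act p (fun κ => G (κ + v)) = fun κ => act p G (κ + v) := by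
  classical
  have := act_intertwine (P := fun _ : MSeries τ => True) (fun _ _ _ _ => trivial)
    (fun _ _ _ => trivial) (fun _ _ _ => trivial) (fun G κ => G (κ + v)) (fun F G _ _ => rfl)
    (fun c F _ => rfl) (AlgHom.id ℂ (MvPolynomial τ ℂ)) ?_ p (F := G) trivial
  · exact this.symm
  · intro i F _
    funext κ
    rw [AlgHom.id_apply, act_X_apply, act_X_apply, add_sub_right_comm]

/-- Exchanging the variables only changes the sign of X 0 - X 1. -/
theorem act_sub_pow_swap {N : ℕ} {H : ℤ → ℤ → ℂ} (h : act ((X 0 - X 1) ^ N) (ser2 H) = 0) :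
    act ((X 0 - X 1) ^ N) (ser2 fun q p => H p q) = 0 := by
  have := act_intertwine (P := fun _ : MSeries (Fin 2) => True) (fun _ _ _ _ => trivial)
    (fun _ _ _ => trivial) (fun _ _ _ => trivial) (fun (F : MSeries (Fin 2)) (κ : Fin 2 → ℤ) => F ![κ 1, κ 0])
    (fun F G _ _ => rfl) (fun c F _ => rfl)
    (aeval ![X 1, X 0] : MvPolynomial (Fin 2) ℂ →ₐ[ℂ] MvPolynomial (Fin 2) ℂ) ?_
    ((X 0 - X 1) ^ N) (F := ser2 H) trivial
  · have e : (aeval ![X 1, X 0] ((X 0 - X 1) ^ N : MvPolynomial (Fin 2) ℂ) :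
        MvPolynomial (Fin 2) ℂ) = (-1) ^ N * (X 0 - X 1) ^ N := by
      simp only [map_pow, map_sub, aeval_X, Matrix.cons_val_zero, Matrix.cons_val_one]
      rw [← mul_pow]
      ring
    rw [e, act_mul_apply, h] at this
    have h1 : act ((-1) ^ N * ((-1) ^ N * (X 0 - X 1) ^ N)) (ser2 fun q p => H p q) =
        act ((-1 : MvPolynomial (Fin 2) ℂ) ^ N) 0 := by
      rw [act_mul_apply, act_mul_apply]
      exact (DFunLike.congr_arg _ this).symm
    rw [← mul_assoc, ← mul_pow, map_zero] at h1
    simpa using h1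
  · intro i F _
    rw [aeval_X]
    funext κ
    fin_cases i
    · change act (X 0) F ![κ 1, κ 0] = act (X 1) (fun κ => F ![κ 1, κ 0]) κ
      rw [act_X_apply, act_X_apply, vec_two_sub_single_zero]
      simp
    · change act (X 1) F ![κ 1, κ 0] = act (X 0) (fun κ => F ![κ 1, κ 0]) κ
      rw [act_X_apply, act_X_apply, vec_two_sub_single_one]
      simp

/-- Weak commutativity identifies the two series plane by plane up to a power of X i - X j that may
vary, and `act_eq_act_of_slice` shows that the denominator of `F` serves `F'`. `H` describes a plane
by absolute exponents, the form in which commutativity is available. -/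
theorem RationalSeries.of_weakComm {i j : σ} (hij : i ≠ j) {F F' : MSeries σ}
    (hF : RationalSeries F) (hF' : LTrunc j i F')
    (h : ∀ k, ∃ H : ℤ → ℤ → ℂ, (∀ p q, (F - F') (k + (Pi.single i p + Pi.single j q)) =
      H (k i + p) (k j + q)) ∧ ∃ N : ℕ, act ((X 0 - X 1) ^ N) (ser2 H) = 0) :
    RationalSeries F' := by
  obtain ⟨q, hq⟩ := hF
  refine ⟨q, ?_⟩
  rw [act_eq_act_of_slice hij.symm (F := F) (fun k => ?_) hF' hq]
  · exact hq
  · obtain ⟨H, hH, N, hN⟩ := h k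
    refine ⟨N, ?_⟩
    have e : slice j i k (F - F') =
        fun κ => ser2 (fun q p => H p q) (κ + ![k j, k i]) := by
      funext κ
      rw [slice, add_comm (Pi.single j _), hH, ser2]
      simp [add_comm]
    rw [e, act_shift, act_sub_pow_swap hN]
    rfl

end Transfer

section Products

variable {V W σ : Type*} [AddCommGroup V] [Module ℂ V] [AddCommGroup W] [Module ℂ W]

/-- The operator `Y(u_{i₁}, x_{i₁}) ⋯ Y(u_{iₙ}, x_{iₙ})`, coefficient of `x ^ k`. -/
def opLin {Y : V → W → Series W} (hY : IsBilinear Y) (u : σ → V) (k : σ → ℤ) :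
    List σ → W →ₗ[ℂ] W
  | [] => LinearMap.id
  | i :: l => hY.right (u i) (k i) ∘ₗ opLin hY u k l

variable {Y : V → W → Series W} (hY : IsBilinear Y) (u : σ → V)

@[simp]
theorem opLin_nil (k : σ → ℤ) : opLin hY u k [] = LinearMap.id := rfl

theorem opLin_cons (k : σ → ℤ) (i : σ) (l : List σ) (w : W) :
    opLin hY u k (i :: l) w = Y (u i) (opLin hY u k l w) (k i) := rfl

theorem opLin_append (k : σ → ℤ) (l l' : List σ) :
    opLin hY u k (l ++ l') = opLin hY u k l ∘ₗ opLin hY u k l' := by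
  induction l with
  | nil => rfl
  | cons i l ih => rw [List.cons_append, opLin, opLin, ih, LinearMap.comp_assoc]

theorem opLin_congr {k k' : σ → ℤ} {l : List σ} (h : ∀ i ∈ l, k i = k' i) :
    opLin hY u k l = opLin hY u k' l := by
  induction l with
  | nil => rfl
  | cons i l ih =>
    rw [opLin, opLin, h i List.mem_cons_self, ih fun j hj => h j (List.mem_cons_of_mem _ hj)]

theorem opLin_eq_foldr (k : σ → ℤ) (l : List σ) (w : W) :
    opLin hY u k l w = l.foldr (fun i x => Y (u i) x (k i)) w := by
  induction l with
  | nil => rfl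
  | cons i l ih => rw [opLin_cons, ih, List.foldr_cons]

theorem opLin_map_finRange {n : ℕ} (f : Fin n → σ) (k : σ → ℤ) (w : W) :
    opLin hY u k ((List.finRange n).map f) w = prodCoeff Y (u ∘ f) (k ∘ f) w := by
  rw [opLin_eq_foldr, List.foldr_map, prodCoeff, Fin.foldr_eq_finRange_foldr]
  rfl

theorem prodCoeff_succ (Y : V → W → Series W) {n : ℕ} (u : Fin (n + 1) → V) (k : Fin (n + 1) → ℤ)
    (w : W) : prodCoeff Y u k w = Y (u 0) (prodCoeff Y (Fin.tail u) (Fin.tail k) w) (k 0) := by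
  rw [prodCoeff, Fin.foldr_succ]
  rfl

/-- When the exponents to the right of `j` are fixed, the operator number `j` acts on a fixed
vector, so its exponent is bounded below, whatever the exponents to the left are. -/
theorem prodCoeff_eventually_zero (hY : IsBilinear Y) (ht : ∀ u w, Trunc (Y u w))
    {n : ℕ} (u : Fin n → V) (k : Fin n → ℤ) (w : W) (j : Fin n) : ∃ K : ℤ, ∀ k' : Fin n → ℤ, (∀ i > j, k' i = k i) →
      k' j < K → prodCoeff Y u k' w = 0 := by
  induction n with
  | zero => exact j.elim0
  | succ n ih =>
    rcases Fin.eq_zero_or_eq_succ j with rfl | ⟨j, rfl⟩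
    · obtain ⟨K, hK⟩ := ht (u 0) (prodCoeff Y (Fin.tail u) (Fin.tail k) w)
      refine ⟨K, fun k' h1 h2 => ?_⟩
      have e : Fin.tail k' = Fin.tail k := funext fun i => h1 i.succ (Fin.succ_pos i)
      rw [prodCoeff_succ, e, hK _ h2]
    · obtain ⟨K, hK⟩ := ih (Fin.tail u) (Fin.tail k) j
      refine ⟨K, fun k' h1 h2 => ?_⟩
      rw [prodCoeff_succ, hK (Fin.tail k') (fun i hi => h1 i.succ (Fin.succ_lt_succ_iff.2 hi)) h2,
        hY.zero_right]
      rfl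

theorem lTrunc_prodCoeff (hY : IsBilinear Y) (ht : ∀ u w, Trunc (Y u w)) {n : ℕ} (u : Fin n → V)
    (w : W) (φ : Module.Dual ℂ W) {i j : Fin n} (hij : i < j) :
    LTrunc i j fun k : Fin n → ℤ => φ (prodCoeff Y u k w) := by
  intro k
  obtain ⟨K, hK⟩ := prodCoeff_eventually_zero hY ht u k w j
  refine ⟨(k j - K + 1).toNat, fun n hn => ?_⟩
  have h0 := hK (k + (Pi.single i (n : ℤ) - Pi.single j (n : ℤ))) (fun m hm => by
    simp [hm.ne', (hij.trans hm).ne']) (by simp [hij.ne']; omega)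
  simp only [h0, map_zero]

end Products

namespace IsLocalAction

variable {V W σ : Type*} [AddCommGroup V] [Module ℂ V] [AddCommGroup W] [Module ℂ W]
  {𝓥 : VertexData V} {S : Submodule ℂ (Module.Dual ℂ V)}
  {T : Submodule ℂ (Module.Dual ℂ W)} {Y : V → W → Series W} {D : W →ₗ[ℂ] W}

theorem comp_skew_mem (h : IsLocalAction 𝓥 S T Y D) {φ : Module.Dual ℂ W} (hφ : φ ∈ T) (w : W)
    (q : ℤ) : φ ∘ₗ h.bilinear_skew.right w q ∈ S := by
  obtain ⟨J, hJ⟩ := h.comp_D_pow φ hφ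
  have e : φ ∘ₗ h.bilinear_skew.right w q = ∑ s ∈ Finset.range J, (s.factorial : ℂ)⁻¹ •
      (((-1 : ℂ) ^ (q - s)) • ((φ ∘ₗ D ^ s) ∘ₗ h.bilinear.left w (q - s))) := by
    ext u
    rw [LinearMap.comp_apply, h.bilinear_skew.right_apply, h.apply_skew hJ, LinearMap.sum_apply]
    rfl
  rw [e]
  exact S.sum_mem fun s _ => S.smul_mem _ (S.smul_mem _
    (h.comp_left_mem _ (h.comp_D_pow_mem hφ s) _ _))

theorem comp_opLin_mem (h : IsLocalAction 𝓥 S T Y D) {φ : Module.Dual ℂ W} (hφ : φ ∈ T)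
    (u : σ → V) (k : σ → ℤ) (l : List σ) : φ ∘ₗ opLin h.bilinear u k l ∈ T := by
  induction l generalizing φ with
  | nil => simpa using hφ
  | cons i l ih =>
    rw [opLin, ← LinearMap.comp_assoc]
    exact ih (h.comp_right_mem φ hφ _ _)

theorem comp_opLin_skew_mem {E : V →ₗ[ℂ] V} (h : IsLocalAction 𝓥 S S 𝓥.Y E)
    {φ : Module.Dual ℂ V} (hφ : φ ∈ S)
    (u : σ → V) (k : σ → ℤ) (l : List σ) : φ ∘ₗ opLin h.bilinear_skew u k l ∈ S := by
  induction l generalizing φ with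
  | nil => simpa using hφ
  | cons i l ih =>
    rw [opLin, ← LinearMap.comp_assoc]
    exact ih (h.comp_skew_mem hφ _ _)

variable [Fintype σ] [DecidableEq σ]

/-- A left vertex operator can be moved to the right of a right vertex operator. -/
theorem rational_move (h : IsLocalAction 𝓥 S T Y D) (ht : ∀ u v, Trunc (𝓥.Y u v)) {i j : σ}
    (hij : i ≠ j) (a : V) (w : W) {ψ : (σ → ℤ) → Module.Dual ℂ W} (hψ : ∀ k, ψ k ∈ T)
    (hψ' : ∀ k p q, ψ (k + (Pi.single i p + Pi.single j q)) = ψ k) {x : (σ → ℤ) → V}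
    (hx : ∀ k p q, x (k + (Pi.single i p + Pi.single j q)) = x k)
    (hF : RationalSeries fun k => ψ k (Y a (skewOpposite D Y w (x k) (k j)) (k i))) :
    RationalSeries fun k => ψ k (skewOpposite D Y w (𝓥.Y a (x k) (k i)) (k j)) := by
  refine hF.of_weakComm hij ?_ fun k => ?_
  · intro k
    obtain ⟨K, hK⟩ := ht a (x k)
    refine ⟨(k i - K + 1).toNat, fun n hn => ?_⟩
    have e : k + (Pi.single j (n : ℤ) - Pi.single i (n : ℤ)) =
        k + (Pi.single i (-n : ℤ) + Pi.single j (n : ℤ)) := by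
      rw [Pi.single_neg]
      abel
    simp only [e, hψ', hx]
    rw [hK _ (by simp [hij]; omega), h.bilinear_skew.zero_right]
    exact map_zero _
  · refine ⟨fun p q => ψ k (Y a (skewOpposite D Y w (x k) q) p) -
      ψ k (skewOpposite D Y w (𝓥.Y a (x k) p) q), fun p q => ?_, h.weakComm (hψ k) a (x k) w⟩
    rw [Pi.sub_apply]
    simp only [hψ', hx]
    simp [hij, hij.symm]

/-- `∂₁ + ⋯ + ∂ₙ` of a product of vertex operators. -/
theorem D_opLin (h : IsLocalAction 𝓥 S T Y D) (u : σ → V) (k : σ → ℤ) {l : List σ} (hl : l.Nodup)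
    (w : W) : D (opLin h.bilinear u k l w) = ∑ i ∈ l.toFinset, ((k i + 1 : ℤ) : ℂ) •
      opLin h.bilinear u (k + Pi.single i 1) l w + opLin h.bilinear u k l (D w) := by
  induction l with
  | nil => simp
  | cons a l ih =>
    obtain ⟨ha, hl⟩ := List.nodup_cons.1 hl
    have h1 := h.Y_D_apply (u a) (opLin h.bilinear u k l w) (k a)
    rw [List.toFinset_cons, Finset.sum_insert (by simpa using ha)]
    have h2 : ∀ i ∈ l.toFinset, ((k i + 1 : ℤ) : ℂ) •
        opLin h.bilinear u (k + Pi.single i 1) (a :: l) w =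
        h.bilinear.right (u a) (k a) (((k i + 1 : ℤ) : ℂ) •
          opLin h.bilinear u (k + Pi.single i 1) l w) := by
      intro i hi
      have hai : a ≠ i := by
        rintro rfl
        exact ha (List.mem_toFinset.1 hi)
      rw [map_smul, opLin_cons, h.bilinear.right_apply]
      simp [hai]
    have h3 : opLin h.bilinear u (k + Pi.single a 1) l = opLin h.bilinear u k l :=
      opLin_congr _ _ fun i hi => by
        have : i ≠ a := by
          rintro rfl
          exact ha hi
        simp [this]
    rw [Finset.sum_congr rfl h2, ← map_sum, opLin_cons, opLin_cons, opLin_cons, h3, add_assoc,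
      ← h.bilinear.right_apply (u a) (opLin h.bilinear u k l (D w)), ← map_add, ← ih hl,
      h.bilinear.right_apply, h1]
    simp

theorem rational_opLin (h : IsLocalAction 𝓥 S T Y D) {φ : Module.Dual ℂ W} (hφ : φ ∈ T)
    (u : σ → V) {i₀ : σ} {l : List σ} (hl : l.Nodup) (h₀ : i₀ ∉ l) (hall : ∀ i, i ≠ i₀ → i ∈ l)
    (w : W) : RationalSeries fun k : {i // i ≠ i₀} → ℤ =>
      φ (opLin h.bilinear u (Function.extend Subtype.val k 0) l w) := by
  let e : Fin l.length ≃ {i // i ≠ i₀} := Equiv.ofBijective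
    (fun t => ⟨l.get t, fun e => h₀ (e ▸ l.get_mem t)⟩) ⟨fun s t hst =>
      hl.get_inj_iff.1 (congrArg Subtype.val hst), fun x => by
        obtain ⟨t, ht⟩ := List.mem_iff_get.1 (hall x x.2)
        exact ⟨t, Subtype.ext ht⟩⟩
  have := (h.product_rational φ hφ l.length (u ∘ l.get) w).comp_equiv e
  have hmap : l = (List.finRange l.length).map l.get := by rw [← List.ofFn_eq_map, List.ofFn_get]
  convert this using 2 with k
  rw [congrArg (opLin h.bilinear u _) hmap, opLin_map_finRange]
  congr 2
  funext t
  exact Subtype.val_injective.extend_apply k 0 (e t)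

/-- Products of left vertex operators followed by a right vertex operator applied to `𝟏`. -/
theorem rational_opLin_skew_vac (h : IsLocalAction 𝓥 S T Y D) {φ : Module.Dual ℂ W} (hφ : φ ∈ T)
    (u : σ → V) {i₀ : σ} {l : List σ} (hl : l.Nodup) (h₀ : i₀ ∉ l) (hall : ∀ i, i ≠ i₀ → i ∈ l)
    (w : W) : RationalSeries fun k : σ → ℤ =>
      φ (opLin h.bilinear u k l (skewOpposite D Y w 𝓥.vac (k i₀))) := by
  obtain ⟨J, hJ⟩ := h.comp_D_pow φ hφ
  rw [h.skew_vac]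
  -- The right operator on the vacuum is e^{xD} w. Applying D to the whole product is the sum of all
  -- partial derivatives, so inserting powers of D gives a sequence of successive divergences; it
  -- terminates under `φ`. At x_{i₀} = 0 only left operators on `w` remain.
  refine rationalSeries_of_divergence (i₀ := i₀) (fun s k =>
    (φ ∘ₗ D ^ s) (opLin h.bilinear u k l (expX D (Pi.single 0 w) (k i₀)))) (fun s k hk => ?_)
    (fun s => ?_) (fun s => ?_) (J := J) (fun s hs => funext fun k => hJ s hs _) 0
  · simp only [expX_single_of_neg D w hk, map_zero]
  · have huniv : (Finset.univ : Finset σ) = insert i₀ l.toFinset := by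
      ext i
      by_cases hi : i = i₀
      · simp [hi]
      · simp [hi, hall i hi]
    have hd : ddx (expX D (Pi.single 0 w)) = D ∘ expX D (Pi.single 0 w) := by
      have h0 : ddx (Pi.single 0 w : Series W) = 0 := by
        funext k
        rw [ddx]
        rcases eq_or_ne (k + 1) 0 with hk | hk
        · simp [hk]
        · simp [hk]
      rw [ddx_expX D (trunc_single w), h0]
      have : expX D (0 : Series W) = 0 := by simpa using expX_smul D 0 (trunc_single w)
      rw [this, add_zero]
    funext k
    have h1 : opLin h.bilinear u (k + Pi.single i₀ 1) l = opLin h.bilinear u k l :=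
      opLin_congr _ _ fun i hi => by
        have : i ≠ i₀ := by
          rintro rfl
          exact h₀ hi
        simp [this]
    have h2 := congrFun hd (k i₀)
    rw [ddx, Function.comp] at h2
    have h3 : ∀ i ∈ l.toFinset, (k + Pi.single i (1 : ℤ) : σ → ℤ) i₀ = k i₀ := by
      intro i hi
      have : i₀ ≠ i := by
        rintro rfl
        exact h₀ (List.mem_toFinset.1 hi)
      simp [this]
    have h4 := congrArg (φ ∘ₗ D ^ s) (h.D_opLin u k hl (expX D (Pi.single 0 w) (k i₀)))
    rw [divergence, huniv, Finset.sum_insert (by simpa using h₀)]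
    rw [map_add, map_sum, ← h2] at h4
    simp only [map_smul, smul_eq_mul] at h4
    rw [h1, Finset.sum_congr rfl fun i hi => by rw [h3 i hi]]
    simp only [Pi.add_apply, Pi.single_eq_same]
    rw [add_comm, ← h4, pow_succ]
    rfl
  · have := h.rational_opLin (h.comp_D_pow_mem hφ s) u hl h₀ hall w
    convert this using 2 with k
    have h0 : expX D (Pi.single 0 w) 0 = w := by simpa using expX_single D w 0
    rw [layer, extend_val_apply_self, h0]

/-- The list `l` holds left operators in front of Y^R(w), the list `l'` opposite operators behind
it. An opposite operator next to the vacuum is traded for a left operator at the end of `l`, since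
Y(v, x) 𝟏 = e^{xD} v = Y^s(v, x) 𝟏; so induction on `l'` leads back to left operators alone. -/
theorem rational_opLin_skew {E : V →ₗ[ℂ] V} (hV : IsLocalAction 𝓥 S S 𝓥.Y E)
    (hvac : ∀ v, 𝓥.Y v 𝓥.vac = expX E (Pi.single 0 v)) (h : IsLocalAction 𝓥 S T Y D)
    {φ : Module.Dual ℂ W} (hφ : φ ∈ T) (u : σ → V) {i₀ : σ} (w : W) (l' l : List σ)
    (hl : (l ++ l').Nodup) (h₀ : i₀ ∉ l ++ l') (hall : ∀ i, i ≠ i₀ → i ∈ l ++ l') :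
    RationalSeries fun k : σ → ℤ => φ (opLin h.bilinear u k l
      (skewOpposite D Y w (opLin hV.bilinear_skew u k l' 𝓥.vac) (k i₀))) := by
  induction l' using List.reverseRecOn generalizing l with
  | nil =>
    rw [List.append_nil] at hl h₀ hall
    exact h.rational_opLin_skew_vac hφ u hl h₀ hall w
  | append_singleton l' b ih =>
    have hp : (l ++ [b] ++ l').Perm (l ++ (l' ++ [b])) := by
      rw [List.append_assoc]
      exact List.Perm.append_left l List.perm_append_comm
    have h1 := ih (l ++ [b]) (hp.nodup_iff.2 hl) (fun hh => h₀ (hp.mem_iff.1 hh))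
      fun i hi => hp.mem_iff.2 (hall i hi)
    have hbl : b ∉ l := fun hb => by
      have := List.disjoint_of_nodup_append hl hb
      simp at this
    have hb0 : b ≠ i₀ := by
      rintro rfl
      exact h₀ (by simp)
    have hnd := (List.nodup_append.1 hl).2.1
    have hbl' : b ∉ l' := fun hb => by
      have := List.disjoint_of_nodup_append hnd hb
      simp at this
    have hinv : ∀ (m : List σ) (i j : σ), i ∉ m → j ∉ m → ∀ (k : σ → ℤ) (p q : ℤ), ∀ t ∈ m,
        (k + (Pi.single i p + Pi.single j q) : σ → ℤ) t = k t := by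
      intro m i j hi hj k p q t ht
      have h1 : t ≠ i := by rintro rfl; exact hi ht
      have h2 : t ≠ j := by rintro rfl; exact hj ht
      simp [h1, h2]
    have h0l : i₀ ∉ l := fun hh => h₀ (by simp [hh])
    have h0l' : i₀ ∉ l' := fun hh => h₀ (by simp [hh])
    -- The operator `b` passes Y^R(w).
    have h2 : RationalSeries fun k : σ → ℤ => φ (opLin h.bilinear u k l
        (skewOpposite D Y w (𝓥.Y (u b) (opLin hV.bilinear_skew u k l' 𝓥.vac) (k b)) (k i₀))) := by
      refine h.rational_move hV.trunc hb0 (u b) w (ψ := fun k => φ ∘ₗ opLin h.bilinear u k l)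
        (fun k => h.comp_opLin_mem hφ u k l)
        (fun k p q => by simp only [opLin_congr h.bilinear u (hinv l b i₀ hbl h0l k p q)])
        (x := fun k => opLin hV.bilinear_skew u k l' 𝓥.vac)
        (fun k p q => by simp only [opLin_congr hV.bilinear_skew u (hinv l' b i₀ hbl' h0l' k p q)])
        ?_
      simpa [opLin_append, opLin_cons] using h1
    -- The operator `b` passes the opposite operators one at a time: those in `m` are already to its
    -- left, those in `m'` still to its right. This is weak commutativity for V acting on itself.
    have h3 : ∀ (m' m : List σ), (m ++ m').Nodup → b ∉ m ++ m' → i₀ ∉ m ++ m' →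
        l.Disjoint (m ++ m') →
        (RationalSeries fun k : σ → ℤ => φ (opLin h.bilinear u k l
          (skewOpposite D Y w (opLin hV.bilinear_skew u k m
            (𝓥.Y (u b) (opLin hV.bilinear_skew u k m' 𝓥.vac) (k b))) (k i₀)))) →
        RationalSeries fun k : σ → ℤ => φ (opLin h.bilinear u k l
          (skewOpposite D Y w (opLin hV.bilinear_skew u k (m ++ m')
            (𝓥.Y (u b) 𝓥.vac (k b))) (k i₀))) := by
      intro m'
      induction m' with
      | nil =>
        intro m _ _ _ _ hR
        simpa using hR
      | cons c m' ihm =>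
        intro m hnm hbm h0m hdis hR
        rw [List.append_cons] at hnm hbm h0m hdis ⊢
        have hcb : b ≠ c := by
          rintro rfl
          exact hbm (by simp)
        have hcl : c ∉ l := fun hh => by
          have := hdis hh
          simp at this
        have hc0 : i₀ ≠ c := by
          rintro rfl
          exact h0m (by simp)
        have hcm : c ∉ m := by
          rw [List.append_assoc] at hnm
          intro hh
          have := List.disjoint_of_nodup_append hnm hh
          simp at this
        have hcm' : c ∉ m' := by
          rw [List.append_assoc] at hnm
          exact (List.nodup_cons.1 (List.nodup_append.1 hnm).2.1).1
        have hbm1 : b ∉ m := fun hh => hbm (by simp [hh])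
        have hbm2 : b ∉ m' := fun hh => hbm (by simp [hh])
        refine ihm (m ++ [c]) hnm hbm h0m hdis ?_
        have := hV.rational_move hV.trunc hcb (u b) (u c)
          (ψ := fun k => ((φ ∘ₗ opLin h.bilinear u k l) ∘ₗ h.bilinear_skew.right w (k i₀)) ∘ₗ
            opLin hV.bilinear_skew u k m)
          (fun k => hV.comp_opLin_skew_mem (h.comp_skew_mem (h.comp_opLin_mem hφ u k l) w _) u k m)
          (fun k p q => by
            simp only [opLin_congr h.bilinear u (hinv l b c hbl hcl k p q),
              opLin_congr hV.bilinear_skew u (hinv m b c hbm1 hcm k p q)]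
            have : (k + (Pi.single b p + Pi.single c q) : σ → ℤ) i₀ = k i₀ := by simp [hb0.symm, hc0]
            rw [this])
          (x := fun k => opLin hV.bilinear_skew u k m' 𝓥.vac)
          (fun k p q => by
            simp only [opLin_congr hV.bilinear_skew u (hinv m' b c hbm2 hcm' k p q)])
          hR
        simpa [opLin_append, opLin_cons, IsBilinear.right_apply] using this
    have h4 := h3 l' [] (List.nodup_append.1 hnd).1 hbl' h0l'
      (fun t ht ht' => List.disjoint_of_nodup_append hl ht (by simp [show t ∈ l' from ht'])) h2
    simpa [opLin_append, opLin_cons, hvac, hV.skew_vac] using h4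

end IsLocalAction

/-! ### Rationality of products of right vertex operators -/

section RightProducts

variable {V W : Type*} [AddCommGroup V] [Module ℂ V] [AddCommGroup W] [Module ℂ W]

theorem prodCoeff_succ_last (Y : V → W → Series W) {n : ℕ} (u : Fin (n + 1) → V)
    (k : Fin (n + 1) → ℤ) (w : W) : prodCoeff Y u k w =
      prodCoeff Y (u ∘ Fin.castSucc) (k ∘ Fin.castSucc) (Y (u (Fin.last n)) w (k (Fin.last n))) := by
  rw [prodCoeff, Fin.foldr_succ_last]
  rfl

theorem prodCoeff_zero_right {Y : V → W → Series W} (hY : IsBilinear Y) {n : ℕ} (u : Fin n → V)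
    (k : Fin n → ℤ) : prodCoeff Y u k 0 = 0 := by
  have := opLin_map_finRange hY u id k 0
  rw [map_zero] at this
  exact this.symm

theorem rationalSeries_of_isEmpty {σ : Type*} [Fintype σ] [DecidableEq σ] [IsEmpty σ]
    (F : MSeries σ) : RationalSeries F := ⟨0, Set.toFinite _⟩

namespace IsLocalAction

variable {𝓥 : VertexData V} {S : Submodule ℂ (Module.Dual ℂ V)}
  {T : Submodule ℂ (Module.Dual ℂ W)} {Y : V → W → Series W} {D : W →ₗ[ℂ] W}

/-- Products of right vertex operators are rational. -/
theorem rational_skew_prodCoeff {E : V →ₗ[ℂ] V} (hV : IsLocalAction 𝓥 S S 𝓥.Y E)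
    (hvac : ∀ v, 𝓥.Y v 𝓥.vac = expX E (Pi.single 0 v)) (h : IsLocalAction 𝓥 S T Y D)
    {φ : Module.Dual ℂ W} (hφ : φ ∈ T) (w : W) {n : ℕ} (u : Fin n → V) (v : V) :
    RationalSeries fun k : Fin (n + 1) → ℤ => φ (skewOpposite D Y w
      (prodCoeff (skewOpposite E 𝓥.Y) u (Fin.tail k) v) (k 0)) := by
  have h1 := hV.rational_opLin_skew hvac h hφ (Fin.cons (α := fun _ : Fin (n + 2) => V) 0
    (Fin.snoc (α := fun _ : Fin (n + 1) => V) u v)) (i₀ := 0) w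
    ((List.finRange (n + 1)).map Fin.succ) []
    (by simpa using (List.nodup_finRange _).map (Fin.succ_injective _))
    (by simp [Fin.succ_ne_zero]) (by
      intro i hi
      obtain ⟨j, rfl⟩ := Fin.exists_succ_eq.2 hi
      simp)
  have h2 : RationalSeries fun k : Fin (n + 2) → ℤ => φ (skewOpposite D Y w
      (prodCoeff (skewOpposite E 𝓥.Y) u (fun i => k i.castSucc.succ)
        (expX E (Pi.single 0 v) (k (Fin.last (n + 1))))) (k 0)) := by
    convert h1 using 2 with k
    rw [opLin_map_finRange, prodCoeff_succ_last, opLin_nil, LinearMap.id_apply]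
    have e1 : (Fin.cons (α := fun _ : Fin (n + 2) => V) 0
        (Fin.snoc (α := fun _ : Fin (n + 1) => V) u v) ∘ Fin.succ) ∘ Fin.castSucc = u := by
      funext i
      simp
    have e2 : (Fin.cons (α := fun _ : Fin (n + 2) => V) 0
        (Fin.snoc (α := fun _ : Fin (n + 1) => V) u v) ∘ Fin.succ) (Fin.last n) = v := by
      simp
    rw [e1, e2, hV.skew_vac]
    rfl
  have h3 := (h2.layer (i₀ := Fin.last (n + 1)) (fun k hk => by
    simp only [expX_single_of_neg E v hk, prodCoeff_zero_right hV.bilinear_skew,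
      h.bilinear_skew.zero_right]
    exact map_zero φ)).comp_equiv (finSuccAboveEquiv (Fin.last (n + 1))).symm
  convert h3 using 2 with k
  have e0 : expX E (Pi.single 0 v) 0 = v := by simpa using expX_single E v 0
  have e1 : ∀ j : Fin (n + 1), Function.extend Subtype.val
      (k ∘ (finSuccAboveEquiv (Fin.last (n + 1))).symm) 0 j.castSucc = k j := by
    intro j
    have h5 : (finSuccAboveEquiv (Fin.last (n + 1)) j : Fin (n + 2)) = j.castSucc := by
      simp [finSuccAboveEquiv_apply]
    rw [← h5, Subtype.val_injective.extend_apply, Function.comp_apply, Equiv.symm_apply_apply]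
  have e2 := e1 0
  rw [Fin.castSucc_zero] at e2
  simp only [layer, extend_val_apply_self, e0]
  rw [e2]
  congr 3
  funext i
  exact (e1 i.succ).symm

/-- Rationality does not determine the domain of expansion; the truncation in each direction i < j
comes from the inner product of opposite operators, since `j` cannot be the leftmost index. -/
theorem productRational_skew {E : V →ₗ[ℂ] V} (hV : IsLocalAction 𝓥 S S 𝓥.Y E)
    (hvac : ∀ v, 𝓥.Y v 𝓥.vac = expX E (Pi.single 0 v)) (h : IsLocalAction 𝓥 S T Y D)
    {φ : Module.Dual ℂ W} (hφ : φ ∈ T) (w : W) {n : ℕ} (u : Fin n → V) (v : V) :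
    ProductRational fun k : Fin (n + 1) → ℤ => φ (skewOpposite D Y w
      (prodCoeff (skewOpposite E 𝓥.Y) u (Fin.tail k) v) (k 0)) := by
  refine (hV.rational_skew_prodCoeff hvac h hφ w u v).productRational fun i j hij k => ?_
  obtain ⟨j, rfl⟩ := Fin.exists_succ_eq.2 (Fin.ne_zero_of_lt hij)
  obtain ⟨K, hK⟩ := prodCoeff_eventually_zero hV.bilinear_skew hV.trunc_skew u (Fin.tail k) v j
  refine ⟨(k j.succ - K + 1).toNat, fun m hm => ?_⟩
  have h0 := hK (Fin.tail (k + (Pi.single i (m : ℤ) - Pi.single j.succ (m : ℤ)))) (fun t ht => by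
    have h1 : t.succ ≠ i := (hij.trans (Fin.succ_lt_succ_iff.2 ht)).ne'
    have h2 : t ≠ j := ht.ne'
    simp [Fin.tail, h1, h2]) (by simp [Fin.tail, hij.ne']; omega)
  simp only [h0, h.bilinear_skew.zero_right]
  exact map_zero φ

theorem iterate_skew {E : V →ₗ[ℂ] V} (hE : ∀ v, E v = 𝓥.D v) (hV : IsLocalAction 𝓥 S S 𝓥.Y E)
    (hvac : ∀ v, 𝓥.Y v 𝓥.vac = expX E (Pi.single 0 v)) (h : IsLocalAction 𝓥 S T Y D)
    {φ : Module.Dual ℂ W} (hφ : φ ∈ T) (w : W) (a b : V) :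
    IterateRational (fun k l => φ (skewOpposite D Y (skewOpposite D Y w a k) b l)) ∧
    Associates (fun k l => φ (skewOpposite D Y w (skewOpposite 𝓥.D 𝓥.Y a b l) k))
      (fun k l => φ (skewOpposite D Y (skewOpposite D Y w a k) b l)) := by
  have hE' : 𝓥.D = E := (funext hE).symm
  refine (h.weakAssoc_skew hE hV.trunc hφ w a b).iterateRational_and_associates ?_ ?_ ?_
  · rw [hE']
    exact lTrunc_product h.bilinear_skew.zero_right (hV.trunc_skew a b) φ w
  · intro κ
    obtain ⟨K, hK⟩ := h.trunc_skew w a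
    refine ⟨(κ 0 - K + 1).toNat, fun n hn => ?_⟩
    rw [ser2, hK _ (by simp; omega), h.bilinear_skew.zero_left]
    exact map_zero φ
  · have := hV.rational_skew_prodCoeff hvac h hφ w ![a] b
    rw [hE']
    exact this

end IsLocalAction

end RightProducts

/-! ### Opposite algebras and modules -/

section OppositeModule

variable {V W : Type*} [AddCommGroup V] [Module ℂ V] [AddCommGroup W] [Module ℂ W]

theorem IsMOSVA.isLocalAction {𝓥 : VertexData V} (h : IsMOSVA 𝓥) :
    IsLocalAction 𝓥 (gradedDual 𝓥.gr) (gradedDual 𝓥.gr) 𝓥.Y h.DLin where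
  bilinear := h.bilinear
  trunc := h.isGradedAction.trunc
  identity := h.identity
  D_derivative := h.D_derivative
  D_commutator := h.D_commutator
  comp_D_mem _ hφ := h.isGradedAction.comp_D_mem hφ
  comp_D_pow _ hφ := h.isGradedAction.comp_D_eventually_zero hφ
  comp_right_mem _ hφ u k := h.isGradedAction.comp_right_mem hφ u k
  comp_left_mem _ hφ w k := h.isGradedAction.comp_left_mem hφ w k
  product_rational φ hφ n u w := (h.product_rational φ hφ n u w).rationalSeries
  weakAssoc φ hφ u₁ u₂ w := weakAssoc_of_associates
    (lTrunc_product h.bilinear.zero_right (h.isGradedAction.trunc u₂ w) φ u₁) (by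
      have := h.product_rational φ hφ 2 ![u₁, u₂] w
      exact this)
    (h.iterate_rational φ hφ u₁ u₂ w) (h.associativity φ hφ u₁ u₂ w)

theorem IsLeftModule.isLocalAction {𝓥 : VertexData V} (hV : DirectSum.IsInternal 𝓥.gr)
    {gr : ℂ → Submodule ℂ W} {Y : V → W → Series W} {d D : W →ₗ[ℂ] W}
    (h : IsLeftModule 𝓥 gr Y d D) :
    IsLocalAction 𝓥 (gradedDual 𝓥.gr) (gradedDual gr) Y D where
  bilinear := h.bilinear
  trunc := (h.isGradedAction hV).trunc
  identity := h.identity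
  D_derivative := h.D_derivative
  D_commutator := h.D_commutator
  comp_D_mem _ hφ := (h.isGradedAction hV).comp_D_mem hφ
  comp_D_pow _ hφ := (h.isGradedAction hV).comp_D_eventually_zero hφ
  comp_right_mem _ hφ u k := (h.isGradedAction hV).comp_right_mem hφ u k
  comp_left_mem _ hφ w k := (h.isGradedAction hV).comp_left_mem hφ w k
  product_rational φ hφ n u w := (h.product_rational φ hφ n u w).rationalSeries
  weakAssoc φ hφ u₁ u₂ w := weakAssoc_of_associates
    (lTrunc_product h.bilinear.zero_right ((h.isGradedAction hV).trunc u₂ w) φ u₁) (by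
      have := h.product_rational φ hφ 2 ![u₁, u₂] w
      exact this)
    (h.iterate_rational φ hφ u₁ u₂ w) (h.associativity φ hφ u₁ u₂ w)

/-- A left module is a right module for the opposite algebra. -/
theorem IsLeftModule.isRightModule_op {𝓥 : VertexData V} (hV : IsMOSVA 𝓥)
    {gr : ℂ → Submodule ℂ W} {Y : V → W → Series W} {d D : W →ₗ[ℂ] W}
    (h : IsLeftModule 𝓥 gr Y d D) : IsRightModule 𝓥.op gr (skewOpposite D Y) d D := by
  have hL := h.isLocalAction hV.internal
  -- This is the statement that D has weight one, in the form needed to conjugate d by e^{xD}.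
  have hdD : ∀ w, d (D w) = D (d w) + D w := by
    have : d ∘ₗ D = D ∘ₗ d + D := linearMap_ext_of_isInternal h.internal fun m w hw => by
      rw [LinearMap.comp_apply, LinearMap.add_apply, LinearMap.comp_apply, h.d_grading m w hw,
        h.d_grading _ _ (h.D_weight m w hw), map_smul, add_smul, one_smul]
    exact fun w => DFunLike.congr_fun this w
  exact {
    internal := h.internal
    bilinear := hL.bilinear_skew
    D_weight := h.D_weight
    lower_bound := h.lower_bound
    d_grading := h.d_grading
    d_commutator := fun w u => by
      rw [hL.ddx_skew]
      refine hL.skew_weight_commutator hdD (a := 𝓥.d) (fun u w => ?_) w u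
      rw [← h.D_derivative]
      exact h.d_commutator u w
    creation := hL.creation_skew
    D_derivative := hL.ddx_skew
    D_commutator := fun w u => by
      rw [hV.op_D]
      exact hL.ddx_skew_eq_commutator w u
    product_rational := fun φ hφ w n u v => hV.isLocalAction.productRational_skew hV.Y_vac hL hφ w u v
    iterate_rational := fun φ hφ w a b =>
      (hV.isLocalAction.iterate_skew hV.DLin_apply hV.Y_vac hL hφ w a b).1
    associativity := fun φ hφ w a b =>
      (hV.isLocalAction.iterate_skew hV.DLin_apply hV.Y_vac hL hφ w a b).2 }

theorem IsMOSVA.d_D {𝓥 : VertexData V} (h : IsMOSVA 𝓥) (v : V) :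
    𝓥.d (h.DLin v) = h.DLin (𝓥.d v) + h.DLin v := by
  have : 𝓥.d ∘ₗ h.DLin = h.DLin ∘ₗ 𝓥.d + h.DLin :=
    linearMap_ext_of_isInternal h.internal fun m w hw => by
      rw [LinearMap.comp_apply, LinearMap.add_apply, LinearMap.comp_apply,
        VertexData.d_apply h.internal hw, h.DLin_apply, map_smul,
        VertexData.d_apply h.internal (h.D_mem hw), Int.cast_add, add_smul, Int.cast_one, one_smul,
        h.DLin_apply]
  exact DFunLike.congr_fun this v

/-- V is a left module over itself, so the results on right operators apply with W = V. -/
theorem IsMOSVA.op {𝓥 : VertexData V} (h : IsMOSVA 𝓥) : IsMOSVA 𝓥.op := by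
  have hL := h.isLocalAction
  exact {
    internal := h.internal
    bilinear := hL.bilinear_skew
    lower_bound := h.lower_bound
    d_commutator := fun u v => by
      have e : ddx (skewOpposite 𝓥.D 𝓥.Y u v) = skewOpposite 𝓥.D 𝓥.Y (𝓥.D u) v := hL.ddx_skew u v
      change _ = mulX 1 (ddx (skewOpposite 𝓥.D 𝓥.Y u v)) + _
      rw [e, add_comm]
      refine hL.skew_weight_commutator h.d_D (a := 𝓥.d) (fun u w => ?_) u v
      rw [← h.D_derivative, h.d_commutator, add_comm]
    identity := fun v => by
      -- Y^s(𝟏, x) v = e^{xD} Y(v, -x) 𝟏 = e^{xD} e^{-xD} v.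
      change expX 𝓥.D (negX (𝓥.Y v 𝓥.vac)) = _
      rw [h.Y_vac, ← negX_single]
      exact (expX_negX_expX_negX h.DLin (trunc_single v)).trans (negX_single v).symm
    creation := hL.creation_skew
    D_derivative := fun u v => by
      rw [h.op_D]
      exact hL.ddx_skew u v
    D_commutator := fun u v => by
      rw [h.op_D]
      exact hL.ddx_skew_eq_commutator u v
    product_rational := fun φ hφ n u v => by
      -- The result on right operators always has a leftmost operator, so the empty product is
      -- treated separately.
      rcases n with _ | n
      · exact (rationalSeries_of_isEmpty _).productRational fun i => i.elim0
      · have := hL.productRational_skew h.Y_vac hL hφ (u 0) (Fin.tail u) v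
        simp only [prodCoeff_succ]
        exact this
    iterate_rational := fun φ hφ u a b => (hL.iterate_skew h.DLin_apply h.Y_vac hL hφ u a b).1
    associativity := fun φ hφ u a b => (hL.iterate_skew h.DLin_apply h.Y_vac hL hφ u a b).2 }

theorem rep_zero_neg (ρ : Sl2Rep W) (w : W) :
    ρ (slL 0) (ρ (slL (-1)) w) = ρ (slL (-1)) (ρ (slL 0) w) + ρ (slL (-1)) w := by
  have h := congrArg (fun A => ρ A w) lie_slL_zero_neg
  simp only [LieHom.map_lie] at h
  rw [Ring.lie_def] at h
  exact sub_eq_iff_eq_add'.1 h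

theorem rep_zero_pos (ρ : Sl2Rep W) (w : W) :
    ρ (slL 0) (ρ (slL 1) w) = ρ (slL 1) (ρ (slL 0) w) - ρ (slL 1) w := by
  have h := congrArg (fun A => ρ A w) lie_slL_zero_pos
  simp only [LieHom.map_lie, map_neg] at h
  rw [Ring.lie_def] at h
  rw [sub_eq_add_neg]
  exact sub_eq_iff_eq_add'.1 h

theorem rep_pos_neg (ρ : Sl2Rep W) (w : W) :
    ρ (slL 1) (ρ (slL (-1)) w) = ρ (slL (-1)) (ρ (slL 1) w) + (2 : ℂ) • ρ (slL 0) w := by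
  have h := congrArg (fun A => ρ A w) lie_slL_neg_pos
  simp only [LieHom.map_lie, map_smul] at h
  rw [Ring.lie_def] at h
  have h1 : ρ (slL (-1)) (ρ (slL 1) w) - ρ (slL 1) (ρ (slL (-1)) w) = (-2 : ℂ) • ρ (slL 0) w := h
  rw [sub_eq_iff_eq_add] at h1
  rw [h1]
  module

theorem IsMoebiusMOSVA.op {𝓥 : VertexData V} {ρV : Sl2Rep V} (h : IsMoebiusMOSVA 𝓥 ρV) :
    IsMoebiusMOSVA 𝓥.op ρV := by
  have hD : 𝓥.D = ρV (slL (-1)) := (funext h.L_neg).symm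
  have hDL : h.isMOSVA.DLin = ρV (slL (-1)) := LinearMap.ext fun v => (h.L_neg v).symm
  have hL := h.isMOSVA.isLocalAction
  rw [hDL] at hL
  refine ⟨h.isMOSVA.op, h.L_zero, fun v => by rw [h.isMOSVA.op_D, h.L_neg], fun u v => ?_⟩
  have := hL.skew_sl2_commutator (A := ρV (slL 0)) (B := ρV (slL 1)) (a := ρV (slL 0))
    (b := ρV (slL 1)) (rep_zero_neg ρV) (rep_pos_neg ρV) (fun u w => ?_) (fun u w => ?_) u v
  · rw [← hD] at this
    simp only [VertexData.op, ← hD]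
    exact this
  · have e : ⇑(ρV (slL 0)) = 𝓥.d := funext h.L_zero
    rw [e, ← h.isMOSVA.D_derivative, h.isMOSVA.d_commutator, add_comm]
  · rw [hD]
    exact h.L_pos_commutator u w

/-- A Möbius left module is a Möbius right module for the opposite algebra. -/
theorem IsMoebiusLeftModule.isMoebiusRightModule_op {𝓥 : VertexData V} {ρV : Sl2Rep V}
    (hV : IsMoebiusMOSVA 𝓥 ρV) {gr : ℂ → Submodule ℂ W} {Y : V → W → Series W} {ρ : Sl2Rep W}
    (h : IsMoebiusLeftModule 𝓥 ρV gr Y ρ) :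
    IsMoebiusRightModule 𝓥.op ρV gr (skewOpposite (ρ (slL (-1))) Y) ρ := by
  have hD : 𝓥.D = ρV (slL (-1)) := (funext hV.L_neg).symm
  obtain ⟨d, hd⟩ := h.isLeftModule
  have hL := hd.isLocalAction hV.isMOSVA.internal
  have hY : ∀ u w, ρ (slL 0) ∘ Y u w - Y u (ρ (slL 0) w) =
      Y (ρV (slL 0) u) w + mulX 1 (Y (𝓥.D u) w) := fun u w => by
    rw [hD]
    exact h.L_zero_commutator u w
  refine ⟨⟨d, hd.isRightModule_op hV.isMOSVA⟩, fun w u => ?_, fun w u => ?_, h.generalized_weight⟩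
  · exact hL.skew_weight_commutator (rep_zero_neg ρ) hY w u
  · refine hL.skew_sl2_commutator (rep_zero_neg ρ) (rep_pos_neg ρ) hY (fun u w => ?_) w u
    rw [hD]
    exact h.L_pos_commutator u w

end OppositeModule

/-! ### Graded duals -/

section GradedDuals

variable {W : Type*} [AddCommGroup W] [Module ℂ W] {gr : ℂ → Submodule ℂ W}

/-- The analogue of `mem_of_eigenvector` for the non-semisimple L(0), by independence of generalized
eigenspaces. -/
theorem mem_of_generalized_eigenvector (h : DirectSum.IsInternal gr) {A : Module.End ℂ W}
    (hA : ∀ n, ∀ w ∈ gr n, ∃ m : ℕ, ((A - n • (1 : Module.End ℂ W)) ^ m) w = 0) {n : ℂ} {w : W}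
    (hw : ∃ m : ℕ, ((A - n • (1 : Module.End ℂ W)) ^ m) w = 0) : w ∈ gr n := by
  have htop : (⊤ : Submodule ℂ W) ≤ gr n ⊔ ⨆ (j) (_ : j ≠ n), gr j := by
    rw [← h.submodule_iSup_eq_top]
    refine iSup_le fun j => ?_
    by_cases hj : j = n
    · subst hj; exact le_sup_left
    · exact le_sup_of_le_right (le_iSup₂_of_le j hj le_rfl)
  obtain ⟨a, ha, b, hb, rfl⟩ := Submodule.mem_sup.1 (htop (Submodule.mem_top (x := w)))
  have hb1 : b ∈ A.maxGenEigenspace n := by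
    have h1 : a + b ∈ A.maxGenEigenspace n := (Module.End.mem_maxGenEigenspace A n _).2 hw
    have h2 : a ∈ A.maxGenEigenspace n := (Module.End.mem_maxGenEigenspace A n _).2 (hA n a ha)
    exact (Submodule.add_mem_iff_right _ h2).1 h1
  have hb2 : b ∈ ⨆ (j) (_ : j ≠ n), A.maxGenEigenspace j := by
    refine (iSup₂_mono fun j _ => fun x hx => ?_ : (⨆ (j) (_ : j ≠ n), gr j) ≤ _) hb
    exact (Module.End.mem_maxGenEigenspace A j _).2 (hA j x hx)
  have hb0 : b = 0 := by
    have := (Module.End.independent_maxGenEigenspace A n).le_bot ⟨hb1, hb2⟩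
    simpa using this
  rw [hb0, add_zero]
  exact ha

/-- An operator that raises generalized eigenvalues by `c` raises weights by `c`. -/
theorem mem_of_commutator (h : DirectSum.IsInternal gr) {A B : Module.End ℂ W}
    (hA : ∀ n, ∀ w ∈ gr n, ∃ m : ℕ, ((A - n • (1 : Module.End ℂ W)) ^ m) w = 0) {c : ℂ}
    (hAB : ∀ w, A (B w) = B (A w) + c • B w) {n : ℂ} {w : W} (hw : w ∈ gr n) :
    B w ∈ gr (n + c) := by
  refine mem_of_generalized_eigenvector h hA ?_
  obtain ⟨m, hm⟩ := hA n w hw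
  have key : ∀ (m : ℕ) (w : W), ((A - (n + c) • (1 : Module.End ℂ W)) ^ m) (B w) =
      B (((A - n • (1 : Module.End ℂ W)) ^ m) w) := by
    intro m
    induction m with
    | zero => simp
    | succ m ih =>
      intro w
      have : (A - (n + c) • (1 : Module.End ℂ W)) (B w) =
          B ((A - n • (1 : Module.End ℂ W)) w) := by
        simp only [LinearMap.sub_apply, LinearMap.smul_apply, Module.End.one_apply, hAB, map_sub,
          map_smul]
        module
      rw [pow_succ, Module.End.mul_apply, this, ih, pow_succ, Module.End.mul_apply]
  exact ⟨m, by rw [key, hm, map_zero]⟩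

/-- The projection of `W` to a homogeneous subspace. -/
def gradedProj (gr : ℂ → Submodule ℂ W) (i : ℂ) : W →ₗ[ℂ] W :=
  ofHomogeneous gr fun j => if j = i then LinearMap.id else 0

theorem gradedProj_apply_self (h : DirectSum.IsInternal gr) {i : ℂ} {w : W} (hw : w ∈ gr i) :
    gradedProj gr i w = w := by
  rw [gradedProj, ofHomogeneous_apply h _ hw, if_pos rfl, LinearMap.id_apply]

theorem gradedProj_apply_of_ne (h : DirectSum.IsInternal gr) {i j : ℂ} (hij : j ≠ i) {w : W}
    (hw : w ∈ gr j) : gradedProj gr i w = 0 := by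
  rw [gradedProj, ofHomogeneous_apply h _ hw, if_neg hij, LinearMap.zero_apply]

theorem gradedProj_mem (h : DirectSum.IsInternal gr) (i : ℂ) (w : W) :
    gradedProj gr i w ∈ gr i := by
  refine isInternal_induction h (p := fun w => gradedProj gr i w ∈ gr i) (fun j w hw => ?_)
    (by simp) (fun v w hv hw => by rw [map_add]; exact (gr i).add_mem hv hw) w
  by_cases hij : j = i
  · subst hij
    rwa [gradedProj_apply_self h hw]
  · rw [gradedProj_apply_of_ne h hij hw]
    exact (gr i).zero_mem

theorem comp_gradedProj_mem (h : DirectSum.IsInternal gr) (i : ℂ) (φ : Module.Dual ℂ W) :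
    φ ∘ₗ gradedProj gr i ∈ gradedDual gr := by
  refine (Set.finite_singleton i).subset ?_
  rintro j ⟨w, hw, hne⟩
  by_contra hji
  refine hne ?_
  rw [LinearMap.comp_apply, gradedProj_apply_of_ne h hji hw, map_zero]

theorem comp_gradedProj_mem_gradedDualGr (h : DirectSum.IsInternal gr) (i : ℂ)
    (φ : Module.Dual ℂ W) :
    (⟨φ ∘ₗ gradedProj gr i, comp_gradedProj_mem h i φ⟩ : gradedDual gr) ∈ gradedDualGr gr i := by
  intro j hj w hw
  change φ (gradedProj gr i w) = 0
  rw [gradedProj_apply_of_ne h hj hw, map_zero]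

theorem eq_comp_gradedProj (h : DirectSum.IsInternal gr) {i : ℂ} {φ : gradedDual gr}
    (hφ : φ ∈ gradedDualGr gr i) : φ.1 = φ.1 ∘ₗ gradedProj gr i := by
  refine linearMap_ext_of_isInternal h fun j w hw => ?_
  rw [LinearMap.comp_apply]
  by_cases hij : j = i
  · subst hij
    rw [gradedProj_apply_self h hw]
  · rw [gradedProj_apply_of_ne h hij hw, map_zero, hφ j hij w hw]

/-- The transpose of an operator on `W`, as an operator on the graded dual. -/
def dualEnd (T : W →ₗ[ℂ] W) (hT : ∀ φ ∈ gradedDual gr, φ ∘ₗ T ∈ gradedDual gr) :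
    gradedDual gr →ₗ[ℂ] gradedDual gr where
  toFun φ := ⟨φ.1 ∘ₗ T, hT φ.1 φ.2⟩
  map_add' φ ψ := by ext w; rfl
  map_smul' c φ := by ext w; rfl

theorem dualEnd_apply (T : W →ₗ[ℂ] W) (hT : ∀ φ ∈ gradedDual gr, φ ∘ₗ T ∈ gradedDual gr)
    (φ : gradedDual gr) (w : W) : (dualEnd T hT φ).1 w = φ.1 (T w) := rfl

theorem gradedDual_ext {φ ψ : gradedDual gr} (h : ∀ w, φ.1 w = ψ.1 w) : φ = ψ :=
  Subtype.ext (LinearMap.ext h)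

/-- Independence holds because the pieces lie in distinct eigenspaces of the transposed grading
operator. They span because a functional in the graded dual is the sum of its finitely many nonzero
restrictions. -/
theorem isInternal_gradedDualGr (h : DirectSum.IsInternal gr) :
    DirectSum.IsInternal (gradedDualGr gr) := by
  rw [DirectSum.isInternal_submodule_iff_iSupIndep_and_iSup_eq_top]
  constructor
  · set d : W →ₗ[ℂ] W := ofHomogeneous gr fun n => n • LinearMap.id with hd
    have hdw : ∀ n, ∀ w ∈ gr n, d w = n • w := fun n w hw => by
      rw [hd, ofHomogeneous_apply h _ hw]
      rfl
    refine (Module.End.eigenspaces_iSupIndep (dualEnd d fun φ hφ =>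
      comp_mem_gradedDual hφ (e := id) Function.injective_id fun n w hw => by
        rw [hdw n w hw]
        exact (gr n).smul_mem _ hw)).mono fun i φ hφ => ?_
    rw [Module.End.mem_eigenspace_iff]
    refine gradedDual_ext fun w => ?_
    rw [dualEnd_apply]
    refine DFunLike.congr_fun (linearMap_ext_of_isInternal h (f := φ.1 ∘ₗ d) (g := i • φ.1)
      fun n w hw => ?_) w
    rw [LinearMap.comp_apply, hdw n w hw, map_smul, LinearMap.smul_apply]
    by_cases hn : n = i
    · rw [hn]
    · rw [hφ n hn w hw, smul_zero, smul_zero]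
  · rw [eq_top_iff]
    rintro φ -
    have hfin := φ.2
    have e : φ = ∑ i ∈ hfin.toFinset, (⟨φ.1 ∘ₗ gradedProj gr i, comp_gradedProj_mem h i φ.1⟩ :
        gradedDual gr) := by
      refine Subtype.ext (linearMap_ext_of_isInternal h fun j w hw => ?_)
      rw [AddSubmonoidClass.coe_finsetSum, LinearMap.sum_apply]
      simp only [LinearMap.comp_apply]
      rw [Finset.sum_eq_single j, gradedProj_apply_self h hw]
      · intro i _ hij
        rw [gradedProj_apply_of_ne h hij.symm hw, map_zero]
      · intro hj
        rw [gradedProj_apply_self h hw]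
        by_contra hne
        exact hj (hfin.mem_toFinset.2 ⟨w, hw, hne⟩)
    rw [e]
    exact Submodule.sum_mem _ fun i _ =>
      Submodule.mem_iSup_of_mem i (comp_gradedProj_mem_gradedDualGr h i φ.1)

/-- A graded space with finite-dimensional homogeneous subspaces is its own double graded dual. -/
theorem exists_eq_eval (h : DirectSum.IsInternal gr) (hfin : GradingRestricted gr)
    {Φ : Module.Dual ℂ (gradedDual gr)} (hΦ : Φ ∈ gradedDual (gradedDualGr gr)) :
    ∃ w : W, ∀ φ : gradedDual gr, Φ φ = φ.1 w := by
  -- Reflexivity of the finite-dimensional space W_[m], whose dual is embedded in the graded dual by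
  -- extension by zero.
  have hloc : ∀ m, ∃ w ∈ gr m, ∀ φ ∈ gradedDualGr gr m, Φ φ = φ.1 w := by
    intro m
    have := hfin m
    let π : W →ₗ[ℂ] gr m := (gradedProj gr m).codRestrict (gr m) (gradedProj_mem h m)
    let ext' : Module.Dual ℂ (gr m) →ₗ[ℂ] gradedDual gr :=
      LinearMap.codRestrict (gradedDual gr) π.dualMap fun f => by
        refine (Set.finite_singleton m).subset ?_
        rintro j ⟨w, hw, hne⟩
        by_contra hji
        refine hne ?_
        have : π w = 0 := Subtype.ext (gradedProj_apply_of_ne h hji hw)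
        rw [LinearMap.dualMap_apply, this, map_zero]
    obtain ⟨w, hw⟩ := (Module.evalEquiv ℂ (gr m)).surjective (Φ ∘ₗ ext')
    refine ⟨w, w.2, fun φ hφ => ?_⟩
    have e : ext' (φ.1 ∘ₗ (gr m).subtype) = φ := by
      refine Subtype.ext (Eq.trans ?_ (eq_comp_gradedProj h hφ).symm)
      rfl
    have h2 := DFunLike.congr_fun hw (φ.1 ∘ₗ (gr m).subtype)
    rw [LinearMap.comp_apply, e] at h2
    rw [← h2]
    rfl
  choose w hw hΦw using hloc
  refine ⟨∑ m ∈ hΦ.toFinset, w m, fun φ => ?_⟩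
  refine isInternal_induction (isInternal_gradedDualGr h)
    (p := fun φ : gradedDual gr => Φ φ = φ.1 (∑ m ∈ hΦ.toFinset, w m)) (fun m φ hφ => ?_)
    (by simp) (fun φ ψ h1 h2 => by
      rw [map_add, h1, h2]
      rfl) φ
  rw [map_sum]
  by_cases hm : m ∈ hΦ.toFinset
  · rw [Finset.sum_eq_single m (fun j _ hj => hφ j hj _ (hw j)) (fun hne => absurd hm hne)]
    exact hΦw m φ hφ
  · rw [Finset.sum_eq_zero fun j hj => hφ j (fun e => hm (e ▸ hj)) _ (hw j)]
    by_contra hne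
    exact hm (hΦ.mem_toFinset.2 ⟨φ, hφ, hne⟩)

end GradedDuals

/-! ### Weights and the operators of sl(2) -/

section Weights

variable {V W : Type*} [AddCommGroup V] [Module ℂ V] [AddCommGroup W] [Module ℂ W]

theorem IsMoebiusMOSVA.L_zero_apply {𝓥 : VertexData V} {ρV : Sl2Rep V}
    (h : IsMoebiusMOSVA 𝓥 ρV) {n : ℤ} {v : V} (hv : v ∈ 𝓥.gr n) : ρV (slL 0) v = (n : ℂ) • v := by
  rw [h.L_zero, VertexData.d_apply h.isMOSVA.internal hv]

theorem IsMoebiusMOSVA.L_pos_mem {𝓥 : VertexData V} {ρV : Sl2Rep V}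
    (h : IsMoebiusMOSVA 𝓥 ρV) {n : ℤ} {v : V} (hv : v ∈ 𝓥.gr n) : ρV (slL 1) v ∈ 𝓥.gr (n - 1) := by
  refine mem_of_eigenvector h.isMOSVA.internal (f := fun n : ℤ => (n : ℂ)) Int.cast_injective
    (fun n v hv => VertexData.d_apply h.isMOSVA.internal hv) ?_
  rw [← h.L_zero, rep_zero_pos, h.L_zero_apply hv, map_smul]
  push_cast
  module

theorem IsMoebiusMOSVA.L_pos_pow_mem {𝓥 : VertexData V} {ρV : Sl2Rep V}
    (h : IsMoebiusMOSVA 𝓥 ρV) {n : ℤ} {v : V} (hv : v ∈ 𝓥.gr n) (j : ℕ) :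
    (ρV (slL 1) ^ j) v ∈ 𝓥.gr (n - j) := by
  induction j with
  | zero => simpa using hv
  | succ j ih =>
    rw [pow_succ', Module.End.mul_apply]
    have := h.L_pos_mem ih
    convert this using 2
    push_cast
    ring

theorem IsMoebiusMOSVA.exists_L_pos_pow_eq_zero {𝓥 : VertexData V} {ρV : Sl2Rep V}
    (h : IsMoebiusMOSVA 𝓥 ρV) {n : ℤ} {v : V} (hv : v ∈ 𝓥.gr n) :
    ∃ J : ℕ, ∀ j ≥ J, (ρV (slL 1) ^ j) v = 0 := by
  obtain ⟨N, hN⟩ := h.isMOSVA.lower_bound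
  refine ⟨(n - N + 1).toNat, fun j hj => ?_⟩
  have := h.L_pos_pow_mem hv j
  rwa [hN _ (by omega), Submodule.mem_bot] at this

/-- L(0) and L(-1) kill the vacuum, so the bracket of L(1) with Y(𝟏, x) = 1 leaves only Y(L(1) 𝟏, x)
𝟏, whose constant term is L(1) 𝟏. -/
theorem IsMoebiusMOSVA.L_pos_vac {𝓥 : VertexData V} {ρV : Sl2Rep V}
    (h : IsMoebiusMOSVA 𝓥 ρV) : ρV (slL 1) 𝓥.vac = 0 := by
  have h0 : ρV (slL 0) 𝓥.vac = 0 := by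
    rw [h.L_zero_apply h.isMOSVA.vac_mem]
    simp
  have h1 : ρV (slL (-1)) 𝓥.vac = 0 := by
    rw [h.L_neg, VertexData.D, h.isMOSVA.identity, ddx]
    simp
  have h2 := congrFun (h.L_pos_commutator 𝓥.vac 𝓥.vac) 0
  rw [h0, h1, h.isMOSVA.identity, h.isMOSVA.identity] at h2
  simp only [h.isMOSVA.bilinear.zero_left, Pi.add_apply, Pi.sub_apply, Pi.smul_apply, mulX,
    Function.comp, Pi.single_eq_same, sub_self, Pi.zero_apply, smul_zero, add_zero,
    (h.isMOSVA.creation (ρV (slL 1) 𝓥.vac)).2] at h2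
  exact h2.symm

theorem IsMoebiusLeftModule.L_zero_mem {𝓥 : VertexData V} {ρV : Sl2Rep V}
    {gr : ℂ → Submodule ℂ W} {Y : V → W → Series W} {ρ : Sl2Rep W}
    (h : IsMoebiusLeftModule 𝓥 ρV gr Y ρ) {n : ℂ} {w : W} (hw : w ∈ gr n) :
    ρ (slL 0) w ∈ gr n := by
  obtain ⟨d, hd⟩ := h.isLeftModule
  simpa using mem_of_commutator hd.internal h.generalized_weight (B := ρ (slL 0)) (c := 0)
    (fun w => by simp) hw

theorem IsMoebiusLeftModule.L_pos_mem {𝓥 : VertexData V} {ρV : Sl2Rep V}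
    {gr : ℂ → Submodule ℂ W} {Y : V → W → Series W} {ρ : Sl2Rep W}
    (h : IsMoebiusLeftModule 𝓥 ρV gr Y ρ) {n : ℂ} {w : W} (hw : w ∈ gr n) :
    ρ (slL 1) w ∈ gr (n + -1) := by
  obtain ⟨d, hd⟩ := h.isLeftModule
  exact mem_of_commutator hd.internal h.generalized_weight (B := ρ (slL 1)) (c := -1)
    (fun w => by rw [rep_zero_pos, sub_eq_add_neg, neg_one_smul]) hw

theorem IsMoebiusLeftModule.L_neg_mem {𝓥 : VertexData V} {ρV : Sl2Rep V}
    {gr : ℂ → Submodule ℂ W} {Y : V → W → Series W} {ρ : Sl2Rep W}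
    (h : IsMoebiusLeftModule 𝓥 ρV gr Y ρ) {n : ℂ} {w : W} (hw : w ∈ gr n) :
    ρ (slL (-1)) w ∈ gr (n + 1) := by
  obtain ⟨d, hd⟩ := h.isLeftModule
  exact hd.D_weight n w hw

end Weights

/-! ### The opposite vertex operator -/

section Opposite

variable {V W : Type*} [AddCommGroup V] [Module ℂ V] [AddCommGroup W] [Module ℂ W]
  {𝓥 : VertexData V} {ρV : Sl2Rep V} {gr : ℂ → Submodule ℂ W} {Y : V → W → Series W}
  {ρ : Sl2Rep W}

namespace IsMoebiusMOSVA

theorem negInvSqPow_apply (hV : IsMoebiusMOSVA 𝓥 ρV) {n : ℤ} {u : V} (hu : u ∈ 𝓥.gr n) :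
    negInvSqPow 𝓥 u = mulX (-2 * n) (Pi.single 0 ((-1 : ℂ) ^ n • u)) := by
  rw [negInvSqPow, ofHomogeneous_apply hV.isMOSVA.internal _ hu]
  funext k
  rw [LinearMap.smul_apply, Pi.smul_apply, LinearMap.single_apply, mulX]
  by_cases hk : k = -2 * n
  · subst hk
    simp
  · rw [Pi.single_eq_of_ne hk, Pi.single_eq_of_ne (sub_ne_zero.2 hk), smul_zero]

theorem trunc_negInvSqPow (hV : IsMoebiusMOSVA 𝓥 ρV) (u : V) : Trunc (negInvSqPow 𝓥 u) := by
  refine isInternal_induction hV.isMOSVA.internal (p := fun u => Trunc (negInvSqPow 𝓥 u))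
    (fun n u hu => ?_) ⟨0, fun k _ => by rw [map_zero]; rfl⟩ (fun u v h1 h2 => ?_) u
  · rw [hV.negInvSqPow_apply hu]
    exact (trunc_single _).mulX _
  · rw [map_add]
    exact h1.add h2

theorem expX_negInvSqPow_apply (hV : IsMoebiusMOSVA 𝓥 ρV) {n : ℤ} {u : V} (hu : u ∈ 𝓥.gr n)
    (j : ℕ) : expX (ρV (slL 1)) (negInvSqPow 𝓥 u) (j - 2 * n) =
      ((-1 : ℂ) ^ n) • ((j.factorial : ℂ)⁻¹) • (ρV (slL 1) ^ j) u := by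
  rw [hV.negInvSqPow_apply hu, expX_mulX, mulX, show (j : ℤ) - 2 * n - -2 * n = j by ring,
    expX_single, map_smul, smul_comm]

theorem expX_negInvSqPow_eq_zero (hV : IsMoebiusMOSVA 𝓥 ρV) {n : ℤ} {u : V} (hu : u ∈ 𝓥.gr n)
    {p : ℤ} (hp : p < -2 * n) : expX (ρV (slL 1)) (negInvSqPow 𝓥 u) p = 0 := by
  rw [hV.negInvSqPow_apply hu, expX_mulX, mulX, expX_single_of_neg _ _ (by omega)]

theorem support_expX_negInvSqPow (hV : IsMoebiusMOSVA 𝓥 ρV) {n : ℤ} {u : V} (hu : u ∈ 𝓥.gr n)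
    {J : ℕ} (hJ : ∀ j ≥ J, (ρV (slL 1) ^ j) u = 0) {p : ℤ}
    (hp : expX (ρV (slL 1)) (negInvSqPow 𝓥 u) p ≠ 0) :
    p ∈ (Finset.range J).image fun j : ℕ => (j : ℤ) - 2 * n := by
  have h1 : -2 * n ≤ p := by
    by_contra h
    exact hp (hV.expX_negInvSqPow_eq_zero hu (by omega))
  obtain ⟨j, hj⟩ := Int.eq_ofNat_of_zero_le (show 0 ≤ p + 2 * n by omega)
  obtain rfl : p = j - 2 * n := by omega
  rw [hV.expX_negInvSqPow_apply hu] at hp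
  refine Finset.mem_image_of_mem _ (Finset.mem_range.2 (by_contra fun h => hp ?_))
  rw [hJ j (by omega), smul_zero, smul_zero]

/-- L(1) lowers weights and V is bounded below. Hence the first argument of the opposite operator is
a Laurent polynomial, and the formal sum that defines the operator is a genuine finite sum. -/
theorem finite_support_expX_negInvSqPow (hV : IsMoebiusMOSVA 𝓥 ρV) (u : V) :
    (Function.support (expX (ρV (slL 1)) (negInvSqPow 𝓥 u))).Finite := by
  refine isInternal_induction hV.isMOSVA.internal
    (p := fun u => (Function.support (expX (ρV (slL 1)) (negInvSqPow 𝓥 u))).Finite)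
    (fun n u hu => ?_) ?_ (fun u v h1 h2 => ?_) u
  · obtain ⟨J, hJ⟩ := hV.exists_L_pos_pow_eq_zero hu
    exact (Finset.finite_toSet _).subset fun p hp => hV.support_expX_negInvSqPow hu hJ hp
  · exact (Finset.finite_toSet _).subset fun p hp =>
      hV.support_expX_negInvSqPow (n := 0) (zero_mem _) (J := 0) (fun j _ => map_zero _) hp
  · rw [map_add, expX_add _ (hV.trunc_negInvSqPow u) (hV.trunc_negInvSqPow v)]
    exact (h1.union h2).subset (Function.support_add _ _)

/-- Any `J` beyond the nilpotency order of L(1) on `u` is allowed, so that sums with shifted indices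
can be compared. -/
theorem opposite_apply (hV : IsMoebiusMOSVA 𝓥 ρV) (hY : IsBilinear Y) {n : ℤ} {u : V}
    (hu : u ∈ 𝓥.gr n) {J : ℕ} (hJ : ∀ j ≥ J, (ρV (slL 1) ^ j) u = 0) (w : W) (k : ℤ) :
    oppositeVertexOperator 𝓥 ρV Y u w k = ((-1 : ℂ) ^ n) • ∑ j ∈ Finset.range J,
      ((j.factorial : ℂ)⁻¹) • Y ((ρV (slL 1) ^ j) u) w (j - 2 * n - k) := by
  rw [oppositeVertexOperator, finsum_eq_sum_of_support_subset
    (s := (Finset.range J).image fun j : ℕ => (j : ℤ) - 2 * n), Finset.sum_image, Finset.smul_sum]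
  · refine Finset.sum_congr rfl fun j _ => ?_
    rw [hV.expX_negInvSqPow_apply hu, hY.smul_left, hY.smul_left]
    rfl
  · intro i _ j _ h
    simpa using h
  · intro p hp
    refine hV.support_expX_negInvSqPow hu hJ fun h => hp ?_
    simp only [h, hY.zero_left, Pi.zero_apply]

theorem bilinear_opposite (hV : IsMoebiusMOSVA 𝓥 ρV) (hY : IsBilinear Y) :
    IsBilinear (oppositeVertexOperator 𝓥 ρV Y) := by
  have hfin : ∀ (u : V) (w : W) (k : ℤ), (Function.support fun p : ℤ =>
      Y (expX (ρV (slL 1)) (negInvSqPow 𝓥 u) p) w (p - k)).Finite := fun u w k =>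
    (hV.finite_support_expX_negInvSqPow u).subset fun p hp h => hp (by
      simp only [h, hY.zero_left]
      rfl)
  refine ⟨fun w => ⟨fun u v => funext fun k => ?_, fun c u => funext fun k => ?_⟩,
    fun u => ⟨fun w w' => funext fun k => ?_, fun c w => funext fun k => ?_⟩⟩
  · simp only [oppositeVertexOperator, Pi.add_apply]
    rw [map_add, expX_add _ (hV.trunc_negInvSqPow u) (hV.trunc_negInvSqPow v),
      ← finsum_add_distrib (hfin u w k) (hfin v w k)]
    exact finsum_congr fun p => by rw [Pi.add_apply, hY.add_left, Pi.add_apply]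
  · simp only [oppositeVertexOperator, Pi.smul_apply]
    rw [map_smul, expX_smul _ _ (hV.trunc_negInvSqPow u), smul_finsum]
    exact finsum_congr fun p => by rw [Pi.smul_apply, hY.smul_left, Pi.smul_apply]
  · simp only [oppositeVertexOperator, Pi.add_apply]
    rw [← finsum_add_distrib (hfin u w k) (hfin u w' k)]
    exact finsum_congr fun p => by rw [hY.add_right, Pi.add_apply]
  · simp only [oppositeVertexOperator, Pi.smul_apply]
    rw [smul_finsum]
    exact finsum_congr fun p => by rw [hY.smul_right, Pi.smul_apply]

/-- Moving L(-1) through each L(1) costs 2 L(0), and the eigenvalues 2(n - i) for i = 0, …, j add up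
to (j + 1)(2n - j). -/
theorem L_pos_pow_L_neg (hV : IsMoebiusMOSVA 𝓥 ρV) {n : ℤ} {u : V} (hu : u ∈ 𝓥.gr n) (j : ℕ) :
    (ρV (slL 1) ^ (j + 1)) (ρV (slL (-1)) u) = ρV (slL (-1)) ((ρV (slL 1) ^ (j + 1)) u) +
      (((j + 1 : ℕ) : ℂ) * (2 * n - j)) • (ρV (slL 1) ^ j) u := by
  induction j with
  | zero =>
    simp only [zero_add, pow_one, pow_zero, Module.End.one_apply, rep_pos_neg,
      hV.L_zero_apply hu, smul_smul]
    simp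
  | succ j ih =>
    have e : ∀ (i : ℕ) (v : V), ρV (slL 1) ((ρV (slL 1) ^ i) v) = (ρV (slL 1) ^ (i + 1)) v :=
      fun i v => by rw [pow_succ', Module.End.mul_apply]
    rw [← e, ih, map_add, rep_pos_neg, map_smul, e, e, add_assoc,
      hV.L_zero_apply (hV.L_pos_pow_mem hu (j + 1))]
    congr 1
    rw [smul_smul, ← add_smul]
    congr 1
    push_cast
    ring

theorem opposite_vac (hV : IsMoebiusMOSVA 𝓥 ρV) (hY : IsBilinear Y)
    (hvac : ∀ w, Y 𝓥.vac w = Pi.single 0 w) (w : W) :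
    oppositeVertexOperator 𝓥 ρV Y 𝓥.vac w = Pi.single 0 w := by
  funext k
  have hJ : ∀ j ≥ 1, (ρV (slL 1) ^ j) 𝓥.vac = 0 := by
    rintro (_ | j) hj
    · omega
    · rw [pow_succ, Module.End.mul_apply, hV.L_pos_vac, map_zero]
  rw [hV.opposite_apply hY hV.isMOSVA.vac_mem hJ]
  simp only [zpow_zero, one_smul, Finset.sum_range_one, Nat.factorial_zero, Nat.cast_one, inv_one,
    pow_zero, Module.End.one_apply, hvac]
  rcases eq_or_ne k 0 with rfl | hk
  · simp
  · rw [Pi.single_eq_of_ne hk, Pi.single_eq_of_ne (by simpa using hk)]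

end IsMoebiusMOSVA

namespace IsMoebiusLeftModule

theorem bilinear (h : IsMoebiusLeftModule 𝓥 ρV gr Y ρ) : IsBilinear Y := by
  obtain ⟨d, hd⟩ := h.isLeftModule
  exact hd.bilinear

theorem Y_L_neg_apply (hV : IsMoebiusMOSVA 𝓥 ρV) (h : IsMoebiusLeftModule 𝓥 ρV gr Y ρ) (u : V)
    (w : W) (p : ℤ) : Y (ρV (slL (-1)) u) w p = ((p + 1 : ℤ) : ℂ) • Y u w (p + 1) := by
  obtain ⟨d, hd⟩ := h.isLeftModule
  rw [hV.L_neg, ← hd.D_derivative]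
  rfl

theorem L_neg_Y_apply (h : IsMoebiusLeftModule 𝓥 ρV gr Y ρ) (u : V) (w : W) (p : ℤ) :
    ρ (slL (-1)) (Y u w p) =
      Y u (ρ (slL (-1)) w) p + ((p + 1 : ℤ) : ℂ) • Y u w (p + 1) := by
  obtain ⟨d, hd⟩ := h.isLeftModule
  have := congrFun (hd.D_commutator u w) p
  exact (sub_eq_iff_eq_add'.1 this.symm)

theorem L_zero_Y_apply (hV : IsMoebiusMOSVA 𝓥 ρV) (h : IsMoebiusLeftModule 𝓥 ρV gr Y ρ) {n : ℤ}
    {u : V} (hu : u ∈ 𝓥.gr n) (w : W) (p : ℤ) :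
    ρ (slL 0) (Y u w p) = Y u (ρ (slL 0) w) p + ((n + p : ℤ) : ℂ) • Y u w p := by
  have := congrFun (h.L_zero_commutator u w) p
  rw [hV.L_zero_apply hu, h.bilinear.smul_left] at this
  refine (sub_eq_iff_eq_add'.1 this).trans ?_
  simp only [Pi.add_apply, Pi.smul_apply, mulX, h.Y_L_neg_apply hV, sub_add_cancel]
  rw [← add_smul]
  push_cast
  rfl

theorem L_pos_Y_apply (hV : IsMoebiusMOSVA 𝓥 ρV) (h : IsMoebiusLeftModule 𝓥 ρV gr Y ρ) {n : ℤ}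
    {u : V} (hu : u ∈ 𝓥.gr n) (w : W) (p : ℤ) :
    ρ (slL 1) (Y u w p) = Y u (ρ (slL 1) w) p + (Y (ρV (slL 1) u) w p +
      ((2 * n + p - 1 : ℤ) : ℂ) • Y u w (p - 1)) := by
  have := congrFun (h.L_pos_commutator u w) p
  rw [hV.L_zero_apply hu, h.bilinear.smul_left] at this
  refine (sub_eq_iff_eq_add'.1 this).trans ?_
  simp only [Pi.add_apply, Pi.smul_apply, mulX, h.Y_L_neg_apply hV,
    show p - 2 + 1 = p - 1 by ring]
  rw [smul_smul, add_assoc, ← add_smul]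
  push_cast
  congr 4
  ring

theorem Y_mem (hV : IsMoebiusMOSVA 𝓥 ρV) (h : IsMoebiusLeftModule 𝓥 ρV gr Y ρ) {n : ℤ} {m : ℂ}
    {u : V} (hu : u ∈ 𝓥.gr n) {w : W} (hw : w ∈ gr m) (p : ℤ) :
    Y u w p ∈ gr (m + ((n + p : ℤ) : ℂ)) := by
  obtain ⟨d, hd⟩ := h.isLeftModule
  have := (hd.isGradedAction hV.isMOSVA.internal).Y_mem n u hu m w hw p
  convert this using 2
  simp
  ring

theorem opposite_mem (hV : IsMoebiusMOSVA 𝓥 ρV) (h : IsMoebiusLeftModule 𝓥 ρV gr Y ρ) {n : ℤ}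
    {m : ℂ} {u : V} (hu : u ∈ 𝓥.gr n) {w : W} (hw : w ∈ gr m) (k : ℤ) :
    oppositeVertexOperator 𝓥 ρV Y u w k ∈ gr (m - ((n + k : ℤ) : ℂ)) := by
  obtain ⟨J, hJ⟩ := hV.exists_L_pos_pow_eq_zero hu
  rw [hV.opposite_apply h.bilinear hu hJ]
  refine Submodule.smul_mem _ _ (Submodule.sum_mem _ fun j _ => Submodule.smul_mem _ _ ?_)
  convert h.Y_mem hV (hV.L_pos_pow_mem hu j) hw (j - 2 * n - k) using 2
  push_cast
  ring

theorem opposite_L_zero (hV : IsMoebiusMOSVA 𝓥 ρV) (h : IsMoebiusLeftModule 𝓥 ρV gr Y ρ) {n : ℤ}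
    {u : V} (hu : u ∈ 𝓥.gr n) (w : W) (k : ℤ) :
    oppositeVertexOperator 𝓥 ρV Y u (ρ (slL 0) w) k =
      ρ (slL 0) (oppositeVertexOperator 𝓥 ρV Y u w k) +
        ((n + k : ℤ) : ℂ) • oppositeVertexOperator 𝓥 ρV Y u w k := by
  obtain ⟨J, hJ⟩ := hV.exists_L_pos_pow_eq_zero hu
  simp only [hV.opposite_apply h.bilinear hu hJ, map_smul, map_sum, Finset.smul_sum]
  rw [← Finset.sum_add_distrib]
  refine Finset.sum_congr rfl fun j _ => ?_
  rw [h.L_zero_Y_apply hV (hV.L_pos_pow_mem hu j)]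
  push_cast
  module

/-- Transposed, this is the bracket of L'(-1) with Y'. In the bracket of L(1) with the terms of the
sum, Y(L(1)^{j+1} u) cancels against the index shift j / j!, and only the derivative survives. -/
theorem ddx_opposite (hV : IsMoebiusMOSVA 𝓥 ρV) (h : IsMoebiusLeftModule 𝓥 ρV gr Y ρ) {n : ℤ}
    {u : V} (hu : u ∈ 𝓥.gr n) (w : W) (k : ℤ) :
    oppositeVertexOperator 𝓥 ρV Y u (ρ (slL 1) w) k =
      ρ (slL 1) (oppositeVertexOperator 𝓥 ρV Y u w k) +
        ((k + 1 : ℤ) : ℂ) • oppositeVertexOperator 𝓥 ρV Y u w (k + 1) := by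
  obtain ⟨J, hJ⟩ := hV.exists_L_pos_pow_eq_zero hu
  have hJ1 : ∀ j ≥ J + 1, (ρV (slL 1) ^ j) u = 0 := fun j hj => hJ j (by omega)
  have hshift := sum_range_inv_factorial_smul J
    (fun j => Y ((ρV (slL 1) ^ j) u) w (j - 2 * n - (k + 1)))
  rw [hV.opposite_apply h.bilinear hu hJ, hV.opposite_apply h.bilinear hu hJ,
    hV.opposite_apply h.bilinear hu hJ1, map_smul, smul_comm (((k + 1 : ℤ) : ℂ)), ← smul_add,
    map_sum]
  congr 1
  have e : ∀ j : ℕ, ρ (slL 1) ((j.factorial : ℂ)⁻¹ • Y ((ρV (slL 1) ^ j) u) w (j - 2 * n - k)) =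
      (j.factorial : ℂ)⁻¹ • Y ((ρV (slL 1) ^ j) u) (ρ (slL 1) w) (j - 2 * n - k) +
      (j.factorial : ℂ)⁻¹ • Y ((ρV (slL 1) ^ (j + 1)) u) w ((j + 1 : ℕ) - 2 * n - (k + 1)) -
      (((k + 1 : ℤ) : ℂ) • (j.factorial : ℂ)⁻¹ •
        Y ((ρV (slL 1) ^ j) u) w (j - 2 * n - (k + 1)) +
      (j.factorial : ℂ)⁻¹ • (j : ℂ) • Y ((ρV (slL 1) ^ j) u) w (j - 2 * n - (k + 1))) := by
    intro j
    rw [map_smul, h.L_pos_Y_apply hV (hV.L_pos_pow_mem hu j), pow_succ', Module.End.mul_apply,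
      show (j : ℤ) - 2 * n - k - 1 = j - 2 * n - (k + 1) by ring,
      show ((j + 1 : ℕ) : ℤ) - 2 * n - (k + 1) = j - 2 * n - k by push_cast; ring]
    push_cast
    module
  have e0 : Y ((ρV (slL 1) ^ J) u) w = 0 := by rw [hJ J le_rfl, h.bilinear.zero_left]
  rw [Finset.sum_range_succ] at hshift
  simp only [e, Finset.sum_sub_distrib, Finset.sum_add_distrib, ← Finset.smul_sum,
    Finset.sum_range_succ, e0, Pi.zero_apply, smul_zero, add_zero] at hshift ⊢
  rw [hshift]
  module

/-- The D-derivative property of the opposite operator. L(-1) is moved to the left of the powers of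
L(1), where it differentiates Y; the correction terms supply the derivative of the factors x^{j -
2n}. -/
theorem opposite_L_neg (hV : IsMoebiusMOSVA 𝓥 ρV) (h : IsMoebiusLeftModule 𝓥 ρV gr Y ρ) {n : ℤ}
    {u : V} (hu : u ∈ 𝓥.gr n) (w : W) (k : ℤ) :
    oppositeVertexOperator 𝓥 ρV Y (ρV (slL (-1)) u) w k =
      ((k + 1 : ℤ) : ℂ) • oppositeVertexOperator 𝓥 ρV Y u w (k + 1) := by
  obtain ⟨J, hJ⟩ := hV.exists_L_pos_pow_eq_zero hu
  have hu' : ρV (slL (-1)) u ∈ 𝓥.gr (n + 1) := by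
    rw [hV.L_neg]
    exact hV.isMOSVA.D_mem hu
  have hJ1 : ∀ j ≥ J + 1, (ρV (slL 1) ^ j) (ρV (slL (-1)) u) = 0 := by
    rintro (_ | j) hj
    · omega
    · rw [hV.L_pos_pow_L_neg hu, hJ j (by omega), hJ (j + 1) (by omega), map_zero, smul_zero,
        add_zero]
  rw [hV.opposite_apply h.bilinear hu' hJ1, hV.opposite_apply h.bilinear hu hJ,
    neg_one_zpow_add_one, neg_smul, ← smul_neg, smul_comm (((k + 1 : ℤ) : ℂ))]
  congr 1
  let f : ℕ → W := fun j => Y ((ρV (slL 1) ^ j) u) w (j - 2 * n - (k + 1))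
  have hshift := sum_range_inv_factorial_smul J f
  have h2 := sum_range_inv_factorial_smul J fun j => ((2 * n - j + 1 : ℤ) : ℂ) • f (j - 1)
  -- At j = 0 the term with f (j - 1) carries the factor j, so the truncated subtraction does no
  -- harm.
  have e : ∀ j : ℕ, (j.factorial : ℂ)⁻¹ •
      Y ((ρV (slL 1) ^ j) (ρV (slL (-1)) u)) w (j - 2 * (n + 1) - k) =
      (j.factorial : ℂ)⁻¹ • (j : ℂ) • f j - ((2 * n + k + 1 : ℤ) : ℂ) • (j.factorial : ℂ)⁻¹ • f j
      + (j.factorial : ℂ)⁻¹ • (j : ℂ) • ((2 * n - j + 1 : ℤ) : ℂ) • f (j - 1) := by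
    intro j
    have e1 : Y (ρV (slL (-1)) ((ρV (slL 1) ^ j) u)) w (j - 2 * (n + 1) - k) =
        ((j - 2 * n - k - 1 : ℤ) : ℂ) • f j := by
      rw [h.Y_L_neg_apply hV, show (j : ℤ) - 2 * (n + 1) - k + 1 = j - 2 * n - k - 1 by ring]
      simp only [f, show (j : ℤ) - 2 * n - k - 1 = j - 2 * n - (k + 1) by ring]
    rcases j with _ | j
    · rw [pow_zero, Module.End.one_apply] at e1 ⊢
      rw [e1]
      push_cast
      module
    · rw [hV.L_pos_pow_L_neg hu, h.bilinear.add_left, h.bilinear.smul_left, Pi.add_apply,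
        Pi.smul_apply, e1, show ((j + 1 : ℕ) : ℤ) - 2 * (n + 1) - k = j - 2 * n - (k + 1) by
          push_cast; ring, Nat.add_sub_cancel]
      push_cast
      module
  have e0 : f J = 0 := by
    simp only [f]
    rw [hJ J le_rfl, h.bilinear.zero_left]
    rfl
  have e3 : ∀ j : ℕ, (j.factorial : ℂ)⁻¹ • ((2 * n - (j + 1 : ℕ) + 1 : ℤ) : ℂ) • f (j + 1 - 1) =
      ((2 * n : ℤ) : ℂ) • (j.factorial : ℂ)⁻¹ • f j - (j.factorial : ℂ)⁻¹ • (j : ℂ) • f j := by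
    intro j
    rw [Nat.add_sub_cancel]
    push_cast
    module
  simp only [e, Finset.sum_add_distrib, Finset.sum_sub_distrib, h2, e3, ← Finset.smul_sum]
  change -(_ - _ • _ + (_ • ∑ j ∈ Finset.range J, _ - _)) =
    _ • ∑ j ∈ Finset.range J, (j.factorial : ℂ)⁻¹ • f j
  rw [Finset.sum_range_succ, Finset.sum_range_succ, e0]
  push_cast
  module

/-- Transposed, this is the bracket of L'(1) with Y'. L(-1) differentiates Y in x⁻¹, and the part of
the resulting factor proportional to j is the contribution of L(1) u. -/
theorem opposite_L_pos (hV : IsMoebiusMOSVA 𝓥 ρV) (h : IsMoebiusLeftModule 𝓥 ρV gr Y ρ) {n : ℤ}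
    {u : V} (hu : u ∈ 𝓥.gr n) (w : W) (k : ℤ) :
    oppositeVertexOperator 𝓥 ρV Y u (ρ (slL (-1)) w) k =
      ρ (slL (-1)) (oppositeVertexOperator 𝓥 ρV Y u w k) +
        (oppositeVertexOperator 𝓥 ρV Y (ρV (slL 1) u) w k +
          ((2 * n + k - 1 : ℤ) : ℂ) • oppositeVertexOperator 𝓥 ρV Y u w (k - 1)) := by
  obtain ⟨J, hJ⟩ := hV.exists_L_pos_pow_eq_zero hu
  have hJ1 : ∀ j ≥ J, (ρV (slL 1) ^ j) (ρV (slL 1) u) = 0 := fun j hj => by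
    rw [← Module.End.mul_apply, ← pow_succ]
    exact hJ _ (by omega)
  let f : ℕ → W := fun j => Y ((ρV (slL 1) ^ j) u) w (j - 2 * n - (k - 1))
  have hshift := sum_range_inv_factorial_smul J f
  have e0 : f J = 0 := by
    simp only [f]
    rw [hJ J le_rfl, h.bilinear.zero_left]
    rfl
  have e : ∀ j : ℕ, ρ (slL (-1)) ((j.factorial : ℂ)⁻¹ •
      Y ((ρV (slL 1) ^ j) u) w (j - 2 * n - k)) =
      (j.factorial : ℂ)⁻¹ • Y ((ρV (slL 1) ^ j) u) (ρ (slL (-1)) w) (j - 2 * n - k) +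
      ((j.factorial : ℂ)⁻¹ • (j : ℂ) • f j -
        ((2 * n + k - 1 : ℤ) : ℂ) • (j.factorial : ℂ)⁻¹ • f j) := by
    intro j
    rw [map_smul, h.L_neg_Y_apply, show (j : ℤ) - 2 * n - k + 1 = j - 2 * n - (k - 1) by ring]
    simp only [f]
    push_cast
    module
  have e1 : ∀ j : ℕ, (j.factorial : ℂ)⁻¹ • Y ((ρV (slL 1) ^ j) (ρV (slL 1) u)) w
      (j - 2 * (n - 1) - k) = (j.factorial : ℂ)⁻¹ • f (j + 1) := by
    intro j
    simp only [f]
    rw [pow_succ, Module.End.mul_apply,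
      show ((j + 1 : ℕ) : ℤ) - 2 * n - (k - 1) = j - 2 * (n - 1) - k by push_cast; ring]
  rw [hV.opposite_apply h.bilinear hu hJ, hV.opposite_apply h.bilinear hu hJ,
    hV.opposite_apply h.bilinear hu hJ, hV.opposite_apply h.bilinear (hV.L_pos_mem hu) hJ1,
    neg_one_zpow_sub_one, map_smul, map_sum, smul_comm (((2 * n + k - 1 : ℤ) : ℂ)), neg_smul,
    ← smul_neg, ← smul_add, ← smul_add]
  congr 1
  simp only [e, e1, Finset.sum_add_distrib, Finset.sum_sub_distrib, ← Finset.smul_sum, ← hshift]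
  change _ = _ + (-_ + _ • ∑ j ∈ Finset.range J, (j.factorial : ℂ)⁻¹ • f j)
  rw [Finset.sum_range_succ, e0]
  module

end IsMoebiusLeftModule

end Opposite

/-! ### The contragredient module -/

section Contragredient

variable {V W : Type*} [AddCommGroup V] [Module ℂ V] [AddCommGroup W] [Module ℂ W]
  {𝓥 : VertexData V} {ρV : Sl2Rep V} {gr : ℂ → Submodule ℂ W} {Y : V → W → Series W}
  {ρ : Sl2Rep W}

/-- The anti-automorphism of the algebra of `2 × 2` matrices that exchanges `L₁` and `L₋₁`. -/
def matrixAnti (A : Matrix (Fin 2) (Fin 2) ℂ) : Matrix (Fin 2) (Fin 2) ℂ :=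
  !![A 0 0, -A 1 0; -A 0 1, A 1 1]

theorem matrixAnti_add (A B : Matrix (Fin 2) (Fin 2) ℂ) :
    matrixAnti (A + B) = matrixAnti A + matrixAnti B := by
  ext i j
  fin_cases i <;> fin_cases j <;> simp [matrixAnti, add_comm]

theorem matrixAnti_smul (c : ℂ) (A : Matrix (Fin 2) (Fin 2) ℂ) :
    matrixAnti (c • A) = c • matrixAnti A := by
  ext i j
  fin_cases i <;> fin_cases j <;> simp [matrixAnti]

theorem matrixAnti_lie (A B : Matrix (Fin 2) (Fin 2) ℂ) :
    matrixAnti (A * B - B * A) =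
      matrixAnti B * matrixAnti A - matrixAnti A * matrixAnti B := by
  ext i j
  fin_cases i <;> fin_cases j <;>
    simp [matrixAnti, Matrix.mul_apply, Fin.sum_univ_two] <;> ring

theorem add_eq_zero_of_mem_sl2 (A : sl2) : A.1 0 0 + A.1 1 1 = 0 := by
  have := A.2
  simp only [LieAlgebra.SpecialLinear.sl] at this
  simpa [Matrix.trace_fin_two] using this

theorem matrixAnti_mem (A : sl2) : matrixAnti A.1 ∈ LieAlgebra.SpecialLinear.sl (Fin 2) ℂ := by
  have := add_eq_zero_of_mem_sl2 A
  simpa [LieAlgebra.SpecialLinear.sl, matrixAnti, Matrix.trace_fin_two] using this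

/-- The anti-automorphism of `sl(2)` that exchanges `L₁` and `L₋₁`. -/
def sl2Anti : sl2 →ₗ[ℂ] sl2 where
  toFun A := ⟨matrixAnti A.1, matrixAnti_mem A⟩
  map_add' A B := Subtype.ext (matrixAnti_add A.1 B.1)
  map_smul' c A := Subtype.ext (matrixAnti_smul c A.1)

theorem sl2Anti_lie (A B : sl2) : sl2Anti ⁅A, B⁆ = ⁅sl2Anti B, sl2Anti A⁆ :=
  Subtype.ext (matrixAnti_lie A.1 B.1)

theorem sl2Anti_slL (j : SignType) : sl2Anti (slL j) = slL (-j) := by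
  apply Subtype.ext
  cases j <;> ext i j <;> fin_cases i <;> fin_cases j <;> simp [sl2Anti, matrixAnti, slL]

theorem sl2_eq_sum (A : sl2) :
    A = (2 * A.1 0 0) • slL 0 + A.1 0 1 • slL (-1) + (-A.1 1 0) • slL 1 := by
  have h := add_eq_zero_of_mem_sl2 A
  apply Subtype.ext
  ext i j
  fin_cases i <;> fin_cases j <;> 
    simp [slL]
  · ring
  · linear_combination h

namespace IsMoebiusLeftModule

theorem comp_rep_mem (h : IsMoebiusLeftModule 𝓥 ρV gr Y ρ) (A : sl2) (φ : Module.Dual ℂ W)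
    (hφ : φ ∈ gradedDual gr) : φ ∘ₗ ρ A ∈ gradedDual gr := by
  have h0 : φ ∘ₗ ρ (slL 0) ∈ gradedDual gr :=
    comp_mem_gradedDual hφ Function.injective_id fun i w hw => h.L_zero_mem hw
  have h1 : φ ∘ₗ ρ (slL 1) ∈ gradedDual gr :=
    comp_mem_gradedDual hφ (add_left_injective (-1)) fun i w hw => h.L_pos_mem hw
  have h2 : φ ∘ₗ ρ (slL (-1)) ∈ gradedDual gr :=
    comp_mem_gradedDual hφ (add_left_injective 1) fun i w hw => h.L_neg_mem hw
  rw [sl2_eq_sum A]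
  simp only [map_add, map_smul, LinearMap.comp_add, LinearMap.comp_smul]
  exact add_mem (add_mem (Submodule.smul_mem _ _ h0) (Submodule.smul_mem _ _ h2))
    (Submodule.smul_mem _ _ h1)

/-- The contragredient representation of `sl(2)`. -/
def dualRep (h : IsMoebiusLeftModule 𝓥 ρV gr Y ρ) : Sl2Rep (gradedDual gr) where
  toFun A := dualEnd (ρ (sl2Anti A)) (h.comp_rep_mem _)
  map_add' A B := LinearMap.ext fun φ => gradedDual_ext fun w => by
    rw [dualEnd_apply, map_add, map_add, LinearMap.add_apply, map_add]
    rfl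
  map_smul' c A := LinearMap.ext fun φ => gradedDual_ext fun w => by
    rw [dualEnd_apply, map_smul, map_smul, LinearMap.smul_apply, map_smul]
    rfl
  map_lie' {A B} := LinearMap.ext fun φ => gradedDual_ext fun w => by
    -- Transposition reverses products and so does `sl2Anti`; together they preserve brackets.
    rw [dualEnd_apply, sl2Anti_lie, LieHom.map_lie, Ring.lie_def, Ring.lie_def,
      LinearMap.sub_apply, map_sub]
    rfl

theorem dualRep_apply (h : IsMoebiusLeftModule 𝓥 ρV gr Y ρ) (j : SignType) (φ : gradedDual gr)
    (w : W) : (h.dualRep (slL j) φ).1 w = φ.1 (ρ (slL (-j)) w) := by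
  rw [← sl2Anti_slL]
  rfl

theorem comp_opposite_mem (hV : IsMoebiusMOSVA 𝓥 ρV) (h : IsMoebiusLeftModule 𝓥 ρV gr Y ρ)
    (φ : Module.Dual ℂ W) (hφ : φ ∈ gradedDual gr) (u : V) (k : ℤ) :
    φ ∘ₗ (hV.bilinear_opposite h.bilinear).right u k ∈ gradedDual gr := by
  refine isInternal_induction hV.isMOSVA.internal
    (p := fun u => φ ∘ₗ (hV.bilinear_opposite h.bilinear).right u k ∈ gradedDual gr)
    (fun n u hu => comp_mem_gradedDual hφ (sub_left_injective (b := ((n + k : ℤ) : ℂ)))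
      fun i w hw => h.opposite_mem hV hu hw k) ?_ (fun u v h1 h2 => ?_) u
  · convert zero_mem (gradedDual gr) using 1
    ext w
    rw [LinearMap.comp_apply, IsBilinear.right_apply,
      (hV.bilinear_opposite h.bilinear).zero_left]
    exact map_zero φ
  · convert add_mem h1 h2 using 1
    ext w
    rw [LinearMap.add_apply, LinearMap.comp_apply, LinearMap.comp_apply, LinearMap.comp_apply,
      IsBilinear.right_apply, (hV.bilinear_opposite h.bilinear).add_left]
    exact map_add φ _ _

/-- The contragredient vertex operator map. -/
def dualVertexOperator (hV : IsMoebiusMOSVA 𝓥 ρV) (h : IsMoebiusLeftModule 𝓥 ρV gr Y ρ) :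
    V → gradedDual gr → Series (gradedDual gr) :=
  fun u φ k => ⟨φ.1 ∘ₗ (hV.bilinear_opposite h.bilinear).right u k,
    h.comp_opposite_mem hV φ.1 φ.2 u k⟩

theorem dualVertexOperator_apply (hV : IsMoebiusMOSVA 𝓥 ρV)
    (h : IsMoebiusLeftModule 𝓥 ρV gr Y ρ) (u : V) (φ : gradedDual gr) (k : ℤ) (w : W) :
    (h.dualVertexOperator hV u φ k).1 w = φ.1 (oppositeVertexOperator 𝓥 ρV Y u w k) := rfl

/-- Once the weight n is written as the action of L(0) on V, the identity is linear in `u` and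
extends from homogeneous vectors to all of V. The next results follow the same pattern. -/
theorem opposite_rep_zero (hV : IsMoebiusMOSVA 𝓥 ρV) (h : IsMoebiusLeftModule 𝓥 ρV gr Y ρ)
    (u : V) (w : W) (k : ℤ) : oppositeVertexOperator 𝓥 ρV Y u (ρ (slL 0) w) k =
      ρ (slL 0) (oppositeVertexOperator 𝓥 ρV Y u w k) +
        (oppositeVertexOperator 𝓥 ρV Y (ρV (slL 0) u) w k +
          (k : ℂ) • oppositeVertexOperator 𝓥 ρV Y u w k) := by
  have hO := hV.bilinear_opposite h.bilinear
  have : hO.left (ρ (slL 0) w) k = ρ (slL 0) ∘ₗ hO.left w k +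
      (hO.left w k ∘ₗ ρV (slL 0) + (k : ℂ) • hO.left w k) :=
    linearMap_ext_of_isInternal hV.isMOSVA.internal fun n u hu => by
      simp only [LinearMap.add_apply, LinearMap.comp_apply, LinearMap.smul_apply, hO.left_apply]
      rw [h.opposite_L_zero hV hu, hV.L_zero_apply hu, hO.smul_left, Pi.smul_apply, ← add_smul]
      push_cast
      rfl
  exact DFunLike.congr_fun this u

theorem opposite_d (hV : IsMoebiusMOSVA 𝓥 ρV) (h : IsMoebiusLeftModule 𝓥 ρV gr Y ρ)
    {d D : W →ₗ[ℂ] W} (hd : IsLeftModule 𝓥 gr Y d D) (u : V) (w : W) (k : ℤ) :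
    oppositeVertexOperator 𝓥 ρV Y u (d w) k =
      d (oppositeVertexOperator 𝓥 ρV Y u w k) +
        (oppositeVertexOperator 𝓥 ρV Y (𝓥.d u) w k +
          (k : ℂ) • oppositeVertexOperator 𝓥 ρV Y u w k) := by
  have hO := hV.bilinear_opposite h.bilinear
  have : hO.left (d w) k = d ∘ₗ hO.left w k + (hO.left w k ∘ₗ 𝓥.d + (k : ℂ) • hO.left w k) :=
    linearMap_ext_of_isInternal hV.isMOSVA.internal fun n u hu => by
      simp only [LinearMap.add_apply, LinearMap.comp_apply, LinearMap.smul_apply, hO.left_apply]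
      rw [VertexData.d_apply hV.isMOSVA.internal hu, hO.smul_left, Pi.smul_apply, ← add_smul]
      have : hO.right u k ∘ₗ d = d ∘ₗ hO.right u k + ((n : ℂ) + k) • hO.right u k :=
        linearMap_ext_of_isInternal hd.internal fun m w hw => by
          simp only [LinearMap.add_apply, LinearMap.comp_apply, LinearMap.smul_apply,
            hO.right_apply]
          rw [hd.d_grading m w hw, hd.d_grading _ _ (h.opposite_mem hV hu hw k), hO.smul_right,
            Pi.smul_apply]
          push_cast
          module
      exact DFunLike.congr_fun this w
  exact DFunLike.congr_fun this u

theorem opposite_rep_pos (hV : IsMoebiusMOSVA 𝓥 ρV) (h : IsMoebiusLeftModule 𝓥 ρV gr Y ρ)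
    (u : V) (w : W) (k : ℤ) : oppositeVertexOperator 𝓥 ρV Y u (ρ (slL 1) w) k =
      ρ (slL 1) (oppositeVertexOperator 𝓥 ρV Y u w k) +
        ((k + 1 : ℤ) : ℂ) • oppositeVertexOperator 𝓥 ρV Y u w (k + 1) := by
  have hO := hV.bilinear_opposite h.bilinear
  have : hO.left (ρ (slL 1) w) k = ρ (slL 1) ∘ₗ hO.left w k +
      ((k + 1 : ℤ) : ℂ) • hO.left w (k + 1) :=
    linearMap_ext_of_isInternal hV.isMOSVA.internal fun n u hu => h.ddx_opposite hV hu w k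
  exact DFunLike.congr_fun this u

theorem opposite_neg_left (hV : IsMoebiusMOSVA 𝓥 ρV) (h : IsMoebiusLeftModule 𝓥 ρV gr Y ρ)
    (u : V) (w : W) (k : ℤ) : oppositeVertexOperator 𝓥 ρV Y (ρV (slL (-1)) u) w k =
      ((k + 1 : ℤ) : ℂ) • oppositeVertexOperator 𝓥 ρV Y u w (k + 1) := by
  have hO := hV.bilinear_opposite h.bilinear
  have : hO.left w k ∘ₗ ρV (slL (-1)) = ((k + 1 : ℤ) : ℂ) • hO.left w (k + 1) :=
    linearMap_ext_of_isInternal hV.isMOSVA.internal fun n u hu => h.opposite_L_neg hV hu w k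
  exact DFunLike.congr_fun this u

theorem opposite_rep_neg (hV : IsMoebiusMOSVA 𝓥 ρV) (h : IsMoebiusLeftModule 𝓥 ρV gr Y ρ)
    (u : V) (w : W) (k : ℤ) : oppositeVertexOperator 𝓥 ρV Y u (ρ (slL (-1)) w) k =
      ρ (slL (-1)) (oppositeVertexOperator 𝓥 ρV Y u w k) +
        (oppositeVertexOperator 𝓥 ρV Y (ρV (slL 1) u) w k +
          (2 : ℂ) • oppositeVertexOperator 𝓥 ρV Y (ρV (slL 0) u) w (k - 1) +
          oppositeVertexOperator 𝓥 ρV Y (ρV (slL (-1)) u) w (k - 2)) := by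
  have hO := hV.bilinear_opposite h.bilinear
  have : hO.left (ρ (slL (-1)) w) k = ρ (slL (-1)) ∘ₗ hO.left w k +
      (hO.left w k ∘ₗ ρV (slL 1) + (2 : ℂ) • hO.left w (k - 1) ∘ₗ ρV (slL 0) +
        hO.left w (k - 2) ∘ₗ ρV (slL (-1))) :=
    linearMap_ext_of_isInternal hV.isMOSVA.internal fun n u hu => by
      simp only [LinearMap.add_apply, LinearMap.comp_apply, LinearMap.smul_apply, hO.left_apply]
      rw [h.opposite_L_pos hV hu, hV.L_zero_apply hu, hO.smul_left, Pi.smul_apply,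
        h.opposite_neg_left hV, show k - 2 + 1 = k - 1 by ring]
      push_cast
      module
  exact DFunLike.congr_fun this u

variable (hV : IsMoebiusMOSVA 𝓥 ρV) (h : IsMoebiusLeftModule 𝓥 ρV gr Y ρ)

theorem bilinear_dual : IsBilinear (h.dualVertexOperator hV) := by
  have hO := hV.bilinear_opposite h.bilinear
  refine ⟨fun φ => ⟨fun u v => funext fun k => gradedDual_ext fun w => ?_,
    fun c u => funext fun k => gradedDual_ext fun w => ?_⟩,
    fun u => ⟨fun φ ψ => funext fun k => gradedDual_ext fun w => rfl,
      fun c φ => funext fun k => gradedDual_ext fun w => rfl⟩⟩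
  · rw [dualVertexOperator_apply, hO.add_left]
    exact map_add φ.1 _ _
  · rw [dualVertexOperator_apply, hO.smul_left]
    exact map_smul φ.1 _ _

theorem dual_identity (φ : gradedDual gr) :
    h.dualVertexOperator hV 𝓥.vac φ = Pi.single 0 φ := by
  obtain ⟨d, hd⟩ := h.isLeftModule
  funext k
  refine gradedDual_ext fun w => ?_
  rw [dualVertexOperator_apply, hV.opposite_vac h.bilinear hd.identity]
  rcases eq_or_ne k 0 with rfl | hk
  · simp
  · rw [Pi.single_eq_of_ne hk, Pi.single_eq_of_ne hk]
    exact map_zero φ.1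

theorem dual_D_derivative (u : V) (φ : gradedDual gr) :
    ddx (h.dualVertexOperator hV u φ) = h.dualVertexOperator hV (ρV (slL (-1)) u) φ := by
  funext k
  refine gradedDual_ext fun w => ?_
  rw [dualVertexOperator_apply, h.opposite_neg_left hV, map_smul]
  rfl

theorem dual_D_commutator (u : V) (φ : gradedDual gr) : ddx (h.dualVertexOperator hV u φ) =
    h.dualRep (slL (-1)) ∘ h.dualVertexOperator hV u φ -
      h.dualVertexOperator hV u (h.dualRep (slL (-1)) φ) := by
  funext k
  refine gradedDual_ext fun w => ?_
  have h1 : (h.dualRep (slL (-1)) (h.dualVertexOperator hV u φ k)).1 w =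
      φ.1 (oppositeVertexOperator 𝓥 ρV Y u (ρ (slL 1) w) k) := by
    rw [dualRep_apply, neg_neg, dualVertexOperator_apply]
  have h2 : (h.dualVertexOperator hV u (h.dualRep (slL (-1)) φ) k).1 w =
      φ.1 (ρ (slL 1) (oppositeVertexOperator 𝓥 ρV Y u w k)) := by
    rw [dualVertexOperator_apply, dualRep_apply, neg_neg]
  refine Eq.trans ?_ (congrArg₂ (· - ·) h1 h2).symm
  rw [h.opposite_rep_pos hV, map_add, add_sub_cancel_left, map_smul]
  rfl

theorem dual_L_zero_commutator (u : V) (φ : gradedDual gr) :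
    h.dualRep (slL 0) ∘ h.dualVertexOperator hV u φ -
      h.dualVertexOperator hV u (h.dualRep (slL 0) φ) =
    h.dualVertexOperator hV (ρV (slL 0) u) φ +
      mulX 1 (h.dualVertexOperator hV (ρV (slL (-1)) u) φ) := by
  funext k
  refine gradedDual_ext fun w => ?_
  have h1 : (h.dualRep (slL 0) (h.dualVertexOperator hV u φ k)).1 w =
      φ.1 (oppositeVertexOperator 𝓥 ρV Y u (ρ (slL 0) w) k) := by
    rw [dualRep_apply, neg_zero, dualVertexOperator_apply]
  have h2 : (h.dualVertexOperator hV u (h.dualRep (slL 0) φ) k).1 w =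
      φ.1 (ρ (slL 0) (oppositeVertexOperator 𝓥 ρV Y u w k)) := by
    rw [dualVertexOperator_apply, dualRep_apply, neg_zero]
  refine (congrArg₂ (· - ·) h1 h2).trans ?_
  rw [h.opposite_rep_zero hV, map_add, add_sub_cancel_left, map_add]
  refine congrArg (_ + ·) ?_
  rw [mulX, dualVertexOperator_apply, h.opposite_neg_left hV, sub_add_cancel]

theorem dual_d_commutator {d D : W →ₗ[ℂ] W} (hd : IsLeftModule 𝓥 gr Y d D)
    (hd' : ∀ φ ∈ gradedDual gr, φ ∘ₗ d ∈ gradedDual gr) (u : V) (φ : gradedDual gr) :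
    dualEnd d hd' ∘ h.dualVertexOperator hV u φ -
      h.dualVertexOperator hV u (dualEnd d hd' φ) =
    h.dualVertexOperator hV (𝓥.d u) φ + mulX 1 (ddx (h.dualVertexOperator hV u φ)) := by
  funext k
  refine gradedDual_ext fun w => ?_
  have h1 : (dualEnd d hd' (h.dualVertexOperator hV u φ k)).1 w =
      φ.1 (oppositeVertexOperator 𝓥 ρV Y u (d w) k) := rfl
  have h2 : (h.dualVertexOperator hV u (dualEnd d hd' φ) k).1 w =
      φ.1 (d (oppositeVertexOperator 𝓥 ρV Y u w k)) := rfl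
  refine (congrArg₂ (· - ·) h1 h2).trans ?_
  rw [h.opposite_d hV hd, map_add, add_sub_cancel_left, map_add]
  refine congrArg (_ + ·) ?_
  rw [mulX, ddx, sub_add_cancel, map_smul]
  rfl

theorem dual_L_pos_commutator (u : V) (φ : gradedDual gr) :
    h.dualRep (slL 1) ∘ h.dualVertexOperator hV u φ -
      h.dualVertexOperator hV u (h.dualRep (slL 1) φ) =
    h.dualVertexOperator hV (ρV (slL 1) u) φ +
      (2 : ℂ) • mulX 1 (h.dualVertexOperator hV (ρV (slL 0) u) φ) +
      mulX 2 (h.dualVertexOperator hV (ρV (slL (-1)) u) φ) := by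
  funext k
  refine gradedDual_ext fun w => ?_
  have h1 : (h.dualRep (slL 1) (h.dualVertexOperator hV u φ k)).1 w =
      φ.1 (oppositeVertexOperator 𝓥 ρV Y u (ρ (slL (-1)) w) k) := by
    rw [dualRep_apply, dualVertexOperator_apply]
  have h2 : (h.dualVertexOperator hV u (h.dualRep (slL 1) φ) k).1 w =
      φ.1 (ρ (slL (-1)) (oppositeVertexOperator 𝓥 ρV Y u w k)) := by
    rw [dualVertexOperator_apply, dualRep_apply]
  refine (congrArg₂ (· - ·) h1 h2).trans ?_
  rw [h.opposite_rep_neg hV, map_add, add_sub_cancel_left, map_add, map_add, map_smul]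
  rfl

theorem dual_L_neg_mem (m : ℂ) (φ : gradedDual gr) (hφ : φ ∈ gradedDualGr gr m) :
    h.dualRep (slL (-1)) φ ∈ gradedDualGr gr (m + 1) := by
  intro j hj w hw
  rw [dualRep_apply, neg_neg]
  exact hφ (j + -1) (fun e => hj (by rw [← e]; ring)) _ (h.L_pos_mem hw)

/-- A functional of weight n is killed by a power of L'(0) - n only if one exponent works on all of
W_[n]. A finite spanning set of W_[n] provides it. -/
theorem dual_generalized_weight (hfin : GradingRestricted gr) (n : ℂ) (φ : gradedDual gr)
    (hφ : φ ∈ gradedDualGr gr n) : ∃ m : ℕ,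
    ((h.dualRep (slL 0) - n • (1 : Module.End ℂ (gradedDual gr))) ^ m) φ = 0 := by
  obtain ⟨d, hd⟩ := h.isLeftModule
  have := hfin n
  obtain ⟨s, hs⟩ := Module.Finite.fg_top (R := ℂ) (M := gr n)
  choose m hm using fun w : gr n => h.generalized_weight n w w.2
  refine ⟨s.sup m, gradedDual_ext fun w => ?_⟩
  have key : ∀ (t : ℕ) (ψ : gradedDual gr) (w : W),
      (((h.dualRep (slL 0) - n • (1 : Module.End ℂ (gradedDual gr))) ^ t) ψ).1 w =
        ψ.1 (((ρ (slL 0) - n • (1 : Module.End ℂ W)) ^ t) w) := by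
    intro t
    induction t with
    | zero => exact fun ψ w => rfl
    | succ t ih =>
      intro ψ w
      rw [pow_succ, Module.End.mul_apply, ih, pow_succ', Module.End.mul_apply]
      generalize ((ρ (slL 0) - n • (1 : Module.End ℂ W)) ^ t) w = w
      have h1 := h.dualRep_apply 0 ψ w
      rw [neg_zero] at h1
      rw [LinearMap.sub_apply, LinearMap.sub_apply, map_sub, ← h1, LinearMap.smul_apply,
        LinearMap.smul_apply, map_smul]
      rfl
  rw [key]
  have hgen : ∀ w : gr n, ((ρ (slL 0) - n • (1 : Module.End ℂ W)) ^ s.sup m) w.1 = 0 := by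
    intro w
    have hw : w ∈ Submodule.span ℂ (s : Set (gr n)) := by
      rw [hs]
      trivial
    refine Submodule.span_induction (p := fun w _ =>
      ((ρ (slL 0) - n • (1 : Module.End ℂ W)) ^ s.sup m) w.1 = 0) (fun w hw => ?_) ?_
      (fun x y _ _ hx hy => ?_) (fun c x _ hx => ?_) hw
    · have : m w ≤ s.sup m := Finset.le_sup hw
      obtain ⟨t, ht⟩ := Nat.exists_eq_add_of_le' this
      rw [ht, pow_add, Module.End.mul_apply, hm, map_zero]
    · exact map_zero _
    · rw [Submodule.coe_add, map_add, hx, hy, add_zero]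
    · rw [Submodule.coe_smul, map_smul, hx, smul_zero]
  refine isInternal_induction hd.internal
    (p := fun w => φ.1 (((ρ (slL 0) - n • (1 : Module.End ℂ W)) ^ s.sup m) w) = 0)
    (fun j w hw => ?_) (by simp) (fun v w h1 h2 => by rw [map_add, map_add, h1, h2, add_zero]) w
  by_cases hj : j = n
  · subst hj
    rw [hgen ⟨w, hw⟩, map_zero]
  · refine hφ j hj _ ?_
    generalize s.sup m = t
    induction t with
    | zero => exact hw
    | succ t ih =>
      rw [pow_succ', Module.End.mul_apply, LinearMap.sub_apply]
      exact sub_mem (h.L_zero_mem ih) (Submodule.smul_mem _ _ ih)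

end IsMoebiusLeftModule

end Contragredient

/-! ### Associativity of the contragredient vertex operators -/

section SwapSeries

/-- The exchange of the two variables. -/
def swapSeries (F : MSeries (Fin 2)) : MSeries (Fin 2) := fun κ => F ![κ 1, κ 0]

theorem swapSeries_vec (F : MSeries (Fin 2)) (k l : ℤ) : swapSeries F ![k, l] = F ![l, k] := rfl

theorem act_add_pow_swapSeries (N : ℕ) (F : MSeries (Fin 2)) :
    act ((X 0 + X 1) ^ N) (swapSeries F) = swapSeries (act ((X 0 + X 1) ^ N) F) := by
  have := act_intertwine (P := fun _ : MSeries (Fin 2) => True) (fun _ _ _ _ => trivial)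
    (fun _ _ _ => trivial) (fun _ _ _ => trivial) swapSeries (fun F G _ _ => rfl)
    (fun c F _ => rfl) (aeval ![X 1, X 0]) ?_ ((X 0 + X 1) ^ N) (F := F) trivial
  · have e : (aeval ![X 1, X 0] ((X 0 + X 1) ^ N : MvPolynomial (Fin 2) ℂ) :
        MvPolynomial (Fin 2) ℂ) = (X 0 + X 1) ^ N := by
      simp only [map_pow, map_add, aeval_X, Matrix.cons_val_zero, Matrix.cons_val_one]
      rw [add_comm]
    rw [this, e]
  · intro i F _
    rw [aeval_X]
    funext κ
    fin_cases i
    · change act (X 0) F ![κ 1, κ 0] = act (X 1) (swapSeries F) κ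
      rw [act_X_apply, act_X_apply, vec_two_sub_single_zero]
      simp [swapSeries]
    · change act (X 1) F ![κ 1, κ 0] = act (X 0) (swapSeries F) κ
      rw [act_X_apply, act_X_apply, vec_two_sub_single_one]
      simp [swapSeries]

/-- The second variable is common to both sides and is not affected by the substitution, so its
powers may be factored out. -/
theorem WeakAssoc.shift {a b : MSeries (Fin 2)} (h : WeakAssoc a b) (f : ℤ) :
    WeakAssoc (fun κ => a (κ + Pi.single 1 f)) (fun κ => b (κ + Pi.single 1 f)) := by
  obtain ⟨N, hN⟩ := h
  refine ⟨N, ?_⟩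
  have e : substSum 1 (fun κ => a (κ + Pi.single 1 f)) - (fun κ => b (κ + Pi.single 1 f)) =
      fun κ => (substSum 1 a - b) (κ + Pi.single 1 f) := by
    funext κ
    simp only [Pi.sub_apply]
    congr 1
    refine finsum_congr fun i => ?_
    congr 2
    · simp
    · exact congrArg a (add_right_comm _ _ _)
  rw [e, act_shift, hN]
  rfl

theorem LTrunc.shift {i j : Fin 2} {F : MSeries (Fin 2)} (hF : LTrunc i j F) (v : Fin 2 → ℤ) :
    LTrunc i j fun κ => F (κ + v) := by
  intro κ
  obtain ⟨I, hI⟩ := hF (κ + v)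
  exact ⟨I, fun n hn => (congrArg F (add_right_comm _ _ _)).trans (hI n hn)⟩

theorem LTrunc.swapSeries {F : MSeries (Fin 2)} (hF : LTrunc 1 0 F) :
    LTrunc 0 1 (MOSVA.swapSeries F) := by
  intro κ
  obtain ⟨I, hI⟩ := hF ![κ 1, κ 0]
  refine ⟨I, fun n hn => ?_⟩
  rw [← hI n hn, MOSVA.swapSeries]
  congr 1
  funext i
  fin_cases i <;> simp

theorem LTrunc.of_eq_sum {ι : Type*} {s : Finset ι} {c : ι → ℂ} {e : ι → ℤ}
    {A : ι → MSeries (Fin 2)} (hA : ∀ t ∈ s, LTrunc 0 1 (A t)) {F : MSeries (Fin 2)}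
    (h : ∀ κ, F κ = ∑ t ∈ s, c t * A t (κ - Pi.single 0 (e t))) : LTrunc 0 1 F := by
  have := LTrunc.sum s fun t ht => ((hA t ht).shift (-Pi.single 0 (e t))).smul (c t)
  convert this using 1
  funext κ
  rw [h, Finset.sum_apply]
  rfl

/-- `F` is a combination of the series x₀^{e t} A t, with `e t` possibly negative. A large power
x₀^M makes all exponents nonnegative, and under the substitution x₀ becomes x₀ + x₁. -/
theorem act_add_pow_substSum {ι : Type*} {s : Finset ι} {c : ι → ℂ} {e : ι → ℤ}
    {A : ι → MSeries (Fin 2)} (hA : ∀ t ∈ s, LTrunc 0 1 (A t)) {F : MSeries (Fin 2)}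
    (h : ∀ κ, F κ = ∑ t ∈ s, c t * A t (κ - Pi.single 0 (e t))) {M : ℕ}
    {E : ι → ℕ} (hE : ∀ t ∈ s, (E t : ℤ) = M + e t) :
    act ((X 0 + X 1) ^ M) (substSum 1 F) =
      ∑ t ∈ s, c t • act ((X 0 + X 1) ^ E t) (substSum 1 (A t)) := by
  have hF := LTrunc.of_eq_sum hA h
  have key : ∀ (N : ℕ) {G : MSeries (Fin 2)}, LTrunc 0 1 G →
      act ((X 0 + X 1) ^ N) (substSum 1 G) = substSum 1 (act (X 0 ^ N) G) := by
    intro N G hG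
    rw [substSum_act hG]
    simp [substHom]
  have h1 : act (X 0 ^ M) F = ∑ t ∈ s, c t • act (X 0 ^ E t) (A t) := by
    funext κ
    rw [act_X_pow_apply, h, Finset.sum_apply]
    refine Finset.sum_congr rfl fun t ht => ?_
    rw [Pi.smul_apply, act_X_pow_apply, smul_eq_mul, hE t ht, sub_sub, ← Pi.single_add]
  rw [key M hF, h1, substSum_sum s 1 fun t ht => ((hA t ht).act _).smul _]
  refine Finset.sum_congr rfl fun t ht => ?_
  rw [substSum_smul, key _ (hA t ht)]

/-- Both sides are combinations of weakly associative pairs with the same coefficients and the same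
powers of x₀ + x₁. The shear in `C` undoes the shear by -1 on `B t`, so a large power of x₀ + x₁
kills each term of the difference. -/
theorem weakAssoc_of_eq_sum {ι : Type*} {s : Finset ι} {c : ι → ℂ} {e : ι → ℤ}
    {A B : ι → MSeries (Fin 2)} (hA : ∀ t ∈ s, LTrunc 0 1 (A t)) (hB : ∀ t ∈ s, LTrunc 1 0 (B t))
    (hAB : ∀ t ∈ s, WeakAssoc (A t) (B t)) {a C : MSeries (Fin 2)}
    (ha : ∀ κ, a κ = ∑ t ∈ s, c t * A t (κ - Pi.single 0 (e t)))
    (hC : ∀ κ, C κ = ∑ t ∈ s, c t *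
      substSum (-1) (swapSeries (B t)) (κ - Pi.single 0 (e t))) :
    WeakAssoc a (swapSeries (substSum 1 C)) := by
  choose! N hN using hAB
  let M : ℕ := ∑ t ∈ s, (N t + (e t).natAbs)
  have hM : ∀ t ∈ s, N t + (e t).natAbs ≤ M := fun t ht =>
    Finset.single_le_sum (f := fun t => N t + (e t).natAbs) (fun _ _ => Nat.zero_le _) ht
  let E : ι → ℕ := fun t => (M + e t).toNat
  have hE : ∀ t ∈ s, (E t : ℤ) = M + e t := fun t ht => by
    have := hM t ht
    simp only [E]
    omega
  have hNE : ∀ t ∈ s, N t ≤ E t := fun t ht => by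
    have := hM t ht
    have := hE t ht
    omega
  refine ⟨M, ?_⟩
  rw [map_sub, act_add_pow_swapSeries, act_add_pow_substSum hA ha hE,
    act_add_pow_substSum (fun t ht => (hB t ht).swapSeries.substSum) hC hE]
  have h1 : swapSeries (∑ t ∈ s, c t • act ((X 0 + X 1) ^ E t)
      (substSum 1 (substSum (-1) (swapSeries (B t))))) =
      ∑ t ∈ s, c t • act ((X 0 + X 1) ^ E t) (B t) := by
    funext κ
    rw [swapSeries, Finset.sum_apply, Finset.sum_apply]
    refine Finset.sum_congr rfl fun t ht => ?_
    rw [Pi.smul_apply, Pi.smul_apply, substSum_substSum (hB t ht).swapSeries,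
      act_add_pow_swapSeries, swapSeries_vec, ← vec_eta]
  rw [h1, ← Finset.sum_sub_distrib]
  refine Finset.sum_eq_zero fun t ht => ?_
  rw [← smul_sub, ← map_sub, exists_act_eq_zero_of_le (hN t ht) (hNE t ht), smul_zero]

end SwapSeries

/-! ### Sums over triples with given total -/

section Simplex

variable {M : Type*} [AddCommMonoid M]

/-- The sum over `j + i + s = r`. -/
def simplexSum (r : ℕ) (G : ℕ → ℕ → ℕ → M) : M :=
  ∑ x ∈ Finset.HasAntidiagonal.antidiagonal r,
    ∑ y ∈ Finset.HasAntidiagonal.antidiagonal x.2, G x.1 y.1 y.2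

theorem simplexSum_add (r : ℕ) (G H : ℕ → ℕ → ℕ → M) :
    simplexSum r (fun j i s => G j i s + H j i s) = simplexSum r G + simplexSum r H := by
  simp only [simplexSum, Finset.sum_add_distrib]

theorem map_simplexSum {N : Type*} [AddCommMonoid N] (f : M →+ N) (r : ℕ)
    (G : ℕ → ℕ → ℕ → M) : f (simplexSum r G) = simplexSum r fun j i s => f (G j i s) := by
  simp only [simplexSum, map_sum]

theorem simplexSum_congr {r : ℕ} {G H : ℕ → ℕ → ℕ → M}
    (h : ∀ j i s, j + i + s = r → G j i s = H j i s) : simplexSum r G = simplexSum r H :=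
  Finset.sum_congr rfl fun x hx => Finset.sum_congr rfl fun y hy => h _ _ _ (by
    rw [Finset.HasAntidiagonal.mem_antidiagonal] at hx hy
    omega)

theorem simplexSum_succ_left (r : ℕ) {G : ℕ → ℕ → ℕ → M} (h : ∀ i s, G 0 i s = 0) :
    simplexSum (r + 1) G = simplexSum r fun j i s => G (j + 1) i s := by
  rw [simplexSum, Finset.Nat.sum_antidiagonal_succ]
  simp only [h, Finset.sum_const_zero, zero_add]
  rfl

theorem simplexSum_succ_mid (r : ℕ) {G : ℕ → ℕ → ℕ → M} (h : ∀ j s, G j 0 s = 0) :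
    simplexSum (r + 1) G = simplexSum r fun j i s => G j (i + 1) s := by
  rw [simplexSum, Finset.Nat.sum_antidiagonal_succ']
  simp only [Finset.Nat.sum_antidiagonal_succ, h, zero_add, Finset.Nat.antidiagonal_zero,
    Finset.sum_singleton]
  rfl

theorem simplexSum_succ_right (r : ℕ) {G : ℕ → ℕ → ℕ → M} (h : ∀ j i, G j i 0 = 0) :
    simplexSum (r + 1) G = simplexSum r fun j i s => G j i (s + 1) := by
  rw [simplexSum, Finset.Nat.sum_antidiagonal_succ']
  simp only [Finset.Nat.sum_antidiagonal_succ', h, zero_add, Finset.Nat.antidiagonal_zero,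
    Finset.sum_singleton]
  rfl

theorem sum_range_subset {f : ℕ → M} {J R : ℕ} (hR : J ≤ R) (h : ∀ j ≥ J, f j = 0) :
    ∑ j ∈ Finset.range R, f j = ∑ j ∈ Finset.range J, f j :=
  (Finset.sum_subset (Finset.range_mono hR) fun j _ hj =>
    h j (not_lt.1 fun h' => hj (Finset.mem_range.2 h'))).symm

theorem sum_range_simplexSum {G : ℕ → ℕ → ℕ → M} {J I S R : ℕ} (hR : J + I + S ≤ R)
    (hJ : ∀ j ≥ J, ∀ i s, G j i s = 0) (hI : ∀ i ≥ I, ∀ j s, G j i s = 0)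
    (hS : ∀ s ≥ S, ∀ j i, G j i s = 0) :
    ∑ r ∈ Finset.range R, simplexSum r G =
      ∑ j ∈ Finset.range J, ∑ s ∈ Finset.range S, ∑ i ∈ Finset.range I, G j i s := by
  have h0 : ∀ j i s, R ≤ j + (i + s) → G j i s = 0 := fun j i s h => by
    by_cases h1 : J ≤ j
    · exact hJ j h1 i s
    by_cases h2 : I ≤ i
    · exact hI i h2 j s
    exact hS s (by omega) j i
  simp only [simplexSum]
  rw [sum_range_antidiagonal (f := fun a b =>
    ∑ y ∈ Finset.HasAntidiagonal.antidiagonal b, G a y.1 y.2) fun a b hab =>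
      Finset.sum_eq_zero fun y hy => h0 _ _ _ (by
        rw [Finset.HasAntidiagonal.mem_antidiagonal] at hy
        omega)]
  rw [sum_range_subset (show J ≤ R by omega) fun j hj => Finset.sum_eq_zero fun b _ =>
    Finset.sum_eq_zero fun y _ => hJ j hj _ _]
  refine Finset.sum_congr rfl fun j _ => ?_
  rw [sum_range_antidiagonal (f := fun i s => G j i s) fun i s his => h0 _ _ _ (by omega),
    Finset.sum_comm, sum_range_subset (show S ≤ R by omega) fun s hs => Finset.sum_eq_zero
      fun i _ => hS s hs j i]
  refine Finset.sum_congr rfl fun s _ => ?_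
  exact sum_range_subset (by omega) fun i hi => hI i hi j s

end Simplex

/-! ### Powers of L(1) applied to a vertex operator -/

section LPosPow

variable {V : Type*} [AddCommGroup V] [Module ℂ V] {𝓥 : VertexData V} {ρV : Sl2Rep V}

theorem IsMoebiusMOSVA.L_pos_Y_apply (hV : IsMoebiusMOSVA 𝓥 ρV) {n : ℤ} {u : V} (hu : u ∈ 𝓥.gr n)
    (v : V) (p : ℤ) : ρV (slL 1) (𝓥.Y u v p) = 𝓥.Y u (ρV (slL 1) v) p +
      (𝓥.Y (ρV (slL 1) u) v p + ((2 * n + p - 1 : ℤ) : ℂ) • 𝓥.Y u v (p - 1)) := by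
  have := congrFun (hV.L_pos_commutator u v) p
  rw [hV.L_zero_apply hu, hV.isMOSVA.bilinear.smul_left] at this
  refine (sub_eq_iff_eq_add'.1 this).trans ?_
  have e : 𝓥.Y (ρV (slL (-1)) u) v (p - 2) = ((p - 1 : ℤ) : ℂ) • 𝓥.Y u v (p - 1) := by
    rw [hV.L_neg, ← hV.isMOSVA.D_derivative, ddx, show p - 2 + 1 = p - 1 by ring]
  simp only [Pi.add_apply, Pi.smul_apply, mulX, e]
  rw [smul_smul, add_assoc, ← add_smul]
  push_cast
  congr 4
  ring

/-- Pascal's rule combined with the absorption identity. It supplies the contribution with raised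
`i` in the induction for `L_pos_pow_Y_apply`. -/
theorem choose_identity (t : ℤ) (j i : ℕ) :
    ((i + 1 + j : ℕ) : ℂ) * ((Ring.choose (t + (i + 1 : ℕ)) (i + 1) : ℤ) : ℂ) -
      (j : ℂ) * ((Ring.choose (t - 1 + (i + 1 : ℕ)) (i + 1) : ℤ) : ℂ) =
    ((t + j + i + 1 : ℤ) : ℂ) * ((Ring.choose (t + i) i : ℤ) : ℂ) := by
  have h1 := succ_mul_choose (t + i) i
  have h2 : (Ring.choose (t + i + 1) (i + 1) : ℤ) = Ring.choose (t + i) i +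
      Ring.choose (t + i) (i + 1) := Ring.choose_succ_succ _ _
  have h3 := congrArg (Int.cast : ℤ → ℂ) h2
  rw [show t + ((i + 1 : ℕ) : ℤ) = t + i + 1 by push_cast; ring,
    show t - 1 + ((i + 1 : ℕ) : ℤ) = t + i by push_cast; ring]
  push_cast at h1 h3 ⊢
  linear_combination h1 + (j : ℂ) * h3

/-- The coefficients of `e ^ (x L(1)) Y(u, y) v`. -/
theorem IsMoebiusMOSVA.L_pos_pow_Y_apply (hV : IsMoebiusMOSVA 𝓥 ρV) {n : ℤ} {u : V}
    (hu : u ∈ 𝓥.gr n) (v : V) (k : ℤ) (r : ℕ) :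
    ((r.factorial : ℂ)⁻¹) • (ρV (slL 1) ^ r) (𝓥.Y u v k) = simplexSum r fun j i s =>
      ((j.factorial : ℂ)⁻¹ * (s.factorial : ℂ)⁻¹ * ((-1) ^ i *
        ((Ring.choose (j - 2 * n - k + i) i : ℤ) : ℂ))) •
          𝓥.Y ((ρV (slL 1) ^ j) u) ((ρV (slL 1) ^ s) v) (k - i) := by
  -- In closed form: e^{xL(1)} Y(u, y) v = Y(e^{x(1-xy)L(1)} (1-xy)^{-2L(0)} u, y / (1-xy))
  -- e^{xL(1)} v. The index `i` counts the powers of xy in the expansion of 1 - xy.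
  induction r with
  | zero => simp [simplexSum]
  | succ r ih =>
    have hr : (r + 1 : ℂ) ≠ 0 := Nat.cast_add_one_ne_zero r
    refine (smul_right_inj hr).1 ?_
    rw [Nat.factorial_succ, smul_smul, pow_succ', Module.End.mul_apply]
    push_cast
    rw [mul_inv, mul_inv_cancel_left₀ hr, ← map_smul, ih]
    let Z : ℕ → ℕ → ℕ → V := fun j i s =>
      𝓥.Y ((ρV (slL 1) ^ j) u) ((ρV (slL 1) ^ s) v) (k - i)
    let t : ℕ → ℤ := fun j => j - 2 * n - k
    -- The factor r + 1 = j + i + s is distributed over the three terms of the bracket of L(1),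
    -- which raise `j`, `i` and `s`. The binomial coefficient in `Q₁` belongs to j - 1, and `Q₂`
    -- compensates for that.
    let Q₁ : ℕ → ℕ → ℕ → V := fun j i s => ((j : ℂ) * ((j.factorial : ℂ)⁻¹ *
      (s.factorial : ℂ)⁻¹ * ((-1) ^ i * ((Ring.choose (t j - 1 + i) i : ℤ) : ℂ)))) • Z j i s
    let Q₂ : ℕ → ℕ → ℕ → V := fun j i s => ((j.factorial : ℂ)⁻¹ * (s.factorial : ℂ)⁻¹ *
      ((-1) ^ i * (((i + j : ℕ) : ℂ) * ((Ring.choose (t j + i) i : ℤ) : ℂ) -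
        (j : ℂ) * ((Ring.choose (t j - 1 + i) i : ℤ) : ℂ)))) • Z j i s
    let Q₃ : ℕ → ℕ → ℕ → V := fun j i s => ((s : ℂ) * ((j.factorial : ℂ)⁻¹ *
      (s.factorial : ℂ)⁻¹ * ((-1) ^ i * ((Ring.choose (t j + i) i : ℤ) : ℂ)))) • Z j i s
    have hfac : ∀ m : ℕ, ((m + 1 : ℕ) : ℂ) * ((m + 1).factorial : ℂ)⁻¹ = (m.factorial : ℂ)⁻¹ := by
      intro m
      rw [Nat.factorial_succ, Nat.cast_mul, mul_inv,
        mul_inv_cancel_left₀ (Nat.cast_ne_zero.2 m.succ_ne_zero)]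
    have e₁ := simplexSum_succ_left r (G := Q₁) fun i s => by simp [Q₁]
    have e₂ := simplexSum_succ_mid r (G := Q₂) fun j s => by simp [Q₂]
    have e₃ := simplexSum_succ_right r (G := Q₃) fun j i => by simp [Q₃]
    have eL : ∀ G : ℕ → ℕ → ℕ → V, ρV (slL 1) (simplexSum r G) =
        simplexSum r fun j i s => ρV (slL 1) (G j i s) := fun G =>
      map_simplexSum (ρV (slL 1) : V →ₗ[ℂ] V).toAddMonoidHom r G
    have eS : ∀ G : ℕ → ℕ → ℕ → V, ((r : ℂ) + 1) • simplexSum (r + 1) G =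
        simplexSum (r + 1) fun j i s => ((r : ℂ) + 1) • G j i s := fun G =>
      map_simplexSum (DistribSMul.toAddMonoidHom V ((r : ℂ) + 1)) (r + 1) G
    rw [eL, eS]
    have hR : simplexSum (r + 1) (fun j i s => Q₁ j i s + Q₂ j i s + Q₃ j i s) =
        simplexSum (r + 1) fun j i s => ((r : ℂ) + 1) • ((j.factorial : ℂ)⁻¹ *
          (s.factorial : ℂ)⁻¹ * ((-1) ^ i * ((Ring.choose (t j + i) i : ℤ) : ℂ))) • Z j i s :=
      simplexSum_congr fun j i s hr => by
        have : (r : ℂ) + 1 = (i + j : ℕ) + s := by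
          rw [← Nat.cast_add_one, ← Nat.cast_add]
          congr 1
          omega
        simp only [Q₁, Q₂, Q₃]
        rw [this]
        module
    refine Eq.trans ?_ hR
    rw [simplexSum_add, simplexSum_add, e₁, e₂, e₃, ← simplexSum_add, ← simplexSum_add]
    refine simplexSum_congr fun j i s _ => ?_
    rw [map_smul, hV.L_pos_Y_apply (hV.L_pos_pow_mem hu j)]
    have z₁ : Q₁ (j + 1) i s = ((j.factorial : ℂ)⁻¹ * (s.factorial : ℂ)⁻¹ * ((-1) ^ i *
        ((Ring.choose (t j + i) i : ℤ) : ℂ))) • Z (j + 1) i s := by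
      simp only [Q₁]
      rw [show t (j + 1) - 1 = t j by simp only [t]; push_cast; ring, ← hfac j]
      congr 1
      ring
    have z₂ : Q₂ j (i + 1) s = -((j.factorial : ℂ)⁻¹ * (s.factorial : ℂ)⁻¹ * ((-1) ^ i *
        (((t j + j + i + 1 : ℤ) : ℂ) * ((Ring.choose (t j + i) i : ℤ) : ℂ)))) • Z j (i + 1) s := by
      simp only [Q₂]
      rw [choose_identity, pow_succ]
      congr 1
      ring
    have z₃ : Q₃ j i (s + 1) = ((j.factorial : ℂ)⁻¹ * (s.factorial : ℂ)⁻¹ * ((-1) ^ i *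
        ((Ring.choose (t j + i) i : ℤ) : ℂ))) • Z j i (s + 1) := by
      simp only [Q₃]
      rw [← hfac s]
      congr 1
      ring
    rw [z₁, z₂, z₃]
    simp only [Z, t]
    rw [← Module.End.mul_apply, ← pow_succ', ← Module.End.mul_apply, ← pow_succ',
      show k - ((i + 1 : ℕ) : ℤ) = k - i - 1 by push_cast; ring]
    push_cast
    module

end LPosPow

/-! ### Weak associativity of the opposite vertex operators -/

section ContragredientAssociativity

variable {V W : Type*} [AddCommGroup V] [Module ℂ V] [AddCommGroup W] [Module ℂ W]
  {𝓥 : VertexData V} {ρV : Sl2Rep V} {gr : ℂ → Submodule ℂ W} {Y : V → W → Series W}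
  {ρ : Sl2Rep W}

namespace IsMoebiusLeftModule

/-- The factor e^{x₀L(-1)} in Y^s(u₁, x₀) u₂ = e^{x₀L(-1)} Y(u₂, -x₀) u₁ translates the variable x₁
of the opposite operator to x₁ + x₀. -/
theorem opposite_op (hV : IsMoebiusMOSVA 𝓥 ρV) (h : IsMoebiusLeftModule 𝓥 ρV gr Y ρ)
    (φ : Module.Dual ℂ W) (u₁ u₂ : V) (w : W) :
    (ser2 fun k l => φ (oppositeVertexOperator 𝓥 ρV Y (𝓥.op.Y u₁ u₂ k) w l)) =
      swapSeries (substSum 1 (ser2 fun l k => (-1 : ℂ) ^ k *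
        φ (oppositeVertexOperator 𝓥 ρV Y (𝓥.Y u₂ u₁ k) w l))) := by
  have hO := hV.bilinear_opposite h.bilinear
  have hD : 𝓥.D = ρV (slL (-1)) := (funext hV.L_neg).symm
  funext κ
  rw [vec_eta κ]
  obtain ⟨k, hk⟩ : ∃ k, k = κ 0 := ⟨_, rfl⟩
  obtain ⟨l, hl⟩ : ∃ l, l = κ 1 := ⟨_, rfl⟩
  rw [← hk, ← hl, ser2_vec, swapSeries_vec]
  obtain ⟨K, hK⟩ := hV.isMOSVA.isGradedAction.trunc u₂ u₁
  obtain ⟨I, hI⟩ := exists_nat_gt k K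
  have hK' : ∀ k < K, negX (𝓥.Y u₂ u₁) k = 0 := fun k hk => by rw [negX, hK k hk, smul_zero]
  rw [substSum_vec (I := I) fun n hn => by
    rw [ser2_vec, hK _ (by omega), hO.zero_left, Pi.zero_apply, map_zero, mul_zero]]
  have e : 𝓥.op.Y u₁ u₂ k = ∑ i ∈ Finset.range I, ((i.factorial : ℂ)⁻¹) •
      (ρV (slL (-1)) ^ i) (negX (𝓥.Y u₂ u₁) (k - i)) := by
    change expX 𝓥.D (negX (𝓥.Y u₂ u₁)) k = _
    rw [hD, expX_apply hK' _ hI]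
  rw [e, ← hO.left_apply, map_sum, map_sum]
  refine Finset.sum_congr rfl fun i _ => ?_
  have h1 := inv_factorial_smul_derivative (Z := fun u => oppositeVertexOperator 𝓥 ρV Y u w)
    (E := ρV (slL (-1))) (fun u p => h.opposite_neg_left hV u w p)
    (negX (𝓥.Y u₂ u₁) (k - i)) l i
  rw [map_smul, hO.left_apply, h1, negX, hO.smul_left, Pi.smul_apply, map_smul, map_smul, ser2_vec,
    smul_eq_mul, smul_eq_mul, one_pow, mul_one]

/-- A homogeneous series of degree d satisfies f(x⁻¹, y⁻¹) = (xy)^{-d} f(y, x). So inverting the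
variables exchanges them up to a monomial, and the exchange accounts for the reversed order of the
two operators. The iterate is brought to the same shape by the formula for e^{xL(1)} Y(u₂, x₀) u₁.
-/
theorem weakAssoc_opposite_of_homogeneous (hV : IsMoebiusMOSVA 𝓥 ρV)
    (h : IsMoebiusLeftModule 𝓥 ρV gr Y ρ) {φ : Module.Dual ℂ W} (hφ : φ ∈ gradedDual gr)
    {n₁ n₂ δ : ℤ} {u₁ u₂ : V} (hu₁ : u₁ ∈ 𝓥.gr n₁) (hu₂ : u₂ ∈ 𝓥.gr n₂) {w : W}
    (hprod : ∀ x y, ∀ a ∈ 𝓥.gr x, ∀ b ∈ 𝓥.gr y, ∀ p q : ℤ, x + y + p + q ≠ δ →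
      φ (Y a (Y b w q) p) = 0)
    (hiter : ∀ x y, ∀ a ∈ 𝓥.gr x, ∀ b ∈ 𝓥.gr y, ∀ p q : ℤ, x + y + p + q ≠ δ →
      φ (Y (𝓥.Y a b p) w q) = 0) :
    LTrunc 0 1 (ser2 fun k l => φ (oppositeVertexOperator 𝓥 ρV Y u₂
        (oppositeVertexOperator 𝓥 ρV Y u₁ w k) l)) ∧
    WeakAssoc
      (ser2 fun k l => φ (oppositeVertexOperator 𝓥 ρV Y u₂
        (oppositeVertexOperator 𝓥 ρV Y u₁ w k) l))
      (ser2 fun k l => φ (oppositeVertexOperator 𝓥 ρV Y (𝓥.op.Y u₁ u₂ k) w l)) := by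
  obtain ⟨d, hd⟩ := id h.isLeftModule
  have hL := hd.isLocalAction hV.isMOSVA.internal
  have hY := h.bilinear
  obtain ⟨J₁, hJ₁⟩ := hV.exists_L_pos_pow_eq_zero hu₁
  obtain ⟨J₂, hJ₂⟩ := hV.exists_L_pos_pow_eq_zero hu₂
  let v₁ : ℕ → V := fun s => (ρV (slL 1) ^ s) u₁
  let v₂ : ℕ → V := fun j => (ρV (slL 1) ^ j) u₂
  have hv₁ : ∀ s : ℕ, v₁ s ∈ 𝓥.gr (n₁ - s) := hV.L_pos_pow_mem hu₁
  have hv₂ : ∀ j : ℕ, v₂ j ∈ 𝓥.gr (n₂ - j) := hV.L_pos_pow_mem hu₂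
  let c : ℕ × ℕ → ℂ := fun t => (-1) ^ (n₁ + n₂) * ((t.1.factorial : ℂ)⁻¹ *
    (t.2.factorial : ℂ)⁻¹)
  -- The shifts `e` and `f` come from solving k + l = -δ - n₁ - n₂, the support condition, for the
  -- exponents j - 2 n₂ - l and s - 2 n₁ - k in terms of k and l respectively.
  let e : ℕ × ℕ → ℤ := fun t => n₂ - n₁ - t.1 - δ
  let f : ℕ × ℕ → ℤ := fun t => δ + t.2 - n₁ + n₂
  let A : ℕ × ℕ → MSeries (Fin 2) := fun t κ =>
    ser2 (fun p q => φ (Y (v₂ t.1) (Y (v₁ t.2) w q) p)) (κ + Pi.single 1 (f t))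
  let B : ℕ × ℕ → MSeries (Fin 2) := fun t κ =>
    ser2 (fun p q => φ (Y (𝓥.Y (v₂ t.1) (v₁ t.2) p) w q)) (κ + Pi.single 1 (f t))
  have hsingle : ∀ k l m : ℤ, (![k, l] : Fin 2 → ℤ) + Pi.single 1 m = ![k, l + m] := by
    intro k l m
    funext i
    fin_cases i <;> simp
  have hA : ∀ t, LTrunc 0 1 (A t) := fun t =>
    (lTrunc_product hY.zero_right (hL.trunc (v₁ t.2) w) φ (v₂ t.1)).shift _
  have hB : ∀ t, LTrunc 1 0 (B t) := fun t => by
    refine LTrunc.shift (F := ser2 (fun p q => φ (Y (𝓥.Y (v₂ t.1) (v₁ t.2) p) w q)))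
      (fun κ => ?_) _
    obtain ⟨K, hK⟩ := hV.isMOSVA.isGradedAction.trunc (v₂ t.1) (v₁ t.2)
    refine ⟨(κ 0 - K + 1).toNat, fun n hn => ?_⟩
    rw [ser2, hK _ (by simp; omega), hY.zero_left]
    exact map_zero φ
  have hAB : ∀ t, WeakAssoc (A t) (B t) := fun t =>
    (hL.weakAssoc φ hφ (v₂ t.1) (v₁ t.2) w).shift _
  have ha : ∀ κ, (ser2 fun k l => φ (oppositeVertexOperator 𝓥 ρV Y u₂
      (oppositeVertexOperator 𝓥 ρV Y u₁ w k) l)) κ =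
      ∑ t ∈ Finset.range J₂ ×ˢ Finset.range J₁, c t * A t (κ - Pi.single 0 (e t)) := by
    intro κ
    rw [vec_eta κ]
    obtain ⟨k, hk⟩ : ∃ k, k = κ 0 := ⟨_, rfl⟩
    obtain ⟨l, hl⟩ : ∃ l, l = κ 1 := ⟨_, rfl⟩
    rw [← hk, ← hl, ser2_vec, hV.opposite_apply hY hu₂ hJ₂, hV.opposite_apply hY hu₁ hJ₁,
      Finset.sum_product, map_smul, map_sum, smul_eq_mul, Finset.mul_sum]
    refine Finset.sum_congr rfl fun j _ => ?_
    rw [hY.smul_right, Pi.smul_apply, ← hY.right_apply, map_sum, map_smul, map_smul, map_sum,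
      smul_eq_mul, smul_eq_mul, Finset.mul_sum, Finset.mul_sum, Finset.mul_sum]
    refine Finset.sum_congr rfl fun s _ => ?_
    have key : φ (Y (v₂ j) (Y (v₁ s) w (s - 2 * n₁ - k)) (j - 2 * n₂ - l)) =
        A (j, s) (![k, l] - Pi.single 0 (e (j, s))) := by
      simp only [A]
      rw [vec_two_sub_single_zero, hsingle, ser2_vec]
      -- Off the line of support both coefficients vanish by homogeneity.
      by_cases hkl : k + l = -δ - n₁ - n₂
      · rw [show k - e (j, s) = j - 2 * n₂ - l by simp only [e]; omega,
          show l + f (j, s) = s - 2 * n₁ - k by simp only [f]; omega]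
      · rw [hprod _ _ _ (hv₂ j) _ (hv₁ s) _ _ (by omega),
          hprod _ _ _ (hv₂ j) _ (hv₁ s) _ _ (by simp only [e, f]; omega)]
    rw [← key, map_smul, map_smul, hY.right_apply, smul_eq_mul]
    simp only [c, v₁, v₂]
    rw [zpow_add₀ (by norm_num)]
    ring
  refine ⟨LTrunc.of_eq_sum (fun t _ => hA t) ha, ?_⟩
  rw [h.opposite_op hV]
  refine weakAssoc_of_eq_sum (fun t _ => hA t) (fun t _ => hB t) (fun t _ => hAB t) ha fun κ => ?_
  rw [vec_eta κ]
  obtain ⟨l, hl⟩ : ∃ l, l = κ 0 := ⟨_, rfl⟩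
  obtain ⟨k, hk⟩ : ∃ k, k = κ 1 := ⟨_, rfl⟩
  rw [← hk, ← hl, ser2_vec]
  obtain ⟨N, hN⟩ := hV.isMOSVA.lower_bound
  -- A truncation bound independent of j and s, because L(1) only lowers the weights of the two
  -- vectors.
  let I : ℕ := (n₁ + n₂ + k - N + 1).toNat
  have hI : ∀ (j s i : ℕ), I ≤ i → 𝓥.Y (v₂ j) (v₁ s) (k - i) = 0 := fun j s i hi => by
    have h1 := hV.isMOSVA.Y_mem (hv₂ j) (hv₁ s) (k - i)
    rwa [hN _ (by omega), Submodule.mem_bot] at h1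
  have hv : 𝓥.Y u₂ u₁ k ∈ 𝓥.gr (n₂ + n₁ + k) := hV.isMOSVA.Y_mem hu₂ hu₁ k
  obtain ⟨J, hJ⟩ := hV.exists_L_pos_pow_eq_zero hv
  let G : ℕ → ℕ → ℕ → ℂ := fun j i s => (j.factorial : ℂ)⁻¹ * (s.factorial : ℂ)⁻¹ * ((-1) ^ i *
    ((Ring.choose (j - 2 * n₂ - k + i) i : ℤ) : ℂ)) *
      φ (Y (𝓥.Y (v₂ j) (v₁ s) (k - i)) w ((j + i + s : ℕ) - 2 * (n₂ + n₁ + k) - l))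
  have hG : ∀ r : ℕ, φ ((r.factorial : ℂ)⁻¹ • Y ((ρV (slL 1) ^ r) (𝓥.Y u₂ u₁ k)) w
      (r - 2 * (n₂ + n₁ + k) - l)) = simplexSum r G := by
    intro r
    rw [← Pi.smul_apply, ← hY.smul_left, hV.L_pos_pow_Y_apply hu₂]
    refine (map_simplexSum (φ ∘ₗ hY.left w (r - 2 * (n₂ + n₁ + k) - l)).toAddMonoidHom r _).trans
      (simplexSum_congr fun j i s hr => ?_)
    subst hr
    exact map_smul (φ ∘ₗ hY.left w _) _ _
  have hYz : ∀ q, φ (Y 0 w q) = 0 := fun q => by rw [hY.zero_left]; exact map_zero φ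
  -- The range is long enough to contain all nonzero triples (j, i, s), so the simplex sums become a
  -- full triple sum.
  rw [hV.opposite_apply hY hv (J := J₂ + I + J₁ + J) fun j hj => hJ j (by omega), map_smul,
    map_sum, Finset.sum_congr rfl fun r _ => hG r, sum_range_simplexSum (J := J₂) (I := I) (S := J₁)
      (by omega) ?_ ?_ ?_, Finset.sum_product, smul_eq_mul, Finset.mul_sum, Finset.mul_sum]
  · refine Finset.sum_congr rfl fun j _ => ?_
    rw [Finset.mul_sum, Finset.mul_sum]
    refine Finset.sum_congr rfl fun s _ => ?_
    rw [vec_two_sub_single_zero, substSum_vec (I := I) fun i hi => by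
      simp only [swapSeries_vec, B]
      rw [hsingle, ser2_vec, hI j s i hi, hYz], Finset.mul_sum, Finset.mul_sum, Finset.mul_sum]
    refine Finset.sum_congr rfl fun i _ => ?_
    simp only [swapSeries_vec, B]
    rw [hsingle, ser2_vec]
    have hs : (-1 : ℂ) ^ k * (-1) ^ (n₂ + n₁ + k) = (-1) ^ (n₁ + n₂) := by
      rw [← zpow_add₀ (by norm_num), show k + (n₂ + n₁ + k) = n₁ + n₂ + 2 * k by ring,
        zpow_add₀ (by norm_num), zpow_mul]
      norm_num
    rw [← mul_assoc, hs]
    simp only [c, G]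
    by_cases hkl : k + l = -δ - n₁ - n₂
    · rw [show l - e (j, s) = j - 2 * n₂ - k by simp only [e]; omega,
        show j - 2 * n₂ - k + i + f (j, s) =
          (j + i + s : ℕ) - 2 * (n₂ + n₁ + k) - l by simp only [f]; push_cast; omega]
      ring
    · rw [hiter _ _ _ (hv₂ j) _ (hv₁ s) _ _ (by push_cast; omega),
        hiter _ _ _ (hv₂ j) _ (hv₁ s) _ _ (by simp only [e, f]; omega)]
      simp
  · intro j hj i s
    simp only [G, v₂]
    rw [hJ₂ j hj, hV.isMOSVA.bilinear.zero_left, Pi.zero_apply, hYz, mul_zero]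
  · intro i hi j s
    simp only [G]
    rw [hI j s i hi, hYz, mul_zero]
  · intro s hs j i
    simp only [G, v₁]
    rw [hJ₁ s hs, hV.isMOSVA.bilinear.zero_right, Pi.zero_apply, hYz, mul_zero]

theorem weakAssoc_opposite (hV : IsMoebiusMOSVA 𝓥 ρV)
    (h : IsMoebiusLeftModule 𝓥 ρV gr Y ρ) {φ : Module.Dual ℂ W} (hφ : φ ∈ gradedDual gr)
    (u₁ u₂ : V) (w : W) : WeakAssoc
      (ser2 fun k l => φ (oppositeVertexOperator 𝓥 ρV Y u₂
        (oppositeVertexOperator 𝓥 ρV Y u₁ w k) l))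
      (ser2 fun k l => φ (oppositeVertexOperator 𝓥 ρV Y (𝓥.op.Y u₁ u₂ k) w l)) := by
  obtain ⟨d, hd⟩ := id h.isLeftModule
  have hY := h.bilinear
  have hO := hV.bilinear_opposite hY
  have hop := hV.isMOSVA.op.bilinear
  let a : Module.Dual ℂ W → V → V → W → MSeries (Fin 2) := fun φ u₁ u₂ w =>
    ser2 fun k l => φ (oppositeVertexOperator 𝓥 ρV Y u₂
        (oppositeVertexOperator 𝓥 ρV Y u₁ w k) l)
  let b : Module.Dual ℂ W → V → V → W → MSeries (Fin 2) := fun φ u₁ u₂ w =>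
    ser2 fun k l => φ (oppositeVertexOperator 𝓥 ρV Y (𝓥.op.Y u₁ u₂ k) w l)
  -- Truncation is carried along because sums of weakly associative pairs need it. The reduction to
  -- homogeneous data is then additive in `φ`, `w`, `u₂` and `u₁` in turn.
  let Q : Module.Dual ℂ W → V → V → W → Prop := fun φ u₁ u₂ w =>
    LTrunc 0 1 (a φ u₁ u₂ w) ∧ WeakAssoc (a φ u₁ u₂ w) (b φ u₁ u₂ w)
  have hadd : ∀ {φ φ' φ'' u₁ u₁' u₁'' u₂ u₂' u₂'' w w' w''},
      a φ u₁ u₂ w = a φ' u₁' u₂' w' + a φ'' u₁'' u₂'' w'' →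
      b φ u₁ u₂ w = b φ' u₁' u₂' w' + b φ'' u₁'' u₂'' w'' →
      Q φ' u₁' u₂' w' → Q φ'' u₁'' u₂'' w'' → Q φ u₁ u₂ w := by
    intro φ φ' φ'' u₁ u₁' u₁'' u₂ u₂' u₂'' w w' w'' e e' h1 h2
    simp only [Q]
    rw [e, e']
    exact ⟨h1.1.add h2.1, h1.2.add h1.1 h2.1 h2.2⟩
  have hom : ∀ n₁, ∀ u₁ ∈ 𝓥.gr n₁, ∀ n₂, ∀ u₂ ∈ 𝓥.gr n₂, ∀ α, ∀ w ∈ gr α, ∀ β,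
      ∀ ψ ∈ gradedDualGr gr β, Q ψ.1 u₁ u₂ w := by
    intro n₁ u₁ hu₁ n₂ u₂ hu₂ α w hw β ψ hψ
    -- If β - α is not an integer, every matrix coefficient vanishes and any `δ` will do.
    obtain ⟨δ, hδ⟩ : ∃ δ : ℤ, ∀ m : ℤ, α + m = β → m = δ := by
      by_cases hm : ∃ m : ℤ, α + m = β
      · obtain ⟨δ, hδ⟩ := hm
        exact ⟨δ, fun m hm => by exact_mod_cast add_left_cancel (hm.trans hδ.symm)⟩
      · exact ⟨0, fun m hm' => absurd ⟨m, hm'⟩ hm⟩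
    refine h.weakAssoc_opposite_of_homogeneous hV ψ.2 (δ := δ) hu₁ hu₂
      (fun x y a ha b hb p q hne => ?_) (fun x y a ha b hb p q hne => ?_)
    · refine hψ _ (fun hβ => hne (hδ _ ?_)) _ (h.Y_mem hV ha (h.Y_mem hV hb hw q) p)
      rw [← hβ]
      push_cast
      ring
    · refine hψ _ (fun hβ => hne (hδ _ ?_)) _ (h.Y_mem hV (hV.isMOSVA.Y_mem ha hb p) hw q)
      rw [← hβ]
  have hom₁ : ∀ n₁, ∀ u₁ ∈ 𝓥.gr n₁, ∀ n₂, ∀ u₂ ∈ 𝓥.gr n₂, ∀ α, ∀ w ∈ gr α,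
      ∀ ψ : gradedDual gr, Q ψ.1 u₁ u₂ w := by
    intro n₁ u₁ hu₁ n₂ u₂ hu₂ α w hw
    exact isInternal_induction (isInternal_gradedDualGr hd.internal)
      (hom n₁ u₁ hu₁ n₂ u₂ hu₂ α w hw) (hom n₁ u₁ hu₁ n₂ u₂ hu₂ α w hw 0 0 (zero_mem _))
      fun ψ χ => hadd rfl rfl
  have hom₂ : ∀ n₁, ∀ u₁ ∈ 𝓥.gr n₁, ∀ n₂, ∀ u₂ ∈ 𝓥.gr n₂, ∀ w, ∀ ψ : gradedDual gr,
      Q ψ.1 u₁ u₂ w := by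
    intro n₁ u₁ hu₁ n₂ u₂ hu₂ w ψ
    refine isInternal_induction hd.internal (p := fun w => Q ψ.1 u₁ u₂ w)
      (fun α w hw => hom₁ n₁ u₁ hu₁ n₂ u₂ hu₂ α w hw ψ)
      (hom₁ n₁ u₁ hu₁ n₂ u₂ hu₂ 0 0 (zero_mem _) ψ) (fun w w' => hadd ?_ ?_) w
    · funext κ
      simp only [a, ser2, Pi.add_apply, hO.add_right, map_add]
    · funext κ
      simp only [b, ser2, Pi.add_apply, hO.add_right, map_add]
  have hom₃ : ∀ n₁, ∀ u₁ ∈ 𝓥.gr n₁, ∀ u₂ w, ∀ ψ : gradedDual gr, Q ψ.1 u₁ u₂ w := by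
    intro n₁ u₁ hu₁ u₂ w ψ
    refine isInternal_induction hV.isMOSVA.internal (p := fun u₂ => Q ψ.1 u₁ u₂ w)
      (fun n₂ u₂ hu₂ => hom₂ n₁ u₁ hu₁ n₂ u₂ hu₂ w ψ)
      (hom₂ n₁ u₁ hu₁ 0 0 (zero_mem _) w ψ) (fun v v' => hadd ?_ ?_) u₂
    · funext κ
      simp only [a, ser2, Pi.add_apply, hO.add_left, map_add]
    · funext κ
      simp only [b, ser2, Pi.add_apply, hop.add_right, hO.add_left, map_add]
  refine (isInternal_induction hV.isMOSVA.internal (p := fun u₁ => Q φ u₁ u₂ w)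
    (fun n₁ u₁ hu₁ => hom₃ n₁ u₁ hu₁ u₂ w ⟨φ, hφ⟩)
    (hom₃ 0 0 (zero_mem _) u₂ w ⟨φ, hφ⟩) (fun v v' => hadd ?_ ?_) u₁).2
  · funext κ
    simp only [a, ser2, Pi.add_apply, hO.add_left, hO.add_right, map_add]
  · funext κ
    simp only [b, ser2, Pi.add_apply, hop.add_left, hO.add_left, map_add]

end IsMoebiusLeftModule

end ContragredientAssociativity

/-! ### The contragredient as a left module over the opposite algebra -/

section ContragredientModule

variable {V W : Type*} [AddCommGroup V] [Module ℂ V] [AddCommGroup W] [Module ℂ W]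
  {𝓥 : VertexData V} {ρV : Sl2Rep V} {gr : ℂ → Submodule ℂ W} {Y : V → W → Series W}
  {ρ : Sl2Rep W}

namespace IsMoebiusLeftModule

/-- The opposite operator is a finite sum of terms x^m Y(a, x⁻¹). Hence products of opposite
operators are finite sums of ordinary products in inverted variables, and rationality follows by
reflection. -/
theorem exists_opposite_eq_sum (hV : IsMoebiusMOSVA 𝓥 ρV)
    (h : IsMoebiusLeftModule 𝓥 ρV gr Y ρ) (u : V) :
    ∃ (α : Type) (_ : Fintype α) (a : α → V) (m : α → ℤ), ∀ (w : W) (k : ℤ),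
      oppositeVertexOperator 𝓥 ρV Y u w k = ∑ t, Y (a t) w (m t - k) := by
  have hO := hV.bilinear_opposite h.bilinear
  refine isInternal_induction hV.isMOSVA.internal (p := fun u => ∃ (α : Type) (_ : Fintype α)
    (a : α → V) (m : α → ℤ), ∀ (w : W) (k : ℤ),
      oppositeVertexOperator 𝓥 ρV Y u w k = ∑ t, Y (a t) w (m t - k)) (fun n u hu => ?_) ?_ ?_ u
  · obtain ⟨J, hJ⟩ := hV.exists_L_pos_pow_eq_zero hu
    refine ⟨Fin J, inferInstance, fun j => (((-1 : ℂ) ^ n) * ((j : ℕ).factorial : ℂ)⁻¹) •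
      (ρV (slL 1) ^ (j : ℕ)) u, fun j => (j : ℕ) - 2 * n, fun w k => ?_⟩
    rw [hV.opposite_apply h.bilinear hu hJ, Finset.smul_sum, Finset.sum_range]
    refine Finset.sum_congr rfl fun j _ => ?_
    rw [h.bilinear.smul_left, Pi.smul_apply, smul_smul]
  · refine ⟨Empty, inferInstance, fun _ => 0, fun _ => 0, fun w k => ?_⟩
    rw [hO.zero_left]
    rfl
  · rintro u v ⟨α, _, a, m, hu⟩ ⟨β, _, b, n, hv⟩
    refine ⟨α ⊕ β, inferInstance, Sum.elim a b, Sum.elim m n, fun w k => ?_⟩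
    rw [hO.add_left, Pi.add_apply, hu, hv, Fintype.sum_sum_type]
    rfl

theorem exists_prodCoeff_opposite_eq_sum (hV : IsMoebiusMOSVA 𝓥 ρV)
    (h : IsMoebiusLeftModule 𝓥 ρV gr Y ρ) {n : ℕ} (u : Fin n → V) :
    ∃ (α : Type) (_ : Fintype α) (a : α → Fin n → V) (m : α → Fin n → ℤ),
      ∀ (k : Fin n → ℤ) (w : W), prodCoeff (oppositeVertexOperator 𝓥 ρV Y) u k w =
        ∑ t, prodCoeff Y (a t) (m t - k) w := by
  induction n with
  | zero => exact ⟨Unit, inferInstance, fun _ => u, fun _ => 0, fun k w => by simp [prodCoeff]⟩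
  | succ n ih =>
    obtain ⟨α, _, a, m, ha⟩ := h.exists_opposite_eq_sum hV (u 0)
    obtain ⟨β, _, b, l, hb⟩ := ih (Fin.tail u)
    refine ⟨α × β, inferInstance, fun t => Fin.cons (a t.1) (b t.2),
      fun t => Fin.cons (m t.1) (l t.2), fun k w => ?_⟩
    rw [prodCoeff_succ, ha, hb, Fintype.sum_prod_type]
    refine Finset.sum_congr rfl fun s _ => ?_
    rw [← h.bilinear.right_apply, map_sum]
    refine Finset.sum_congr rfl fun t _ => ?_
    rw [prodCoeff_succ]
    rfl

theorem rational_prodCoeff_opposite (hV : IsMoebiusMOSVA 𝓥 ρV)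
    (h : IsMoebiusLeftModule 𝓥 ρV gr Y ρ) {φ : Module.Dual ℂ W} (hφ : φ ∈ gradedDual gr) {n : ℕ}
    (u : Fin n → V) (w : W) :
    RationalSeries fun k : Fin n → ℤ => φ (prodCoeff (oppositeVertexOperator 𝓥 ρV Y) u k w) := by
  obtain ⟨d, hd⟩ := h.isLeftModule
  obtain ⟨α, _, a, m, ha⟩ := h.exists_prodCoeff_opposite_eq_sum hV u
  have := RationalSeries.sum Finset.univ (F := fun (t : α) (k : Fin n → ℤ) =>
    φ (prodCoeff Y (a t) (m t - k) w)) fun t _ =>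
      (hd.product_rational φ hφ n (a t) w).rationalSeries.reflect (m t)
  convert this using 1
  funext k
  rw [ha, map_sum, Finset.sum_apply]

variable (hV : IsMoebiusMOSVA 𝓥 ρV) (h : IsMoebiusLeftModule 𝓥 ρV gr Y ρ)

/-- Transposition reverses the order of the operators. -/
theorem prodCoeff_dual_apply {n : ℕ} (u : Fin n → V) (k : Fin n → ℤ) (φ : gradedDual gr) (w : W) :
    (prodCoeff (h.dualVertexOperator hV) u k φ).1 w =
      φ.1 (prodCoeff (oppositeVertexOperator 𝓥 ρV Y) (u ∘ Fin.rev) (k ∘ Fin.rev) w) := by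
  induction n generalizing w with
  | zero => rfl
  | succ n ih =>
    have e (i : Fin n) : i.rev.succ = i.castSucc.rev := (Fin.rev_castSucc i).symm
    have e₁ : Fin.tail u ∘ Fin.rev = (u ∘ Fin.rev) ∘ Fin.castSucc :=
      funext fun i => congrArg u (e i)
    have e₂ : Fin.tail k ∘ Fin.rev = (k ∘ Fin.rev) ∘ Fin.castSucc :=
      funext fun i => congrArg k (e i)
    rw [prodCoeff_succ, dualVertexOperator_apply, ih, prodCoeff_succ_last, ← e₁, ← e₂]
    simp

theorem rational_prodCoeff_dual (hfin : GradingRestricted gr)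
    {Φ : Module.Dual ℂ (gradedDual gr)} (hΦ : Φ ∈ gradedDual (gradedDualGr gr)) {n : ℕ}
    (u : Fin n → V) (φ : gradedDual gr) :
    RationalSeries fun k : Fin n → ℤ => Φ (prodCoeff (h.dualVertexOperator hV) u k φ) := by
  obtain ⟨d, hd⟩ := h.isLeftModule
  -- Finite-dimensional weight spaces make every admissible functional on W' the evaluation at a
  -- vector of W.
  obtain ⟨w, hw⟩ := exists_eq_eval hd.internal hfin hΦ
  have := (h.rational_prodCoeff_opposite hV φ.2 (u ∘ Fin.rev) w).comp_equiv Fin.revPerm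
  convert this using 2 with k
  rw [hw, prodCoeff_dual_apply]
  rfl

theorem dual_mem {n : ℤ} {u : V} (hu : u ∈ 𝓥.gr n) {m : ℂ} {φ : gradedDual gr}
    (hφ : φ ∈ gradedDualGr gr m) (k : ℤ) :
    h.dualVertexOperator hV u φ k ∈ gradedDualGr gr (n + m + k) := by
  intro j hj w hw
  rw [dualVertexOperator_apply]
  refine hφ _ (fun e => hj ?_) _ (h.opposite_mem hV hu hw k)
  rw [← e]
  push_cast
  ring

theorem gradedDualGr_eq_bot (hgr : DirectSum.IsInternal gr) {m : ℂ} (hm : gr m = ⊥) :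
    gradedDualGr gr m = ⊥ := by
  refine (Submodule.eq_bot_iff _).2 fun φ hφ => Subtype.ext ?_
  refine linearMap_ext_of_isInternal hgr fun j w hw => ?_
  by_cases hj : j = m
  · subst hj
    rw [hm, Submodule.mem_bot] at hw
    rw [hw, map_zero, map_zero]
  · exact hφ j hj w hw

theorem isGradedAction_dual : IsGradedAction (Int.castAddHom ℂ) Complex.reAddGroupHom 𝓥
    (gradedDualGr gr) (h.dualVertexOperator hV) (h.dualRep (slL (-1))) := by
  obtain ⟨d, hd⟩ := h.isLeftModule
  exact {
    height := fun n => by simp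
    internal_left := hV.isMOSVA.internal
    internal := isInternal_gradedDualGr hd.internal
    bilinear := h.bilinear_dual hV
    lower_bound := by
      obtain ⟨N, hN⟩ := hd.lower_bound
      exact ⟨N, fun m hm => gradedDualGr_eq_bot hd.internal (hN m hm)⟩
    Y_mem := fun n u hu m φ hφ k => h.dual_mem hV hu hφ k
    D_mem := fun m φ hφ => by simpa using h.dual_L_neg_mem m φ hφ }

theorem dual_iterate (hfin : GradingRestricted gr) {Φ : Module.Dual ℂ (gradedDual gr)}
    (hΦ : Φ ∈ gradedDual (gradedDualGr gr)) (u₁ u₂ : V) (φ : gradedDual gr) :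
    IterateRational (fun k l => Φ (h.dualVertexOperator hV (𝓥.op.Y u₁ u₂ k) φ l)) ∧
    Associates (fun k l => Φ (h.dualVertexOperator hV u₁ (h.dualVertexOperator hV u₂ φ l) k))
      (fun k l => Φ (h.dualVertexOperator hV (𝓥.op.Y u₁ u₂ k) φ l)) := by
  obtain ⟨d, hd⟩ := h.isLeftModule
  have hY := h.bilinear_dual hV
  refine WeakAssoc.iterateRational_and_associates ?_
    (lTrunc_product hY.zero_right ((h.isGradedAction_dual hV).trunc u₂ φ) Φ u₁) ?_
    (h.rational_prodCoeff_dual hV hfin hΦ ![u₁, u₂] φ)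
  · obtain ⟨w, hw⟩ := exists_eq_eval hd.internal hfin hΦ
    simp only [hw, dualVertexOperator_apply]
    exact h.weakAssoc_opposite hV φ.2 u₁ u₂ w
  · intro κ
    obtain ⟨K, hK⟩ := hV.isMOSVA.op.isGradedAction.trunc u₁ u₂
    refine ⟨(κ 0 - K + 1).toNat, fun n hn => ?_⟩
    rw [ser2, hK _ (by simp; omega), hY.zero_left]
    exact map_zero Φ

/-- The contragredient of a grading-restricted left module is a left module for the opposite
algebra. -/
theorem isMoebiusLeftModule_dual (hfin : GradingRestricted gr) :
    IsMoebiusLeftModule 𝓥.op ρV (gradedDualGr gr) (h.dualVertexOperator hV) h.dualRep := by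
  obtain ⟨d, hd⟩ := id h.isLeftModule
  have hA := h.isGradedAction_dual hV
  have hd' : ∀ φ ∈ gradedDual gr, φ ∘ₗ d ∈ gradedDual gr := fun φ hφ =>
    comp_mem_gradedDual hφ Function.injective_id fun m w hw => by
      rw [hd.d_grading m w hw]
      exact Submodule.smul_mem _ _ hw
  refine ⟨⟨dualEnd d hd', ?_⟩, h.dual_L_zero_commutator hV, h.dual_L_pos_commutator hV,
    h.dual_generalized_weight hfin⟩
  exact {
    internal := hA.internal
    bilinear := hA.bilinear
    D_weight := h.dual_L_neg_mem
    lower_bound := hA.lower_bound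
    d_grading := fun m φ hφ => Subtype.ext <| linearMap_ext_of_isInternal hd.internal
      fun j w hw => by
        rw [dualEnd_apply, hd.d_grading j w hw, map_smul]
        by_cases hj : j = m
        · subst hj
          rfl
        · exact (congrArg (j • ·) (hφ j hj w hw)).trans ((smul_zero j).trans
            ((smul_zero m).symm.trans (congrArg (m • ·) (hφ j hj w hw).symm)))
    d_commutator := h.dual_d_commutator hV hd hd'
    identity := h.dual_identity hV
    D_derivative := fun u φ => by
      rw [hV.isMOSVA.op_D, ← hV.L_neg]
      exact h.dual_D_derivative hV u φ
    D_commutator := h.dual_D_commutator hV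
    product_rational := fun Φ hΦ n u φ =>
      (h.rational_prodCoeff_dual hV hfin hΦ u φ).productRational fun i j hij =>
        lTrunc_prodCoeff hA.bilinear hA.trunc u φ Φ hij
    iterate_rational := fun Φ hΦ u₁ u₂ φ => (h.dual_iterate hV hfin hΦ u₁ u₂ φ).1
    associativity := fun Φ hΦ u₁ u₂ φ => (h.dual_iterate hV hfin hΦ u₁ u₂ φ).2 }

end IsMoebiusLeftModule

end ContragredientModule

end MOSVA

end

open MOSVA

theorem mainTheorem7 {V W : Type*} [AddCommGroup V] [Module ℂ V] [AddCommGroup W] [Module ℂ W]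
    (𝓥 : VertexData V) (ρV : Sl2Rep V) (hV : IsMoebiusMOSVA 𝓥 ρV)
    (gr : ℂ → Submodule ℂ W) (Y : V → W → Series W) (ρ : Sl2Rep W)
    (hW : IsMoebiusLeftModule 𝓥 ρV gr Y ρ) (hfin : GradingRestricted gr) :
    ∃ (Y' : V → gradedDual gr → Series (gradedDual gr)) (ρ' : Sl2Rep (gradedDual gr)),
      (∀ (u : V) (φ : gradedDual gr) (k : ℤ) (w : W),
        (Y' u φ k).1 w = φ.1 (oppositeVertexOperator 𝓥 ρV Y u w k)) ∧
      (∀ (j : SignType) (φ : gradedDual gr) (w : W),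
        (ρ' (slL j) φ).1 w = φ.1 (ρ (slL (-j)) w)) ∧
      IsMoebiusMOSVA 𝓥.op ρV ∧
      IsMoebiusLeftModule 𝓥.op ρV (gradedDualGr gr) Y' ρ' ∧
      IsMoebiusRightModule 𝓥 ρV (gradedDualGr gr) (skewOpposite (ρ' (slL (-1))) Y') ρ' := by
  have hW' := hW.isMoebiusLeftModule_dual hV hfin
  refine ⟨hW.dualVertexOperator hV, hW.dualRep, hW.dualVertexOperator_apply hV, hW.dualRep_apply,
    hV.op, hW', ?_⟩
  -- A left module over V^op is a right module over (V^op)^op, which is V because skew-symmetry is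
  -- an involution.
  have := hW'.isMoebiusRightModule_op hV.op
  rwa [hV.isMOSVA.op_op] at this
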